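/- Fix $\mu>0$ and $\mu'\in\mathbb R$ with $2\mu+\mu'=1$, a constant $\beta_0>0$, and a function $\phi_0\in\mathscr S(\mathbb R^3)$ with $0\le\phi_0\le1$, $\operatorname{supp}\phi_0\subset\{2^{-1}\le|\xi|\le2\}$ and $\sum_{j\in\mathbb Z}\phi_0(2^{-j}\xi)=1$ for $\xi\ne0$. For a tempered distribution $h$ on $\mathbb R^3$ put $\Delta_jh=\mathscr F^{-1}\big[\phi_0(2^{-j}\cdot)\,\mathscr F h\big]$, where $\mathscr F$ has kernel $e^{-ix\cdot\xi}$, and let $\langle x\rangle=\sqrt{1+x^2}$. Norms of tuples are sums of the norms of the components; $\|h\|_{L^q}=\infty$ if $h$ is not an $L^q$ function. For $\alpha>0$ put $$\|h\|^{\ell;\alpha}_{\dot B^s_{p,1}}=\sum_{2^j\le\alpha}2^{sj}\|\Delta_jh\|_{L^p},\qquad \|F\|^{\ell;\alpha}_{L^r(0,t;\dot B^s_{p,1})}=\Big\|\,\|F(\cdot)\|^{\ell;\alpha}_{\dot B^s_{p,1}}\Big\|_{L^r(0,t)},\qquad \|F\|^{\ell;\alpha}_{\widetilde{L^r}(0,t;\dot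 B^s_{p,1})}=\sum_{2^j\le\alpha}2^{sj}\|\Delta_jF\|_{L^r(0,t;L^p)} .$$ **Proposition 3.1.** Let $2\le q,r\le\infty$ satisfy $\frac1q+\frac1r\le\frac12$ and $(q,r)\ne(\infty,2)$. Then there is a constant $C>0$, depending only on $q$, $r$ and the fixed quantities $\mu,\beta_0,\phi_0$, such that the following holds for all $\varepsilon>0$, $\Omega\in\mathbb R\setminus\{0\}$ and $0<t\le T<\infty$. Let $(a,u)$ be a solution on $[0,T]$, in the sense of tempered distributions (weakly continuous in time, with $f,g$ weakly integrable in time on $(0,T)$), of $$\partial_ta+\tfrac1\varepsilon\operatorname{div}u=f,\qquad \partial_tu-\mu\Delta u-(\mu+\mu')\nabla\operatorname{div}u+\Omega(e_3\times u)+\tfrac1\varepsilon\nabla a=g,\qquad (a,u)(0)=(a_0,u_0).$$ 1. For all $j\in\mathbb Z$ with $2^j\le|\Omega|\varepsilon$, $$\|\Delta_j(a,u)\|_{L^r(0,t;L^q)}\le C\,2^{3(\frac12-\frac1q-\frac1r)j}|\Omega|^{\frac2r}\varepsilon^{\frac3r}\langle\Omega^2\varepsilon^2T\rangle\Big(\|\Delta_j(a_0,u_0)\|_{L^2}+\|\Delta_j(f,g)\|_{L^1(0,t;L^2)}\Big).$$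 2. For all $j\in\mathbb Z$ with $|\Omega|\varepsilon<2^j\le\beta_0/\varepsilon$, $$\|\Delta_j(a,u)\|_{L^r(0,t;L^q)}\le C\,2^{3(\frac12-\frac1q)j}|\Omega|^{-\frac1r}\Big(\|\Delta_j(a_0,u_0)\|_{L^2}+\|\Delta_j(f,g)\|_{L^1(0,t;L^2)}\Big).$$ 3. If $|\Omega|\varepsilon\le1$ and $1\le\alpha\le\beta_0/\varepsilon$, then $$\|(a,u)\|^{\ell;\alpha}_{\widetilde{L^r}(0,t;\dot B_{q,1}^{\frac3q-1+\frac2r})}\le C\langle\alpha^2T\rangle^{3r+1}\Big(\varepsilon^{\frac2{3r}}+|\Omega|^{-\frac1r}\alpha^{\frac2r}\Big)\Big(\|(a_0,u_0)\|^{\ell;\alpha}_{\dot B_{2,1}^{\frac12}}+\|(f,g)\|^{\ell;\alpha}_{L^1(0,t;\dot B_{2,1}^{\frac12})}\Big),$$ where for $r=\infty$ the exponent $3r+1$ is read as $1$. -/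

import Mathlib

open MeasureTheory Set
open scoped ENNReal SchwartzMap LineDeriv Laplacian

namespace RotatingNSC

noncomputable section

/-- The space `ℝ³`. -/
abbrev R3 := EuclideanSpace ℝ (Fin 3)

/-- The space `𝓢'(ℝ³)` of (complex-valued) tempered distributions. -/
abbrev Distr := 𝓢'(R3, ℂ)

/-- The `k`-th standard basis vector of `ℝ³`. -/
def basisVec (k : Fin 3) : R3 := EuclideanSpace.single k (1 : ℝ)

/-- The Japanese bracket `⟨x⟩ = √(1 + x²)`. -/
def bracket (x : ℝ) : ℝ := Real.sqrt (1 + x ^ 2)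

/-! ### Littlewood-Paley blocks and norms -/

/-- The generating function `φ₀` of a homogeneous Littlewood-Paley decomposition of `ℝ³`. -/
structure LittlewoodPaley where
  φ : 𝓢(R3, ℝ)
  nonneg : ∀ ξ, 0 ≤ φ ξ
  le_one : ∀ ξ, φ ξ ≤ 1
  supp : tsupport (φ : R3 → ℝ) ⊆ {ξ | 2⁻¹ ≤ ‖ξ‖ ∧ ‖ξ‖ ≤ 2}
  sum_eq_one : ∀ ξ : R3, ξ ≠ 0 → HasSum (fun j : ℤ => φ (((2 : ℝ) ^ (-j)) • ξ)) 1

/-- The dyadic block `Δ_j = φ₀(2^{-j} D)`, `D = -i∇`. The factor `2π` turns the frequency variable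
of Mathlib's Fourier transform (kernel `e^{-2πi x·ξ}`) into that of the transform with kernel
`e^{-i x·ξ}`. -/
def LittlewoodPaley.block (P : LittlewoodPaley) (j : ℤ) : Distr → Distr :=
  fun T => TemperedDistribution.fourierMultiplierCLM ℂ
    (fun ξ : R3 => ((P.φ (((2 : ℝ) ^ (-j)) • ((2 * Real.pi) • ξ)) : ℝ) : ℂ)) T

/-- The `L^q` norm of a tempered distribution: the `L^q` norm of the function that represents it,
and `∞` if it is not represented by an `L^q` function. -/
def lqNorm (q : ℝ≥0∞) (T : Distr) : ℝ≥0∞ :=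
  ⨅ (h : R3 → ℂ) (_ : MemLp h q volume) (_ : ∀ θ : 𝓢(R3, ℂ), T θ = ∫ x, θ x * h x),
    eLpNorm h q volume

/-- `‖Δ_j (a, u)‖_{L^q}`; the norm of a tuple is the sum of the norms of its components. -/
def blockNorm (P : LittlewoodPaley) (j : ℤ) (q : ℝ≥0∞) (a : Distr) (u : Fin 3 → Distr) : ℝ≥0∞ :=
  lqNorm q (P.block j a) + ∑ k, lqNorm q (P.block j (u k))

/-- `‖Δ_j (a, u)‖_{L^r(0,t; L^q)}`. -/
def blockNormLr (P : LittlewoodPaley) (j : ℤ) (r q : ℝ≥0∞) (t : ℝ)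
    (a : ℝ → Distr) (u : ℝ → Fin 3 → Distr) : ℝ≥0∞ :=
  eLpNorm (fun s => blockNorm P j q (a s) (u s)) r (volume.restrict (Ioo 0 t))

/-- The low-frequency part `‖(a, u)‖^{ℓ;α}` of the norm of `Ḃ^s_{p,1}` (sum over `2^j ≤ α`). -/
def besovLow (P : LittlewoodPaley) (α s : ℝ) (p : ℝ≥0∞) (a : Distr) (u : Fin 3 → Distr) : ℝ≥0∞ :=
  ∑' j : {j : ℤ // (2 : ℝ) ^ j ≤ α},
    ENNReal.ofReal ((2 : ℝ) ^ (s * ((j : ℤ) : ℝ))) * blockNorm P j p a u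

/-- The low-frequency part of the norm of `L^r(0,t; Ḃ^s_{p,1})`. -/
def lrBesovLow (P : LittlewoodPaley) (α s : ℝ) (r p : ℝ≥0∞) (t : ℝ)
    (a : ℝ → Distr) (u : ℝ → Fin 3 → Distr) : ℝ≥0∞ :=
  eLpNorm (fun τ => besovLow P α s p (a τ) (u τ)) r (volume.restrict (Ioo 0 t))

/-- The low-frequency part of the Chemin-Lerner norm of `L̃^r(0,t; Ḃ^s_{p,1})`. -/
def cheminLernerLow (P : LittlewoodPaley) (α s : ℝ) (r p : ℝ≥0∞) (t : ℝ)
    (a : ℝ → Distr) (u : ℝ → Fin 3 → Distr) : ℝ≥0∞ :=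
  ∑' j : {j : ℤ // (2 : ℝ) ^ j ≤ α},
    ENNReal.ofReal ((2 : ℝ) ^ (s * ((j : ℤ) : ℝ))) * blockNormLr P j r p t a u

/-! ### The linearized system -/

/-- `div u`. -/
def divergence (u : Fin 3 → Distr) : Distr := ∑ k, ∂_{basisVec k} (u k)

/-- `e₃ × u = (-u₂, u₁, 0)`. -/
def e3Cross (u : Fin 3 → Distr) : Fin 3 → Distr := ![-(u 1), u 0, 0]

/-- `𝓛 u = μ Δ u + (μ + μ') ∇ div u`. -/
def lame (μ μ' : ℝ) (u : Fin 3 → Distr) : Fin 3 → Distr := fun k =>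
  (μ : ℂ) • Laplacian.laplacian (u k) + ((μ + μ' : ℝ) : ℂ) • ∂_{basisVec k} (divergence u)

/-- `(a, u)` is a solution on `[0, T]`, in the sense of tempered distributions, of
`∂ₜ a + ε⁻¹ div u = f`, `∂ₜ u - 𝓛 u + Ω (e₃ × u) + ε⁻¹ ∇ a = g`, `(a, u)(0) = (a₀, u₀)`:
`a` and `u` are weakly continuous in time, the forces are weakly integrable in time, and the
system holds in time-integrated form against every Schwartz function of the space variable. -/
structure IsSolution (μ μ' ε Ω T : ℝ) (a₀ : Distr) (u₀ : Fin 3 → Distr)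
    (f : ℝ → Distr) (g : ℝ → Fin 3 → Distr)
    (a : ℝ → Distr) (u : ℝ → Fin 3 → Distr) : Prop where
  cont_a : ∀ θ : 𝓢(R3, ℂ), ContinuousOn (fun t => a t θ) (Icc 0 T)
  cont_u : ∀ (k : Fin 3) (θ : 𝓢(R3, ℂ)), ContinuousOn (fun t => u t k θ) (Icc 0 T)
  int_f : ∀ θ : 𝓢(R3, ℂ), IntegrableOn (fun t => f t θ) (Ioo 0 T)
  int_g : ∀ (k : Fin 3) (θ : 𝓢(R3, ℂ)), IntegrableOn (fun t => g t k θ) (Ioo 0 T)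
  eq_a : ∀ t ∈ Icc (0 : ℝ) T, ∀ θ : 𝓢(R3, ℂ),
    a t θ = a₀ θ + ∫ s in (0 : ℝ)..t, (f s - ((1 / ε : ℝ) : ℂ) • divergence (u s)) θ
  eq_u : ∀ t ∈ Icc (0 : ℝ) T, ∀ (k : Fin 3) (θ : 𝓢(R3, ℂ)),
    u t k θ = u₀ k θ + ∫ s in (0 : ℝ)..t,
      (g s k + lame μ μ' (u s) k - (Ω : ℂ) • e3Cross (u s) k
        - ((1 / ε : ℝ) : ℂ) • ∂_{basisVec k} (a s)) θ

/-- The exponent `3r + 1`; at `r = ∞`, where this is not a number, it is `1`. -/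
def growthExponent (r : ℝ≥0∞) : ℝ := if r = ∞ then 1 else 3 * r.toReal + 1

end

end RotatingNSC

open RotatingNSC

namespace RotatingNSC

open FourierTransform Filter Topology Metric Module
open scoped Real
open Complex (norm_real norm_exp_ofReal_mul_I I_sq real_smul exp_add ofReal_pow I)
open Real (norm_eq_abs norm_of_nonneg sq_sqrt sinc sin cos pi_pos sqrt_sq rpow_le_rpow rpow_add
  rpow_nonneg mul_rpow rpow_mul rpow_one rpow_natCast sqrt)
open intervalIntegral (integral_congr integral_add_adjacent_intervals integral_same
  integral_eq_sub_of_hasDerivAt integral_of_le)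
open EuclideanSpace (real_norm_sq_eq proj)
open ENNReal (toReal_ofReal ofReal_mul ofReal_ofNat ofReal_le_ofReal ofReal_rpow_of_nonneg
  toReal_nonneg ofReal_toReal ofReal_ne_top toReal_inv ofReal_one toReal_mono ofReal)
open Finset (mul_sum sum_le_sum sum_mul sum_add_distrib single_le_sum sum_nonneg sum_congr)
open Function (uncurry)
open SchwartzMap (seminorm smulLeftCLM smulLeftCLM_apply_apply toLpCLM)
open NormedSpace (exp)
open Complex renaming exp → cexp

noncomputable section

local notation "𝒮" => 𝓢(R3, ℂ)

/-! ### One-dimensional oscillatory integrals -/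

lemma continuousOn_deriv_of_contDiffAt {E : Type*} [NormedAddCommGroup E]
    [NormedSpace ℝ E] {a b : ℝ} {F : ℝ → E}
    (hF : ∀ s ∈ Icc a b, ContDiffAt ℝ 1 F s) : ContinuousOn (deriv F) (Icc a b) := by
  intro s hs
  have h := ((hF s hs).continuousAt_fderiv one_ne_zero).clm_apply (continuousAt_const (y := (1 : ℝ)))
  simp only [fderiv_apply_one_eq_deriv] at h
  exact h.continuousWithinAt

/-- Integration by parts against a bounded primitive: the variation of the amplitude controls
the integral. -/
lemma norm_integral_smul_deriv_le {a b V : ℝ} (hab : a ≤ b) {A : ℝ → ℝ} {F : ℝ → ℂ}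
    (hA : ∀ s ∈ Icc a b, ContDiffAt ℝ 1 A s) (hF : ∀ s ∈ Icc a b, ContDiffAt ℝ 1 F s)
    (hF1 : ∀ s ∈ Icc a b, ‖F s‖ ≤ 1) (hV : ∫ s in a..b, |deriv A s| ≤ V) :
    ‖∫ s in a..b, (A s : ℂ) * deriv F s‖ ≤ |A a| + |A b| + V := by
  have hI : uIcc a b = Icc a b := uIcc_of_le hab
  have cA := continuousOn_deriv_of_contDiffAt hA
  have cF := continuousOn_deriv_of_contDiffAt hF
  have dA : ∀ s ∈ uIcc a b, HasDerivAt (fun s => (A s : ℂ)) ((deriv A s : ℝ) : ℂ) s := fun s hs =>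
    (((hA s (hI ▸ hs)).differentiableAt (by simp)).hasDerivAt).ofReal_comp
  have dF : ∀ s ∈ uIcc a b, HasDerivAt F (deriv F s) s := fun s hs =>
    ((hF s (hI ▸ hs)).differentiableAt (by simp)).hasDerivAt
  have iA : IntervalIntegrable (fun s => ((deriv A s : ℝ) : ℂ)) volume a b :=
    ContinuousOn.intervalIntegrable (by
      rw [hI]; exact Complex.continuous_ofReal.comp_continuousOn cA)
  have iF : IntervalIntegrable (deriv F) volume a b :=
    ContinuousOn.intervalIntegrable (by rw [hI]; exact cF)
  rw [intervalIntegral.integral_mul_deriv_eq_deriv_mul dA dF iA iF]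
  have h1 : ‖∫ s in a..b, ((deriv A s : ℝ) : ℂ) * F s‖ ≤ V := by
    refine le_trans (intervalIntegral.norm_integral_le_of_norm_le hab
      (g := fun s => |deriv A s|) ?_ ?_) hV
    · refine .of_forall fun s hs => ?_
      rw [norm_mul, norm_real, norm_eq_abs]
      exact mul_le_of_le_one_right (abs_nonneg _) (hF1 s (Ioc_subset_Icc_self hs))
    · exact ContinuousOn.intervalIntegrable (by rw [hI]; exact cA.abs)
  have ha := hF1 a (left_mem_Icc.2 hab)
  have hb := hF1 b (right_mem_Icc.2 hab)
  calc _ ≤ ‖(A b : ℂ) * F b - (A a : ℂ) * F a‖ + V := (norm_sub_le _ _).trans (by gcongr)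
    _ ≤ ‖(A b : ℂ) * F b‖ + ‖(A a : ℂ) * F a‖ + V := by gcongr; exact norm_sub_le _ _
    _ ≤ |A b| + |A a| + V := by
      gcongr
      · rw [norm_mul, norm_real]; exact mul_le_of_le_one_right (abs_nonneg _) hb
      · rw [norm_mul, norm_real]; exact mul_le_of_le_one_right (abs_nonneg _) ha
    _ = _ := by ring

lemma integral_deriv_of_contDiffAt {a b : ℝ} (hab : a ≤ b) {A : ℝ → ℝ}
    (hA : ∀ s ∈ Icc a b, ContDiffAt ℝ 1 A s) : ∫ s in a..b, deriv A s = A b - A a := by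
  have hI : uIcc a b = Icc a b := uIcc_of_le hab
  exact intervalIntegral.integral_deriv_eq_sub
    (fun s hs => (hA s (hI ▸ hs)).differentiableAt (by simp))
    (ContinuousOn.intervalIntegrable (by
      rw [hI]; exact continuousOn_deriv_of_contDiffAt hA))

lemma norm_integral_antitone_smul_deriv_le {a b M : ℝ} (hab : a ≤ b) {A : ℝ → ℝ} {F : ℝ → ℂ}
    (hA : ∀ s ∈ Icc a b, ContDiffAt ℝ 1 A s) (hF : ∀ s ∈ Icc a b, ContDiffAt ℝ 1 F s)
    (hF1 : ∀ s ∈ Icc a b, ‖F s‖ ≤ 1) (hanti : AntitoneOn A (Icc a b)) (h0 : 0 ≤ A b)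
    (hM : A a ≤ M) :
    ‖∫ s in a..b, (A s : ℂ) * deriv F s‖ ≤ 2 * M := by
  have key : ∫ s in a..b, |deriv A s| = A a - A b := by
    rw [← neg_sub (A b), ← integral_deriv_of_contDiffAt hab hA, ← intervalIntegral.integral_neg]
    refine intervalIntegral.integral_congr_ae ?_
    have : ∀ᵐ s : ℝ, s ≠ b := by simp [ae_iff, measure_singleton]
    filter_upwards [this] with s hsb hs
    rw [uIoc_of_le hab] at hs
    refine abs_of_nonpos ?_
    have hm : Icc a b ∈ nhds s := Icc_mem_nhds hs.1 (lt_of_le_of_ne hs.2 hsb)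
    rw [← derivWithin_of_mem_nhds hm]
    exact hanti.derivWithin_nonpos
  have hba := hanti (left_mem_Icc.2 hab) (right_mem_Icc.2 hab) hab
  refine (norm_integral_smul_deriv_le hab hA hF hF1 key.le).trans ?_
  rw [abs_of_nonneg h0, abs_of_nonneg (h0.trans hba)]
  linarith

lemma norm_integral_monotone_smul_deriv_le {a b M : ℝ} (hab : a ≤ b) {A : ℝ → ℝ} {F : ℝ → ℂ}
    (hA : ∀ s ∈ Icc a b, ContDiffAt ℝ 1 A s) (hF : ∀ s ∈ Icc a b, ContDiffAt ℝ 1 F s)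
    (hF1 : ∀ s ∈ Icc a b, ‖F s‖ ≤ 1) (hmono : MonotoneOn A (Icc a b)) (h0 : 0 ≤ A a)
    (hM : A b ≤ M) :
    ‖∫ s in a..b, (A s : ℂ) * deriv F s‖ ≤ 2 * M := by
  have key : ∫ s in a..b, |deriv A s| = A b - A a := by
    rw [← integral_deriv_of_contDiffAt hab hA]
    refine intervalIntegral.integral_congr_ae ?_
    have : ∀ᵐ s : ℝ, s ≠ b := by simp [ae_iff, measure_singleton]
    filter_upwards [this] with s hsb hs
    rw [uIoc_of_le hab] at hs
    refine abs_of_nonneg ?_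
    have hm : Icc a b ∈ nhds s := Icc_mem_nhds hs.1 (lt_of_le_of_ne hs.2 hsb)
    rw [← derivWithin_of_mem_nhds hm]
    exact hmono.derivWithin_nonneg
  have hba := hmono (left_mem_Icc.2 hab) (right_mem_Icc.2 hab) hab
  refine (norm_integral_smul_deriv_le hab hA hF hF1 key.le).trans ?_
  rw [abs_of_nonneg h0, abs_of_nonneg (h0.trans hba)]
  linarith

/-- A continuous antitone function crosses a level at most once. -/
lemma exists_level_of_antitoneOn {a b ℓ : ℝ} (hab : a ≤ b) {f : ℝ → ℝ}
    (hf : ContinuousOn f (Icc a b)) (hanti : AntitoneOn f (Icc a b)) :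
    ∃ m ∈ Icc a b, (m = a ∨ ∀ s ∈ Icc a m, ℓ ≤ f s) ∧ (m = b ∨ ∀ s ∈ Icc m b, f s ≤ ℓ) := by
  have ha := left_mem_Icc.2 hab
  have hb := right_mem_Icc.2 hab
  by_cases h1 : f a ≤ ℓ
  · exact ⟨a, ha, Or.inl rfl, Or.inr fun s hs => (hanti ha hs hs.1).trans h1⟩
  by_cases h2 : ℓ ≤ f b
  · exact ⟨b, hb, Or.inr fun s hs => h2.trans (hanti hs hb hs.2), Or.inl rfl⟩
  obtain ⟨m, hm, rfl⟩ := intermediate_value_Icc' hab hf ⟨(not_le.1 h2).le, (not_le.1 h1).le⟩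
  exact ⟨m, hm, Or.inr fun s hs => hanti ⟨hs.1, hs.2.trans hm.2⟩ hm hs.2,
    Or.inr fun s hs => hanti hm ⟨hm.1.trans hs.1, hs.2⟩ hs.1⟩

/-- Abel summation: a nonnegative increasing amplitude. -/
lemma norm_integral_monotone_mul_le {a b M : ℝ} (hab : a ≤ b) {A : ℝ → ℝ} {f : ℝ → ℂ}
    (hA : ContDiff ℝ 1 A) (hf : Continuous f) (hmono : MonotoneOn A (Icc a b)) (h0 : 0 ≤ A a)
    (hM : 0 < M) (hfM : ∀ s ∈ Icc a b, ‖∫ y in a..s, f y‖ ≤ M) :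
    ‖∫ s in a..b, (A s : ℂ) * f s‖ ≤ 2 * (M * A b) := by
  have hd : ∀ s, HasDerivAt (fun s => (M⁻¹ : ℝ) • ∫ y in a..s, f y) ((M⁻¹ : ℝ) • f s) s := fun s =>
    (intervalIntegral.integral_hasDerivAt_right (hf.intervalIntegrable _ _)
      (hf.stronglyMeasurableAtFilter _ _) hf.continuousAt).fun_const_smul _
  have hdd : deriv (fun s => (M⁻¹ : ℝ) • ∫ y in a..s, f y) = fun s => (M⁻¹ : ℝ) • f s :=
    funext fun s => (hd s).deriv
  have h := norm_integral_monotone_smul_deriv_le (M := A b) hab (fun s _ => hA.contDiffAt)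
    (F := fun s => (M⁻¹ : ℝ) • ∫ y in a..s, f y) (fun s _ => ?_) (fun s hs => ?_) hmono h0 le_rfl
  · rw [hdd] at h
    have : (fun s => (A s : ℂ) * (M⁻¹ : ℝ) • f s) = fun s => (M⁻¹ : ℝ) • ((A s : ℂ) * f s) := by
      funext s; rw [mul_smul_comm]
    rw [this, intervalIntegral.integral_smul, norm_smul, norm_inv, norm_of_nonneg hM.le] at h
    rw [inv_mul_le_iff₀ hM] at h
    linarith
  · refine ContDiff.contDiffAt (contDiff_one_iff_deriv.2 ⟨fun s => (hd s).differentiableAt, ?_⟩)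
    rw [hdd]; fun_prop
  · rw [norm_smul, norm_inv, norm_of_nonneg hM.le, inv_mul_le_iff₀ hM, mul_one]
    exact hfM s hs

/-! ### The radius along a spheroidal ray -/

/-- `(s² - 1) b² + (s x + c)²`. -/
def quad (b x c s : ℝ) : ℝ := (s ^ 2 - 1) * b ^ 2 + (s * x + c) ^ 2

/-- The square root of `quad`. -/
def rad (b x c s : ℝ) : ℝ := sqrt (quad b x c s)

lemma quad_pos {b x c s : ℝ} (hb : b ≠ 0) (hc : x + c ≠ 0) (hs : 1 ≤ s) : 0 < quad b x c s := by
  unfold quad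
  rcases hs.eq_or_lt with rfl | h
  · have : 0 < (x + c) ^ 2 := by positivity
    nlinarith
  · have : 0 < b ^ 2 := by positivity
    have h2 : 0 < s ^ 2 - 1 := by nlinarith
    positivity

lemma rad_pos {b x c s : ℝ} (hb : b ≠ 0) (hc : x + c ≠ 0) (hs : 1 ≤ s) : 0 < rad b x c s :=
  Real.sqrt_pos.2 (quad_pos hb hc hs)

lemma rad_sq {b x c s : ℝ} (hb : b ≠ 0) (hc : x + c ≠ 0) (hs : 1 ≤ s) :
    rad b x c s ^ 2 = quad b x c s := sq_sqrt (quad_pos hb hc hs).le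

lemma continuous_rad (b x c : ℝ) : Continuous (rad b x c) := by
  unfold rad quad; fun_prop

lemma contDiffAt_rad {b x c s : ℝ} (hb : b ≠ 0) (hc : x + c ≠ 0) (hs : 1 ≤ s) :
    ContDiffAt ℝ 1 (rad b x c) s := by
  unfold rad
  refine ContDiffAt.sqrt ?_ (quad_pos hb hc hs).ne'
  unfold quad; fun_prop

lemma hasDerivAt_rad {b x c s : ℝ} (hb : b ≠ 0) (hc : x + c ≠ 0) (hs : 1 ≤ s) :
    HasDerivAt (rad b x c) (((b ^ 2 + x ^ 2) * s + x * c) / rad b x c s) s := by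
  have h : HasDerivAt (quad b x c) (2 * s * b ^ 2 + 2 * (s * x + c) * x) s := by
    have h1 := (((hasDerivAt_id' s).fun_pow 2).sub_const 1).mul_const (b ^ 2)
    have h2 := (((hasDerivAt_id' s).mul_const x).add_const c).fun_pow 2
    exact (h1.fun_add h2).congr_deriv (by push_cast; ring)
  refine (h.sqrt (quad_pos hb hc hs).ne').congr_deriv ?_
  have := (Real.sqrt_pos.2 (quad_pos hb hc hs)).ne'
  simp only [rad]
  field_simp
  ring

lemma sinc_rad {b x c s : ℝ} (hb : b ≠ 0) (hc : x + c ≠ 0) (hs : 1 ≤ s) :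
    sinc (rad b x c s) = sin (rad b x c s) / rad b x c s :=
  Real.sinc_of_ne_zero (rad_pos hb hc hs).ne'

lemma continuous_sinc_rad (b x c : ℝ) : Continuous fun s => sinc (rad b x c s) :=
  Real.continuous_sinc.comp (continuous_rad b x c)

lemma abs_mul_cos_sub_sin_le {y : ℝ} (hy : 0 ≤ y) : |y * cos y - sin y| ≤ y ^ 3 := by
  have hd : ∀ u : ℝ, HasDerivAt (fun u => u * cos u - sin u) (-(u * sin u)) u := by
    intro u
    exact (((hasDerivAt_id' u).fun_mul (Real.hasDerivAt_cos u)).fun_sub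
      (Real.hasDerivAt_sin u)).congr_deriv (by ring)
  have := (convex_Icc (0 : ℝ) y).norm_image_sub_le_of_norm_hasDerivWithin_le
    (f := fun u => u * cos u - sin u) (C := y ^ 2)
    (fun u _ => (hd u).hasDerivWithinAt) (fun u hu => ?_) (left_mem_Icc.2 hy) (right_mem_Icc.2 hy)
  · simpa [norm_eq_abs, abs_of_nonneg hy, ← pow_succ] using this
  · rw [norm_neg, norm_eq_abs, abs_mul]
    have h1 : |sin u| ≤ |u| := Real.abs_sin_le_abs
    have h2 : |u| ≤ y := by rw [abs_of_nonneg hu.1]; exact hu.2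
    nlinarith [abs_nonneg u, abs_nonneg (sin u)]

lemma mul_cos_le_sin {y : ℝ} (hy : 0 ≤ y) (hy1 : y ≤ 1) : y * cos y ≤ sin y := by
  rcases hy.eq_or_lt with rfl | h0
  · simp
  have hlt : y < π / 2 := by linarith [Real.pi_gt_three]
  have hc : 0 < cos y := Real.cos_pos_of_mem_Ioo ⟨by linarith [pi_pos], hlt⟩
  have := (Real.lt_tan h0 hlt).le
  rwa [Real.tan_eq_sin_div_cos, le_div_iff₀ hc] at this

lemma contDiffAt_sinc_rad {b x c s : ℝ} (hb : b ≠ 0) (hc : x + c ≠ 0) (hs : 1 ≤ s) :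
    ContDiffAt ℝ 1 (fun s => sin (rad b x c s) / rad b x c s) s :=
  ContDiffAt.div (Real.contDiff_sin.contDiffAt.comp s (contDiffAt_rad hb hc hs))
    (contDiffAt_rad hb hc hs) (rad_pos hb hc hs).ne'

lemma hasDerivAt_sinc_rad {b x c s : ℝ} (hb : b ≠ 0) (hc : x + c ≠ 0) (hs : 1 ≤ s) :
    HasDerivAt (fun s => sin (rad b x c s) / rad b x c s)
      ((rad b x c s * cos (rad b x c s) - sin (rad b x c s)) / rad b x c s ^ 3 *
        ((b ^ 2 + x ^ 2) * s + x * c)) s := by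
  have h := hasDerivAt_rad hb hc hs
  have hp := (rad_pos hb hc hs).ne'
  exact (h.sin.fun_div h hp).congr_deriv (by field_simp)

section SincIntegrals

variable {b x c : ℝ}

lemma norm_integral_sinc_rad_right (hb : b ≠ 0) (hc : x + c ≠ 0) {X : ℝ} (hX : 0 < X)
    (hX2 : X ^ 2 = b ^ 2 + x ^ 2) {p q : ℝ} (hp : 1 ≤ p) (hpq : p ≤ q)
    (hD : ∀ s ∈ Icc p q, X ≤ X ^ 2 * s + x * c) :
    ‖∫ s in p..q, (sinc (rad b x c s) : ℂ)‖ ≤ 2 / X := by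
  have h := norm_integral_antitone_smul_deriv_le (M := 1 / X) hpq
    (A := fun s => 1 / (X ^ 2 * s + x * c)) (F := fun s => ((-cos (rad b x c s) : ℝ) : ℂ))
    (fun s hs => ContDiffAt.div (n := 1) (g := fun s => X ^ 2 * s + x * c) contDiffAt_const (by fun_prop) (hX.trans_le (hD s hs)).ne')
    (fun s hs => Complex.ofRealCLM.contDiff.contDiffAt.comp s
      (Real.contDiff_cos.contDiffAt.comp s (contDiffAt_rad hb hc (hp.trans hs.1))).neg)
    (fun s _ => by rw [norm_real, norm_neg]; exact Real.abs_cos_le_one _)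
    (fun s hs t ht hst => one_div_le_one_div_of_le (hX.trans_le (hD s hs)) (by gcongr))
    (one_div_nonneg.2 (hX.le.trans (hD q (right_mem_Icc.2 hpq))))
    (one_div_le_one_div_of_le hX (hD p (left_mem_Icc.2 hpq)))
  rw [mul_one_div] at h
  refine le_trans (le_of_eq ?_) h
  congr 1
  refine integral_congr fun s hs => ?_
  rw [uIcc_of_le hpq] at hs
  have h1 := hp.trans hs.1
  have hD' := (hX.trans_le (hD s hs)).ne'
  have hd := ((hasDerivAt_rad hb hc h1).cos.fun_neg).ofReal_comp
  rw [hd.deriv, sinc_rad hb hc h1, ← Complex.ofReal_mul, ← hX2]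
  congr 1
  have := (rad_pos hb hc h1).ne'
  field_simp

lemma norm_integral_sinc_rad_left (hb : b ≠ 0) (hc : x + c ≠ 0) {X : ℝ} (hX : 0 < X)
    (hX2 : X ^ 2 = b ^ 2 + x ^ 2) {p q : ℝ} (hp : 1 ≤ p) (hpq : p ≤ q)
    (hD : ∀ s ∈ Icc p q, X ≤ -(X ^ 2 * s + x * c)) :
    ‖∫ s in p..q, (sinc (rad b x c s) : ℂ)‖ ≤ 2 / X := by
  have h := norm_integral_monotone_smul_deriv_le (M := 1 / X) hpq
    (A := fun s => 1 / (-(X ^ 2 * s + x * c))) (F := fun s => ((cos (rad b x c s) : ℝ) : ℂ))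
    (fun s hs => ContDiffAt.div (n := 1) (g := fun s => -(X ^ 2 * s + x * c)) contDiffAt_const (by fun_prop) (hX.trans_le (hD s hs)).ne')
    (fun s hs => Complex.ofRealCLM.contDiff.contDiffAt.comp s
      (Real.contDiff_cos.contDiffAt.comp s (contDiffAt_rad hb hc (hp.trans hs.1))))
    (fun s _ => by rw [norm_real]; exact Real.abs_cos_le_one _)
    (fun s hs t ht hst => one_div_le_one_div_of_le (hX.trans_le (hD t ht)) (by gcongr))
    (one_div_nonneg.2 (hX.le.trans (hD p (left_mem_Icc.2 hpq))))
    (one_div_le_one_div_of_le hX (hD q (right_mem_Icc.2 hpq)))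
  rw [mul_one_div] at h
  refine le_trans (le_of_eq ?_) h
  congr 1
  refine integral_congr fun s hs => ?_
  rw [uIcc_of_le hpq] at hs
  have h1 := hp.trans hs.1
  have hD' : X ^ 2 * s + x * c ≠ 0 := by have := hD s hs; intro h0; linarith
  have hd := ((hasDerivAt_rad hb hc h1).cos).ofReal_comp
  rw [hd.deriv, sinc_rad hb hc h1, ← Complex.ofReal_mul, ← hX2]
  congr 1
  have := (rad_pos hb hc h1).ne'
  field_simp

lemma norm_integral_sinc_rad_le_length {p q : ℝ} (hpq : p ≤ q) :
    ‖∫ s in p..q, (sinc (rad b x c s) : ℂ)‖ ≤ q - p := by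
  have := intervalIntegral.norm_integral_le_of_norm_le_const (a := p) (b := q) (C := 1)
    (f := fun s => (sinc (rad b x c s) : ℂ))
    (fun s _ => by rw [norm_real]; exact Real.abs_sinc_le_one _)
  rwa [one_mul, abs_of_nonneg (sub_nonneg.2 hpq)] at this

lemma norm_integral_sinc_rad_le_inv (hb : b ≠ 0) (hc : x + c ≠ 0) {X : ℝ} (hX : 0 < X)
    (hX2 : X ^ 2 = b ^ 2 + x ^ 2) {S : ℝ} (hS : 1 ≤ S) :
    ‖∫ s in (1 : ℝ)..S, (sinc (rad b x c s) : ℂ)‖ ≤ 6 / X := by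
  have hint : ∀ p q, IntervalIntegrable (fun s => (sinc (rad b x c s) : ℂ)) volume p q :=
    fun p q => (Complex.continuous_ofReal.comp (continuous_sinc_rad b x c)).intervalIntegrable _ _
  obtain ⟨m₁, hm₁, h1a, h1b⟩ := exists_level_of_antitoneOn (ℓ := X) hS
    (f := fun s => -(X ^ 2 * s + x * c)) (by fun_prop)
    (fun s _ t _ hst => by dsimp only; gcongr)
  obtain ⟨m₂, hm₂, h2a, h2b⟩ := exists_level_of_antitoneOn (ℓ := -X) hm₁.2
    (f := fun s => -(X ^ 2 * s + x * c)) (by fun_prop)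
    (fun s _ t _ hst => by dsimp only; gcongr)
  rw [← integral_add_adjacent_intervals (hint 1 m₁) (hint m₁ S),
    ← integral_add_adjacent_intervals (hint m₁ m₂) (hint m₂ S)]
  have e1 : ‖∫ s in (1 : ℝ)..m₁, (sinc (rad b x c s) : ℂ)‖ ≤ 2 / X := by
    rcases h1a with h | h
    · rw [h, integral_same, norm_zero]; positivity
    · exact norm_integral_sinc_rad_left hb hc hX hX2 le_rfl hm₁.1 h
  have e3 : ‖∫ s in m₂..S, (sinc (rad b x c s) : ℂ)‖ ≤ 2 / X := by
    rcases h2b with h | h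
    · rw [h, integral_same, norm_zero]; positivity
    · exact norm_integral_sinc_rad_right hb hc hX hX2 (hm₁.1.trans hm₂.1) hm₂.2
        (fun s hs => by linarith [h s hs])
  have e2 : ‖∫ s in m₁..m₂, (sinc (rad b x c s) : ℂ)‖ ≤ 2 / X := by
    refine (norm_integral_sinc_rad_le_length hm₂.1).trans ?_
    rw [le_div_iff₀ hX]
    rcases h2a with h | h
    · rw [h]; simp
    rcases h1b with h' | h'
    · have : m₂ = m₁ := le_antisymm (h' ▸ hm₂.2) hm₂.1
      rw [this]; simp
    have i1 := h' m₁ (left_mem_Icc.2 hm₁.2)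
    have i2 := h m₂ (right_mem_Icc.2 hm₂.1)
    nlinarith
  calc _ ≤ 2 / X + (2 / X + 2 / X) :=
        (norm_add_le _ _).trans (add_le_add e1 ((norm_add_le _ _).trans (add_le_add e2 e3)))
    _ = _ := by ring

lemma sq_le_quad {s : ℝ} (hs : 1 ≤ s) : (s * x + c) ^ 2 ≤ quad b x c s := by
  unfold quad
  have : 0 ≤ (s ^ 2 - 1) * b ^ 2 := mul_nonneg (by nlinarith) (sq_nonneg _)
  linarith

/-- Decay in the shift `c`. -/
lemma norm_integral_sinc_rad_le (hb : b ≠ 0) (hc : x + c ≠ 0) (hc0 : c ≠ 0) {S : ℝ}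
    (hS : 1 ≤ S) :
    ‖∫ s in (1 : ℝ)..S, (sinc (rad b x c s) : ℂ)‖ ≤ 12 * S / |c| := by
  have hc' : 0 < |c| := abs_pos.2 hc0
  set X := sqrt (b ^ 2 + x ^ 2) with hXd
  have hpos : 0 < b ^ 2 + x ^ 2 := by positivity
  have hX : 0 < X := Real.sqrt_pos.2 hpos
  have hX2 : X ^ 2 = b ^ 2 + x ^ 2 := sq_sqrt hpos.le
  by_cases h : |c| ≤ 2 * S * X
  · refine (norm_integral_sinc_rad_le_inv hb hc hX hX2 hS).trans ?_
    rw [div_le_div_iff₀ hX hc']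
    nlinarith
  push Not at h
  have hxX : |x| ≤ X := Real.abs_le_sqrt (by nlinarith [sq_nonneg b])
  have := intervalIntegral.norm_integral_le_of_norm_le_const (a := 1) (b := S) (C := 2 / |c|)
    (f := fun s => (sinc (rad b x c s) : ℂ)) (fun s hs => ?_)
  · refine this.trans ?_
    rw [abs_of_nonneg (by linarith : 0 ≤ S - 1), div_mul_eq_mul_div]
    refine div_le_div_of_nonneg_right ?_ hc'.le
    linarith
  · rw [uIoc_of_le hS] at hs
    have h1 := hs.1.le
    rw [norm_real, sinc_rad hb hc h1, norm_div, norm_of_nonneg (rad_pos hb hc h1).le]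
    have hr : |c| / 2 ≤ rad b x c s := by
      refine Real.le_sqrt_of_sq_le (le_trans ?_ (sq_le_quad h1))
      rw [← sq_abs (s * x + c)]
      refine pow_le_pow_left₀ (by positivity) ?_ 2
      have h3 : |c| ≤ |s * x + c| + |s * x| := by
        have := abs_sub (s * x + c) (s * x); rwa [add_sub_cancel_left] at this
      have h4 : |s * x| ≤ S * X := by
        rw [abs_mul, abs_of_pos (by linarith)]
        exact mul_le_mul hs.2 hxX (abs_nonneg _) (by linarith)
      linarith
    calc _ ≤ 1 / (|c| / 2) := div_le_div₀ zero_le_one (Real.abs_sin_le_one _) (by positivity) hr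
      _ = _ := by field_simp

/-! ### Decay in the modulation -/

/-- The derivative of `rad`. -/
def radDeriv (b x c s : ℝ) : ℝ := ((b ^ 2 + x ^ 2) * s + x * c) / rad b x c s

lemma contDiffAt_radDeriv (hb : b ≠ 0) (hc : x + c ≠ 0) {s : ℝ} (hs : 1 ≤ s) :
    ContDiffAt ℝ 1 (radDeriv b x c) s :=
  ContDiffAt.div (by fun_prop) (contDiffAt_rad hb hc hs) (rad_pos hb hc hs).ne'

lemma modulation_deriv (τ s : ℝ) :
    HasDerivAt (fun s : ℝ => cexp (τ * s * I))
      (τ * I * cexp (τ * s * I)) s := by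
  have h : HasDerivAt (fun s : ℝ => (τ : ℂ) * s * I) (τ * I) s := by
    have := (((hasDerivAt_id' s).ofReal_comp).const_mul (τ : ℂ)).mul_const I
    simpa using this
  exact h.cexp.congr_deriv (by ring)

lemma contDiff_modulation (τ : ℝ) :
    ContDiff ℝ 1 (fun s : ℝ => cexp (τ * s * I)) := by
  have : ContDiff ℝ 1 (fun s : ℝ => (s : ℂ)) := Complex.ofRealCLM.contDiff
  exact ((contDiff_const.mul this).mul contDiff_const).cexp

lemma norm_modulation (τ s : ℝ) : ‖cexp (τ * s * I)‖ = 1 := by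
  rw [← Complex.ofReal_mul, norm_exp_ofReal_mul_I]

/-- Integration by parts in the modulation. -/
lemma norm_integral_modulation_mul_le {τ : ℝ} (hτ : 0 < τ) {a₁ b₁ V : ℝ} (hab : a₁ ≤ b₁)
    {A : ℝ → ℝ} (hA : ∀ s ∈ Icc a₁ b₁, ContDiffAt ℝ 1 A s)
    (hV : ∫ s in a₁..b₁, |deriv A s| ≤ V) :
    ‖∫ s in a₁..b₁, cexp (τ * s * I) * (A s : ℂ)‖ ≤
      (|A a₁| + |A b₁| + V) / τ := by
  have h := norm_integral_smul_deriv_le hab hA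
    (fun s _ => (contDiff_modulation τ).contDiffAt) (fun s _ => (norm_modulation τ s).le) hV
  have e : ∀ s : ℝ, (A s : ℂ) * deriv (fun s : ℝ => cexp (τ * s * I)) s =
      (τ * I) * (cexp (τ * s * I) * (A s : ℂ)) := fun s => by
    rw [(modulation_deriv τ s).deriv]; ring
  simp only [e] at h
  rw [intervalIntegral.integral_const_mul, norm_mul, norm_mul, Complex.norm_I,
    norm_real, norm_of_nonneg hτ.le, mul_one] at h
  rwa [le_div_iff₀' hτ]

lemma norm_integral_modulation_antitone_le {τ : ℝ} (hτ : 0 < τ) {a₁ b₁ M : ℝ} (hab : a₁ ≤ b₁)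
    {A : ℝ → ℝ} (hA : ∀ s ∈ Icc a₁ b₁, ContDiffAt ℝ 1 A s) (hanti : AntitoneOn A (Icc a₁ b₁))
    (h0 : 0 ≤ A b₁) (hM : A a₁ ≤ M) :
    ‖∫ s in a₁..b₁, cexp (τ * s * I) * (A s : ℂ)‖ ≤ 2 * M / τ := by
  have h := norm_integral_antitone_smul_deriv_le hab hA
    (fun s _ => (contDiff_modulation τ).contDiffAt) (fun s _ => (norm_modulation τ s).le)
    hanti h0 hM
  have e : ∀ s : ℝ, (A s : ℂ) * deriv (fun s : ℝ => cexp (τ * s * I)) s =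
      (τ * I) * (cexp (τ * s * I) * (A s : ℂ)) := fun s => by
    rw [(modulation_deriv τ s).deriv]; ring
  simp only [e] at h
  rw [intervalIntegral.integral_const_mul, norm_mul, norm_mul, Complex.norm_I,
    norm_real, norm_of_nonneg hτ.le, mul_one] at h
  rwa [le_div_iff₀' hτ]

/-- Small frequencies: the variation of the amplitude is bounded. -/
lemma norm_integral_modulation_sinc_small (hb : b ≠ 0) (hc : x + c ≠ 0) (hc2 : |c| ≤ 2)
    {X : ℝ} (hX : 0 < X) (hX2 : X ^ 2 = b ^ 2 + x ^ 2) (hXc : X ≤ 4) {τ : ℝ} (hτ : 0 < τ)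
    {S : ℝ} (hS : 1 ≤ S) :
    ‖∫ s in (1 : ℝ)..S, cexp (τ * s * I) * (sinc (rad b x c s) : ℂ)‖ ≤
      40 * S ^ 2 / τ := by
  have h := norm_integral_modulation_mul_le hτ hS (V := 24 * S * (S - 1))
    (A := fun s => sin (rad b x c s) / rad b x c s)
    (fun s hs => contDiffAt_sinc_rad hb hc hs.1) ?_
  · have e : ∫ s in (1 : ℝ)..S, cexp (τ * s * I) * (sinc (rad b x c s) : ℂ) =
        ∫ s in (1 : ℝ)..S, cexp (τ * s * I) *
          ((sin (rad b x c s) / rad b x c s : ℝ) : ℂ) :=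
      integral_congr fun s hs => by
        rw [uIcc_of_le hS] at hs; simp only [sinc_rad hb hc hs.1]
    rw [e]
    refine h.trans ?_
    rw [← sinc_rad hb hc le_rfl, ← sinc_rad hb hc hS]
    have h1 := Real.abs_sinc_le_one (rad b x c 1)
    have h2 := Real.abs_sinc_le_one (rad b x c S)
    gcongr
    nlinarith
  · have hxX : |x| ≤ X := abs_le_of_sq_le_sq (by nlinarith [sq_nonneg b]) hX.le
    have := intervalIntegral.norm_integral_le_of_norm_le_const (a := 1) (b := S) (C := 24 * S)
      (f := fun s => |deriv (fun s => sin (rad b x c s) / rad b x c s) s|) (fun s hs => ?_)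
    · rw [abs_of_nonneg (by linarith : 0 ≤ S - 1)] at this
      exact (le_abs_self _).trans this
    · rw [uIoc_of_le hS] at hs
      have h1 := hs.1.le
      have hr := rad_pos hb hc h1
      rw [(hasDerivAt_sinc_rad hb hc h1).deriv, norm_eq_abs, abs_abs, abs_mul, abs_div,
        abs_of_pos (pow_pos hr 3), ← hX2]
      have i1 := (div_le_one (pow_pos hr 3)).2 (abs_mul_cos_sub_sin_le hr.le)
      have i2 : |X ^ 2 * s + x * c| ≤ 24 * S := by
        refine (abs_add_le _ _).trans ?_
        rw [abs_mul, abs_mul, abs_of_pos (by positivity : 0 < X ^ 2), abs_of_pos (by linarith : 0 < s)]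
        have : X ^ 2 ≤ 16 := by nlinarith
        have : |x| * |c| ≤ 4 * 2 := mul_le_mul (hxX.trans hXc) hc2 (abs_nonneg _) (by norm_num)
        nlinarith [hs.2]
      calc _ ≤ 1 * (24 * S) := mul_le_mul i1 i2 (abs_nonneg _) zero_le_one
        _ = _ := one_mul _

end SincIntegrals

section ModulatedSinc

variable {b x c X : ℝ}

lemma radDeriv_num_bounds (hX : 0 < X) (hX2 : X ^ 2 = b ^ 2 + x ^ 2) (hXc : 2 * |c| ≤ X)
    {s : ℝ} (hs : 1 ≤ s) :
    X ^ 2 / 2 ≤ (b ^ 2 + x ^ 2) * s + x * c ∧ (b ^ 2 + x ^ 2) * s + x * c ≤ 3 / 2 * X ^ 2 * s := by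
  have hxX : |x| ≤ X := abs_le_of_sq_le_sq (by nlinarith [sq_nonneg b]) hX.le
  have h : |x * c| ≤ X ^ 2 / 2 := by
    rw [abs_mul]; nlinarith [abs_nonneg c, abs_nonneg x]
  have h' := abs_le.1 h
  rw [← hX2]
  have : 0 < X ^ 2 := by positivity
  constructor <;> nlinarith

lemma monotoneOn_rad (hX : 0 < X) (hX2 : X ^ 2 = b ^ 2 + x ^ 2) (hXc : 2 * |c| ≤ X) :
    MonotoneOn (rad b x c) (Ici 1) := by
  intro s hs t ht hst
  refine Real.sqrt_le_sqrt ?_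
  have h1 := (radDeriv_num_bounds hX hX2 hXc hs).1
  have h2 := (radDeriv_num_bounds hX hX2 hXc ht).1
  unfold quad
  have : 0 ≤ (t - s) * (((b ^ 2 + x ^ 2) * s + x * c) + ((b ^ 2 + x ^ 2) * t + x * c)) :=
    mul_nonneg (by linarith) (by nlinarith)
  linarith

lemma radDeriv_nonneg (hb : b ≠ 0) (hc : x + c ≠ 0) (hX : 0 < X)
    (hX2 : X ^ 2 = b ^ 2 + x ^ 2) (hXc : 2 * |c| ≤ X) {s : ℝ} (hs : 1 ≤ s) :
    0 ≤ radDeriv b x c s :=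
  div_nonneg (by nlinarith [(radDeriv_num_bounds hX hX2 hXc hs).1]) (rad_pos hb hc hs).le

lemma radDeriv_sq (hb : b ≠ 0) (hc : x + c ≠ 0) {s : ℝ} (hs : 1 ≤ s) :
    radDeriv b x c s ^ 2 =
      (b ^ 2 + x ^ 2) + b ^ 2 * (b ^ 2 + x ^ 2 - c ^ 2) / rad b x c s ^ 2 := by
  have h := rad_sq hb hc hs
  have h' := (rad_pos hb hc hs).ne'
  unfold radDeriv
  field_simp
  rw [h]; unfold quad; ring

lemma antitoneOn_radDeriv (hb : b ≠ 0) (hc : x + c ≠ 0) (hX : 0 < X)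
    (hX2 : X ^ 2 = b ^ 2 + x ^ 2) (hXc : 2 * |c| ≤ X) :
    AntitoneOn (radDeriv b x c) (Ici 1) := by
  intro s hs t ht hst
  rw [← pow_le_pow_iff_left₀ (radDeriv_nonneg hb hc hX hX2 hXc ht)
    (radDeriv_nonneg hb hc hX hX2 hXc hs) two_ne_zero, radDeriv_sq hb hc hs, radDeriv_sq hb hc ht]
  have hm := monotoneOn_rad hX hX2 hXc hs ht hst
  have hp := rad_pos hb hc hs
  have h0 : 0 ≤ b ^ 2 + x ^ 2 - c ^ 2 := by
    rw [← hX2, ← sq_abs c]; nlinarith [abs_nonneg c]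
  gcongr

/-- The region without stationary points. -/
lemma norm_integral_modulation_sinc_nonstationary (hb : b ≠ 0) (hc : x + c ≠ 0) (hX : 0 < X)
    (hX2 : X ^ 2 = b ^ 2 + x ^ 2) (hXc : 2 * |c| ≤ X) {τ : ℝ} (hτ : 0 < τ) {p q : ℝ}
    (hp : 1 ≤ p) (hpq : p ≤ q) (hR : ∀ s ∈ Icc p q, 1 ≤ rad b x c s)
    (hR' : ∀ s ∈ Icc p q, radDeriv b x c s ≤ τ / 2) :
    ‖∫ s in p..q, cexp (τ * s * I) * (sinc (rad b x c s) : ℂ)‖ ≤ 6 / τ := by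
  set R := rad b x c with hRd
  set R' := radDeriv b x c with hR'd
  have h1 : ∀ s ∈ Icc p q, 1 ≤ s := fun s hs => hp.trans hs.1
  have hden : ∀ s ∈ Icc p q, 3 / 4 * τ ^ 2 ≤ R s * (τ ^ 2 - R' s ^ 2) := fun s hs => by
    have i0 := radDeriv_nonneg hb hc hX hX2 hXc (h1 s hs)
    have i1 : R' s ^ 2 ≤ (τ / 2) ^ 2 := pow_le_pow_left₀ i0 (hR' s hs) 2
    nlinarith [hR s hs, sq_nonneg τ]
  have hden0 : ∀ s ∈ Icc p q, 0 < R s * (τ ^ 2 - R' s ^ 2) := fun s hs =>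
    lt_of_lt_of_le (by positivity) (hden s hs)
  have hdenmono : MonotoneOn (fun s => R s * (τ ^ 2 - R' s ^ 2)) (Icc p q) := by
    intro s hs t ht hst
    have i0 := radDeriv_nonneg hb hc hX hX2 hXc (h1 t ht)
    have i1 := monotoneOn_rad hX hX2 hXc (h1 s hs) (h1 t ht) hst
    have i2 : R' t ^ 2 ≤ R' s ^ 2 :=
      pow_le_pow_left₀ i0 (antitoneOn_radDeriv hb hc hX hX2 hXc (h1 s hs) (h1 t ht) hst) 2
    have i3 : R' s ^ 2 ≤ (τ / 2) ^ 2 :=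
      pow_le_pow_left₀ (radDeriv_nonneg hb hc hX hX2 hXc (h1 s hs)) (hR' s hs) 2
    exact mul_le_mul i1 (by linarith) (by nlinarith) (by linarith [hR t ht])
  have cden : ∀ s ∈ Icc p q, ContDiffAt ℝ 1 (fun s => R s * (τ ^ 2 - R' s ^ 2)) s := fun s hs =>
    (contDiffAt_rad hb hc (h1 s hs)).mul
      (contDiffAt_const.sub ((contDiffAt_radDeriv hb hc (h1 s hs)).pow 2))
  have cC : ∀ s ∈ Icc p q, ContDiffAt ℝ 1 (fun s : ℝ => ((cos (R s) : ℝ) : ℂ)) s :=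
    fun s hs => Complex.ofRealCLM.contDiff.contDiffAt.comp s
      (Real.contDiff_cos.contDiffAt.comp s (contDiffAt_rad hb hc (h1 s hs)))
  have cS : ∀ s ∈ Icc p q, ContDiffAt ℝ 1 (fun s : ℝ => ((sin (R s) : ℝ) : ℂ)) s :=
    fun s hs => Complex.ofRealCLM.contDiff.contDiffAt.comp s
      (Real.contDiff_sin.contDiffAt.comp s (contDiffAt_rad hb hc (h1 s hs)))
  have hpI := left_mem_Icc.2 hpq
  have hqI := right_mem_Icc.2 hpq
  have cF1 : ∀ s ∈ Icc p q, ContDiffAt ℝ 1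
      (fun s : ℝ => cexp (τ * s * I) * ((cos (R s) : ℝ) : ℂ)) s :=
    fun s hs => (contDiff_modulation τ).contDiffAt.mul (cC s hs)
  have cF2 : ∀ s ∈ Icc p q, ContDiffAt ℝ 1
      (fun s : ℝ => -I * (cexp (τ * s * I) * ((sin (R s) : ℝ) : ℂ))) s :=
    fun s hs => contDiffAt_const.mul ((contDiff_modulation τ).contDiffAt.mul (cS s hs))
  have cA1 : ∀ s ∈ Icc p q, ContDiffAt ℝ 1 (fun s => R' s / (R s * (τ ^ 2 - R' s ^ 2))) s :=
    fun s hs => (contDiffAt_radDeriv hb hc (h1 s hs)).div (cden s hs) (hden0 s hs).ne'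
  have cA2 : ∀ s ∈ Icc p q, ContDiffAt ℝ 1 (fun s => τ / (R s * (τ ^ 2 - R' s ^ 2))) s :=
    fun s hs => contDiffAt_const.div (cden s hs) (hden0 s hs).ne'
  have e1 := norm_integral_antitone_smul_deriv_le (M := 1 / τ) hpq
    (A := fun s => R' s / (R s * (τ ^ 2 - R' s ^ 2)))
    (F := fun s : ℝ => cexp (τ * s * I) * ((cos (R s) : ℝ) : ℂ)) cA1 cF1
    (fun s _ => by
      rw [norm_mul, norm_modulation, one_mul, norm_real]; exact Real.abs_cos_le_one _)
    (fun s hs t ht hst => div_le_div₀ (radDeriv_nonneg hb hc hX hX2 hXc (h1 s hs))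
      (antitoneOn_radDeriv hb hc hX hX2 hXc (h1 s hs) (h1 t ht) hst) (hden0 s hs)
      (hdenmono hs ht hst))
    (div_nonneg (radDeriv_nonneg hb hc hX hX2 hXc (h1 q hqI)) (hden0 q hqI).le)
    (by
      rw [div_le_div_iff₀ (hden0 p hpI) hτ]
      nlinarith [hden p hpI, hR' p hpI])
  have e2 := norm_integral_antitone_smul_deriv_le (M := 2 / τ) hpq
    (A := fun s => τ / (R s * (τ ^ 2 - R' s ^ 2)))
    (F := fun s : ℝ => -I * (cexp (τ * s * I) * ((sin (R s) : ℝ) : ℂ)))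
    cA2 cF2
    (fun s _ => by
      rw [norm_mul, norm_mul, norm_modulation, one_mul, norm_real, norm_neg,
        Complex.norm_I, one_mul]
      exact Real.abs_sin_le_one _)
    (fun s hs t ht hst => div_le_div₀ hτ.le le_rfl (hden0 s hs) (hdenmono hs ht hst))
    (div_nonneg hτ.le (hden0 q hqI).le)
    (by
      rw [div_le_div_iff₀ (hden0 p hpI) hτ]
      nlinarith [hden p hpI])
  have hsplit : ∫ s in p..q, cexp (τ * s * I) * (sinc (R s) : ℂ) =
      (∫ s in p..q, ((R' s / (R s * (τ ^ 2 - R' s ^ 2)) : ℝ) : ℂ) *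
        deriv (fun s : ℝ => cexp (τ * s * I) * ((cos (R s) : ℝ) : ℂ)) s) +
      ∫ s in p..q, ((τ / (R s * (τ ^ 2 - R' s ^ 2)) : ℝ) : ℂ) *
        deriv (fun s : ℝ => -I *
          (cexp (τ * s * I) * ((sin (R s) : ℝ) : ℂ))) s := by
    rw [← intervalIntegral.integral_add]
    · refine integral_congr fun s hs => ?_
      rw [uIcc_of_le hpq] at hs
      have d1 := (modulation_deriv τ s).fun_mul (hasDerivAt_rad hb hc (h1 s hs)).cos.ofReal_comp
      have d2 := ((modulation_deriv τ s).fun_mul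
        (hasDerivAt_rad hb hc (h1 s hs)).sin.ofReal_comp).const_mul (-I)
      rw [d1.deriv, d2.deriv, hRd, sinc_rad hb hc (h1 s hs), ← hRd]
      change _ = _ * (_ + _ * ((-sin (R s) * R' s : ℝ) : ℂ)) +
        _ * (_ * (_ + _ * ((cos (R s) * R' s : ℝ) : ℂ)))
      have n1 : (R s : ℂ) ≠ 0 := by exact_mod_cast (rad_pos hb hc (h1 s hs)).ne'
      have n2 : (τ : ℂ) ^ 2 - (R' s : ℂ) ^ 2 ≠ 0 := by
        have := (hden0 s hs).ne'
        have h3 : τ ^ 2 - R' s ^ 2 ≠ 0 := right_ne_zero_of_mul this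
        exact_mod_cast h3
      push_cast
      field_simp
      ring_nf
      simp only [I_sq]
      ring
    · refine ContinuousOn.intervalIntegrable ?_
      rw [uIcc_of_le hpq]
      exact (Complex.continuous_ofReal.comp_continuousOn fun s hs =>
        (cA1 s hs).continuousAt.continuousWithinAt).mul (continuousOn_deriv_of_contDiffAt cF1)
    · refine ContinuousOn.intervalIntegrable ?_
      rw [uIcc_of_le hpq]
      exact (Complex.continuous_ofReal.comp_continuousOn fun s hs =>
        (cA2 s hs).continuousAt.continuousWithinAt).mul (continuousOn_deriv_of_contDiffAt cF2)
  rw [hsplit]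
  refine (norm_add_le _ _).trans ((add_le_add e1 e2).trans (le_of_eq ?_))
  ring

lemma norm_integral_modulation_sinc_large (hb : b ≠ 0) (hc : x + c ≠ 0) (hX : 0 < X)
    (hX2 : X ^ 2 = b ^ 2 + x ^ 2) (hXc : 2 * |c| ≤ X) {τ : ℝ} (hτ : 0 < τ) {S : ℝ} (hS : 1 ≤ S) :
    ‖∫ s in (1 : ℝ)..S, cexp (τ * s * I) * (sinc (rad b x c s) : ℂ)‖ ≤
      14 * S / τ := by
  have hcont : Continuous fun s : ℝ =>
      cexp (τ * s * I) * (sinc (rad b x c s) : ℂ) :=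
    (contDiff_modulation τ).continuous.mul
      (Complex.continuous_ofReal.comp (continuous_sinc_rad b x c))
  have hint : ∀ p q, IntervalIntegrable (fun s : ℝ =>
      cexp (τ * s * I) * (sinc (rad b x c s) : ℂ)) volume p q :=
    fun p q => hcont.intervalIntegrable _ _
  have hsub : Icc 1 S ⊆ Ici (1 : ℝ) := fun s hs => hs.1
  obtain ⟨m₁, hm₁, h1a, h1b⟩ := exists_level_of_antitoneOn (ℓ := τ / 2) hS (f := radDeriv b x c)
    (fun s hs => (contDiffAt_radDeriv hb hc hs.1).continuousAt.continuousWithinAt)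
    ((antitoneOn_radDeriv hb hc hX hX2 hXc).mono hsub)
  obtain ⟨m₂, hm₂, h2a, h2b⟩ := exists_level_of_antitoneOn (ℓ := -1) hm₁.2
    (f := fun s => -rad b x c s) (continuous_rad b x c).neg.continuousOn
    (fun s hs t ht hst => neg_le_neg (monotoneOn_rad hX hX2 hXc
      (show 1 ≤ s from hm₁.1.trans hs.1) (show 1 ≤ t from hm₁.1.trans ht.1) hst))
  rw [← integral_add_adjacent_intervals (hint 1 m₁) (hint m₁ S),
    ← integral_add_adjacent_intervals (hint m₁ m₂) (hint m₂ S)]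
  have e1 : ‖∫ s in (1 : ℝ)..m₁,
      cexp (τ * s * I) * (sinc (rad b x c s) : ℂ)‖ ≤ 6 * S / τ := by
    rcases h1a with h | h
    · rw [h, integral_same, norm_zero]; positivity
    have hu : uIcc 1 m₁ = Icc 1 m₁ := uIcc_of_le hm₁.1
    have hi : IntervalIntegrable (radDeriv b x c) volume 1 m₁ :=
      ContinuousOn.intervalIntegrable (by
        rw [hu]
        exact fun s hs => (contDiffAt_radDeriv hb hc hs.1).continuousAt.continuousWithinAt)
    have := intervalIntegral.norm_integral_le_of_norm_le hm₁.1
      (f := fun s : ℝ => cexp (τ * s * I) * (sinc (rad b x c s) : ℂ))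
      (g := fun s => 2 / X ^ 2 * radDeriv b x c s)
      (.of_forall fun s hs => ?_) (hi.const_mul _)
    · refine this.trans ?_
      have hd : ∫ s in (1 : ℝ)..m₁, radDeriv b x c s = rad b x c m₁ - rad b x c 1 :=
        integral_eq_sub_of_hasDerivAt
          (fun s hs => hasDerivAt_rad hb hc (hu ▸ hs : s ∈ Icc 1 m₁).1) hi
      rw [intervalIntegral.integral_const_mul, hd]
      have i1 := h m₁ (right_mem_Icc.2 hm₁.1)
      have i2 := (radDeriv_num_bounds hX hX2 hXc hm₁.1).2
      have i3 := rad_pos hb hc hm₁.1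
      have i4 := rad_pos hb hc (le_refl (1 : ℝ))
      rw [radDeriv, le_div_iff₀ i3] at i1
      have hX2p : 0 < X ^ 2 := by positivity
      rw [div_mul_eq_mul_div, div_le_div_iff₀ hX2p hτ]
      nlinarith [hm₁.2]
    · have h1 := hs.1.le
      have hr := rad_pos hb hc h1
      rw [norm_mul, norm_modulation, one_mul, norm_real, sinc_rad hb hc h1, norm_div,
        norm_of_nonneg hr.le, radDeriv, ← mul_div_assoc]
      refine div_le_div_of_nonneg_right ((Real.abs_sin_le_one _).trans ?_) hr.le
      have i1 := (radDeriv_num_bounds hX hX2 hXc h1).1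
      rw [div_mul_eq_mul_div, le_div_iff₀ (by positivity)]
      linarith
  have e2 : ‖∫ s in m₁..m₂,
      cexp (τ * s * I) * (sinc (rad b x c s) : ℂ)‖ ≤ 2 / τ := by
    rcases h2a with h | h
    · rw [h, integral_same, norm_zero]; positivity
    have hs1 : ∀ s ∈ Icc m₁ m₂, 1 ≤ s := fun s hs => hm₁.1.trans hs.1
    have hsr : ∀ s ∈ Icc m₁ m₂, rad b x c s ≤ 1 := fun s hs => by linarith [h s hs]
    have hs0 : ∀ s ∈ Icc m₁ m₂, 0 ≤ sin (rad b x c s) / rad b x c s := fun s hs => by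
      have hr := rad_pos hb hc (hs1 s hs)
      exact div_nonneg (Real.sin_nonneg_of_nonneg_of_le_pi hr.le
        (by linarith [hsr s hs, Real.pi_gt_three])) hr.le
    have := norm_integral_modulation_antitone_le hτ hm₂.1 (M := 1)
      (A := fun s => sin (rad b x c s) / rad b x c s)
      (fun s hs => contDiffAt_sinc_rad hb hc (hs1 s hs)) ?_ (hs0 m₂ (right_mem_Icc.2 hm₂.1)) ?_
    · rw [mul_one] at this
      refine le_trans (le_of_eq ?_) this
      congr 1
      refine integral_congr fun s hs => ?_
      rw [uIcc_of_le hm₂.1] at hs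
      simp only [sinc_rad hb hc (hs1 s hs)]
    · refine antitoneOn_of_deriv_nonpos (convex_Icc _ _)
        (fun s hs => (contDiffAt_sinc_rad hb hc (hs1 s hs)).continuousAt.continuousWithinAt)
        (fun s hs => ((contDiffAt_sinc_rad hb hc (hs1 s (interior_subset hs))).differentiableAt
          (by simp)).differentiableWithinAt) fun s hs => ?_
      have hs' := interior_subset hs
      rw [(hasDerivAt_sinc_rad hb hc (hs1 s hs')).deriv]
      have hr := rad_pos hb hc (hs1 s hs')
      refine mul_nonpos_of_nonpos_of_nonneg (div_nonpos_of_nonpos_of_nonneg ?_ (by positivity)) ?_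
      · linarith [mul_cos_le_sin hr.le (hsr s hs')]
      · have := (radDeriv_num_bounds hX hX2 hXc (hs1 s hs')).1
        nlinarith
    · rw [← sinc_rad hb hc hm₁.1]; exact Real.sinc_le_one _
  have e3 : ‖∫ s in m₂..S,
      cexp (τ * s * I) * (sinc (rad b x c s) : ℂ)‖ ≤ 6 / τ := by
    rcases h2b with h | h
    · rw [h, integral_same, norm_zero]; positivity
    rcases h1b with h' | h'
    · have : m₂ = S := le_antisymm hm₂.2 (h' ▸ hm₂.1)
      rw [this, integral_same, norm_zero]; positivity
    exact norm_integral_modulation_sinc_nonstationary hb hc hX hX2 hXc hτ (hm₁.1.trans hm₂.1) hm₂.2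
      (fun s hs => by linarith [h s hs]) (fun s hs => h' s ⟨hm₂.1.trans hs.1, hs.2⟩)
  calc _ ≤ 6 * S / τ + (2 / τ + 6 / τ) :=
        (norm_add_le _ _).trans (add_le_add e1 ((norm_add_le _ _).trans (add_le_add e2 e3)))
    _ = (6 * S + 8) / τ := by ring
    _ ≤ _ := by gcongr; linarith

lemma norm_integral_modulation_sinc_pos (hb : b ≠ 0) (hc : x + c ≠ 0) (hc2 : |c| ≤ 2) {τ : ℝ}
    (hτ : 0 < τ) {S : ℝ} (hS : 1 ≤ S) :
    ‖∫ s in (1 : ℝ)..S, cexp (τ * s * I) * (sinc (rad b x c s) : ℂ)‖ ≤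
      40 * S ^ 2 / τ := by
  have hpos : 0 < b ^ 2 + x ^ 2 := by positivity
  have hX : 0 < sqrt (b ^ 2 + x ^ 2) := Real.sqrt_pos.2 hpos
  have hX2 : sqrt (b ^ 2 + x ^ 2) ^ 2 = b ^ 2 + x ^ 2 := sq_sqrt hpos.le
  by_cases h : sqrt (b ^ 2 + x ^ 2) ≤ 4
  · exact norm_integral_modulation_sinc_small hb hc hc2 hX hX2 h hτ hS
  · refine (norm_integral_modulation_sinc_large hb hc hX hX2 (by linarith) hτ hS).trans ?_
    refine div_le_div_of_nonneg_right ?_ hτ.le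
    nlinarith

/-- Decay in the modulation `τ`. -/
lemma norm_integral_modulation_sinc_le (hb : b ≠ 0) (hc : x + c ≠ 0) (hc2 : |c| ≤ 2) {τ : ℝ}
    (hτ : τ ≠ 0) {S : ℝ} (hS : 1 ≤ S) :
    ‖∫ s in (1 : ℝ)..S, cexp (τ * s * I) * (sinc (rad b x c s) : ℂ)‖ ≤
      40 * S ^ 2 / |τ| := by
  rcases hτ.lt_or_gt with h | h
  · have := norm_integral_modulation_sinc_pos hb hc hc2 (neg_pos.2 h) hS
    rw [abs_of_neg h]
    refine le_trans (le_of_eq ?_) this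
    rw [← Complex.norm_conj, ← intervalIntegral.intervalIntegral_conj]
    congr 1
    refine integral_congr fun s _ => ?_
    simp [← Complex.exp_conj]
  · rw [abs_of_pos h]; exact norm_integral_modulation_sinc_pos hb hc hc2 h hS

end ModulatedSinc

/-! ### Polar coordinates and the Fourier transform of the sphere -/

lemma integrable_polar {f : R3 → ℂ} (hf : Integrable f) :
    Integrable (fun p : sphere (0 : R3) 1 × Ioi (0 : ℝ) => f (p.2.1 • p.1.1))
      ((volume : Measure R3).toSphere.prod (.volumeIoiPow 2)) := by
  have hd : finrank ℝ R3 - 1 = 2 := by simp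
  have h := (volume : Measure R3).measurePreserving_homeomorphUnitSphereProd
  rw [hd] at h
  refine (h.integrable_comp_emb (Homeomorph.measurableEmbedding _)).1 ?_
  have h2 : IntegrableOn f ({0}ᶜ : Set R3) := hf.integrableOn
  rw [integrableOn_iff_comap_subtypeVal (measurableSet_singleton _).compl] at h2
  refine h2.congr (.of_forall fun x => ?_)
  have hx : (x : R3) ≠ 0 := x.2
  simp [hx]

lemma integral_polar {f : R3 → ℂ} (hf : Integrable f) :
    ∫ y, f y = ∫ r in Ioi (0 : ℝ), (r ^ 2 : ℝ) •
      ∫ ω : sphere (0 : R3) 1, f (r • ω.1) ∂(volume : Measure R3).toSphere := by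
  have hd : finrank ℝ R3 - 1 = 2 := by simp
  have h := (volume : Measure R3).measurePreserving_homeomorphUnitSphereProd
  rw [hd] at h
  calc ∫ y, f y = ∫ x : ({(0 : R3)}ᶜ : Set R3), f x.1
          ∂(Measure.comap (Subtype.val : ({(0 : R3)}ᶜ : Set R3) → R3) volume) := by
        rw [integral_subtype_comap (measurableSet_singleton _).compl f, restrict_compl_singleton]
    _ = ∫ p, f (p.2.1 • p.1.1) ∂(volume : Measure R3).toSphere.prod (.volumeIoiPow 2) := by
        refine Eq.trans ?_ (h.integral_comp (Homeomorph.measurableEmbedding _)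
          (fun p : sphere (0 : R3) 1 × Ioi (0 : ℝ) => f (p.2.1 • p.1.1)))
        refine integral_congr_ae (.of_forall fun x => ?_)
        have hx : (x : R3) ≠ 0 := x.2
        simp [hx]
    _ = ∫ r : Ioi (0 : ℝ), ∫ ω : sphere (0 : R3) 1, f (r.1 • ω.1)
          ∂(volume : Measure R3).toSphere ∂(Measure.volumeIoiPow 2) :=
        integral_prod_symm _ (integrable_polar hf)
    _ = _ := by
        simp only [Measure.volumeIoiPow, ofReal]
        rw [integral_withDensity_eq_integral_smul,
          integral_subtype_comap measurableSet_Ioi fun a => Real.toNNReal (a ^ 2) •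
            ∫ ω : sphere (0 : R3) 1, f (a • ω.1) ∂(volume : Measure R3).toSphere]
        · refine setIntegral_congr_fun measurableSet_Ioi fun x hx => ?_
          simp only [NNReal.smul_def, Real.coe_toNNReal _ (pow_nonneg (mem_Ioi.1 hx).le 2)]
        · exact (measurable_subtype_coe.pow_const _).real_toNNReal

/-- Slicing a function of one coordinate over a ball. -/
lemma integral_ball_coord {R : ℝ} (hR : 0 < R) {g : ℝ → ℂ} (hg : Continuous g) :
    ∫ y in ball (0 : R3) R, g (y 2) = ∫ z in (-R)..R, ((π * (R ^ 2 - z ^ 2) : ℝ) : ℂ) * g z := by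
  let e1 := (MeasurableEquiv.toLp 2 (Fin 3 → ℝ)).symm
  let e2 := MeasurableEquiv.piFinSuccAbove (fun _ : Fin 3 => ℝ) 2
  have h1 : MeasurePreserving e1 (volume : Measure R3) volume :=
    EuclideanSpace.volume_preserving_symm_measurableEquiv_toLp (Fin 3)
  have h2 : MeasurePreserving e2 volume volume :=
    volume_preserving_piFinSuccAbove (fun _ : Fin 3 => ℝ) 2
  have h := h1.trans h2
  let s : Set (ℝ × (Fin 2 → ℝ)) := {p | p.1 ^ 2 + (p.2 0 ^ 2 + p.2 1 ^ 2) < R ^ 2}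
  have hs : MeasurableSet s := by
    refine measurableSet_lt ?_ measurable_const
    fun_prop
  have hball : ball (0 : R3) R = (e1.trans e2) ⁻¹' s := by
    ext y
    rw [mem_ball_zero_iff, ← abs_of_pos hR, ← sq_lt_sq₀ (norm_nonneg _) (abs_nonneg _), abs_of_pos hR,
      real_norm_sq_eq, Fin.sum_univ_three]
    change _ ↔ y 2 ^ 2 + (y 0 ^ 2 + y 1 ^ 2) < R ^ 2
    constructor <;> intro h <;> linarith
  have hfin : volume s < ⊤ := by
    have := h.measure_preimage hs.nullMeasurableSet
    rw [← this]
    change volume ((e1.trans e2) ⁻¹' s) < ⊤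
    rw [← hball]; exact measure_ball_lt_top
  have e : ∫ y in ball (0 : R3) R, g (y 2) = ∫ p in s, g p.1 := by
    rw [hball]
    exact h.setIntegral_preimage_emb (e1.trans e2).measurableEmbedding (fun p => g p.1) s
  have hbound : ∀ p ∈ s, p.1 ∈ Icc (-R) R := fun p hp => by
    have : p.1 ^ 2 ≤ R ^ 2 := by
      have : p.1 ^ 2 + (p.2 0 ^ 2 + p.2 1 ^ 2) < R ^ 2 := hp
      nlinarith [sq_nonneg (p.2 0), sq_nonneg (p.2 1)]
    exact abs_le.1 (abs_le_of_sq_le_sq this hR.le)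
  obtain ⟨C, hC⟩ := (isCompact_Icc (a := -R) (b := R)).exists_bound_of_continuousOn hg.continuousOn
  have hint : Integrable (s.indicator fun p : ℝ × (Fin 2 → ℝ) => g p.1)
      ((volume : Measure ℝ).prod volume) := by
    rw [integrable_indicator_iff hs]
    exact Measure.integrableOn_of_bounded hfin.ne
      (hg.comp continuous_fst).aestronglyMeasurable (M := C)
      ((ae_restrict_iff' hs).2 (.of_forall fun p hp => hC _ (hbound p hp)))
  rw [e, ← integral_indicator hs]
  change ∫ p, s.indicator (fun p => g p.1) p ∂((volume : Measure ℝ).prod volume) = _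
  rw [integral_prod _ hint, integral_of_le (by linarith),
    ← integral_indicator measurableSet_Ioc]
  refine integral_congr_ae ?_
  have hne : ∀ᵐ z : ℝ, z ≠ -R := by simp [ae_iff, measure_singleton]
  filter_upwards [hne] with z hz
  have hslice : ∀ h : Fin 2 → ℝ, s.indicator (fun p : ℝ × (Fin 2 → ℝ) => g p.1) (z, h) =
      (Prod.mk z ⁻¹' s).indicator (fun _ => g z) h := fun h => by
    by_cases hh : (z, h) ∈ s <;> simp [hh]
  simp only [hslice]
  rw [integral_indicator_const _ (measurable_prodMk_left hs)]
  have hvol : volume (Prod.mk z ⁻¹' s) = ofReal (sqrt (R ^ 2 - z ^ 2)) ^ 2 * ofReal π := by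
    have h3 := EuclideanSpace.volume_preserving_symm_measurableEquiv_toLp (Fin 2)
    have h4 := EuclideanSpace.volume_ball_fin_two 0 (sqrt (R ^ 2 - z ^ 2))
    rw [← h4, ← h3.measure_preimage (measurable_prodMk_left hs).nullMeasurableSet]
    congr 1
    ext y
    rw [mem_ball_zero_iff, Real.lt_sqrt (norm_nonneg _), real_norm_sq_eq,
      Fin.sum_univ_two]
    change z ^ 2 + (y 0 ^ 2 + y 1 ^ 2) < R ^ 2 ↔ _
    constructor <;> intro h <;> linarith
  rw [measureReal_def, hvol]
  by_cases hzR : z ∈ Ioc (-R) R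
  · rw [indicator_of_mem hzR]
    have h0 : 0 ≤ R ^ 2 - z ^ 2 := by nlinarith [hzR.1, hzR.2]
    simp only [ENNReal.toReal_mul, ENNReal.toReal_pow, toReal_ofReal (Real.sqrt_nonneg _),
      sq_sqrt h0, toReal_ofReal Real.pi_pos.le, real_smul]
    push_cast; ring
  · rw [indicator_of_notMem hzR]
    have h0 : R ^ 2 - z ^ 2 ≤ 0 := by
      rw [mem_Ioc, not_and_or, not_lt, not_le] at hzR
      rcases hzR with h | h <;> nlinarith
    rw [Real.sqrt_eq_zero_of_nonpos h0]; simp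

/-- The primitive of `e^{ikz} π (R² - z²)`. -/
lemma integral_slice_exp {k : ℝ} (hk : k ≠ 0) (R : ℝ) :
    ∫ z in (-R)..R, ((π * (R ^ 2 - z ^ 2) : ℝ) : ℂ) * cexp (k * z * I) =
      ((4 * π * (sin (k * R) - k * R * cos (k * R)) / k ^ 3 : ℝ) : ℂ) := by
  have hk' : (k : ℂ) ≠ 0 := by exact_mod_cast hk
  have hI := Complex.I_ne_zero
  have hd : ∀ z : ℝ, HasDerivAt (fun z : ℝ => (π : ℂ) *
      (((R : ℂ) ^ 2 - (z : ℂ) ^ 2) / (k * I) - 2 * z / k ^ 2 + 2 / (k ^ 3 * I)) *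
        cexp (k * z * I))
      (((π * (R ^ 2 - z ^ 2) : ℝ) : ℂ) * cexp (k * z * I)) z := by
    intro z
    have hz := (hasDerivAt_id' z).ofReal_comp
    have h1 := ((((((hz.fun_pow 2).const_sub ((R : ℂ) ^ 2)).div_const (k * I)).fun_sub
      ((hz.const_mul (2 : ℂ)).div_const ((k : ℂ) ^ 2))).add_const
        (2 / (k ^ 3 * I))).const_mul (π : ℂ)).fun_mul (modulation_deriv k z)
    refine h1.congr_deriv ?_
    push_cast
    field_simp
    ring_nf
    simp only [I_sq]
    ring
  rw [integral_eq_sub_of_hasDerivAt (fun z _ => hd z)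
    (Continuous.intervalIntegrable (by fun_prop) _ _)]
  have e1 : cexp (k * (R : ℂ) * I) = Complex.cos (k * R) + Complex.sin (k * R) * I :=
    Complex.exp_mul_I _
  have e2 : cexp (k * ((-R : ℝ) : ℂ) * I) =
      Complex.cos (k * R) - Complex.sin (k * R) * I := by
    rw [Complex.exp_mul_I]; push_cast
    rw [mul_neg, Complex.cos_neg, Complex.sin_neg]; ring
  rw [e1, e2]
  push_cast
  field_simp
  ring

lemma integral_ball_exp (v : R3) {R : ℝ} (hR : 0 < R) (hv : v ≠ 0) :
    ∫ y in ball (0 : R3) R, cexp ((inner ℝ v y : ℝ) * I) =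
      ((4 * π * (sin (‖v‖ * R) - ‖v‖ * R * cos (‖v‖ * R)) / ‖v‖ ^ 3 : ℝ) : ℂ) := by
  set w : R3 := ‖v‖ • basisVec 2
  have hw : ‖v‖ = ‖w‖ := by simp [w, basisVec, norm_smul]
  set A := Submodule.reflection (Submodule.span ℝ {v - w})ᗮ
  have hA : A v = w := Submodule.reflection_sub hw
  have hmp : MeasurePreserving A volume volume := A.measurePreserving
  have hpre : ball (0 : R3) R = A ⁻¹' ball 0 R := by ext y; simp
  have : ∫ y in ball (0 : R3) R, cexp ((inner ℝ v y : ℝ) * I) =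
      ∫ y in ball (0 : R3) R, cexp ((inner ℝ w y : ℝ) * I) := by
    rw [← hmp.setIntegral_preimage_emb A.toHomeomorph.measurableEmbedding
      (fun y => cexp ((inner ℝ w y : ℝ) * I)), ← hpre]
    refine integral_congr_ae (.of_forall fun y => ?_)
    simp only [← hA, A.inner_map_map]
  rw [this]
  have hin : ∀ y : R3, (inner ℝ w y : ℝ) = ‖v‖ * y 2 := fun y => by
    simp [w, basisVec, inner_smul_left, EuclideanSpace.inner_single_left]
  simp only [hin]
  have := integral_ball_coord hR (g := fun z => cexp (‖v‖ * z * I)) (by fun_prop)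
  push_cast
  push_cast at this
  rw [this]
  have h2 := integral_slice_exp (norm_ne_zero_iff.2 hv) R
  push_cast at h2
  exact h2

lemma continuous_sphere_exp (v : R3) : Continuous fun r : ℝ =>
    ∫ ω : sphere (0 : R3) 1, cexp ((inner ℝ v (r • ω.1) : ℝ) * I)
      ∂(volume : Measure R3).toSphere := by
  refine continuous_of_dominated (bound := fun _ => 1) (fun r => ?_) (fun r => ?_) (by simp)
    (.of_forall fun ω => by fun_prop)
  · exact Continuous.aestronglyMeasurable (by fun_prop)
  · exact .of_forall fun ω => (norm_exp_ofReal_mul_I _).le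

lemma integral_ball_exp_polar (v : R3) {R : ℝ} (hR : 0 < R) :
    ∫ y in ball (0 : R3) R, cexp ((inner ℝ v y : ℝ) * I) =
      ∫ r in (0 : ℝ)..R, ((r ^ 2 : ℝ) : ℂ) *
        ∫ ω : sphere (0 : R3) 1, cexp ((inner ℝ v (r • ω.1) : ℝ) * I)
          ∂(volume : Measure R3).toSphere := by
  have hint : Integrable ((ball (0 : R3) R).indicator
      fun y => cexp ((inner ℝ v y : ℝ) * I)) := by
    rw [integrable_indicator_iff measurableSet_ball]
    exact Measure.integrableOn_of_bounded measure_ball_lt_top.ne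
      (Continuous.aestronglyMeasurable (by fun_prop)) (M := 1)
      (.of_forall fun y => (norm_exp_ofReal_mul_I _).le)
  rw [← integral_indicator measurableSet_ball, integral_polar hint,
    integral_of_le hR.le, integral_Ioc_eq_integral_Ioo,
    ← integral_indicator measurableSet_Ioo, ← integral_indicator measurableSet_Ioi]
  refine integral_congr_ae (.of_forall fun r => ?_)
  by_cases h0 : 0 < r
  · have hmem : ∀ ω : sphere (0 : R3) 1, r • ω.1 ∈ ball (0 : R3) R ↔ r < R := fun ω => by
      rw [mem_ball_zero_iff, norm_smul, norm_eq_of_mem_sphere, mul_one, norm_of_nonneg h0.le]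
    rw [indicator_of_mem (mem_Ioi.2 h0)]
    by_cases hr : r < R
    · rw [indicator_of_mem (mem_Ioo.2 ⟨h0, hr⟩), real_smul]
      congr 1
      refine integral_congr_ae (.of_forall fun ω => ?_)
      simp only [indicator_of_mem ((hmem ω).2 hr)]
    · rw [indicator_of_notMem (fun h => hr h.2)]
      simp only [indicator_of_notMem (fun h => hr ((hmem _).1 h)), integral_zero, smul_zero]
  · rw [indicator_of_notMem (show r ∉ Ioi (0 : ℝ) from h0),
      indicator_of_notMem (show r ∉ Ioo 0 R from fun h => h0 h.1)]

/-- The Fourier transform of the surface measure of the sphere. -/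
lemma integral_sphere_exp (v : R3) :
    ∫ ω : sphere (0 : R3) 1, cexp ((inner ℝ v ω.1 : ℝ) * I)
      ∂(volume : Measure R3).toSphere = ((4 * π * sinc ‖v‖ : ℝ) : ℂ) := by
  by_cases hv : v = 0
  · subst hv
    have h1 := (volume : Measure R3).toSphere_real_apply_univ
    have h2 : (volume : Measure R3).real (ball 0 1) = π * 4 / 3 := by
      rw [measureReal_def, EuclideanSpace.volume_ball_fin_three]
      simp [toReal_ofReal (by positivity : 0 ≤ π * 4 / 3)]
    simp only [inner_zero_left, Complex.ofReal_zero, zero_mul, Complex.exp_zero, integral_const, h1,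
      h2, norm_zero, Real.sinc_zero]
    simp
    ring
  have hk : ‖v‖ ≠ 0 := norm_ne_zero_iff.2 hv
  set G : ℝ → ℂ := fun r => ((r ^ 2 : ℝ) : ℂ) *
        ∫ ω : sphere (0 : R3) 1, cexp ((inner ℝ v (r • ω.1) : ℝ) * I)
          ∂(volume : Measure R3).toSphere with hG
  have cG : Continuous G := (by fun_prop : Continuous fun r : ℝ => ((r ^ 2 : ℝ) : ℂ)).mul
    (continuous_sphere_exp v)
  have d1 : HasDerivAt (fun R => ∫ r in (0 : ℝ)..R, G r) (G 1) 1 :=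
    intervalIntegral.integral_hasDerivAt_right (cG.intervalIntegrable _ _)
      (cG.stronglyMeasurableAtFilter _ _) cG.continuousAt
  have d2 : HasDerivAt (fun R : ℝ => ((4 * π * (sin (‖v‖ * R) -
      ‖v‖ * R * cos (‖v‖ * R)) / ‖v‖ ^ 3 : ℝ) : ℂ))
      ((4 * π * (sin ‖v‖ / ‖v‖) : ℝ) : ℂ) 1 := by
    refine HasDerivAt.ofReal_comp ?_
    have hl := (hasDerivAt_id' (1 : ℝ)).const_mul ‖v‖
    refine (((hl.sin.fun_sub (hl.fun_mul hl.cos)).const_mul (4 * π)).div_const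
      (‖v‖ ^ 3)).congr_deriv ?_
    simp only [mul_one]
    field_simp
    ring
  have heq : (fun R => ∫ r in (0 : ℝ)..R, G r) =ᶠ[nhds 1] fun R : ℝ =>
      ((4 * π * (sin (‖v‖ * R) - ‖v‖ * R * cos (‖v‖ * R)) / ‖v‖ ^ 3 : ℝ) : ℂ) := by
    filter_upwards [lt_mem_nhds one_pos] with R hR
    rw [← integral_ball_exp v hR hv, integral_ball_exp_polar v hR]
  have := (d1.congr_of_eventuallyEq heq.symm).unique d2
  rw [Real.sinc_of_ne_zero hk, ← this, hG]
  simp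

/-! ### Prolate spheroidal coordinates -/

/-- The radial prolate spheroidal coordinate with foci `±e₃`. -/
def sig (η : R3) : ℝ := (‖η + basisVec 2‖ + ‖η - basisVec 2‖) / 2

/-- The angular prolate spheroidal coordinate with foci `±e₃`. -/
def nu (η : R3) : ℝ := (‖η + basisVec 2‖ - ‖η - basisVec 2‖) / 2

lemma norm_basisVec (k : Fin 3) : ‖basisVec k‖ = 1 := by simp [basisVec]

lemma inner_basisVec (k : Fin 3) (η : R3) : (inner ℝ η (basisVec k) : ℝ) = η k := by
  simp [basisVec, EuclideanSpace.inner_single_right]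

lemma norm_sq_R3 (η : R3) : ‖η‖ ^ 2 = η 0 ^ 2 + η 1 ^ 2 + η 2 ^ 2 := by
  rw [real_norm_sq_eq, Fin.sum_univ_three]

lemma norm_add_basisVec_sq (η : R3) : ‖η + basisVec 2‖ ^ 2 = ‖η‖ ^ 2 + 2 * η 2 + 1 := by
  rw [norm_add_sq_real, inner_basisVec, norm_basisVec]; ring

lemma norm_sub_basisVec_sq (η : R3) : ‖η - basisVec 2‖ ^ 2 = ‖η‖ ^ 2 - 2 * η 2 + 1 := by
  rw [norm_sub_sq_real, inner_basisVec, norm_basisVec]; ring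

lemma sig_mul_nu (η : R3) : sig η * nu η = η 2 := by
  have h1 := norm_add_basisVec_sq η
  have h2 := norm_sub_basisVec_sq η
  unfold sig nu; nlinarith

lemma sig_sq_add_nu_sq (η : R3) : sig η ^ 2 + nu η ^ 2 = ‖η‖ ^ 2 + 1 := by
  have h1 := norm_add_basisVec_sq η
  have h2 := norm_sub_basisVec_sq η
  unfold sig nu; nlinarith

lemma sig_nu_horizontal (η : R3) :
    (sig η ^ 2 - 1) * (1 - nu η ^ 2) = η 0 ^ 2 + η 1 ^ 2 := by
  have h1 := sig_mul_nu η
  have h2 := sig_sq_add_nu_sq η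
  have h3 := norm_sq_R3 η
  have : sig η ^ 2 * nu η ^ 2 = η 2 ^ 2 := by rw [← h1]; ring
  nlinarith

lemma one_le_sig (η : R3) : 1 ≤ sig η := by
  have h : ‖(η + basisVec 2) - (η - basisVec 2)‖ ≤ ‖η + basisVec 2‖ + ‖η - basisVec 2‖ :=
    norm_sub_le _ _
  have h2 : (η + basisVec 2) - (η - basisVec 2) = (2 : ℝ) • basisVec 2 := by
    rw [two_smul]; abel
  rw [h2, norm_smul, norm_basisVec] at h
  norm_num at h
  unfold sig; linarith

lemma abs_nu_le_one (η : R3) : |nu η| ≤ 1 := by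
  have h := abs_norm_sub_norm_le (η + basisVec 2) (η - basisVec 2)
  have h2 : (η + basisVec 2) - (η - basisVec 2) = (2 : ℝ) • basisVec 2 := by
    rw [two_smul]; abel
  rw [h2, norm_smul, norm_basisVec] at h
  norm_num at h
  unfold nu
  rw [abs_div, abs_two]; linarith

lemma norm_le_sig (η : R3) : ‖η‖ ≤ sig η := by
  have h := sig_sq_add_nu_sq η
  have h1 : nu η ^ 2 ≤ 1 := by
    rw [← sq_abs]; nlinarith [abs_nu_le_one η, abs_nonneg (nu η)]
  exact abs_le_of_sq_le_sq' (by linarith) (by linarith [one_le_sig η]) |>.2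

lemma sig_le_norm_add_one (η : R3) : sig η ≤ ‖η‖ + 1 := by
  have h1 := norm_add_le η (basisVec 2)
  have h2 := norm_sub_le η (basisVec 2)
  rw [norm_basisVec] at h1 h2
  unfold sig; linarith

lemma continuous_sig : Continuous sig := by unfold sig; fun_prop
lemma continuous_nu : Continuous nu := by unfold nu; fun_prop

/-- The weight, comparable to `1` on `{sig ≤ S}`, whose transform can be computed. -/
def weight (S : ℝ) (η : R3) : ℝ :=
  if sig η ≤ S then ((sig η ^ 2 - 1) + cos (π * nu η / 2)) / (sig η ^ 2 - nu η ^ 2)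
  else 0

lemma cos_pi_mul_le {n : ℝ} (hn : |n| ≤ 1) : cos (π * n / 2) ≤ 2 * (1 - n ^ 2) := by
  have h : cos (π * n / 2) = sin (π / 2 * (1 - |n|)) := by
    rw [← Real.cos_abs, ← Real.cos_pi_div_two_sub]
    congr 1
    rw [abs_div, abs_mul, abs_of_pos pi_pos, abs_two]; ring
  have h1 : sin (π / 2 * (1 - |n|)) ≤ π / 2 * (1 - |n|) :=
    Real.sin_le (by have := pi_pos; apply mul_nonneg <;> linarith)
  rw [h, ← sq_abs]
  nlinarith [Real.pi_lt_four, abs_nonneg n, mul_nonneg (abs_nonneg n) (sub_nonneg.2 hn)]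

lemma le_cos_pi_mul {n : ℝ} (hn : |n| ≤ 1) : (1 - n ^ 2) / 2 ≤ cos (π * n / 2) := by
  have h : cos (π * n / 2) = sin (π / 2 * (1 - |n|)) := by
    rw [← Real.cos_abs, ← Real.cos_pi_div_two_sub]
    congr 1
    rw [abs_div, abs_mul, abs_of_pos pi_pos, abs_two]; ring
  have hp := pi_pos
  have h1 := Real.mul_le_sin (x := π / 2 * (1 - |n|)) (by apply mul_nonneg <;> linarith)
    (by nlinarith [abs_nonneg n])
  have h2 : 2 / π * (π / 2 * (1 - |n|)) = 1 - |n| := by field_simp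
  rw [h2] at h1
  rw [h, ← sq_abs]
  nlinarith [abs_nonneg n]

lemma one_sub_nu_sq_nonneg (η : R3) : 0 ≤ 1 - nu η ^ 2 := by
  rw [← sq_abs]; nlinarith [abs_nu_le_one η, abs_nonneg (nu η)]

lemma sig_sq_sub_one_nonneg (η : R3) : 0 ≤ sig η ^ 2 - 1 := by nlinarith [one_le_sig η]

lemma weight_nonneg (S : ℝ) (η : R3) : 0 ≤ weight S η := by
  unfold weight
  have h1 := one_sub_nu_sq_nonneg η
  have h2 := sig_sq_sub_one_nonneg η
  have h3 := le_cos_pi_mul (abs_nu_le_one η)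
  split_ifs
  · exact div_nonneg (by linarith) (by linarith)
  · rfl

lemma weight_le (S : ℝ) (η : R3) : weight S η ≤ 2 := by
  unfold weight
  have h1 := one_sub_nu_sq_nonneg η
  have h2 := sig_sq_sub_one_nonneg η
  have h3 := cos_pi_mul_le (abs_nu_le_one η)
  split_ifs
  · exact div_le_of_le_mul₀ (by linarith) (by norm_num) (by linarith)
  · norm_num

lemma le_weight {S : ℝ} {η : R3} (hS : sig η ≤ S) (h0 : η 0 ≠ 0) : 1 / 2 ≤ weight S η := by
  unfold weight
  have h1 := one_sub_nu_sq_nonneg η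
  have h2 := sig_sq_sub_one_nonneg η
  have h3 := le_cos_pi_mul (abs_nu_le_one η)
  have h4 : 0 < (sig η ^ 2 - 1) * (1 - nu η ^ 2) := by rw [sig_nu_horizontal]; positivity
  have h5 : 0 < sig η ^ 2 - 1 := pos_of_mul_pos_left h4 h1
  rw [if_pos hS, le_div_iff₀ (by linarith)]
  linarith

lemma measurable_weight (S : ℝ) : Measurable (weight S) := by
  refine Measurable.ite (measurableSet_le continuous_sig.measurable measurable_const) ?_
    measurable_const
  have h1 := continuous_sig.measurable
  have h2 := continuous_nu.measurable
  fun_prop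

lemma weight_eq_zero {S : ℝ} {η : R3} (h : S < ‖η‖) : weight S η = 0 :=
  if_neg (not_le.2 (h.trans_le (norm_le_sig η)))

lemma integrable_weight_mul (S : ℝ) {f : R3 → ℂ} (hf : Measurable f) (hb : ∀ η, ‖f η‖ ≤ 1) :
    Integrable fun η => (weight S η : ℂ) * f η := by
  have h : (fun η => (weight S η : ℂ) * f η) =
      (closedBall (0 : R3) S).indicator fun η => (weight S η : ℂ) * f η := by
    ext η
    by_cases hη : η ∈ closedBall (0 : R3) S
    · rw [indicator_of_mem hη]
    · rw [indicator_of_notMem hη, weight_eq_zero (by simpa using hη)]; simp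
  rw [h, integrable_indicator_iff measurableSet_closedBall]
  refine Measure.integrableOn_of_bounded measure_closedBall_lt_top.ne
    ((Complex.measurable_ofReal.comp (measurable_weight S)).mul hf).aestronglyMeasurable (M := 2)
      (.of_forall fun η => ?_)
  rw [norm_mul, norm_real, norm_of_nonneg (weight_nonneg S η)]
  nlinarith [weight_le S η, hb η, norm_nonneg (f η), weight_nonneg S η]

/-- The map from spherical to prolate spheroidal coordinates. -/
def spheroidal (y : R3) : R3 := y + ((sqrt (1 + ‖y‖ ^ 2) / ‖y‖ - 1) * y 2) • basisVec 2

section Spheroidal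
variable {y : R3}

lemma spheroidal_zero : spheroidal y 0 = y 0 := by simp [spheroidal, basisVec]
lemma spheroidal_one : spheroidal y 1 = y 1 := by simp [spheroidal, basisVec]
lemma spheroidal_two : spheroidal y 2 = sqrt (1 + ‖y‖ ^ 2) * (y 2 / ‖y‖) := by
  simp [spheroidal, basisVec]; ring

lemma abs_coord_div_norm_le (hy : y ≠ 0) : |y 2 / ‖y‖| ≤ 1 := by
  rw [abs_div, abs_norm, div_le_one (norm_pos_iff.2 hy)]
  exact PiLp.norm_apply_le y 2

lemma one_le_sqrt_one_add_sq (r : ℝ) : 1 ≤ sqrt (1 + r ^ 2) := by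
  rw [Real.one_le_sqrt]; nlinarith

lemma norm_spheroidal_sq (hy : y ≠ 0) :
    ‖spheroidal y‖ ^ 2 + 1 = sqrt (1 + ‖y‖ ^ 2) ^ 2 + (y 2 / ‖y‖) ^ 2 := by
  have h0 := norm_sq_R3 y
  have h1 : ‖y‖ ≠ 0 := norm_ne_zero_iff.2 hy
  rw [norm_sq_R3, spheroidal_zero, spheroidal_one, spheroidal_two, mul_pow,
    sq_sqrt (by positivity)]
  have : (y 2 / ‖y‖) ^ 2 * ‖y‖ ^ 2 = y 2 ^ 2 := by field_simp
  nlinarith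

lemma norm_spheroidal_add (hy : y ≠ 0) :
    ‖spheroidal y + basisVec 2‖ = sqrt (1 + ‖y‖ ^ 2) + y 2 / ‖y‖ := by
  have h1 := abs_le.1 (abs_coord_div_norm_le hy)
  have h2 := one_le_sqrt_one_add_sq ‖y‖
  rw [← sq_eq_sq₀ (norm_nonneg _) (by linarith), norm_add_basisVec_sq, spheroidal_two]
  have := norm_spheroidal_sq hy
  linarith

lemma norm_spheroidal_sub (hy : y ≠ 0) :
    ‖spheroidal y - basisVec 2‖ = sqrt (1 + ‖y‖ ^ 2) - y 2 / ‖y‖ := by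
  have h1 := abs_le.1 (abs_coord_div_norm_le hy)
  have h2 := one_le_sqrt_one_add_sq ‖y‖
  rw [← sq_eq_sq₀ (norm_nonneg _) (by linarith), norm_sub_basisVec_sq, spheroidal_two]
  have := norm_spheroidal_sq hy
  linarith

lemma sig_spheroidal (hy : y ≠ 0) : sig (spheroidal y) = sqrt (1 + ‖y‖ ^ 2) := by
  unfold sig; rw [norm_spheroidal_add hy, norm_spheroidal_sub hy]; ring

lemma nu_spheroidal (hy : y ≠ 0) : nu (spheroidal y) = y 2 / ‖y‖ := by
  unfold nu; rw [norm_spheroidal_add hy, norm_spheroidal_sub hy]; ring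

lemma ne_zero_of_coord (h : y 0 ≠ 0) : y ≠ 0 := fun h' => h (by simp [h'])

lemma injOn_spheroidal : InjOn spheroidal {y | y 0 ≠ 0} := by
  intro y hy z hz h
  have hy' := ne_zero_of_coord hy
  have hz' := ne_zero_of_coord hz
  have h1 : ‖y‖ = ‖z‖ := by
    have := congrArg sig h
    rw [sig_spheroidal hy', sig_spheroidal hz', Real.sqrt_inj (by positivity) (by positivity)]
      at this
    exact (sq_eq_sq₀ (norm_nonneg _) (norm_nonneg _)).1 (by linarith)
  have h2 : y 2 = z 2 := by
    have := congrArg nu h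
    rw [nu_spheroidal hy', nu_spheroidal hz', h1] at this
    exact (div_left_inj' (norm_ne_zero_iff.2 hz')).1 this
  ext i
  fin_cases i
  · have := congrArg (fun w : R3 => w 0) h
    simp only [spheroidal_zero] at this
    exact this
  · have := congrArg (fun w : R3 => w 1) h
    simp only [spheroidal_one] at this
    exact this
  · exact h2

lemma image_spheroidal : spheroidal '' {y | y 0 ≠ 0} = {y | y 0 ≠ 0} := by
  ext η
  constructor
  · rintro ⟨y, hy, rfl⟩
    rwa [mem_ofPred_eq, spheroidal_zero]
  · intro hη
    have hh := sig_nu_horizontal η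
    have hpos : 0 < (sig η ^ 2 - 1) * (1 - nu η ^ 2) := by
      rw [hh]; have : η 0 ≠ 0 := hη; positivity
    have h5 : 0 < sig η ^ 2 - 1 := pos_of_mul_pos_left hpos (one_sub_nu_sq_nonneg η)
    set r := sqrt (sig η ^ 2 - 1) with hr
    have hr0 : 0 < r := Real.sqrt_pos.2 h5
    have hr2 : r ^ 2 = sig η ^ 2 - 1 := sq_sqrt h5.le
    let y : R3 := !₂[η 0, η 1, r * nu η]
    have y0 : y 0 = η 0 := rfl
    have y1 : y 1 = η 1 := rfl
    have y2 : y 2 = r * nu η := rfl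
    have hny : ‖y‖ = r := by
      rw [← sq_eq_sq₀ (norm_nonneg _) hr0.le, norm_sq_R3, y0, y1, y2, mul_pow, hr2]
      linarith
    refine ⟨y, by rw [mem_ofPred_eq, y0]; exact hη, ?_⟩
    ext i
    fin_cases i
    · exact spheroidal_zero.trans y0
    · exact spheroidal_one.trans y1
    · refine spheroidal_two.trans ?_
      have : sqrt (1 + r ^ 2) = sig η := by
        rw [hr2, add_sub_cancel, sqrt_sq (by linarith [one_le_sig η])]
      rw [hny, y2, mul_div_cancel_left₀ _ hr0.ne', this]
      exact sig_mul_nu η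

lemma hasFDerivAt_spheroidal (hy : y ≠ 0) : ∃ ℓ : R3 →L[ℝ] ℝ,
    HasFDerivAt spheroidal (ContinuousLinearMap.id ℝ R3 + ℓ.smulRight (basisVec 2)) y ∧
    1 + ℓ (basisVec 2) =
      (sqrt (1 + ‖y‖ ^ 2) ^ 2 - (y 2 / ‖y‖) ^ 2) / (‖y‖ * sqrt (1 + ‖y‖ ^ 2)) := by
  have hd : DifferentiableAt ℝ (fun y : R3 => (sqrt (1 + ‖y‖ ^ 2) / ‖y‖ - 1) * y 2) y := by
    have h1 : DifferentiableAt ℝ (fun y : R3 => ‖y‖) y := differentiableAt_id.norm ℝ hy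
    have h2 : DifferentiableAt ℝ (fun y : R3 => sqrt (1 + ‖y‖ ^ 2)) y :=
      DifferentiableAt.sqrt (by fun_prop) (by positivity)
    have h3 : DifferentiableAt ℝ (fun y : R3 => y 2) y := by fun_prop
    simp only [div_eq_mul_inv]
    exact ((h2.mul (h1.inv (norm_ne_zero_iff.2 hy))).sub_const 1).mul h3
  refine ⟨_, (hasFDerivAt_id y).add (hd.hasFDerivAt.smul_const (basisVec 2)), ?_⟩
  have hline : HasDerivAt (fun t : ℝ => y + t • basisVec 2) (basisVec 2) 0 := by
    simpa using ((hasDerivAt_id' (0 : ℝ)).smul_const (basisVec 2)).const_add y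
  have hcomp := (hd.hasFDerivAt.congr_of_eventuallyEq (EventuallyEq.refl _ _))
  have h0 : y + (0 : ℝ) • basisVec 2 = y := by simp
  rw [← h0] at hcomp
  have hc := hcomp.comp_hasDerivAt (0 : ℝ) hline
  rw [h0] at hc
  set r := ‖y‖ with hr
  have hr0 : 0 < r := norm_pos_iff.2 hy
  have hnorm : ∀ t : ℝ, ‖y + t • basisVec 2‖ = sqrt (r ^ 2 + 2 * t * y 2 + t ^ 2) := by
    intro t
    rw [← sqrt_sq (norm_nonneg (y + t • basisVec 2)), norm_add_sq_real, inner_smul_right,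
      inner_basisVec, norm_smul, norm_basisVec, mul_one, norm_eq_abs, sq_abs]
    congr 1; ring
  have hN : HasDerivAt (fun t : ℝ => sqrt (r ^ 2 + 2 * t * y 2 + t ^ 2)) (y 2 / r) 0 := by
    have : HasDerivAt (fun t : ℝ => r ^ 2 + 2 * t * y 2 + t ^ 2) (2 * y 2) 0 := by
      have := ((((hasDerivAt_id' (0 : ℝ)).const_mul 2).mul_const (y 2)).const_add (r ^ 2)).fun_add
        ((hasDerivAt_id' (0 : ℝ)).fun_pow 2)
      refine this.congr_deriv (by simp)
    refine (this.sqrt (by simp [hr0.ne'])).congr_deriv ?_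
    simp only [mul_zero, zero_mul, add_zero, ne_eq, OfNat.ofNat_ne_zero, not_false_eq_true, zero_pow,
      sqrt_sq hr0.le]
    field_simp
  have hN0 : sqrt (r ^ 2 + 2 * 0 * y 2 + 0 ^ 2) = r := by simp [sqrt_sq hr0.le]
  have hS : HasDerivAt (fun t : ℝ => sqrt (1 + sqrt (r ^ 2 + 2 * t * y 2 + t ^ 2) ^ 2))
      (y 2 / sqrt (1 + r ^ 2)) 0 := by
    refine (((hN.fun_pow 2).const_add 1).sqrt (by positivity)).congr_deriv ?_
    simp only [hN0]
    push_cast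
    field_simp
  have hz : HasDerivAt (fun t : ℝ => y 2 + t) 1 0 := (hasDerivAt_id' (0 : ℝ)).const_add (y 2)
  have hfin := ((hS.fun_div hN (by rw [hN0]; exact hr0.ne')).fun_sub
    (hasDerivAt_const (0 : ℝ) (1 : ℝ))).fun_mul hz
  have heq : ((fun y : R3 => (sqrt (1 + ‖y‖ ^ 2) / ‖y‖ - 1) * y 2) ∘
      fun t : ℝ => y + t • basisVec 2) = fun t : ℝ =>
      (sqrt (1 + sqrt (r ^ 2 + 2 * t * y 2 + t ^ 2) ^ 2) /
        sqrt (r ^ 2 + 2 * t * y 2 + t ^ 2) - 1) * (y 2 + t) := by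
    funext t
    simp only [Function.comp, hnorm]
    simp [basisVec]
  rw [heq] at hc
  rw [hc.unique hfin]
  simp only [hN0, add_zero]
  have hs : 0 < sqrt (1 + r ^ 2) := by positivity
  have hs2 : sqrt (1 + r ^ 2) ^ 2 = 1 + r ^ 2 := sq_sqrt (by positivity)
  set s := sqrt (1 + r ^ 2)
  field_simp
  linear_combination (-y 2 ^ 2) * hs2

lemma det_id_add_smulRight (ℓ : R3 →L[ℝ] ℝ) (v : R3) :
    (ContinuousLinearMap.id ℝ R3 + ℓ.smulRight v).det = 1 + ℓ v := by
  have := LinearMap.transvection.det (ℓ : R3 →ₗ[ℝ] ℝ) v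
  rw [ContinuousLinearMap.det, ← ContinuousLinearMap.coe_coe ℓ, ← this]
  rfl

end Spheroidal

lemma ae_coord_ne_zero : ∀ᵐ y : R3, y 0 ≠ 0 := by
  have h : (LinearMap.ker (proj (𝕜 := ℝ) (0 : Fin 3) : R3 →L[ℝ] ℝ).toLinearMap) ≠ ⊤ := by
    intro h
    have : basisVec 0 ∈ LinearMap.ker
        (proj (𝕜 := ℝ) (0 : Fin 3) : R3 →L[ℝ] ℝ).toLinearMap := h ▸ trivial
    simp [basisVec] at this
  have := Measure.addHaar_submodule (volume : Measure R3) _ h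
  rw [ae_iff]
  refine measure_mono_null (fun y hy => ?_) this
  simpa using hy

/-- Change of variables to prolate spheroidal coordinates. -/
lemma integral_spheroidal (F : R3 → ℂ) :
    ∫ η, F η = ∫ y : R3, (((sqrt (1 + ‖y‖ ^ 2) ^ 2 - (y 2 / ‖y‖) ^ 2) /
      (‖y‖ * sqrt (1 + ‖y‖ ^ 2)) : ℝ) : ℂ) * F (spheroidal y) ∧
    (Integrable F → Integrable fun y : R3 => (((sqrt (1 + ‖y‖ ^ 2) ^ 2 - (y 2 / ‖y‖) ^ 2) /
      (‖y‖ * sqrt (1 + ‖y‖ ^ 2)) : ℝ) : ℂ) * F (spheroidal y)) := by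
  set A : Set R3 := {y | y 0 ≠ 0} with hA
  have mA : MeasurableSet A := by
    have : Measurable fun y : R3 => y 0 := by fun_prop
    exact (measurableSet_eq_fun this measurable_const).compl
  have hr : (volume : Measure R3).restrict A = volume :=
    Measure.restrict_eq_self_of_ae_mem ae_coord_ne_zero
  have hder : ∀ y : R3, ∃ L : R3 →L[ℝ] R3, y ∈ A → HasFDerivAt spheroidal L y ∧ |L.det| =
      (sqrt (1 + ‖y‖ ^ 2) ^ 2 - (y 2 / ‖y‖) ^ 2) / (‖y‖ * sqrt (1 + ‖y‖ ^ 2)) := by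
    intro y
    by_cases hy : y ∈ A
    · have hy' := ne_zero_of_coord hy
      obtain ⟨ℓ, h1, h2⟩ := hasFDerivAt_spheroidal hy'
      refine ⟨_, fun _ => ⟨h1, ?_⟩⟩
      rw [det_id_add_smulRight, h2, abs_of_nonneg]
      refine div_nonneg ?_ (by positivity)
      have := one_le_sqrt_one_add_sq ‖y‖
      have h3 := abs_coord_div_norm_le hy'
      rw [← sq_abs (y 2 / ‖y‖)]
      nlinarith [abs_nonneg (y 2 / ‖y‖)]
    · exact ⟨0, fun h => absurd h hy⟩
  choose L hL using hder
  have hL' : ∀ y ∈ A, HasFDerivWithinAt spheroidal (L y) A y := fun y hy =>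
    (hL y hy).1.hasFDerivWithinAt
  have i1 := integral_image_eq_integral_abs_det_fderiv_smul volume mA hL' injOn_spheroidal F
  have i2 := integrableOn_image_iff_integrableOn_abs_det_fderiv_smul volume mA hL' injOn_spheroidal F
  rw [image_spheroidal] at i1 i2
  have hae : ∀ᵐ y : R3 ∂volume.restrict A, |(L y).det| • F (spheroidal y) =
      (((sqrt (1 + ‖y‖ ^ 2) ^ 2 - (y 2 / ‖y‖) ^ 2) /
      (‖y‖ * sqrt (1 + ‖y‖ ^ 2)) : ℝ) : ℂ) * F (spheroidal y) := by
    filter_upwards [ae_restrict_mem mA] with y hy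
    rw [(hL y hy).2, real_smul]
  constructor
  · rw [integral_congr_ae hae, hr] at i1
    exact i1
  · intro hF
    have := (i2.1 hF.integrableOn).congr hae
    rwa [hr] at this

/-! ### The dispersive kernel -/

/-- The transform of the weight, modulated by a combination of the spheroidal coordinates. -/
def spheroidalKernel (S τ c : ℝ) (x : R3) : ℂ :=
  ∫ η, (weight S η : ℂ) * (cexp ((inner ℝ x η : ℝ) * I) *
    cexp ((τ * sig η + c * nu η : ℝ) * I))

/-- The radial profile of the transform. -/
def radialProfile (b x c s : ℝ) : ℝ :=
  (s ^ 2 - 1) * sinc (rad b x c s) +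
    (sinc (rad b x (c + π / 2) s) + sinc (rad b x (c - π / 2) s)) / 2

lemma continuous_radialProfile (b x c : ℝ) : Continuous (radialProfile b x c) := by
  have h1 := continuous_sinc_rad b x c
  have h2 := continuous_sinc_rad b x (c + π / 2)
  have h3 := continuous_sinc_rad b x (c - π / 2)
  unfold radialProfile
  fun_prop

lemma integral_sphere_vec (x : R3) {b r s : ℝ} (hb : b ^ 2 = x 0 ^ 2 + x 1 ^ 2)
    (hs : s ^ 2 = 1 + r ^ 2) (c : ℝ) :
    ∫ ω : sphere (0 : R3) 1, cexp ((r * inner ℝ x ω.1 + ((s - r) * x 2 + c) * ω.1 2 : ℝ) *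
      I) ∂(volume : Measure R3).toSphere =
      ((4 * π * sinc (rad b (x 2) c s) : ℝ) : ℂ) := by
  set v : R3 := r • x + ((s - r) * x 2 + c) • basisVec 2 with hv
  have hin : ∀ ω : R3, (inner ℝ v ω : ℝ) = r * inner ℝ x ω + ((s - r) * x 2 + c) * ω 2 := by
    intro ω
    rw [hv, inner_add_left, inner_smul_left, inner_smul_left, real_inner_comm ω (basisVec 2),
      inner_basisVec]
    rfl
  have hn : ‖v‖ = rad b (x 2) c s := by
    unfold rad
    rw [← sqrt_sq (norm_nonneg v), norm_sq_R3]
    congr 1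
    simp [hv, basisVec, quad]
    linear_combination (-r^2) * hb + (-b^2) * hs
  rw [← hn, ← integral_sphere_exp]
  simp only [hin]

lemma integral_sphere_profile (x : R3) {b r s : ℝ} (hb : b ^ 2 = x 0 ^ 2 + x 1 ^ 2)
    (hs : s ^ 2 = 1 + r ^ 2) (c : ℝ) :
    ∫ ω : sphere (0 : R3) 1, ((r ^ 2 + cos (π * ω.1 2 / 2) : ℝ) : ℂ) *
      cexp ((r * inner ℝ x ω.1 + ((s - r) * x 2 + c) * ω.1 2 : ℝ) *
      I) ∂(volume : Measure R3).toSphere =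
      ((4 * π * radialProfile b (x 2) c s : ℝ) : ℂ) := by
  have hint : ∀ c : ℝ, Integrable (fun ω : sphere (0 : R3) 1 =>
      cexp ((r * inner ℝ x ω.1 + ((s - r) * x 2 + c) * ω.1 2 : ℝ) * I))
      (volume : Measure R3).toSphere := fun c => by
    refine Integrable.of_bound (Continuous.aestronglyMeasurable (by fun_prop)) 1
      (.of_forall fun ω => (norm_exp_ofReal_mul_I _).le)
  have hsplit : ∀ ω : sphere (0 : R3) 1, ((r ^ 2 + cos (π * ω.1 2 / 2) : ℝ) : ℂ) *
      cexp ((r * inner ℝ x ω.1 + ((s - r) * x 2 + c) * ω.1 2 : ℝ) * I) =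
      (r : ℂ) ^ 2 * cexp ((r * inner ℝ x ω.1 + ((s - r) * x 2 + c) * ω.1 2 : ℝ) * I)
      + ((1 / 2 : ℂ) * cexp ((r * inner ℝ x ω.1 +
          ((s - r) * x 2 + (c + π / 2)) * ω.1 2 : ℝ) * I)
      + (1 / 2 : ℂ) * cexp ((r * inner ℝ x ω.1 +
          ((s - r) * x 2 + (c - π / 2)) * ω.1 2 : ℝ) * I)) := by
    intro ω
    have e1 : ((r * inner ℝ x ω.1 + ((s - r) * x 2 + (c + π / 2)) * ω.1 2 : ℝ) : ℂ) *
        I = ((r * inner ℝ x ω.1 + ((s - r) * x 2 + c) * ω.1 2 : ℝ) : ℂ) * I +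
          ((π * ω.1 2 / 2 : ℝ) : ℂ) * I := by push_cast; ring
    have e2 : ((r * inner ℝ x ω.1 + ((s - r) * x 2 + (c - π / 2)) * ω.1 2 : ℝ) : ℂ) *
        I = ((r * inner ℝ x ω.1 + ((s - r) * x 2 + c) * ω.1 2 : ℝ) : ℂ) * I +
          -((π * ω.1 2 / 2 : ℝ) : ℂ) * I := by push_cast; ring
    rw [e1, e2, exp_add, exp_add, Complex.ofReal_add, Complex.ofReal_cos,
      Complex.cos, ofReal_pow]
    ring
  simp only [hsplit]
  rw [integral_add ((hint c).const_mul _) (((hint _).const_mul _).fun_add ((hint _).const_mul _)),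
    integral_add ((hint _).const_mul _) ((hint _).const_mul _), integral_const_mul,
    integral_const_mul, integral_const_mul, integral_sphere_vec x hb hs,
    integral_sphere_vec x hb hs, integral_sphere_vec x hb hs]
  unfold radialProfile
  rw [hs]
  push_cast
  ring

lemma integral_radial_substitution {S : ℝ} (hS : 1 ≤ S) {g : ℝ → ℂ} (hg : Continuous g) :
    ∫ r in (0 : ℝ)..Real.sqrt (S ^ 2 - 1), ((r / sqrt (1 + r ^ 2) : ℝ) : ℂ) *
      g (sqrt (1 + r ^ 2)) = ∫ s in (1 : ℝ)..S, g s := by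
  have hd : ∀ r : ℝ, HasDerivAt (fun r : ℝ => sqrt (1 + r ^ 2)) (r / sqrt (1 + r ^ 2)) r := by
    intro r
    refine ((((hasDerivAt_id' r).fun_pow 2).const_add 1).sqrt (by positivity)).congr_deriv ?_
    push_cast
    field_simp
  have h := intervalIntegral.integral_deriv_smul_comp (a := 0) (b := sqrt (S ^ 2 - 1))
    (f := fun r : ℝ => sqrt (1 + r ^ 2)) (f' := fun r => r / sqrt (1 + r ^ 2)) (g := g)
    (fun r _ => hd r) (Continuous.continuousOn (by
      refine continuous_id.div (by fun_prop) fun r => ?_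
      positivity)) hg
  have e1 : sqrt (1 + sqrt (S ^ 2 - 1) ^ 2) = S := by
    rw [sq_sqrt (by nlinarith), add_sub_cancel, sqrt_sq (by linarith)]
  simp only [e1, Function.comp, real_smul] at h
  simpa using h

lemma spheroidalKernel_eq {S : ℝ} (hS : 1 ≤ S) (τ c : ℝ) (x : R3) {b : ℝ}
    (hb : b ^ 2 = x 0 ^ 2 + x 1 ^ 2) :
    spheroidalKernel S τ c x = ((4 * π : ℝ) : ℂ) * ∫ s in (1 : ℝ)..S,
      cexp (τ * s * I) * (radialProfile b (x 2) c s : ℂ) := by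
  have cs := continuous_sig
  have cn := continuous_nu
  have hF : Integrable fun η => (weight S η : ℂ) * (cexp ((inner ℝ x η : ℝ) * I) *
      cexp ((τ * sig η + c * nu η : ℝ) * I)) := by
    refine integrable_weight_mul S (Continuous.measurable (by fun_prop)) fun η => ?_
    rw [norm_mul, norm_exp_ofReal_mul_I, norm_exp_ofReal_mul_I, one_mul]
  obtain ⟨h1, h2⟩ := integral_spheroidal (fun η => (weight S η : ℂ) *
    (cexp ((inner ℝ x η : ℝ) * I) *
      cexp ((τ * sig η + c * nu η : ℝ) * I)))
  set sq : ℝ → ℝ := fun r => sqrt (1 + r ^ 2) with hsq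
  let f : R3 → ℂ := fun y => (if sq ‖y‖ ≤ S then cexp (τ * sq ‖y‖ * I) /
    ((‖y‖ * sq ‖y‖ : ℝ) : ℂ) else 0) * (((‖y‖ ^ 2 + cos (π * (y 2 / ‖y‖) / 2) : ℝ) : ℂ) *
      cexp ((inner ℝ x y + ((sq ‖y‖ - ‖y‖) * x 2 + c) * (y 2 / ‖y‖) : ℝ) * I))
  have hae : (fun y : R3 => (((sqrt (1 + ‖y‖ ^ 2) ^ 2 - (y 2 / ‖y‖) ^ 2) /
      (‖y‖ * sqrt (1 + ‖y‖ ^ 2)) : ℝ) : ℂ) * ((weight S (spheroidal y) : ℂ) *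
      (cexp ((inner ℝ x (spheroidal y) : ℝ) * I) *
      cexp ((τ * sig (spheroidal y) + c * nu (spheroidal y) : ℝ) * I)))) =ᵐ[volume]
      f := by
    filter_upwards [ae_coord_ne_zero] with y hy
    have hy' := ne_zero_of_coord hy
    have hr : 0 < ‖y‖ := norm_pos_iff.2 hy'
    simp only [f, weight, sig_spheroidal hy', nu_spheroidal hy']
    change _ * ((((if sq ‖y‖ ≤ S then _ else _ : ℝ)) : ℂ) * _) = _
    by_cases hs : sq ‖y‖ ≤ S
    · rw [if_pos hs, if_pos hs]
      have hin : (inner ℝ x (spheroidal y) : ℝ) =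
          inner ℝ x y + (sq ‖y‖ - ‖y‖) * x 2 * (y 2 / ‖y‖) := by
        rw [spheroidal, inner_add_right, inner_smul_right, inner_basisVec]
        change _ + (sq ‖y‖ / ‖y‖ - 1) * y 2 * x 2 = _
        field_simp
      have hpos : 0 < sq ‖y‖ ^ 2 - (y 2 / ‖y‖) ^ 2 := by
        have e := sig_sq_sub_one_nonneg (spheroidal y)
        have h0 : spheroidal y 0 ≠ 0 := by rwa [spheroidal_zero]
        have h4 := sig_nu_horizontal (spheroidal y)
        have h5 : 0 < (sig (spheroidal y) ^ 2 - 1) * (1 - nu (spheroidal y) ^ 2) := by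
          rw [h4]; positivity
        have h6 := pos_of_mul_pos_left h5 (one_sub_nu_sq_nonneg _)
        have h7 := one_sub_nu_sq_nonneg (spheroidal y)
        rw [sig_spheroidal hy'] at h6
        rw [nu_spheroidal hy'] at h7
        change 0 < sq ‖y‖ ^ 2 - 1 at h6
        linarith
      have hsp : 0 < sq ‖y‖ := by positivity
      have hs1 : sq ‖y‖ ^ 2 - 1 = ‖y‖ ^ 2 := by
        rw [hsq]; simp only; rw [sq_sqrt (by positivity)]; ring
      change (((sq ‖y‖ ^ 2 - (y 2 / ‖y‖) ^ 2) / (‖y‖ * sq ‖y‖) : ℝ) : ℂ) * ((((sq ‖y‖ ^ 2 - 1 +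
        cos (π * (y 2 / ‖y‖) / 2)) / (sq ‖y‖ ^ 2 - (y 2 / ‖y‖) ^ 2) : ℝ) : ℂ) *
          (_ * cexp ((τ * sq ‖y‖ + c * (y 2 / ‖y‖) : ℝ) * I))) = _
      rw [hin, hs1]
      have hexp : cexp (((inner ℝ x y + (sq ‖y‖ - ‖y‖) * x 2 * (y 2 / ‖y‖) : ℝ) : ℂ) * I) *
          cexp ((τ * sq ‖y‖ + c * (y 2 / ‖y‖) : ℝ) * I) =
          cexp (τ * sq ‖y‖ * I) * cexp ((inner ℝ x y +
            ((sq ‖y‖ - ‖y‖) * x 2 + c) * (y 2 / ‖y‖) : ℝ) * I) := by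
        rw [← exp_add, ← exp_add]
        congr 1
        push_cast; ring
      rw [hexp]
      have n1 : ((sq ‖y‖ ^ 2 - (y 2 / ‖y‖) ^ 2 : ℝ) : ℂ) ≠ 0 := by exact_mod_cast hpos.ne'
      rw [Complex.ofReal_div, Complex.ofReal_div]
      generalize ((sq ‖y‖ ^ 2 - (y 2 / ‖y‖) ^ 2 : ℝ) : ℂ) = A at n1 ⊢
      generalize ((‖y‖ ^ 2 + cos (π * (y 2 / ‖y‖) / 2) : ℝ) : ℂ) = B
      generalize ((‖y‖ * sq ‖y‖ : ℝ) : ℂ) = D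
      field_simp
    · rw [if_neg hs, if_neg hs]; simp
  have hf : Integrable f := (h2 hF).congr hae
  unfold spheroidalKernel
  rw [h1, integral_congr_ae hae, integral_polar hf]
  have hrad : ∀ r ∈ Ioi (0 : ℝ), (r ^ 2 : ℝ) • ∫ ω : sphere (0 : R3) 1, f (r • ω.1)
      ∂(volume : Measure R3).toSphere = (Ioc 0 (sqrt (S ^ 2 - 1))).indicator
      (fun r => ((r / sq r : ℝ) : ℂ) * (cexp (τ * sq r * I) *
        ((4 * π * radialProfile b (x 2) c (sq r) : ℝ) : ℂ))) r := by
    intro r hr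
    have hr0 : 0 < r := hr
    have hn : ∀ ω : sphere (0 : R3) 1, ‖r • ω.1‖ = r := fun ω => by
      rw [norm_smul, norm_eq_of_mem_sphere, mul_one, norm_of_nonneg hr0.le]
    have h2c : ∀ ω : sphere (0 : R3) 1, (r • ω.1) 2 / r = ω.1 2 := fun ω => by
      simp [hr0.ne']
    have hsr : sq r ^ 2 = 1 + r ^ 2 := sq_sqrt (by positivity)
    have hsp : 0 < sq r := by positivity
    have hiff : sq r ≤ S ↔ r ∈ Ioc 0 (sqrt (S ^ 2 - 1)) := by
      rw [mem_Ioc, Real.le_sqrt' hr0, ← sq_le_sq₀ hsp.le (by linarith), hsr]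
      constructor
      · intro h; exact ⟨hr0, by linarith⟩
      · intro h; linarith [h.2]
    simp only [f, hn, h2c, inner_smul_right]
    rw [integral_const_mul, integral_sphere_profile x hb hsr c, real_smul]
    by_cases hs : sq r ≤ S
    · rw [if_pos hs, indicator_of_mem (hiff.1 hs)]
      have : (r : ℂ) ≠ 0 := by exact_mod_cast hr0.ne'
      have : (sq r : ℂ) ≠ 0 := by exact_mod_cast hsp.ne'
      push_cast
      field_simp
    · rw [if_neg hs, indicator_of_notMem (fun h => hs (hiff.2 h))]; simp
  rw [setIntegral_congr_fun measurableSet_Ioi hrad, setIntegral_indicator measurableSet_Ioc,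
    inter_eq_self_of_subset_right Ioc_subset_Ioi_self, ← integral_of_le
      (Real.sqrt_nonneg _), ← intervalIntegral.integral_const_mul]
  have hcp := continuous_radialProfile b (x 2) c
  rw [← integral_radial_substitution hS (g := fun s => ((4 * π : ℝ) : ℂ) *
    (cexp (τ * s * I) * (radialProfile b (x 2) c s : ℂ))) (by fun_prop)]
  refine integral_congr fun r _ => ?_
  simp only [hsq]
  push_cast
  ring

lemma norm_integral_modulation_sinc_unshifted {b x : ℝ} (hb : b ≠ 0) (hx : x ≠ 0) {τ : ℝ}
    (hτ : τ ≠ 0) {S : ℝ} (hS : 1 ≤ S) :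
    ‖∫ s in (1 : ℝ)..S, cexp (τ * s * I) * (sinc (rad b x 0 s) : ℂ)‖ ≤
      14 * S / |τ| := by
  have hpos : 0 < b ^ 2 + x ^ 2 := by positivity
  have hX : 0 < sqrt (b ^ 2 + x ^ 2) := Real.sqrt_pos.2 hpos
  have hX2 : sqrt (b ^ 2 + x ^ 2) ^ 2 = b ^ 2 + x ^ 2 := sq_sqrt hpos.le
  have hx0 : x + 0 ≠ 0 := by simpa using hx
  have hX3 : 2 * |(0 : ℝ)| ≤ sqrt (b ^ 2 + x ^ 2) := by simp
  rcases hτ.lt_or_gt with h | h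
  · have := norm_integral_modulation_sinc_large hb hx0 hX hX2 hX3 (neg_pos.2 h) hS
    rw [abs_of_neg h]
    refine le_trans (le_of_eq ?_) this
    rw [← Complex.norm_conj, ← intervalIntegral.intervalIntegral_conj]
    congr 1
    refine integral_congr fun s _ => ?_
    simp [← Complex.exp_conj]
  · rw [abs_of_pos h]; exact norm_integral_modulation_sinc_large hb hx0 hX hX2 hX3 h hS

lemma radialProfile_integral_split (b x c τ : ℝ) (S : ℝ) :
    ∫ s in (1 : ℝ)..S, cexp (τ * s * I) * (radialProfile b x c s : ℂ) =
      (∫ s in (1 : ℝ)..S, ((s ^ 2 - 1 : ℝ) : ℂ) *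
        (cexp (τ * s * I) * (sinc (rad b x c s) : ℂ))) +
      ((1 / 2 : ℂ) * (∫ s in (1 : ℝ)..S, cexp (τ * s * I) *
        (sinc (rad b x (c + π / 2) s) : ℂ)) +
       (1 / 2 : ℂ) * (∫ s in (1 : ℝ)..S, cexp (τ * s * I) *
        (sinc (rad b x (c - π / 2) s) : ℂ))) := by
  have h1 := continuous_sinc_rad b x c
  have h2 := continuous_sinc_rad b x (c + π / 2)
  have h3 := continuous_sinc_rad b x (c - π / 2)
  rw [← intervalIntegral.integral_const_mul, ← intervalIntegral.integral_const_mul,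
    ← intervalIntegral.integral_add (Continuous.intervalIntegrable (by fun_prop) _ _)
      (Continuous.intervalIntegrable (by fun_prop) _ _),
    ← intervalIntegral.integral_add (Continuous.intervalIntegrable (by fun_prop) _ _)
      (Continuous.intervalIntegrable (by fun_prop) _ _)]
  refine integral_congr fun s _ => ?_
  simp only [radialProfile]
  push_cast
  ring

lemma norm_integral_sq_sub_one_mul_le {S M : ℝ} (hS : 1 ≤ S) (hM : 0 < M) {f : ℝ → ℂ}
    (hf : Continuous f) (h : ∀ s ∈ Icc 1 S, ‖∫ y in (1 : ℝ)..s, f y‖ ≤ M) :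
    ‖∫ s in (1 : ℝ)..S, ((s ^ 2 - 1 : ℝ) : ℂ) * f s‖ ≤ 2 * M * S ^ 2 := by
  refine (norm_integral_monotone_mul_le hS (A := fun s => s ^ 2 - 1) (by fun_prop) hf ?_ (by simp)
    hM h).trans (by nlinarith)
  intro s hs t ht hst
  have := hs.1
  simp only
  nlinarith

lemma norm_radialProfile_integral_sig {b x τ S : ℝ} (hb : b ≠ 0) (hx : x ≠ 0)
    (h1 : x + π / 2 ≠ 0) (h2 : x - π / 2 ≠ 0) (hτ : τ ≠ 0) (hS : 1 ≤ S) :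
    ‖∫ s in (1 : ℝ)..S, cexp (τ * s * I) * (radialProfile b x 0 s : ℂ)‖ ≤
      68 * S ^ 3 / |τ| := by
  have hτ' : 0 < |τ| := abs_pos.2 hτ
  have c0 := continuous_sinc_rad b x 0
  rw [radialProfile_integral_split]
  have e1 := norm_integral_sq_sub_one_mul_le hS (M := 14 * S / |τ|) (by positivity)
    (f := fun s : ℝ => cexp (τ * s * I) * (sinc (rad b x 0 s) : ℂ))
    (by fun_prop) fun s hs => (norm_integral_modulation_sinc_unshifted hb hx hτ hs.1).trans (by
      gcongr; exact hs.2)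
  have hp2 : |π / 2| ≤ 2 := by
    rw [abs_of_pos (by positivity)]; linarith [Real.pi_lt_four]
  have e2 := norm_integral_modulation_sinc_le (c := 0 + π / 2) hb (by simpa using h1)
    (by rwa [zero_add]) hτ hS
  have e3 := norm_integral_modulation_sinc_le (c := 0 - π / 2) hb
    (by simpa [← sub_eq_add_neg] using h2) (by simpa using hp2) hτ hS
  have hS3 : S ^ 2 ≤ S ^ 3 := pow_le_pow_right₀ hS (by norm_num)
  calc _ ≤ 2 * (14 * S / |τ|) * S ^ 2 + (1 / 2 * (40 * S ^ 2 / |τ|) + 1 / 2 * (40 * S ^ 2 / |τ|)) := by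
        refine (norm_add_le _ _).trans (add_le_add e1 ((norm_add_le _ _).trans ?_))
        rw [norm_mul, norm_mul, show ‖(1 / 2 : ℂ)‖ = 1 / 2 by norm_num]
        exact add_le_add (mul_le_mul_of_nonneg_left e2 (by norm_num))
          (mul_le_mul_of_nonneg_left e3 (by norm_num))
    _ = (28 * S ^ 3 + 40 * S ^ 2) / |τ| := by ring
    _ ≤ _ := by gcongr; linarith

lemma norm_radialProfile_integral_nu {b x c S : ℝ} (hb : b ≠ 0) (h0 : x + c ≠ 0)
    (h1 : x + (c + π / 2) ≠ 0) (h2 : x + (c - π / 2) ≠ 0) (hc : c ≠ 0) (hS : 1 ≤ S) :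
    ‖∫ s in (1 : ℝ)..S, cexp ((0 : ℝ) * s * I) * (radialProfile b x c s : ℂ)‖ ≤
      68 * S ^ 3 / |c| := by
  have hc' : 0 < |c| := abs_pos.2 hc
  have hS3 : S ≤ S ^ 3 := le_self_pow₀ hS (by norm_num)
  by_cases hcp : π ≤ |c|
  · have hshift : ∀ d : ℝ, |d| = π / 2 → |c| / 2 ≤ |c + d| := fun d hd => by
      have := abs_add_le (c + d) (-d)
      rw [abs_neg, hd, add_neg_cancel_right] at this
      linarith
    have hp2 : |π / 2| = π / 2 := abs_of_pos (by positivity)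
    have s1 := hshift (π / 2) hp2
    have s2 := hshift (-(π / 2)) (by rw [abs_neg, hp2])
    rw [← sub_eq_add_neg] at s2
    have c0 := continuous_sinc_rad b x c
    rw [radialProfile_integral_split]
    simp only [Complex.ofReal_zero, zero_mul, Complex.exp_zero, one_mul]
    have e1 := norm_integral_sq_sub_one_mul_le hS (M := 12 * S / |c|) (by positivity)
      (f := fun s : ℝ => (sinc (rad b x c s) : ℂ))
      (by fun_prop) fun s hs => (norm_integral_sinc_rad_le hb h0 hc hs.1).trans (by
        gcongr; exact hs.2)
    have half : ∀ d : ℝ, |c| / 2 ≤ |d| → 12 * S / |d| ≤ 24 * S / |c| := fun d hd => by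
      rw [div_le_div_iff₀ (by linarith) hc']
      nlinarith
    have n1 : c + π / 2 ≠ 0 := fun h => by rw [h, abs_zero] at s1; linarith
    have n2 : c - π / 2 ≠ 0 := fun h => by rw [h, abs_zero] at s2; linarith
    have e2 := (norm_integral_sinc_rad_le hb h1 n1 hS).trans (half _ s1)
    have e3 := (norm_integral_sinc_rad_le hb h2 n2 hS).trans (half _ s2)
    calc _ ≤ 2 * (12 * S / |c|) * S ^ 2 + (1 / 2 * (24 * S / |c|) + 1 / 2 * (24 * S / |c|)) := by
          refine (norm_add_le _ _).trans (add_le_add e1 ((norm_add_le _ _).trans ?_))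
          rw [norm_mul, norm_mul, show ‖(1 / 2 : ℂ)‖ = 1 / 2 by norm_num]
          exact add_le_add (mul_le_mul_of_nonneg_left e2 (by norm_num))
            (mul_le_mul_of_nonneg_left e3 (by norm_num))
      _ = (24 * S ^ 3 + 24 * S) / |c| := by ring
      _ ≤ _ := by gcongr; nlinarith
  · have hb' : ∀ s ∈ uIoc 1 S, ‖cexp ((0 : ℝ) * s * I) *
        (radialProfile b x c s : ℂ)‖ ≤ S ^ 2 := by
      intro s hs
      rw [uIoc_of_le hS] at hs
      rw [norm_mul, norm_modulation, one_mul, norm_real, radialProfile, norm_eq_abs]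
      have b1 : ∀ t : ℝ, |sinc t| ≤ 1 := Real.abs_sinc_le_one
      have hs1 : 0 ≤ s ^ 2 - 1 := by nlinarith [hs.1]
      have a1 : |(s ^ 2 - 1) * sinc (rad b x c s)| ≤ s ^ 2 - 1 := by
        rw [abs_mul, abs_of_nonneg hs1]
        exact mul_le_of_le_one_right hs1 (b1 _)
      have a2 := abs_le.1 (b1 (rad b x (c + π / 2) s))
      have a3 := abs_le.1 (b1 (rad b x (c - π / 2) s))
      have a4 := abs_le.1 a1
      have : s ^ 2 ≤ S ^ 2 := by nlinarith [hs.1, hs.2]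
      rw [abs_le]
      constructor <;> linarith
    have := intervalIntegral.norm_integral_le_of_norm_le_const hb'
    refine this.trans ?_
    rw [abs_of_nonneg (by linarith), le_div_iff₀ hc']
    have : |c| ≤ 4 := by linarith [Real.pi_lt_four]
    have h3 : S ^ 2 * (S - 1) ≤ S ^ 3 := by nlinarith [sq_nonneg S]
    have h4 : 0 ≤ S ^ 2 * (S - 1) := mul_nonneg (by positivity) (by linarith)
    calc _ ≤ S ^ 2 * (S - 1) * 4 := mul_le_mul_of_nonneg_left this h4
      _ ≤ _ := by nlinarith

lemma ae_coord_ne (k : Fin 3) (d : ℝ) : ∀ᵐ y : R3, y k ≠ d := by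
  have h : (LinearMap.ker (proj (𝕜 := ℝ) k : R3 →L[ℝ] ℝ).toLinearMap) ≠ ⊤ := by
    intro h
    have : basisVec k ∈ LinearMap.ker
        (proj (𝕜 := ℝ) k : R3 →L[ℝ] ℝ).toLinearMap := h ▸ trivial
    simp [basisVec] at this
  have h0 := Measure.addHaar_submodule (volume : Measure R3) _ h
  have h1 : ∀ᵐ y : R3, y k ≠ 0 := by
    rw [ae_iff]
    refine measure_mono_null (fun y hy => ?_) h0
    simpa using hy
  have h2 := (measurePreserving_sub_right (volume : Measure R3) (d • basisVec k)).quasiMeasurePreserving.ae h1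
  filter_upwards [h2] with y hy h
  apply hy
  simp [basisVec, h]

/-- Dispersive estimate for the phase `sig`. -/
lemma norm_spheroidalKernel_sig_le {S τ : ℝ} (hS : 1 ≤ S) (hτ : τ ≠ 0) :
    ∀ᵐ x : R3, ‖spheroidalKernel S τ 0 x‖ ≤ 1088 * S ^ 3 / |τ| := by
  filter_upwards [ae_coord_ne 0 0, ae_coord_ne 2 0, ae_coord_ne 2 (π / 2),
    ae_coord_ne 2 (-(π / 2))] with x h0 h1 h2 h3
  have hpos : 0 < x 0 ^ 2 + x 1 ^ 2 := by positivity
  rw [spheroidalKernel_eq hS τ 0 x (sq_sqrt hpos.le), norm_mul, norm_real,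
    norm_of_nonneg (by positivity)]
  have e := norm_radialProfile_integral_sig (Real.sqrt_pos.2 hpos).ne' h1
    (fun h => h3 (by linarith)) (fun h => h2 (by linarith)) hτ hS
  calc _ ≤ 4 * 4 * (68 * S ^ 3 / |τ|) := by
        gcongr
        exact Real.pi_lt_four.le
    _ = _ := by ring

/-- Dispersive estimate for the phase `nu`. -/
lemma norm_spheroidalKernel_nu_le {S c : ℝ} (hS : 1 ≤ S) (hc : c ≠ 0) :
    ∀ᵐ x : R3, ‖spheroidalKernel S 0 c x‖ ≤ 1088 * S ^ 3 / |c| := by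
  filter_upwards [ae_coord_ne 0 0, ae_coord_ne 2 (-c), ae_coord_ne 2 (-(c + π / 2)),
    ae_coord_ne 2 (-(c - π / 2))] with x h0 h1 h2 h3
  have hpos : 0 < x 0 ^ 2 + x 1 ^ 2 := by positivity
  rw [spheroidalKernel_eq hS 0 c x (sq_sqrt hpos.le), norm_mul, norm_real,
    norm_of_nonneg (by positivity)]
  have e := norm_radialProfile_integral_nu (x := x 2) (Real.sqrt_pos.2 hpos).ne'
    (fun h => h1 (by linarith)) (fun h => h2 (by linarith)) (fun h => h3 (by linarith)) hc hS
  calc _ ≤ 4 * 4 * (68 * S ^ 3 / |c|) := by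
        gcongr
        exact Real.pi_lt_four.le
    _ = _ := by ring

/-! ### Interpolation of sesquilinear forms on the diagonal -/

/-- Bounded measurable functions that are integrable, on which forms are interpolated. -/
structure IsTame (f : R3 → ℂ) : Prop where
  measurable : Measurable f
  integrable : Integrable f
  bounded : ∃ M : ℝ, ∀ x, ‖f x‖ ≤ M

namespace IsTame
variable {f : R3 → ℂ}

lemma indicator (hf : IsTame f) {A : Set R3} (hA : MeasurableSet A) : IsTame (A.indicator f) where
  measurable := hf.measurable.indicator hA
  integrable := hf.integrable.indicator hA
  bounded := by
    obtain ⟨M, hM⟩ := hf.bounded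
    exact ⟨M, fun x => (norm_indicator_le_norm_self f x).trans (hM x)⟩

lemma integrable_rpow (hf : IsTame f) {p : ℝ} (hp : 1 ≤ p) : Integrable fun x => ‖f x‖ ^ p := by
  obtain ⟨M, hM⟩ := hf.bounded
  have hM0 : 0 ≤ M := (norm_nonneg _).trans (hM 0)
  refine (hf.integrable.norm.const_mul (M ^ (p - 1))).mono'
    ((hf.measurable.norm.pow_const p).aestronglyMeasurable)
    (.of_forall fun x => ?_)
  rw [norm_of_nonneg (by positivity)]
  rcases (norm_nonneg (f x)).eq_or_lt with h | h
  · rw [← h, Real.zero_rpow (by linarith)]; simp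
  · calc ‖f x‖ ^ p = ‖f x‖ ^ (p - 1) * ‖f x‖ := by
          rw [← Real.rpow_add_one h.ne']; ring_nf
      _ ≤ _ := mul_le_mul_of_nonneg_right
          (rpow_le_rpow h.le (hM x) (by linarith)) h.le

lemma integrable_sq (hf : IsTame f) : Integrable fun x => ‖f x‖ ^ 2 := by
  have := hf.integrable_rpow (p := 2) (by norm_num)
  simpa using this

end IsTame

lemma geometric_levels {d δ y : ℝ} (hd : 0 < d) (hδ : 0 < δ) (hy : 0 < y) (K : ℕ) :
    (1 - (2 : ℝ) ^ (-d)) * ∑ k ∈ Finset.range K,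
      (if δ * 2 ^ k ≤ y then (δ * 2 ^ k) ^ d else 0) ≤ y ^ d := by
  set ℓ : ℕ → ℝ := fun k => min ((δ * 2 ^ k / 2) ^ d) (y ^ d) with hℓ
  have h2 : (2 : ℝ) ^ (-d) ≤ 1 := Real.rpow_le_one_of_one_le_of_nonpos (by norm_num) (by linarith)
  have hstep : ∀ k ∈ Finset.range K, (1 - (2 : ℝ) ^ (-d)) *
      (if δ * 2 ^ k ≤ y then (δ * 2 ^ k) ^ d else 0) ≤ ℓ (k + 1) - ℓ k := by
    intro k _
    have e1 : δ * 2 ^ (k + 1) / 2 = δ * 2 ^ k := by rw [pow_succ]; ring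
    have e2 : (δ * 2 ^ k / 2) ^ d = (δ * 2 ^ k) ^ d * (2 : ℝ) ^ (-d) := by
      rw [Real.div_rpow (by positivity) (by norm_num), Real.rpow_neg (by norm_num)]; rfl
    have hmono : (δ * 2 ^ k / 2) ^ d ≤ (δ * 2 ^ k) ^ d :=
      rpow_le_rpow (by positivity) (by
        have : 0 < δ * 2 ^ k := by positivity
        linarith) hd.le
    simp only [hℓ, e1]
    split_ifs with h
    · have h3 : (δ * 2 ^ k) ^ d ≤ y ^ d := rpow_le_rpow (by positivity) h hd.le
      rw [min_eq_left h3, min_eq_left (hmono.trans h3), e2]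
      linarith
    · rw [mul_zero, sub_nonneg]
      exact min_le_min_right _ hmono
  rw [mul_sum]
  refine (sum_le_sum hstep).trans ?_
  rw [Finset.sum_range_sub]
  have h0 : 0 ≤ ℓ 0 := le_min (by positivity) (by positivity)
  have h1 : ℓ K ≤ y ^ d := min_le_right _ _
  linarith

section Interpolation

variable {B : (R3 → ℂ) → (R3 → ℂ) → ℂ} {a b p : ℝ} {f g : R3 → ℂ}

lemma integral_norm_high_le (hf : IsTame f) (hp : 1 < p) {l : ℝ} (hl : 0 < l) {A : Set R3}
    (hA : MeasurableSet A) (hlA : ∀ x ∈ A, l ≤ ‖f x‖) :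
    ∫ x, ‖A.indicator f x‖ ≤ l ^ (1 - p) * ∫ x, A.indicator (fun x => ‖f x‖ ^ p) x := by
  rw [← integral_const_mul]
  refine integral_mono (hf.indicator hA).integrable.norm
    (((hf.integrable_rpow hp.le).indicator hA).const_mul _) fun x => ?_
  by_cases hx : x ∈ A
  · simp only [indicator_of_mem hx]
    have h0 : 0 < ‖f x‖ := hl.trans_le (hlA x hx)
    calc ‖f x‖ = ‖f x‖ ^ (1 - p) * ‖f x‖ ^ p := by
          rw [← rpow_add h0]; simp
      _ ≤ _ := by
          gcongr ?_ * _
          exact Real.rpow_le_rpow_of_nonpos hl (hlA x hx) (by linarith)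
  · simp [indicator_of_notMem hx]

lemma integral_norm_sq_low_le (hf : IsTame f) (hp1 : 1 < p) (hp : p < 2) {l : ℝ}
    {A : Set R3} (hA : MeasurableSet A) (hlA : ∀ x ∈ A, ‖f x‖ ≤ l) :
    ∫ x, ‖A.indicator f x‖ ^ 2 ≤ l ^ (2 - p) * ∫ x, A.indicator (fun x => ‖f x‖ ^ p) x := by
  rw [← integral_const_mul]
  refine integral_mono (hf.indicator hA).integrable_sq
    (((hf.integrable_rpow hp1.le).indicator hA).const_mul _) fun x => ?_
  by_cases hx : x ∈ A
  · simp only [indicator_of_mem hx]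
    rcases (norm_nonneg (f x)).eq_or_lt with h0 | h0
    · rw [← h0, Real.zero_rpow (by linarith)]; simp
    calc ‖f x‖ ^ 2 = ‖f x‖ ^ (2 - p) * ‖f x‖ ^ p := by
          rw [← rpow_add h0]; simp
      _ ≤ _ := by
          gcongr ?_ * _
          exact rpow_le_rpow h0.le (hlA x hx) (by linarith)
  · simp [indicator_of_notMem hx]

lemma integral_indicator_rpow_le (hf : IsTame f) (hp : 1 < p) {A : Set R3}
    (hA : MeasurableSet A) : ∫ x, A.indicator (fun x => ‖f x‖ ^ p) x ≤ ∫ x, ‖f x‖ ^ p :=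
  integral_mono ((hf.integrable_rpow hp.le).indicator hA) (hf.integrable_rpow hp.le) fun x =>
    indicator_le_self' (fun x _ => by positivity) x

/-- The interpolation inequality before the choice of the parameters. -/
lemma norm_form_le_of_levels (ha : 0 < a) (hb : 0 < b) (hp : 1 < p) (hp2 : p < 2)
    (hadd1 : ∀ f f' g, IsTame f → IsTame f' → IsTame g → B (f + f') g = B f g + B f' g)
    (hadd2 : ∀ f g g', IsTame f → IsTame g → IsTame g' → B f (g + g') = B f g + B f g')
    (h1 : ∀ f g, IsTame f → IsTame g → ‖B f g‖ ≤ a * ((∫ x, ‖f x‖) * ∫ x, ‖g x‖))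
    (h2 : ∀ f g, IsTame f → IsTame g →
      ‖B f g‖ ≤ b * (sqrt (∫ x, ‖f x‖ ^ 2) * sqrt (∫ x, ‖g x‖ ^ 2)))
    (hf : IsTame f) (hg : IsTame g) {c θ δ : ℝ} (hc : 0 < c) (hθ : 0 < θ) (hδ : 0 < δ) :
    ‖B f g‖ ≤ a * c ^ (1 - p) * ((∫ x, ‖f x‖ ^ p) * ∫ x, ‖g x‖ ^ p) +
      b * (θ * ((1 - (2 : ℝ) ^ (-(2 - p)))⁻¹ * (c ^ (2 - p) * ∫ x, ‖f x‖ ^ p)) +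
        4 / θ * ∫ x, ‖g x‖ ^ p) +
      b * (sqrt (∫ x, ‖f x‖ ^ 2) * sqrt (δ ^ (2 - p) * ∫ x, ‖g x‖ ^ p)) := by
  set F := ∫ x, ‖f x‖ ^ p with hF
  set H := ∫ x, ‖g x‖ ^ p with hH
  set κ := (1 - (2 : ℝ) ^ (-(2 - p)))⁻¹ with hκ
  have hF0 : 0 ≤ F := integral_nonneg fun x => by positivity
  have hH0 : 0 ≤ H := integral_nonneg fun x => by positivity
  set ℓ : ℕ → ℝ := fun k => δ * 2 ^ k with hℓ
  have hℓ0 : ∀ k, 0 < ℓ k := fun k => by positivity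
  have hℓs : ∀ k, ℓ (k + 1) = 2 * ℓ k := fun k => by simp only [hℓ, pow_succ]; ring
  set E : ℕ → Set R3 := fun k => {x | ‖g x‖ ≤ ℓ k} with hE
  have mE : ∀ k, MeasurableSet (E k) := fun k =>
    measurableSet_le hg.measurable.norm measurable_const
  set D : ℕ → Set R3 := fun k => E (k + 1) \ E k with hD
  have mD : ∀ k, MeasurableSet (D k) := fun k => (mE _).diff (mE _)
  have hEsub : ∀ k, E k ⊆ E (k + 1) := fun k x hx => by
    have : ‖g x‖ ≤ ℓ k := hx
    change ‖g x‖ ≤ ℓ (k + 1)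
    rw [hℓs]; linarith [hℓ0 k]
  obtain ⟨M, hM⟩ := hg.bounded
  obtain ⟨K, hK⟩ := pow_unbounded_of_one_lt (M / δ) (one_lt_two : (1 : ℝ) < 2)
  have hEK : E K = univ := eq_univ_of_forall fun x => by
    change ‖g x‖ ≤ δ * 2 ^ K
    rw [div_lt_iff₀ hδ] at hK
    linarith [hM x]
  have hsum : ∀ n, B f ((E n).indicator g) = B f ((E 0).indicator g) +
      ∑ k ∈ Finset.range n, B f ((D k).indicator g) := by
    intro n
    induction n with
    | zero => simp
    | succ n ih =>
      rw [Finset.sum_range_succ, ← add_assoc, ← ih, ← hadd2 _ _ _ hf (hg.indicator (mE n))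
        (hg.indicator (mD n))]
      congr 1
      have := indicator_union_of_disjoint (disjoint_sdiff_right (s := E n) (t := E (n + 1))) g
      rw [union_sdiff_cancel (hEsub n)] at this
      exact this
  have hBfg : B f g = B f ((E 0).indicator g) + ∑ k ∈ Finset.range K, B f ((D k).indicator g) := by
    rw [← hsum K, hEK, indicator_univ]
  have hDlow : ∀ k, ∀ x ∈ D k, ℓ k ≤ ‖g x‖ := fun k x hx => (not_le.1 hx.2).le
  have hDhigh : ∀ k, ∀ x ∈ D k, ‖g x‖ ≤ 2 * ℓ k := fun k x hx => (hℓs k) ▸ hx.1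
  set Hk : ℕ → ℝ := fun k => ∫ x, (D k).indicator (fun x => ‖g x‖ ^ p) x with hHk
  have hHk0 : ∀ k, 0 ≤ Hk k := fun k => integral_nonneg fun x =>
    indicator_nonneg (fun x _ => by positivity) x
  set P : ℕ → Set R3 := fun k => {x | c / ℓ k ≤ ‖f x‖} with hP
  have mP : ∀ k, MeasurableSet (P k) := fun k =>
    measurableSet_le measurable_const hf.measurable.norm
  set Lk : ℕ → ℝ := fun k => ∫ x, ‖(P k)ᶜ.indicator f x‖ ^ 2 with hLk
  have hLk0 : ∀ k, 0 ≤ Lk k := fun k => integral_nonneg fun x => by positivity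
  have hpiece : ∀ k, ‖B f ((D k).indicator g)‖ ≤ a * c ^ (1 - p) * F * Hk k +
      b * (θ * (ℓ k ^ (2 - p) * Lk k) + 4 / θ * Hk k) := by
    intro k
    have hsplit : f = (P k).indicator f + (P k)ᶜ.indicator f := (indicator_self_add_compl _ _).symm
    have tD := hg.indicator (mD k)
    have tP := hf.indicator (mP k)
    have tPc := hf.indicator (mP k).compl
    have e0 : B f ((D k).indicator g) = B ((P k).indicator f) ((D k).indicator g) +
        B ((P k)ᶜ.indicator f) ((D k).indicator g) := by
      rw [← hadd1 _ _ _ tP tPc tD, ← hsplit]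
    rw [e0]
    refine (norm_add_le _ _).trans (add_le_add ((h1 _ _ tP tD).trans ?_) ((h2 _ _ tPc tD).trans ?_))
    · have i1 := (integral_norm_high_le hf hp (div_pos hc (hℓ0 k)) (mP k) fun x hx => hx).trans
        (mul_le_mul_of_nonneg_left (integral_indicator_rpow_le hf hp (mP k))
          (rpow_nonneg (div_pos hc (hℓ0 k)).le _))
      have i2 := integral_norm_high_le hg hp (hℓ0 k) (mD k) (hDlow k)
      have i3 : (c / ℓ k) ^ (1 - p) * ℓ k ^ (1 - p) = c ^ (1 - p) := by
        rw [← mul_rpow (div_pos hc (hℓ0 k)).le (hℓ0 k).le, div_mul_cancel₀ _ (hℓ0 k).ne']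
      calc _ ≤ a * (((c / ℓ k) ^ (1 - p) * F) * (ℓ k ^ (1 - p) * Hk k)) := by
            refine mul_le_mul_of_nonneg_left (mul_le_mul i1 i2 (integral_nonneg fun x =>
              norm_nonneg _) ?_) ha.le
            have := (div_pos hc (hℓ0 k)).le
            positivity
        _ = a * ((c / ℓ k) ^ (1 - p) * ℓ k ^ (1 - p)) * F * Hk k := by ring
        _ = _ := by rw [i3]
    · have i2 := integral_norm_sq_low_le hg hp hp2 (l := 2 * ℓ k) (mD k)
        (hDhigh k)
      have i3 : (2 * ℓ k) ^ (2 - p) ≤ 4 * ℓ k ^ (2 - p) := by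
        rw [mul_rpow (by norm_num) (hℓ0 k).le]
        have h22 : (2 : ℝ) ^ (2 - p) ≤ 2 ^ (2 : ℝ) :=
          Real.rpow_le_rpow_of_exponent_le (by norm_num) (by linarith)
        have h24 : (2 : ℝ) ^ (2 : ℝ) = 4 := by norm_num
        have := hℓ0 k
        gcongr
        linarith
      have i4 : ∫ x, ‖(D k).indicator g x‖ ^ 2 ≤ 4 * ℓ k ^ (2 - p) * Hk k :=
        i2.trans (mul_le_mul_of_nonneg_right i3 (hHk0 k))
      refine mul_le_mul_of_nonneg_left ?_ hb.le
      have hlk : 0 < ℓ k ^ (2 - p) := Real.rpow_pos_of_pos (hℓ0 k) _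
      have i5 : sqrt (Lk k) * sqrt (∫ x, ‖(D k).indicator g x‖ ^ 2) ≤
          sqrt ((ℓ k ^ (2 - p) * Lk k) * (4 * Hk k)) := by
        rw [← Real.sqrt_mul (hLk0 k)]
        refine Real.sqrt_le_sqrt ?_
        calc _ ≤ Lk k * (4 * ℓ k ^ (2 - p) * Hk k) := mul_le_mul_of_nonneg_left i4 (hLk0 k)
          _ = _ := by ring
      refine i5.trans ?_
      have x0 : 0 ≤ ℓ k ^ (2 - p) * Lk k := mul_nonneg hlk.le (hLk0 k)
      refine Real.sqrt_le_iff.2 ⟨add_nonneg (by positivity)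
        (mul_nonneg (by positivity) (hHk0 k)), ?_⟩
      set X := ℓ k ^ (2 - p) * Lk k
      have e : (θ * X) * (4 / θ * Hk k) = X * (4 * Hk k) := by field_simp
      nlinarith [mul_nonneg hθ.le x0, mul_nonneg (by positivity : 0 ≤ 4 / θ) (hHk0 k),
        sq_nonneg (θ * X), sq_nonneg (4 / θ * Hk k)]
  have hSH : ∑ k ∈ Finset.range K, Hk k ≤ H := by
    rw [← integral_finsetSum _ fun k _ => (hg.integrable_rpow hp.le).indicator (mD k)]
    refine integral_mono (integrable_finsetSum _ fun k _ =>
      (hg.integrable_rpow hp.le).indicator (mD k)) (hg.integrable_rpow hp.le) fun x => ?_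
    have hx : ∀ n, ∑ k ∈ Finset.range n, (D k).indicator (fun x => ‖g x‖ ^ p) x +
        (E 0).indicator (fun x => ‖g x‖ ^ p) x = (E n).indicator (fun x => ‖g x‖ ^ p) x := by
      intro n
      induction n with
      | zero => simp
      | succ n ih =>
        rw [Finset.sum_range_succ, add_right_comm, ih]
        have := congrFun (indicator_union_of_disjoint (f := fun x => ‖g x‖ ^ p)
          (disjoint_sdiff_right (s := E n) (t := E (n + 1)))) x
        rw [union_sdiff_cancel (hEsub n)] at this
        rw [this]
    have h3 := hx K
    have h4 : 0 ≤ (E 0).indicator (fun x => ‖g x‖ ^ p) x :=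
      indicator_nonneg (fun x _ => by positivity) x
    rw [hEK, indicator_univ] at h3
    simp only at h3 ⊢
    linarith
  have hκpos : 0 < 1 - (2 : ℝ) ^ (-(2 - p)) := by
    have := Real.rpow_lt_one_of_one_lt_of_neg (one_lt_two : (1 : ℝ) < 2)
      (show -(2 - p) < 0 by linarith)
    linarith
  have hSL : ∑ k ∈ Finset.range K, ℓ k ^ (2 - p) * Lk k ≤ κ * (c ^ (2 - p) * F) := by
    have e : ∀ k, ℓ k ^ (2 - p) * Lk k = ∫ x, ℓ k ^ (2 - p) * ‖(P k)ᶜ.indicator f x‖ ^ 2 :=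
      fun k => (integral_const_mul _ _).symm
    have hi : ∀ k, Integrable fun x => ℓ k ^ (2 - p) * ‖(P k)ᶜ.indicator f x‖ ^ 2 :=
      fun k => (hf.indicator (mP k).compl).integrable_sq.const_mul _
    simp only [e]
    rw [← integral_finsetSum _ fun k _ => hi k, hF, ← integral_const_mul, ← integral_const_mul]
    refine integral_mono (integrable_finsetSum _ fun k _ => hi k)
      (((hf.integrable_rpow hp.le).const_mul _).const_mul _) fun x => ?_
    rcases (norm_nonneg (f x)).eq_or_lt with h0 | h0
    · have : ∀ k, (P k)ᶜ.indicator f x = 0 := fun k => by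
        rw [indicator_apply_eq_zero]; intro _; exact norm_eq_zero.1 h0.symm
      simp only [this]
      simp [← h0, Real.zero_rpow (by linarith : p ≠ 0)]
    have hgeo := geometric_levels (d := 2 - p) (by linarith) hδ (div_pos hc h0) K
    have hterm : ∀ k, ℓ k ^ (2 - p) * ‖(P k)ᶜ.indicator f x‖ ^ 2 ≤
        (if δ * 2 ^ k ≤ c / ‖f x‖ then (δ * 2 ^ k) ^ (2 - p) else 0) * ‖f x‖ ^ 2 := by
      intro k
      by_cases hx : x ∈ (P k)ᶜ
      · rw [indicator_of_mem hx]
        have h5 : ‖f x‖ < c / ℓ k := not_le.1 hx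
        have h6 : δ * 2 ^ k ≤ c / ‖f x‖ := by
          rw [le_div_iff₀ h0]
          rw [lt_div_iff₀ (hℓ0 k)] at h5
          have : ‖f x‖ * (δ * 2 ^ k) < c := h5
          linarith
        rw [if_pos h6]
      · rw [indicator_of_notMem hx]
        simp only [norm_zero, ne_eq, OfNat.ofNat_ne_zero, not_false_eq_true, zero_pow, mul_zero]
        split_ifs <;> positivity
    refine (sum_le_sum fun k _ => hterm k).trans ?_
    rw [← sum_mul]
    have h7 : ∑ k ∈ Finset.range K, (if δ * 2 ^ k ≤ c / ‖f x‖ then (δ * 2 ^ k) ^ (2 - p) else 0) ≤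
        κ * (c / ‖f x‖) ^ (2 - p) := by
      rw [hκ, inv_mul_eq_div, le_div_iff₀ hκpos, mul_comm]
      exact hgeo
    refine (mul_le_mul_of_nonneg_right h7 (by positivity)).trans (le_of_eq ?_)
    rw [Real.div_rpow hc.le h0.le, mul_assoc, div_mul_eq_mul_div, mul_div_assoc]
    congr 2
    rw [div_eq_iff (by positivity), ← rpow_add h0]
    simp
  have hE0 : ‖B f ((E 0).indicator g)‖ ≤
      b * (sqrt (∫ x, ‖f x‖ ^ 2) * sqrt (δ ^ (2 - p) * H)) := by
    refine (h2 _ _ hf (hg.indicator (mE 0))).trans ?_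
    refine mul_le_mul_of_nonneg_left (mul_le_mul_of_nonneg_left (Real.sqrt_le_sqrt ?_)
      (Real.sqrt_nonneg _)) hb.le
    exact (integral_norm_sq_low_le hg hp hp2 (l := δ) (mE 0) fun x hx => by simpa [hE, hℓ] using hx).trans
      (mul_le_mul_of_nonneg_left (integral_indicator_rpow_le hg hp (mE 0)) (by positivity))
  have htot : ∑ k ∈ Finset.range K, ‖B f ((D k).indicator g)‖ ≤
      a * c ^ (1 - p) * (F * H) + b * (θ * (κ * (c ^ (2 - p) * F)) + 4 / θ * H) := by
    refine (sum_le_sum fun k _ => hpiece k).trans ?_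
    rw [sum_add_distrib, ← mul_sum, ← mul_sum, sum_add_distrib,
      ← mul_sum, ← mul_sum, mul_assoc (a * c ^ (1 - p))]
    gcongr
  calc ‖B f g‖ ≤ ‖B f ((E 0).indicator g)‖ + ∑ k ∈ Finset.range K, ‖B f ((D k).indicator g)‖ := by
        rw [hBfg]
        exact (norm_add_le _ _).trans (add_le_add_right (norm_sum_le _ _) _)
    _ ≤ _ := by linarith

/-- The constant of the interpolation inequality. -/
def interpolationConst (p : ℝ) : ℝ := 5 + (1 - (2 : ℝ) ^ (-(2 - p)))⁻¹

lemma interpolationConst_pos (hp2 : p < 2) : 0 < interpolationConst p := by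
  have := Real.rpow_lt_one_of_one_lt_of_neg (one_lt_two : (1 : ℝ) < 2)
      (show -(2 - p) < 0 by linarith)
  have : 0 < (1 - (2 : ℝ) ^ (-(2 - p)))⁻¹ := inv_pos.2 (by linarith)
  unfold interpolationConst; linarith

lemma norm_form_le_interpolation (ha : 0 < a) (hb : 0 < b) (hp : 1 < p) (hp2 : p < 2)
    (hadd1 : ∀ f f' g, IsTame f → IsTame f' → IsTame g → B (f + f') g = B f g + B f' g)
    (hadd2 : ∀ f g g', IsTame f → IsTame g → IsTame g' → B f (g + g') = B f g + B f g')
    (h1 : ∀ f g, IsTame f → IsTame g → ‖B f g‖ ≤ a * ((∫ x, ‖f x‖) * ∫ x, ‖g x‖))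
    (h2 : ∀ f g, IsTame f → IsTame g →
      ‖B f g‖ ≤ b * (sqrt (∫ x, ‖f x‖ ^ 2) * sqrt (∫ x, ‖g x‖ ^ 2)))
    (hf : IsTame f) (hg : IsTame g) :
    ‖B f g‖ ≤ interpolationConst p * (a ^ (2 / p - 1) * b ^ (2 - 2 / p)) *
      ((∫ x, ‖f x‖ ^ p) ^ (1 / p) * (∫ x, ‖g x‖ ^ p) ^ (1 / p)) := by
  have hzero : ∀ h : R3 → ℂ, IsTame h → ∫ x, ‖h x‖ ^ p = 0 → ∫ x, ‖h x‖ = 0 := by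
    intro h hh h0
    rw [integral_eq_zero_iff_of_nonneg (fun x => by positivity) (hh.integrable_rpow hp.le)] at h0
    refine integral_eq_zero_of_ae ?_
    filter_upwards [h0] with x hx
    exact (Real.rpow_eq_zero (norm_nonneg _) (by linarith)).1 hx
  have hC := interpolationConst_pos hp2
  have hnn : 0 ≤ interpolationConst p * (a ^ (2 / p - 1) * b ^ (2 - 2 / p)) *
      ((∫ x, ‖f x‖ ^ p) ^ (1 / p) * (∫ x, ‖g x‖ ^ p) ^ (1 / p)) := by
    have i1 : 0 ≤ ∫ x, ‖f x‖ ^ p := integral_nonneg fun x => by positivity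
    have i2 : 0 ≤ ∫ x, ‖g x‖ ^ p := integral_nonneg fun x => by positivity
    positivity
  rcases (integral_nonneg (fun x => by positivity) : 0 ≤ ∫ x, ‖f x‖ ^ p).eq_or_lt with hF | hF
  · refine (h1 f g hf hg).trans ?_
    rw [hzero f hf hF.symm, zero_mul, mul_zero]
    exact hnn
  rcases (integral_nonneg (fun x => by positivity) : 0 ≤ ∫ x, ‖g x‖ ^ p).eq_or_lt with hH | hH
  · refine (h1 f g hf hg).trans ?_
    rw [hzero g hg hH.symm, mul_zero, mul_zero]
    exact hnn
  set F := ∫ x, ‖f x‖ ^ p with hFd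
  set H := ∫ x, ‖g x‖ ^ p with hHd
  set Q := a ^ (2 / p - 1) * b ^ (2 - 2 / p) * (F ^ (1 / p) * H ^ (1 / p)) with hQd
  have hQ : 0 < Q := by positivity
  set c := (a / b) ^ (2 / p) * (F * H) ^ (1 / p) with hcd
  have hc : 0 < c := by positivity
  have hp0 : 0 < p := by linarith
  have toexp : ∀ {x : ℝ}, 0 < x → ∃ y, x = Real.exp y := fun {x} hx => ⟨_, (Real.exp_log hx).symm⟩
  have key1 : a * c ^ (1 - p) * (F * H) = Q := by
    rw [hQd, hcd]
    obtain ⟨α, rfl⟩ := toexp ha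
    obtain ⟨β, rfl⟩ := toexp hb
    generalize F = F at hF ⊢
    generalize H = H at hH ⊢
    obtain ⟨φ, rfl⟩ := toexp hF
    obtain ⟨ψ, rfl⟩ := toexp hH
    simp only [← Real.exp_sub, ← Real.exp_add, ← Real.exp_mul]
    congr 1
    field_simp
    ring
  have key2 : b ^ 2 * c ^ (2 - p) * (F * H) = Q ^ 2 := by
    rw [hQd, hcd]
    obtain ⟨α, rfl⟩ := toexp ha
    obtain ⟨β, rfl⟩ := toexp hb
    generalize F = F at hF ⊢
    generalize H = H at hH ⊢
    obtain ⟨φ, rfl⟩ := toexp hF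
    obtain ⟨ψ, rfl⟩ := toexp hH
    simp only [← Real.exp_sub, ← Real.exp_add, ← Real.exp_mul, ← Real.exp_nat_mul]
    congr 1
    push_cast
    field_simp
    ring
  have hθ : 0 < b * H / Q := by positivity
  have hmain : ∀ δ : ℝ, 0 < δ → ‖B f g‖ ≤ interpolationConst p * Q +
      b * (sqrt (∫ x, ‖f x‖ ^ 2) * sqrt (δ ^ (2 - p) * H)) := by
    intro δ hδ
    refine (norm_form_le_of_levels ha hb hp hp2 hadd1 hadd2 h1 h2 hf hg hc hθ hδ).trans
      (le_of_eq ?_)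
    congr 1
    rw [← hFd, ← hHd, key1]
    have k3 : b * (b * H / Q * ((1 - (2 : ℝ) ^ (-(2 - p)))⁻¹ * (c ^ (2 - p) * F))) =
        (1 - (2 : ℝ) ^ (-(2 - p)))⁻¹ * Q := by
      rw [show b * (b * H / Q * ((1 - (2 : ℝ) ^ (-(2 - p)))⁻¹ * (c ^ (2 - p) * F))) =
        (1 - (2 : ℝ) ^ (-(2 - p)))⁻¹ * ((b ^ 2 * c ^ (2 - p) * (F * H)) / Q) by ring, key2]
      field_simp
    have k4 : b * (4 / (b * H / Q) * H) = 4 * Q := by field_simp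
    rw [mul_add, k3, k4, interpolationConst]
    ring
  have hlim : Tendsto (fun δ : ℝ => interpolationConst p * Q +
      b * (sqrt (∫ x, ‖f x‖ ^ 2) * sqrt (δ ^ (2 - p) * H))) (nhdsWithin 0 (Ioi 0))
      (nhds (interpolationConst p * Q)) := by
    have hcont : Continuous fun δ : ℝ => interpolationConst p * Q +
      b * (sqrt (∫ x, ‖f x‖ ^ 2) * sqrt (δ ^ (2 - p) * H)) := by
      have : Continuous fun δ : ℝ => δ ^ (2 - p) :=
        Real.continuous_rpow_const (by linarith)
      fun_prop
    have := hcont.tendsto 0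
    simp only [Real.zero_rpow (by linarith : 2 - p ≠ 0), zero_mul, Real.sqrt_zero, mul_zero,
      add_zero] at this
    exact this.mono_left nhdsWithin_le_nhds
  have := ge_of_tendsto hlim (Filter.eventually_of_mem self_mem_nhdsWithin hmain)
  rwa [hQd, ← mul_assoc] at this

end Interpolation

/-! ### Sesquilinear forms given by a Fourier multiplier -/

section Plancherel

lemma continuous_fourier {f : R3 → ℂ} (h1 : Integrable f) : Continuous (𝓕 f) :=
  VectorFourier.fourierIntegral_continuous Real.continuous_fourierChar (by exact continuous_inner) h1

lemma integral_fourier_smul {f g : R3 → ℂ} (hf : Integrable f) (hg : Integrable g) :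
    ∫ x, 𝓕 f x * g x = ∫ x, f x * 𝓕 g x := by
  have h := VectorFourier.integral_fourierIntegral_smul_eq_flip (μ := (volume : Measure R3))
    (ν := (volume : Measure R3)) (L := innerₗ R3) Real.continuous_fourierChar
    (by exact continuous_inner) hf hg
  rw [flip_innerₗ] at h
  exact h

/-- Plancherel's identity for integrable and square integrable functions. -/
lemma memLp_fourier_two {f : R3 → ℂ} (h1 : Integrable f) (h2 : MemLp f 2) :
    MemLp (𝓕 f) 2 ∧ eLpNorm (𝓕 f) 2 volume = eLpNorm f 2 volume := by
  set F : Lp ℂ 2 (volume : Measure R3) := 𝓕 (h2.toLp f)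
  have hcont : Continuous (𝓕 f) := continuous_fourier h1
  have hkey : ∀ θ : 𝒮, ∫ x, θ x • F x = ∫ x, θ x • (𝓕 f) x := by
    intro θ
    have e1 := congrArg (fun T : 𝓢'(R3, ℂ) => T θ)
      (Lp.fourier_toTemperedDistribution_eq (h2.toLp f))
    simp only [TemperedDistribution.fourier_apply, Lp.toTemperedDistribution_apply] at e1
    have e2 : ∫ x, (𝓕 θ) x • (h2.toLp f) x = ∫ x, (𝓕 θ) x • f x := by
      refine integral_congr_ae ?_
      filter_upwards [h2.coeFn_toLp] with x hx
      rw [hx]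
    have e3 : ∫ x, (𝓕 (θ : R3 → ℂ)) x • f x = ∫ x, θ x • (𝓕 f) x :=
      integral_fourier_smul θ.integrable h1
    rw [← e3, ← SchwartzMap.fourier_coe, ← e2]
    exact e1.symm
  have hae : F =ᵐ[volume] 𝓕 f := by
    refine ae_eq_of_integral_contDiff_smul_eq ((Lp.memLp F).locallyIntegrable (by norm_num))
      hcont.locallyIntegrable fun g hg hgc => ?_
    have hg' : ContDiff ℝ (⊤ : ℕ∞) fun x => ((g x : ℝ) : ℂ) := Complex.ofRealCLM.contDiff.comp hg
    have hgc' : HasCompactSupport fun x => ((g x : ℝ) : ℂ) :=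
      hgc.comp_left (g := fun x : ℝ => (x : ℂ)) (by simp)
    have := hkey (hgc'.toSchwartzMap hg')
    simpa using this
  have hn : ‖F‖ = ‖h2.toLp f‖ := Lp.norm_fourier_eq _
  rw [Lp.norm_def, Lp.norm_def, ENNReal.toReal_eq_toReal_iff' (Lp.eLpNorm_ne_top _)
    (Lp.eLpNorm_ne_top _)] at hn
  refine ⟨(memLp_congr_ae hae).1 (Lp.memLp F), ?_⟩
  rw [← eLpNorm_congr_ae hae, hn, eLpNorm_congr_ae h2.coeFn_toLp]

lemma integral_norm_sq_eq_of_eLpNorm {f g : R3 → ℂ} (hf : MemLp f 2) (hg : MemLp g 2)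
    (h : eLpNorm f 2 volume = eLpNorm g 2 volume) : ∫ x, ‖f x‖ ^ 2 = ∫ x, ‖g x‖ ^ 2 := by
  rw [hf.eLpNorm_eq_integral_rpow_norm (by norm_num) (by norm_num),
    hg.eLpNorm_eq_integral_rpow_norm (by norm_num) (by norm_num),
    ENNReal.ofReal_eq_ofReal_iff (by positivity) (by positivity)] at h
  have h3 : ∀ k : R3 → ℂ, 0 ≤ ∫ x, ‖k x‖ ^ 2 := fun k => integral_nonneg fun x => by positivity
  simp only [ENNReal.toReal_ofNat, Real.rpow_ofNat] at h
  have := (Real.rpow_left_inj (h3 f) (h3 g) (by norm_num : ((2 : ℝ)⁻¹) ≠ 0)).1 h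
  exact this

/-- Plancherel's identity for the inverse transform. -/
lemma integral_norm_sq_fourierInv {f : R3 → ℂ} (h1 : Integrable f) (h2 : MemLp f 2) :
    MemLp (𝓕⁻ f) 2 ∧ ∫ ξ, ‖𝓕⁻ f ξ‖ ^ 2 = ∫ x, ‖f x‖ ^ 2 := by
  obtain ⟨h3, h4⟩ := memLp_fourier_two h1 h2
  have hmp : MeasurePreserving (fun x : R3 => -x) volume volume := Measure.measurePreserving_neg _
  have e : 𝓕⁻ f = 𝓕 f ∘ fun x => -x := by
    ext ξ; exact Real.fourierInv_eq_fourier_neg f ξ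
  have h5 : MemLp (𝓕⁻ f) 2 := by rw [e]; exact h3.comp_measurePreserving hmp
  refine ⟨h5, integral_norm_sq_eq_of_eLpNorm h5 h2 ?_⟩
  rw [e, eLpNorm_comp_measurePreserving h3.1 hmp, h4]

lemma continuous_fourierInv {f : R3 → ℂ} (h1 : Integrable f) : Continuous (𝓕⁻ f) := by
  have e : 𝓕⁻ f = 𝓕 f ∘ fun x => -x := by
    ext ξ; exact Real.fourierInv_eq_fourier_neg f ξ
  rw [e]
  exact (continuous_fourier h1).comp continuous_neg

lemma norm_fourierInv_le {f : R3 → ℂ} (ξ : R3) : ‖𝓕⁻ f ξ‖ ≤ ∫ x, ‖f x‖ := by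
  rw [Real.fourierInv_eq]
  refine (norm_integral_le_integral_norm _).trans (le_of_eq ?_)
  simp

/-- The sesquilinear form with Fourier symbol `m`. -/
def multForm (m : R3 → ℂ) (f g : R3 → ℂ) : ℂ := ∫ ξ, m ξ * (𝓕⁻ f ξ * star (𝓕⁻ g ξ))

variable {m f g h : R3 → ℂ}

lemma integrable_multForm (hm : Integrable m) (hf : Integrable f) (hg : Integrable g) :
    Integrable fun ξ => m ξ * (𝓕⁻ f ξ * star (𝓕⁻ g ξ)) := by
  have c1 := continuous_fourierInv hf
  have c2 := continuous_fourierInv hg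
  refine hm.mul_bdd (c := (∫ x, ‖f x‖) * ∫ x, ‖g x‖)
    (Continuous.aestronglyMeasurable (c1.mul c2.star))
    (.of_forall fun ξ => ?_)
  rw [norm_mul, norm_star]
  exact mul_le_mul (norm_fourierInv_le ξ) (norm_fourierInv_le ξ) (norm_nonneg _)
    (integral_nonneg fun x => norm_nonneg _)

lemma fourierInv_add_apply (hf : Integrable f) (hg : Integrable g) (ξ : R3) :
    𝓕⁻ (f + g) ξ = 𝓕⁻ f ξ + 𝓕⁻ g ξ := by
  simp only [Real.fourierInv_eq_fourier_neg]
  have := congrFun (VectorFourier.fourierIntegral_add (μ := (volume : Measure R3))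
    (L := innerₗ R3) Real.continuous_fourierChar (by exact continuous_inner) hf hg) (-ξ)
  exact this

lemma multForm_add_left (hm : Integrable m) (hf : Integrable f) (hg : Integrable g)
    (hh : Integrable h) : multForm m (f + g) h = multForm m f h + multForm m g h := by
  unfold multForm
  rw [← integral_add (integrable_multForm hm hf hh) (integrable_multForm hm hg hh)]
  refine integral_congr_ae (.of_forall fun ξ => ?_)
  simp only [fourierInv_add_apply hf hg]
  ring

lemma multForm_add_right (hm : Integrable m) (hf : Integrable f) (hg : Integrable g)
    (hh : Integrable h) : multForm m f (g + h) = multForm m f g + multForm m f h := by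
  unfold multForm
  rw [← integral_add (integrable_multForm hm hf hg) (integrable_multForm hm hf hh)]
  refine integral_congr_ae (.of_forall fun ξ => ?_)
  simp only [fourierInv_add_apply hg hh, star_add]
  ring

lemma norm_multForm_le_sq {W : ℝ} (hW : ∀ ξ, ‖m ξ‖ ≤ W) (hf : IsTame f) (hg : IsTame g) :
    ‖multForm m f g‖ ≤ W * (sqrt (∫ x, ‖f x‖ ^ 2) * sqrt (∫ x, ‖g x‖ ^ 2)) := by
  have tame2 : ∀ {f : R3 → ℂ}, IsTame f → MemLp f 2 := fun {f} hf =>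
    (memLp_two_iff_integrable_sq_norm hf.measurable.aestronglyMeasurable).2 hf.integrable_sq
  obtain ⟨f1, f2⟩ := integral_norm_sq_fourierInv hf.integrable (tame2 hf)
  obtain ⟨g1, g2⟩ := integral_norm_sq_fourierInv hg.integrable (tame2 hg)
  have hW0 : 0 ≤ W := (norm_nonneg _).trans (hW 0)
  have i1 : Integrable fun ξ => ‖𝓕⁻ f ξ‖ * ‖𝓕⁻ g ξ‖ := f1.norm.integrable_mul g1.norm
  have hol := integral_mul_norm_le_Lp_mul_Lq (μ := (volume : Measure R3)) (f := 𝓕⁻ f) (g := 𝓕⁻ g)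
    (p := 2) (q := 2) Real.HolderConjugate.two_two (by simpa using f1) (by simpa using g1)
  simp only [Real.rpow_ofNat, f2, g2, ← Real.sqrt_eq_rpow] at hol
  calc ‖multForm m f g‖ ≤ ∫ ξ, W * (‖𝓕⁻ f ξ‖ * ‖𝓕⁻ g ξ‖) := by
        refine norm_integral_le_of_norm_le (i1.const_mul W) (.of_forall fun ξ => ?_)
        rw [norm_mul, norm_mul, norm_star]
        exact mul_le_mul_of_nonneg_right (hW ξ) (by positivity)
    _ = W * ∫ ξ, ‖𝓕⁻ f ξ‖ * ‖𝓕⁻ g ξ‖ := integral_const_mul _ _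
    _ ≤ _ := mul_le_mul_of_nonneg_left hol hW0

lemma norm_multForm_le_one {A : ℝ} (hm : Integrable m)
    (hA : ∀ x : R3, ‖∫ ξ, m ξ * cexp ((2 * π * inner ℝ x ξ : ℝ) * I)‖ ≤ A)
    (hf : Integrable f) (hg : Integrable g) :
    ‖multForm m f g‖ ≤ A * ((∫ x, ‖f x‖) * ∫ x, ‖g x‖) := by
  have hfg : Integrable (fun z : R3 × R3 => f z.1 * star (g z.2)) (volume.prod volume) :=
    hf.mul_prod (ContinuousLinearMap.integrable_comp (Complex.conjCLE : ℂ →L[ℝ] ℂ) hg)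
  have hI : Integrable (fun w : R3 × (R3 × R3) => (m w.1 * (f w.2.1 * star (g w.2.2))) *
      cexp ((2 * π * inner ℝ (w.2.1 - w.2.2) w.1 : ℝ) * I))
      (volume.prod (volume.prod volume)) := by
    refine (hm.mul_prod hfg).mul_bdd (c := 1) (Continuous.aestronglyMeasurable (by fun_prop))
      (.of_forall fun w => (norm_exp_ofReal_mul_I _).le)
  have e1 : ∀ ξ : R3, m ξ * (𝓕⁻ f ξ * star (𝓕⁻ g ξ)) = ∫ z : R3 × R3,
      (m ξ * (f z.1 * star (g z.2))) *
        cexp ((2 * π * inner ℝ (z.1 - z.2) ξ : ℝ) * I)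
          ∂(volume.prod volume) := by
    intro ξ
    have s1 : star (𝓕⁻ g ξ) = ∫ y, star (cexp ((2 * π * inner ℝ y ξ : ℝ) *
        I) * g y) := by
      rw [Real.fourierInv_eq']
      simp only [smul_eq_mul]
      exact (integral_conj (𝕜 := ℂ)).symm
    rw [s1, Real.fourierInv_eq', ← integral_prod_mul, ← integral_const_mul]
    refine integral_congr_ae (.of_forall fun z => ?_)
    have : cexp ((2 * π * inner ℝ (z.1 - z.2) ξ : ℝ) * I) =
        cexp ((2 * π * inner ℝ z.1 ξ : ℝ) * I) *
          star (cexp ((2 * π * inner ℝ z.2 ξ : ℝ) * I)) := by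
      rw [Complex.star_def, ← Complex.exp_conj, ← exp_add, inner_sub_left]
      congr 1
      simp only [map_mul, Complex.conj_ofReal, Complex.conj_I]
      push_cast; ring
    simp only [this, star_mul, smul_eq_mul]
    ring
  unfold multForm
  simp only [e1]
  rw [integral_integral_swap hI]
  have hn : Integrable (fun z : R3 × R3 => ‖f z.1‖ * ‖g z.2‖) (volume.prod volume) :=
    hf.norm.mul_prod hg.norm
  calc _ ≤ ∫ z : R3 × R3, A * (‖f z.1‖ * ‖g z.2‖) ∂(volume.prod volume) := by
        refine norm_integral_le_of_norm_le (hn.const_mul A) (.of_forall fun z => ?_)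
        have : ∀ ξ : R3, (m ξ * (f z.1 * star (g z.2))) *
            cexp ((2 * π * inner ℝ (z.1 - z.2) ξ : ℝ) * I) =
            (f z.1 * star (g z.2)) * (m ξ *
              cexp ((2 * π * inner ℝ (z.1 - z.2) ξ : ℝ) * I)) :=
          fun ξ => by ring
        simp only [this]
        rw [integral_const_mul, norm_mul, norm_mul, norm_star, mul_comm A]
        exact mul_le_mul_of_nonneg_left (hA _) (by positivity)
    _ = _ := by rw [integral_const_mul, integral_prod_mul (fun x => ‖f x‖) (fun x => ‖g x‖)]

/-- The interpolated bound for the form of a dispersive multiplier. -/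
lemma norm_multForm_le {a b p : ℝ} (ha : 0 < a) (hb : 0 < b) (hp : 1 < p) (hp2 : p < 2)
    (hm : Integrable m) (hW : ∀ ξ, ‖m ξ‖ ≤ b)
    (hA : ∀ x : R3, ‖∫ ξ, m ξ * cexp ((2 * π * inner ℝ x ξ : ℝ) * I)‖ ≤ a)
    (hf : IsTame f) (hg : IsTame g) :
    ‖multForm m f g‖ ≤ interpolationConst p * (a ^ (2 / p - 1) * b ^ (2 - 2 / p)) *
      ((∫ x, ‖f x‖ ^ p) ^ (1 / p) * (∫ x, ‖g x‖ ^ p) ^ (1 / p)) :=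
  norm_form_le_interpolation ha hb hp hp2
    (fun _ _ _ h1 h2 h3 => multForm_add_left hm h1.integrable h2.integrable h3.integrable)
    (fun _ _ _ h1 h2 h3 => multForm_add_right hm h1.integrable h2.integrable h3.integrable)
    (fun _ _ h1 h2 => norm_multForm_le_one hm hA h1.integrable h2.integrable)
    (fun _ _ h1 h2 => norm_multForm_le_sq hW h1 h2) hf hg

end Plancherel

/-! ### The Hardy-Littlewood-Sobolev inequality on the line -/

lemma lintegral_comp_abs (h : ℝ → ℝ≥0∞) : ∫⁻ u, h |u| = 2 * ∫⁻ u in Ioi 0, h u := by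
  have e1 : ∫⁻ u in Ioi (0 : ℝ), h |u| = ∫⁻ u in Ioi 0, h u :=
    setLIntegral_congr_fun measurableSet_Ioi fun u hu => by rw [abs_of_pos hu]
  have e2 : ∫⁻ u in (Ioi (0 : ℝ))ᶜ, h |u| = ∫⁻ u in Ioi 0, h |u| := by
    rw [compl_Ioi]
    have := (Measure.measurePreserving_neg (volume : Measure ℝ)).setLIntegral_comp_preimage_emb
      (MeasurableEquiv.neg ℝ).measurableEmbedding (fun u => h |u|) (Ici 0)
    simp only [abs_neg, neg_preimage, Set.neg_Ici, neg_zero] at this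
    rw [this]
    exact setLIntegral_congr Ioi_ae_eq_Ici.symm
  rw [← lintegral_add_compl _ measurableSet_Ioi, e2, e1, two_mul]

lemma lintegral_abs_rpow_near {γ R : ℝ} (hγ1 : γ < 1) (hR : 0 < R) :
    ∫⁻ u : ℝ, ofReal ((Iic R).indicator (fun v => v ^ (-γ)) |u|) =
      ofReal (2 * (R ^ (1 - γ) / (1 - γ))) := by
  rw [lintegral_comp_abs fun v => ofReal ((Iic R).indicator (fun v => v ^ (-γ)) v)]
  have hind : ∀ u : ℝ, ofReal ((Iic R).indicator (fun v => v ^ (-γ)) u) =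
      (Iic R).indicator (fun v => ofReal (v ^ (-γ))) u := fun u => by
    by_cases hu : u ∈ Iic R <;> simp [hu]
  simp only [hind]
  rw [setLIntegral_indicator measurableSet_Iic, inter_comm, Ioi_inter_Iic]
  have hint : IntervalIntegrable (fun v : ℝ => v ^ (-γ)) volume 0 R :=
    intervalIntegral.intervalIntegrable_rpow' (by linarith)
  rw [intervalIntegrable_iff_integrableOn_Ioc_of_le hR.le] at hint
  rw [← ofReal_integral_eq_lintegral_ofReal hint ((ae_restrict_iff' measurableSet_Ioc).2
    (.of_forall fun u hu => rpow_nonneg hu.1.le _)),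
    ← integral_of_le hR.le, integral_rpow (Or.inl (by linarith)),
    Real.zero_rpow (by linarith), ofReal_mul (by norm_num)]
  rw [show -γ + 1 = 1 - γ by ring]
  simp

lemma lintegral_abs_sq_far {R : ℝ} (hR : 0 < R) :
    ∫⁻ u : ℝ, ofReal ((Ioi R).indicator (fun v => v ^ (-2 : ℝ)) |u|) =
      ofReal (2 / R) := by
  rw [lintegral_comp_abs fun v => ofReal ((Ioi R).indicator (fun v => v ^ (-2 : ℝ)) v)]
  have hind : ∀ u : ℝ, ofReal ((Ioi R).indicator (fun v => v ^ (-2 : ℝ)) u) =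
      (Ioi R).indicator (fun v => ofReal (v ^ (-2 : ℝ))) u := fun u => by
    by_cases hu : u ∈ Ioi R <;> simp [hu]
  simp only [hind]
  rw [setLIntegral_indicator measurableSet_Ioi, inter_eq_self_of_subset_left
    (Ioi_subset_Ioi hR.le)]
  rw [← ofReal_integral_eq_lintegral_ofReal (integrableOn_Ioi_rpow_of_lt (by norm_num) hR)
    ((ae_restrict_iff' measurableSet_Ioi).2
    (.of_forall fun u hu => rpow_nonneg (hR.trans hu).le _)),
    integral_Ioi_rpow_of_lt (by norm_num) hR, ← ofReal_ofNat 2,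
    ← ofReal_mul (by norm_num)]
  congr 1
  norm_num
  rw [Real.rpow_neg_one]; rfl

section HLS
variable {γ N : ℝ} {b : ℝ → ℝ}

lemma hls_inner (hγ : 0 < γ) (hγ1 : γ < 1) (hb : Measurable b)
    (hN : 0 < N) (hbN : ∫⁻ s, ofReal (b s) ^ (2 / (2 - γ)) ≤ ofReal N)
    {a : ℝ} (ha : 0 < a) (s : ℝ) :
    ∫⁻ s', ofReal (|s - s'| ^ (-γ)) * {s' | b s' ≤ a}.indicator
      (fun s' => ofReal (b s')) s' ≤
      ofReal ((2 / (1 - γ) + 2) * (N ^ (1 - γ) * a ^ (2 / (2 - γ) - 1))) := by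
  set p := 2 / (2 - γ) with hp
  have h2γ : 0 < 2 - γ := by linarith
  have hp0 : 0 < p := by positivity
  set R := N * a ^ (-p) with hR
  have hR0 : 0 < R := by positivity
  have hsplit : ∀ s', ofReal (|s - s'| ^ (-γ)) * {s' | b s' ≤ a}.indicator
      (fun s' => ofReal (b s')) s' ≤
      ofReal ((Iic R).indicator (fun v => v ^ (-γ)) |s - s'|) * ofReal a +
      ofReal ((Ioi R).indicator (fun v => v ^ (-γ)) |s - s'|) * ofReal (b s') := by
    intro s'
    by_cases h1 : b s' ≤ a
    · rw [indicator_of_mem (show s' ∈ {s' | b s' ≤ a} from h1)]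
      by_cases h2 : |s - s'| ≤ R
      · rw [indicator_of_mem (show |s - s'| ∈ Iic R from h2)]
        exact (mul_le_mul_right (ofReal_le_ofReal h1) _).trans le_self_add
      · rw [indicator_of_mem (show |s - s'| ∈ Ioi R from not_le.1 h2)]
        exact le_add_self
    · rw [indicator_of_notMem (show s' ∉ {s' | b s' ≤ a} from h1), mul_zero]
      exact zero_le
  have mk : ∀ A : Set ℝ, MeasurableSet A →
      Measurable fun s' => ofReal (A.indicator (fun v : ℝ => v ^ (-γ)) |s - s'|) := by
    intro A hA
    have : Measurable (A.indicator fun v : ℝ => v ^ (-γ)) :=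
      (measurable_id.pow_const _).indicator hA
    exact (this.comp (by fun_prop : Measurable fun s' => |s - s'|)).ennreal_ofReal
  have etrans : ∀ h : ℝ → ℝ≥0∞, ∫⁻ s', h |s - s'| = ∫⁻ u, h |u| := fun h =>
    lintegral_sub_left_eq_self (fun u => h |u|) s
  have near : ∫⁻ s', ofReal ((Iic R).indicator (fun v => v ^ (-γ)) |s - s'|) *
      ofReal a = ofReal (2 * (R ^ (1 - γ) / (1 - γ)) * a) := by
    rw [lintegral_mul_const _ (mk _ measurableSet_Iic),
      etrans fun v => ofReal ((Iic R).indicator (fun v => v ^ (-γ)) v),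
      lintegral_abs_rpow_near hγ1 hR0, ← ofReal_mul]
    have : 0 < 1 - γ := by linarith
    positivity
  have hconj : (2 / γ).HolderConjugate p := by
    rw [Real.holderConjugate_iff]
    constructor
    · rw [lt_div_iff₀ hγ]; linarith
    · rw [hp]; field_simp; ring
  have far : ∫⁻ s', ofReal ((Ioi R).indicator (fun v => v ^ (-γ)) |s - s'|) *
      ofReal (b s') ≤ ofReal ((2 / R) ^ (γ / 2) * N ^ (1 / p)) := by
    refine (ENNReal.lintegral_mul_le_Lp_mul_Lq volume hconj (mk _ measurableSet_Ioi).aemeasurable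
      hb.ennreal_ofReal.aemeasurable).trans ?_
    have e1 : ∀ s', ofReal ((Ioi R).indicator (fun v => v ^ (-γ)) |s - s'|) ^ (2 / γ) =
        ofReal ((Ioi R).indicator (fun v => v ^ (-2 : ℝ)) |s - s'|) := by
      intro s'
      by_cases h2 : |s - s'| ∈ Ioi R
      · rw [indicator_of_mem h2, indicator_of_mem h2, ofReal_rpow_of_nonneg
          (rpow_nonneg (abs_nonneg _) _) (by positivity), ← rpow_mul (abs_nonneg _)]
        congr 2
        field_simp
      · rw [indicator_of_notMem h2, indicator_of_notMem h2, ENNReal.ofReal_zero,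
          ENNReal.zero_rpow_of_pos (by positivity)]
    simp only [e1]
    rw [etrans fun v => ofReal ((Ioi R).indicator (fun v => v ^ (-2 : ℝ)) v),
      lintegral_abs_sq_far hR0, ofReal_mul (by positivity),
      ofReal_rpow_of_nonneg (by positivity) (by positivity), one_div_div]
    refine mul_le_mul_right ?_ _
    rw [← ofReal_rpow_of_nonneg hN.le (by positivity)]
    exact ENNReal.rpow_le_rpow hbN (by positivity)
  calc _ ≤ ∫⁻ s', (ofReal ((Iic R).indicator (fun v => v ^ (-γ)) |s - s'|) *
        ofReal a + ofReal ((Ioi R).indicator (fun v => v ^ (-γ)) |s - s'|) *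
          ofReal (b s')) := lintegral_mono hsplit
    _ ≤ ofReal (2 * (R ^ (1 - γ) / (1 - γ)) * a) +
        ofReal ((2 / R) ^ (γ / 2) * N ^ (1 / p)) := by
        rw [lintegral_add_left ((mk _ measurableSet_Iic).mul_const _), near]
        exact add_le_add_right far _
    _ ≤ _ := by
        have h1γ : 0 < 1 - γ := by linarith
        rw [← ENNReal.ofReal_add (by positivity) (by positivity)]
        refine ofReal_le_ofReal ?_
        have k1 : R ^ (1 - γ) * a = N ^ (1 - γ) * a ^ (p - 1) := by
          rw [hR, ← Real.exp_log hN, ← Real.exp_log ha]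
          simp only [← Real.exp_add, ← Real.exp_mul]
          congr 1
          rw [hp]; field_simp; ring
        have k2 : (2 / R) ^ (γ / 2) * N ^ (1 / p) = 2 ^ (γ / 2) * (N ^ (1 - γ) * a ^ (p - 1)) := by
          rw [Real.div_rpow (by norm_num) hR0.le, div_mul_eq_mul_div, mul_div_assoc]
          congr 1
          rw [hR, ← Real.exp_log hN, ← Real.exp_log ha]
          simp only [← Real.exp_add, ← Real.exp_mul, ← Real.exp_sub]
          congr 1
          rw [hp]; field_simp; ring
        rw [k2]
        have k3 : (2 : ℝ) ^ (γ / 2) ≤ 2 := by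
          conv_rhs => rw [← rpow_one 2]
          exact Real.rpow_le_rpow_of_exponent_le (by norm_num) (by linarith)
        have k4 : 0 ≤ N ^ (1 - γ) * a ^ (p - 1) := by positivity
        calc 2 * (R ^ (1 - γ) / (1 - γ)) * a + 2 ^ (γ / 2) * (N ^ (1 - γ) * a ^ (p - 1))
            = 2 / (1 - γ) * (R ^ (1 - γ) * a) + 2 ^ (γ / 2) * (N ^ (1 - γ) * a ^ (p - 1)) := by ring
          _ ≤ 2 / (1 - γ) * (N ^ (1 - γ) * a ^ (p - 1)) + 2 * (N ^ (1 - γ) * a ^ (p - 1)) := by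
              rw [k1]
              gcongr
          _ = _ := by ring

/-- The Hardy-Littlewood-Sobolev inequality on the diagonal. -/
lemma hls (hγ : 0 < γ) (hγ1 : γ < 1) (hb : Measurable b) (hb0 : ∀ s, 0 ≤ b s)
    (hN : 0 < N) (hbN : ∫⁻ s, ofReal (b s) ^ (2 / (2 - γ)) ≤ ofReal N) :
    ∫⁻ s, ∫⁻ s', ofReal (|s - s'| ^ (-γ)) * (ofReal (b s) * ofReal (b s')) ≤
      ofReal (2 * (2 / (1 - γ) + 2) * N ^ (2 - γ)) := by
  set p := 2 / (2 - γ) with hp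
  have h2γ : 0 < 2 - γ := by linarith
  have h1γ : 0 < 1 - γ := by linarith
  have hp1 : 1 < p := by rw [hp, lt_div_iff₀ h2γ]; linarith
  set k : ℝ → ℝ → ℝ≥0∞ := fun s s' => ofReal (|s - s'| ^ (-γ)) with hk
  have mk : Measurable fun z : ℝ × ℝ => k z.1 z.2 := by
    refine Measurable.ennreal_ofReal ?_
    exact (by fun_prop : Measurable fun z : ℝ × ℝ => |z.1 - z.2|).pow_const _
  have mb := hb.ennreal_ofReal
  set Φ : ℝ → ℝ → ℝ≥0∞ := fun s s' => ofReal (b s) *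
    (k s s' * {s' | b s' ≤ b s}.indicator (fun s' => ofReal (b s')) s') with hΦ
  have mset : MeasurableSet {z : ℝ × ℝ | b z.2 ≤ b z.1} :=
    measurableSet_le (hb.comp measurable_snd) (hb.comp measurable_fst)
  have mΦ : Measurable fun z : ℝ × ℝ => Φ z.1 z.2 := by
    have : Measurable ({z : ℝ × ℝ | b z.2 ≤ b z.1}.indicator
      fun z : ℝ × ℝ => ofReal (b z.2)) := (mb.comp measurable_snd).indicator mset
    exact (mb.comp measurable_fst).mul (mk.mul this)
  have hpt : ∀ s s', k s s' * (ofReal (b s) * ofReal (b s')) ≤ Φ s s' + Φ s' s := by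
    intro s s'
    rcases le_total (b s') (b s) with h | h
    · refine le_trans (le_of_eq ?_) le_self_add
      simp only [hΦ]
      rw [indicator_of_mem (show s' ∈ {s' | b s' ≤ b s} from h)]
      ring
    · refine le_trans (le_of_eq ?_) le_add_self
      simp only [hΦ]
      rw [indicator_of_mem (show s ∈ {s | b s ≤ b s'} from h)]
      simp only [hk]
      rw [abs_sub_comm]
      ring
  have hswap : ∫⁻ s, ∫⁻ s', Φ s' s = ∫⁻ s, ∫⁻ s', Φ s s' :=
    lintegral_lintegral_swap (mΦ.comp measurable_swap).aemeasurable
  have hin : ∀ s, ∫⁻ s', Φ s s' ≤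
      ofReal ((2 / (1 - γ) + 2) * N ^ (1 - γ)) * ofReal (b s) ^ p := by
    intro s
    rcases (hb0 s).eq_or_lt with h | h
    · simp only [hΦ, ← h]
      simp
    · have m1 : Measurable fun s' => k s s' * {s' | b s' ≤ b s}.indicator
          (fun s' => ofReal (b s')) s' :=
        (mk.comp measurable_prodMk_left).mul (mb.indicator (measurableSet_le hb measurable_const))
      simp only [hΦ]
      rw [lintegral_const_mul _ m1]
      refine (mul_le_mul_right (hls_inner hγ hγ1 hb hN hbN h s) _).trans (le_of_eq ?_)
      rw [← hp, ofReal_rpow_of_nonneg h.le (by linarith), ← ofReal_mul h.le,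
        ← ofReal_mul (by positivity)]
      congr 1
      have : b s ^ p = b s ^ (p - 1) * b s := by
        rw [← Real.rpow_add_one h.ne']; ring_nf
      rw [this]; ring
  calc _ ≤ ∫⁻ s, ∫⁻ s', (Φ s s' + Φ s' s) :=
        lintegral_mono fun s => lintegral_mono fun s' => hpt s s'
    _ = ∫⁻ s, ((∫⁻ s', Φ s s') + ∫⁻ s', Φ s' s) :=
        lintegral_congr fun s => lintegral_add_left (mΦ.comp measurable_prodMk_left) _
    _ = 2 * ∫⁻ s, ∫⁻ s', Φ s s' := by
        rw [lintegral_add_left mΦ.lintegral_prod_right', hswap, two_mul]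
    _ ≤ 2 * ∫⁻ s, ofReal ((2 / (1 - γ) + 2) * N ^ (1 - γ)) * ofReal (b s) ^ p :=
        mul_le_mul_right (lintegral_mono hin) _
    _ ≤ 2 * (ofReal ((2 / (1 - γ) + 2) * N ^ (1 - γ)) * ofReal N) := by
        rw [lintegral_const_mul _ (mb.pow_const _)]
        exact mul_le_mul_right (mul_le_mul_right hbN _) _
    _ = _ := by
        rw [← ofReal_mul (by positivity), ← ofReal_ofNat 2,
          ← ofReal_mul (by norm_num)]
        congr 1
        have : N ^ (2 - γ) = N ^ (1 - γ) * N := by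
          rw [← Real.rpow_add_one hN.ne']; ring_nf
        rw [this]; ring

end HLS

/-! ### Dual Strichartz estimates -/

lemma isTame_schwartz (f : 𝒮) : IsTame f where
  measurable := f.continuous.measurable
  integrable := f.integrable
  bounded := ⟨_, fun x => f.norm_le_seminorm ℝ x⟩

lemma fourierInv_fourier_coe (f : 𝒮) : 𝓕⁻ (⇑(𝓕 f : 𝒮) : R3 → ℂ) = f := by
  rw [← SchwartzMap.fourierInv_coe, FourierTransform.fourierInv_fourier_eq]

/-- The constant of the dual Strichartz estimate. -/
def dualConst (γ : ℝ) : ℝ :=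
  interpolationConst (2 / (1 + γ)) * 2 ^ (1 - γ) * (2 * (2 / (1 - γ) + 2))

section DualStrichartz
variable {γ A N t₀ t₁ : ℝ} {lam w : R3 → ℝ} {G : ℝ → 𝒮}

lemma norm_multForm_phase_le (hγ : 0 < γ) (hγ1 : γ < 1) (hA : 0 < A)
    (hlam : Continuous lam) (hw0 : ∀ ξ, 0 ≤ w ξ) (hw2 : ∀ ξ, w ξ ≤ 2)
    (hwi : Integrable w)
    (hker : ∀ τ : ℝ, τ ≠ 0 → ∀ x : R3, ‖∫ ξ, (cexp ((τ * lam ξ : ℝ) * I) * (w ξ : ℂ)) *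
      cexp ((2 * π * inner ℝ x ξ : ℝ) * I)‖ ≤ A / |τ|)
    (f g : 𝒮) {τ : ℝ} (hτ : τ ≠ 0) :
    ‖multForm (fun ξ => cexp ((τ * lam ξ : ℝ) * I) * (w ξ : ℂ)) f g‖ ≤
      interpolationConst (2 / (1 + γ)) * 2 ^ (1 - γ) * A ^ γ * (|τ| ^ (-γ) *
        ((∫ x, ‖f x‖ ^ (2 / (1 + γ))) ^ ((1 + γ) / 2) *
          (∫ x, ‖g x‖ ^ (2 / (1 + γ))) ^ ((1 + γ) / 2))) := by
  have h1 : 1 < 2 / (1 + γ) := by rw [lt_div_iff₀ (by linarith)]; linarith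
  have h2 : 2 / (1 + γ) < 2 := by rw [div_lt_iff₀ (by linarith)]; linarith
  have hτ' : 0 < |τ| := abs_pos.2 hτ
  have hm : Integrable fun ξ => cexp ((τ * lam ξ : ℝ) * I) * (w ξ : ℂ) :=
    hwi.ofReal.bdd_mul (c := 1) (Continuous.aestronglyMeasurable (by fun_prop))
      (.of_forall fun ξ => (norm_exp_ofReal_mul_I _).le)
  have := norm_multForm_le (div_pos hA hτ') two_pos h1 h2 hm (fun ξ => by
    rw [norm_mul, norm_exp_ofReal_mul_I, one_mul, norm_real,
      norm_of_nonneg (hw0 ξ)]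
    exact hw2 ξ) (hker τ hτ) (isTame_schwartz f) (isTame_schwartz g)
  refine this.trans (le_of_eq ?_)
  have e1 : 2 / (2 / (1 + γ)) - 1 = γ := by field_simp; ring
  have e2 : 2 - 2 / (2 / (1 + γ)) = 1 - γ := by field_simp; ring
  have e3 : 1 / (2 / (1 + γ)) = (1 + γ) / 2 := by field_simp
  rw [e1, e2, e3, Real.div_rpow hA.le hτ'.le, Real.rpow_neg hτ'.le]
  ring

lemma dual_strichartz (hγ : 0 < γ) (hγ1 : γ < 1) (hA : 0 < A)
    (hlam : Continuous lam) (hw0 : ∀ ξ, 0 ≤ w ξ) (hw2 : ∀ ξ, w ξ ≤ 2)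
    (hwi : Integrable w)
    (hker : ∀ τ : ℝ, τ ≠ 0 → ∀ x : R3, ‖∫ ξ, (cexp ((τ * lam ξ : ℝ) * I) * (w ξ : ℂ)) *
      cexp ((2 * π * inner ℝ x ξ : ℝ) * I)‖ ≤ A / |τ|)
    (ht : t₀ ≤ t₁) (hG : Continuous fun z : ℝ × R3 => G z.1 z.2)
    (hGb : ∃ M : ℝ, ∀ s ∈ Icc t₀ t₁, ∀ ξ, ‖G s ξ‖ ≤ M)
    (hF : Continuous fun z : ℝ × R3 => (𝓕 (G z.1)) z.2) (hN : 0 < N)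
    (hGN : ∫⁻ s in Ioc t₀ t₁, ofReal ((∫ x, ‖(𝓕 (G s)) x‖ ^ (2 / (1 + γ))) ^ ((1 + γ) / 2)) ^
      (2 / (2 - γ)) ≤ ofReal N) :
    ∫ ξ, w ξ * ‖∫ s in t₀..t₁, cexp ((s * lam ξ : ℝ) * I) * G s ξ‖ ^ 2 ≤
      dualConst γ * A ^ γ * N ^ (2 - γ) := by
  set J : Set ℝ := Ioc t₀ t₁ with hI
  set μ : Measure ℝ := volume.restrict J with hμ
  obtain ⟨M, hM⟩ := hGb
  have hM0 : 0 ≤ M := (norm_nonneg _).trans (hM t₀ (left_mem_Icc.2 ht) 0)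
  have hC : 0 < interpolationConst (2 / (1 + γ)) :=
    interpolationConst_pos (by rw [div_lt_iff₀ (by linarith)]; linarith)
  set F : R3 → ℝ × ℝ → ℂ := fun ξ z => (w ξ : ℂ) *
    (cexp (((z.1 - z.2) * lam ξ : ℝ) * I) * (G z.1 ξ * star (G z.2 ξ))) with hFdef
  have hprod : (volume : Measure R3).prod (μ.prod μ) =
      ((volume : Measure R3).prod ((volume : Measure ℝ).prod (volume : Measure ℝ))).restrict
        (univ ×ˢ (J ×ˢ J)) := by
    rw [← Measure.prod_restrict, ← Measure.prod_restrict, Measure.restrict_univ]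
  have hFi : Integrable (fun q : R3 × (ℝ × ℝ) => F q.1 q.2)
      ((volume : Measure R3).prod (μ.prod μ)) := by
    have h1 : Integrable (fun q : R3 × (ℝ × ℝ) => (w q.1 : ℂ) * (1 : ℂ))
        ((volume : Measure R3).prod (μ.prod μ)) :=
      Integrable.mul_prod (f := fun ξ => (w ξ : ℂ)) (g := fun _ : ℝ × ℝ => (1 : ℂ)) hwi.ofReal
        (integrable_const _)
    simp only [mul_one] at h1
    have c1 : Continuous fun q : R3 × (ℝ × ℝ) => G q.2.1 q.1 :=
      hG.comp (by fun_prop : Continuous fun q : R3 × (ℝ × ℝ) => (q.2.1, q.1))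
    have c2 : Continuous fun q : R3 × (ℝ × ℝ) => G q.2.2 q.1 :=
      hG.comp (by fun_prop : Continuous fun q : R3 × (ℝ × ℝ) => (q.2.2, q.1))
    refine h1.mul_bdd (c := M * M) (Continuous.aestronglyMeasurable (by fun_prop)) ?_
    rw [hprod]
    filter_upwards [ae_restrict_mem (MeasurableSet.univ.prod
      (measurableSet_Ioc.prod measurableSet_Ioc))] with q hq
    rw [norm_mul, norm_exp_ofReal_mul_I, one_mul, norm_mul, norm_star]
    exact mul_le_mul (hM _ (Ioc_subset_Icc_self hq.2.1) _) (hM _ (Ioc_subset_Icc_self hq.2.2) _)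
      (norm_nonneg _) hM0
  have hpt : ∀ ξ, ((w ξ * ‖∫ s in t₀..t₁, cexp ((s * lam ξ : ℝ) * I) * G s ξ‖ ^ 2 : ℝ) : ℂ) =
      ∫ z, F ξ z ∂(μ.prod μ) := by
    intro ξ
    rw [Complex.ofReal_mul, ofReal_pow, ← Complex.mul_conj', hFdef]
    simp only
    rw [integral_const_mul, integral_of_le ht, ← integral_conj, ← integral_prod_mul]
    congr 1
    refine integral_congr_ae (.of_forall fun z => ?_)
    have : cexp (((z.1 - z.2) * lam ξ : ℝ) * I) =
        cexp ((z.1 * lam ξ : ℝ) * I) *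
          star (cexp ((z.2 * lam ξ : ℝ) * I)) := by
      rw [Complex.star_def, ← Complex.exp_conj, ← exp_add]
      congr 1
      simp only [map_mul, Complex.conj_ofReal, Complex.conj_I]
      push_cast; ring
    simp only [this, map_mul, Complex.star_def]
    ring
  have hform : ∀ z : ℝ × ℝ, ∫ ξ, F ξ z = multForm
      (fun ξ => cexp (((z.1 - z.2) * lam ξ : ℝ) * I) * (w ξ : ℂ))
        (⇑(𝓕 (G z.1) : 𝒮)) (⇑(𝓕 (G z.2) : 𝒮)) := by
    intro z
    unfold multForm
    rw [fourierInv_fourier_coe, fourierInv_fourier_coe]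
    refine integral_congr_ae (.of_forall fun ξ => ?_)
    simp only [hFdef]
    ring
  set p := 2 / (1 + γ) with hp
  set n : ℝ → ℝ := fun s => (∫ x, ‖(𝓕 (G s)) x‖ ^ p) ^ ((1 + γ) / 2) with hn
  have mn : Measurable n := by
    have h1 : StronglyMeasurable fun z : ℝ × R3 => ‖(𝓕 (G z.1)) z.2‖ ^ p :=
      (hF.norm.measurable.pow_const p).stronglyMeasurable
    exact (h1.integral_prod_right' (ν := volume)).measurable.pow_const _
  have n0 : ∀ s, 0 ≤ n s := fun s =>
    rpow_nonneg (integral_nonneg fun x => rpow_nonneg (norm_nonneg _) _) _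
  set b : ℝ → ℝ := J.indicator n with hb
  have mb : Measurable b := mn.indicator measurableSet_Ioc
  have b0 : ∀ s, 0 ≤ b s := fun s => indicator_nonneg (fun s _ => n0 s) s
  have h2γ : 0 < 2 - γ := by linarith
  have hbN : ∫⁻ s, ofReal (b s) ^ (2 / (2 - γ)) ≤ ofReal N := by
    refine le_trans (le_of_eq ?_) hGN
    rw [← lintegral_indicator measurableSet_Ioc]
    refine lintegral_congr fun s => ?_
    by_cases hs : s ∈ J
    · rw [indicator_of_mem hs, hb, indicator_of_mem hs]
    · rw [indicator_of_notMem hs, hb, indicator_of_notMem hs, ENNReal.ofReal_zero,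
        ENNReal.zero_rpow_of_pos (by positivity)]
  have hhls := hls hγ hγ1 mb b0 hN hbN
  set X := ∫ ξ, w ξ * ‖∫ s in t₀..t₁, cexp ((s * lam ξ : ℝ) * I) * G s ξ‖ ^ 2 with hX
  have hX0 : 0 ≤ X := integral_nonneg fun ξ => mul_nonneg (hw0 ξ) (by positivity)
  have hXeq : (X : ℂ) = ∫ z, multForm
      (fun ξ => cexp (((z.1 - z.2) * lam ξ : ℝ) * I) * (w ξ : ℂ))
        (⇑(𝓕 (G z.1) : 𝒮)) (⇑(𝓕 (G z.2) : 𝒮)) ∂(μ.prod μ) := by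
    rw [hX, ← integral_complex_ofReal]
    simp only [hpt]
    rw [integral_integral_swap hFi]
    simp only [hform]
  have hdiag : ∀ᵐ z ∂(μ.prod μ), z.1 ≠ z.2 := by
    have : MeasurableSet {z : ℝ × ℝ | z.1 = z.2} := measurableSet_eq_fun measurable_fst measurable_snd
    rw [ae_iff]
    simp only [ne_eq, not_not]
    rw [Measure.measure_prod_null this]
    refine .of_forall fun x => ?_
    have e : Prod.mk x ⁻¹' {z : ℝ × ℝ | z.1 = z.2} = {x} := by ext y; simp [eq_comm]
    change μ (Prod.mk x ⁻¹' {z : ℝ × ℝ | z.1 = z.2}) = 0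
    rw [e]
    simp
  have hmem : ∀ᵐ z ∂(μ.prod μ), z ∈ J ×ˢ J := by
    rw [hμ, Measure.prod_restrict]
    exact ae_restrict_mem (measurableSet_Ioc.prod measurableSet_Ioc)
  set c := interpolationConst p * 2 ^ (1 - γ) * A ^ γ with hc
  have hc0 : 0 ≤ c := by positivity
  have mk : Measurable fun z : ℝ × ℝ => ofReal (|z.1 - z.2| ^ (-γ)) *
      (ofReal (b z.1) * ofReal (b z.2)) := by
    refine Measurable.mul ?_ ((mb.comp measurable_fst).ennreal_ofReal.mul
      (mb.comp measurable_snd).ennreal_ofReal)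
    exact ((by fun_prop : Measurable fun z : ℝ × ℝ => |z.1 - z.2|).pow_const _).ennreal_ofReal
  have hfinal : ofReal X ≤ ofReal (c * (2 * (2 / (1 - γ) + 2) * N ^ (2 - γ))) := by
    calc ofReal X = ‖(X : ℂ)‖ₑ := by
          rw [← ofReal_norm, norm_real, norm_of_nonneg hX0]
      _ ≤ ∫⁻ z, ‖multForm (fun ξ => cexp (((z.1 - z.2) * lam ξ : ℝ) * I) * (w ξ : ℂ))
        (⇑(𝓕 (G z.1) : 𝒮)) (⇑(𝓕 (G z.2) : 𝒮))‖ₑ ∂(μ.prod μ) := by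
          rw [hXeq]; exact enorm_integral_le_lintegral_enorm _
      _ ≤ ∫⁻ z, ofReal c * (ofReal (|z.1 - z.2| ^ (-γ)) *
            (ofReal (b z.1) * ofReal (b z.2))) ∂(μ.prod μ) := by
          refine lintegral_mono_ae ?_
          filter_upwards [hdiag, hmem] with z hz hzI
          rw [← ofReal_norm, ← ofReal_mul (b0 _),
            ← ofReal_mul (rpow_nonneg (abs_nonneg _) _), ← ofReal_mul hc0]
          refine ofReal_le_ofReal ?_
          have := norm_multForm_phase_le hγ hγ1 hA hlam hw0 hw2 hwi hker (𝓕 (G z.1)) (𝓕 (G z.2))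
            (sub_ne_zero.2 hz)
          have e1 : b z.1 = n z.1 := indicator_of_mem hzI.1 n
          have e2 : b z.2 = n z.2 := indicator_of_mem hzI.2 n
          rw [e1, e2, ← mul_assoc, mul_assoc c]
          exact this
      _ = ofReal c * ∫⁻ z, ofReal (|z.1 - z.2| ^ (-γ)) *
            (ofReal (b z.1) * ofReal (b z.2)) ∂(μ.prod μ) :=
          lintegral_const_mul _ mk
      _ ≤ ofReal c * ofReal (2 * (2 / (1 - γ) + 2) * N ^ (2 - γ)) := by
          refine mul_le_mul_right (le_trans ?_ hhls) _
          rw [lintegral_prod _ mk.aemeasurable]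
          exact (setLIntegral_le_lintegral _ _).trans
            (lintegral_mono fun s => setLIntegral_le_lintegral _ _)
      _ = _ := (ofReal_mul hc0).symm
  have h1γ : 0 < 1 - γ := by linarith
  rw [ENNReal.ofReal_le_ofReal_iff (by positivity)] at hfinal
  refine hfinal.trans (le_of_eq ?_)
  rw [hc, dualConst, hp]; ring

end DualStrichartz

/-! ### The two phases -/

lemma continuous_spheroidalKernel (S τ c : ℝ) : Continuous (spheroidalKernel S τ c) := by
  have cs := continuous_sig
  have cn := continuous_nu
  have hi := integrable_weight_mul S (f := fun _ => 1) measurable_const (by simp)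
  refine continuous_of_dominated (bound := fun η => ‖(weight S η : ℂ) * 1‖) (fun x => ?_)
    (fun x => .of_forall fun η => ?_) hi.norm
    (.of_forall fun η => by fun_prop)
  · exact (Complex.measurable_ofReal.comp (measurable_weight S)).aestronglyMeasurable.mul
      (Continuous.aestronglyMeasurable (by fun_prop))
  · rw [norm_mul, norm_mul, norm_exp_ofReal_mul_I, norm_exp_ofReal_mul_I, norm_mul]
    simp

lemma norm_le_of_ae_of_continuous {f : R3 → ℂ} (hf : Continuous f) {M : ℝ}
    (h : ∀ᵐ x, ‖f x‖ ≤ M) (x : R3) : ‖f x‖ ≤ M := by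
  have hd : Dense {x | ‖f x‖ ≤ M} := Measure.dense_of_ae h
  have hc : IsClosed {x | ‖f x‖ ≤ M} := isClosed_le hf.norm continuous_const
  have h2 : {x | ‖f x‖ ≤ M} = univ := by rw [← hc.closure_eq, hd.closure_eq]
  have h3 : x ∈ {x | ‖f x‖ ≤ M} := by rw [h2]; trivial
  exact h3

lemma integral_rescaled_kernel {ω : ℝ} (hω : 0 < ω) (S τ c : ℝ) (x : R3) :
    ∫ ξ, (cexp ((τ * sig ((2 * π / ω) • ξ) + c * nu ((2 * π / ω) • ξ) : ℝ) *
      I) * (weight S ((2 * π / ω) • ξ) : ℂ)) *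
      cexp ((2 * π * inner ℝ x ξ : ℝ) * I) =
      (((ω / (2 * π)) ^ 3 : ℝ) : ℂ) * spheroidalKernel S τ c (ω • x) := by
  have hp := pi_pos
  have h := Measure.integral_comp_smul (volume : Measure R3) (fun η => (weight S η : ℂ) *
    (cexp ((inner ℝ (ω • x) η : ℝ) * I) *
    cexp ((τ * sig η + c * nu η : ℝ) * I))) (2 * π / ω)
  have hfin : Module.finrank ℝ R3 = 3 := by simp
  rw [hfin, abs_of_pos (by positivity), real_smul] at h
  have e : ((2 * π / ω) ^ 3)⁻¹ = (ω / (2 * π)) ^ 3 := by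
    rw [← inv_pow, inv_div]
  rw [e] at h
  unfold spheroidalKernel
  rw [← h]
  refine integral_congr_ae (.of_forall fun ξ => ?_)
  have e2 : (inner ℝ (ω • x) ((2 * π / ω) • ξ) : ℝ) = 2 * π * inner ℝ x ξ := by
    rw [inner_smul_left, inner_smul_right]
    simp only [conj_trivial]
    field_simp
  simp only [e2]
  ring

lemma norm_rescaled_kernel_le {ω : ℝ} (hω : 0 < ω) {K : ℂ} {B : ℝ} (h : ‖K‖ ≤ B) :
    ‖(((ω / (2 * π)) ^ 3 : ℝ) : ℂ) * K‖ ≤ ω ^ 3 * B := by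
  have hp := Real.pi_gt_three
  rw [norm_mul, norm_real, norm_of_nonneg (by positivity)]
  refine mul_le_mul (pow_le_pow_left₀ (by positivity) ?_ 3) h (norm_nonneg _) (by positivity)
  rw [div_le_iff₀ (by positivity)]
  nlinarith

/-- The phases of the linearized system, in Mathlib's frequency variable. -/
def phase (θ ω : ℝ) (useSig : Prop) [Decidable useSig] (ξ : R3) : ℝ :=
  θ * (if useSig then sig ((2 * π / ω) • ξ) else nu ((2 * π / ω) • ξ))

lemma continuous_phase (θ ω : ℝ) (b : Prop) [Decidable b] : Continuous (phase θ ω b) := by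
  have cs := continuous_sig
  have cn := continuous_nu
  unfold phase
  split_ifs <;> fun_prop

lemma norm_phase_kernel_le {θ ω S : ℝ} (hθ : θ ≠ 0) (hω : 0 < ω) (hS : 1 ≤ S) (b : Prop)
    [Decidable b] (τ : ℝ) (hτ : τ ≠ 0) (x : R3) :
    ‖∫ ξ, (cexp ((τ * phase θ ω b ξ : ℝ) * I) *
      (weight S ((2 * π / ω) • ξ) : ℂ)) *
      cexp ((2 * π * inner ℝ x ξ : ℝ) * I)‖ ≤
      (1088 * (ω ^ 3 * S ^ 3) / |θ|) / |τ| := by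
  have hτθ : τ * θ ≠ 0 := mul_ne_zero hτ hθ
  have hθ' := abs_pos.2 hθ
  have hτ' := abs_pos.2 hτ
  have hfin : (1088 * (ω ^ 3 * S ^ 3) / |θ|) / |τ| = ω ^ 3 * (1088 * S ^ 3 / |τ * θ|) := by
    rw [abs_mul]; field_simp
  rw [hfin]
  by_cases hb : b
  · have := integral_rescaled_kernel hω S (τ * θ) 0 x
    have e : ∀ ξ, τ * phase θ ω b ξ = τ * θ * sig ((2 * π / ω) • ξ) +
        0 * nu ((2 * π / ω) • ξ) := fun ξ => by
      rw [phase, if_pos hb]; ring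
    simp only [e]
    rw [this]
    exact norm_rescaled_kernel_le hω (norm_le_of_ae_of_continuous
      (continuous_spheroidalKernel S _ _) (norm_spheroidalKernel_sig_le hS hτθ) _)
  · have := integral_rescaled_kernel hω S 0 (τ * θ) x
    have e : ∀ ξ, τ * phase θ ω b ξ = 0 * sig ((2 * π / ω) • ξ) +
        τ * θ * nu ((2 * π / ω) • ξ) := fun ξ => by
      rw [phase, if_neg hb]; ring
    simp only [e]
    rw [this]
    exact norm_rescaled_kernel_le hω (norm_le_of_ae_of_continuous
      (continuous_spheroidalKernel S _ _) (norm_spheroidalKernel_nu_le hS hτθ) _)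

/-- The dual Strichartz estimate for the phases of the linearized system. -/
lemma dual_strichartz_phase {γ N t₀ t₁ θ ω S : ℝ} (hγ : 0 < γ) (hγ1 : γ < 1) (hθ : θ ≠ 0)
    (hω : 0 < ω) (hS : 1 ≤ S) (b : Prop) [Decidable b] {G : ℝ → 𝒮}
    (ht : t₀ ≤ t₁) (hG : Continuous fun z : ℝ × R3 => G z.1 z.2)
    (hGb : ∃ M : ℝ, ∀ s ∈ Icc t₀ t₁, ∀ ξ, ‖G s ξ‖ ≤ M)
    (hF : Continuous fun z : ℝ × R3 => (𝓕 (G z.1)) z.2) (hN : 0 < N)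
    (hGN : ∫⁻ s in Ioc t₀ t₁, ofReal ((∫ x, ‖(𝓕 (G s)) x‖ ^ (2 / (1 + γ))) ^ ((1 + γ) / 2)) ^
      (2 / (2 - γ)) ≤ ofReal N) :
    ∫ ξ, weight S ((2 * π / ω) • ξ) *
      ‖∫ s in t₀..t₁, cexp ((s * phase θ ω b ξ : ℝ) * I) * G s ξ‖ ^ 2 ≤
      dualConst γ * (1088 * (ω ^ 3 * S ^ 3) / |θ|) ^ γ * N ^ (2 - γ) := by
  have hθ' := abs_pos.2 hθ
  have hi : Integrable (weight S) := by
    have := (integrable_weight_mul S (f := fun _ => 1) measurable_const (by simp)).re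
    simpa using this
  have hpi := pi_pos
  exact dual_strichartz hγ hγ1 (by positivity) (continuous_phase θ ω b)
    (fun ξ => weight_nonneg S _) (fun ξ => weight_le S _)
    (hi.comp_smul (by positivity : (2 * π / ω) ≠ 0))
    (fun τ hτ x => norm_phase_kernel_le hθ hω hS b τ hτ x) ht hG hGb hF hN hGN

/-! ### The symbol of the linearized system -/

/-- The vectors `(a, u)` at a fixed frequency. -/
abbrev C4 := EuclideanSpace ℂ (Fin 4)

/-- The skew-adjoint part of the symbol of the dual system. -/
def symB (ε Ω : ℝ) (ζ : R3) : Matrix (Fin 4) (Fin 4) ℂ :=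
  !![0, -(I * ζ 0 / ε), -(I * ζ 1 / ε), -(I * ζ 2 / ε);
     -(I * ζ 0 / ε), 0, -Ω, 0;
     -(I * ζ 1 / ε), Ω, 0, 0;
     -(I * ζ 2 / ε), 0, 0, 0]

/-- The dissipative part of the symbol. -/
def symN (μ : ℝ) (ζ : R3) : Matrix (Fin 4) (Fin 4) ℂ :=
  !![0, 0, 0, 0;
     0, μ * ‖ζ‖ ^ 2 + (1 - μ) * ζ 0 * ζ 0, (1 - μ) * ζ 0 * ζ 1, (1 - μ) * ζ 0 * ζ 2;
     0, (1 - μ) * ζ 1 * ζ 0, μ * ‖ζ‖ ^ 2 + (1 - μ) * ζ 1 * ζ 1, (1 - μ) * ζ 1 * ζ 2;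
     0, (1 - μ) * ζ 2 * ζ 0, (1 - μ) * ζ 2 * ζ 1, μ * ‖ζ‖ ^ 2 + (1 - μ) * ζ 2 * ζ 2]

/-- The operator of a matrix on `ℂ⁴`. -/
def op (M : Matrix (Fin 4) (Fin 4) ℂ) : C4 →L[ℂ] C4 := Matrix.toEuclideanCLM (𝕜 := ℂ) M

lemma op_apply (M : Matrix (Fin 4) (Fin 4) ℂ) (v : C4) (k : Fin 4) :
    op M v k = M k 0 * v 0 + M k 1 * v 1 + M k 2 * v 2 + M k 3 * v 3 := by
  change (M.mulVec v.ofLp) k = _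
  simp [Matrix.mulVec, dotProduct, Fin.sum_univ_four]

lemma op_sub (M M' : Matrix (Fin 4) (Fin 4) ℂ) : op (M - M') = op M - op M' :=
  map_sub (Matrix.toEuclideanCLM (𝕜 := ℂ)) M M'

lemma norm_sq_C4 (v : C4) : ‖v‖ ^ 2 = ((v 0).re ^ 2 + (v 0).im ^ 2) + ((v 1).re ^ 2 + (v 1).im ^ 2)
    + ((v 2).re ^ 2 + (v 2).im ^ 2) + ((v 3).re ^ 2 + (v 3).im ^ 2) := by
  rw [EuclideanSpace.norm_sq_eq, Fin.sum_univ_four]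
  simp only [Complex.sq_norm, Complex.normSq_apply]
  ring

section Lyapunov
variable {μ ε Ω : ℝ} {ζ : R3}

lemma opB_re_im (v : C4) :
    (op (symB ε Ω ζ) v 0).re = (ζ 0 * (v 1).im + ζ 1 * (v 2).im + ζ 2 * (v 3).im) / ε ∧
    (op (symB ε Ω ζ) v 0).im = -((ζ 0 * (v 1).re + ζ 1 * (v 2).re + ζ 2 * (v 3).re) / ε) ∧
    (op (symB ε Ω ζ) v 1).re = ζ 0 * (v 0).im / ε - Ω * (v 2).re ∧
    (op (symB ε Ω ζ) v 1).im = -(ζ 0 * (v 0).re / ε) - Ω * (v 2).im ∧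
    (op (symB ε Ω ζ) v 2).re = ζ 1 * (v 0).im / ε + Ω * (v 1).re ∧
    (op (symB ε Ω ζ) v 2).im = -(ζ 1 * (v 0).re / ε) + Ω * (v 1).im ∧
    (op (symB ε Ω ζ) v 3).re = ζ 2 * (v 0).im / ε ∧
    (op (symB ε Ω ζ) v 3).im = -(ζ 2 * (v 0).re / ε) := by
  have hd : ∀ x : ℝ, (I * (x : ℂ) / (ε : ℂ)) = ((x / ε : ℝ) : ℂ) * I := fun x => by
    push_cast; ring
  simp only [op_apply, symB, hd]
  simp
  refine ⟨by ring, by ring, by ring, by ring, by ring, by ring, by ring, by ring⟩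

lemma opN_re_im (v : C4) (f : ℂ → ℝ) (hf : f = Complex.re ∨ f = Complex.im) :
    f (op (symN μ ζ) v 0) = 0 ∧
    f (op (symN μ ζ) v 1) = μ * ‖ζ‖ ^ 2 * f (v 1) +
      (1 - μ) * ζ 0 * (ζ 0 * f (v 1) + ζ 1 * f (v 2) + ζ 2 * f (v 3)) ∧
    f (op (symN μ ζ) v 2) = μ * ‖ζ‖ ^ 2 * f (v 2) +
      (1 - μ) * ζ 1 * (ζ 0 * f (v 1) + ζ 1 * f (v 2) + ζ 2 * f (v 3)) ∧
    f (op (symN μ ζ) v 3) = μ * ‖ζ‖ ^ 2 * f (v 3) +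
      (1 - μ) * ζ 2 * (ζ 0 * f (v 1) + ζ 1 * f (v 2) + ζ 2 * f (v 3)) := by
  have hz : ((‖ζ‖ : ℂ) ^ 2).re = ‖ζ‖ ^ 2 := by rw [← ofReal_pow, Complex.ofReal_re]
  have hz' : ((‖ζ‖ : ℂ) ^ 2).im = 0 := by rw [← ofReal_pow, Complex.ofReal_im]
  rcases hf with rfl | rfl <;>
  · simp only [op_apply, symN]
    simp [hz, hz']
    refine ⟨by ring, by ring, by ring⟩

/-- The Lyapunov functional. -/
def lyap (d : ℝ) (ζ : R3) (v : C4) : ℝ := ‖v‖ ^ 2 -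
  2 * d * ((v 0).im * (ζ 0 * (v 1).re + ζ 1 * (v 2).re + ζ 2 * (v 3).re) -
    (v 0).re * (ζ 0 * (v 1).im + ζ 1 * (v 2).im + ζ 2 * (v 3).im))

/-- The real quadratic form of the dissipative part. -/
def dissipation (μ : ℝ) (ζ : R3) (v : C4) : ℝ :=
  μ * ‖ζ‖ ^ 2 * ((v 1).re ^ 2 + (v 1).im ^ 2 + ((v 2).re ^ 2 + (v 2).im ^ 2) +
    ((v 3).re ^ 2 + (v 3).im ^ 2)) +
  (1 - μ) * ((ζ 0 * (v 1).re + ζ 1 * (v 2).re + ζ 2 * (v 3).re) ^ 2 +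
    (ζ 0 * (v 1).im + ζ 1 * (v 2).im + ζ 2 * (v 3).im) ^ 2)

/-- The derivative of the Lyapunov functional along the flow. -/
lemma hasDerivAt_lyap (hε : ε ≠ 0) (δ : ℝ) {v : ℝ → C4} {s : ℝ}
    (hv : HasDerivAt v (op (symB ε Ω ζ - symN μ ζ) (v s)) s) :
    HasDerivAt (fun s => lyap (δ * ε) ζ (v s))
      (-2 * dissipation μ ζ (v s) +
        2 * δ * ((ζ 0 * (v s 1).re + ζ 1 * (v s 2).re + ζ 2 * (v s 3).re) ^ 2 +
          (ζ 0 * (v s 1).im + ζ 1 * (v s 2).im + ζ 2 * (v s 3).im) ^ 2) -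
        2 * δ * ‖ζ‖ ^ 2 * ((v s 0).re ^ 2 + (v s 0).im ^ 2) -
        2 * (δ * ε) * ((v s 0).im * (Ω * (ζ 1 * (v s 1).re - ζ 0 * (v s 2).re) - ‖ζ‖ ^ 2 *
            (ζ 0 * (v s 1).re + ζ 1 * (v s 2).re + ζ 2 * (v s 3).re)) -
          (v s 0).re * (Ω * (ζ 1 * (v s 1).im - ζ 0 * (v s 2).im) - ‖ζ‖ ^ 2 *
            (ζ 0 * (v s 1).im + ζ 1 * (v s 2).im + ζ 2 * (v s 3).im)))) s := by
  have hc : ∀ k, HasDerivAt (fun s => v s k) (op (symB ε Ω ζ - symN μ ζ) (v s) k) s :=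
    fun k => (proj (𝕜 := ℂ) k : C4 →L[ℂ] ℂ).hasFDerivAt.restrictScalars ℝ
      |>.comp_hasDerivAt s hv
  have hre : ∀ k, HasDerivAt (fun s => (v s k).re) (op (symB ε Ω ζ - symN μ ζ) (v s) k).re s :=
    fun k => Complex.reCLM.hasFDerivAt.comp_hasDerivAt s (hc k)
  have him : ∀ k, HasDerivAt (fun s => (v s k).im) (op (symB ε Ω ζ - symN μ ζ) (v s) k).im s :=
    fun k => Complex.imCLM.hasFDerivAt.comp_hasDerivAt s (hc k)
  have hsub : ∀ k, op (symB ε Ω ζ - symN μ ζ) (v s) k =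
      op (symB ε Ω ζ) (v s) k - op (symN μ ζ) (v s) k := fun k => by rw [op_sub]; rfl
  simp only [hsub, Complex.sub_re, Complex.sub_im] at hre him
  obtain ⟨b0, b0', b1, b1', b2, b2', b3, b3'⟩ := opB_re_im (Ω := Ω) (ζ := ζ) (v s)
  obtain ⟨n0, n1, n2, n3⟩ := opN_re_im (μ := μ) (ζ := ζ) (v s) Complex.re (Or.inl rfl)
  obtain ⟨m0, m1, m2, m3⟩ := opN_re_im (μ := μ) (ζ := ζ) (v s) Complex.im (Or.inr rfl)
  have r0 := hre 0
  have r1 := hre 1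
  have r2 := hre 2
  have r3 := hre 3
  have i0 := him 0
  have i1 := him 1
  have i2 := him 2
  have i3 := him 3
  rw [b0, n0] at r0
  rw [b1, n1] at r1
  rw [b2, n2] at r2
  rw [b3, n3] at r3
  rw [b0', m0] at i0
  rw [b1', m1] at i1
  rw [b2', m2] at i2
  rw [b3', m3] at i3
  unfold lyap
  simp only [norm_sq_C4]
  have hN := ((((r0.fun_pow 2).fun_add (i0.fun_pow 2)).fun_add
    ((r1.fun_pow 2).fun_add (i1.fun_pow 2))).fun_add
    ((r2.fun_pow 2).fun_add (i2.fun_pow 2))).fun_add ((r3.fun_pow 2).fun_add (i3.fun_pow 2))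
  have hwr := ((r1.const_mul (ζ 0)).fun_add (r2.const_mul (ζ 1))).fun_add (r3.const_mul (ζ 2))
  have hwi := ((i1.const_mul (ζ 0)).fun_add (i2.const_mul (ζ 1))).fun_add (i3.const_mul (ζ 2))
  have hX := ((i0.fun_mul hwr).fun_sub (r0.fun_mul hwi)).const_mul (2 * (δ * ε))
  refine (hN.fun_sub hX).congr_deriv ?_
  unfold dissipation
  rw [norm_sq_R3]
  generalize (v s 0).re = x0
  generalize (v s 0).im = y0
  generalize (v s 1).re = x1
  generalize (v s 1).im = y1
  generalize (v s 2).re = x2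
  generalize (v s 2).im = y2
  generalize (v s 3).re = x3
  generalize (v s 3).im = y3
  field_simp
  ring

lemma coord_sq_le (a b c x y z : ℝ) :
    (a * x + b * y + c * z) ^ 2 ≤ (a ^ 2 + b ^ 2 + c ^ 2) * (x ^ 2 + y ^ 2 + z ^ 2) := by
  nlinarith [sq_nonneg (a * y - b * x), sq_nonneg (a * z - c * x), sq_nonneg (b * z - c * y)]

/-- The kinetic part of the norm. -/
def velSq (v : C4) : ℝ := (v 1).re ^ 2 + (v 1).im ^ 2 + ((v 2).re ^ 2 + (v 2).im ^ 2) +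
    ((v 3).re ^ 2 + (v 3).im ^ 2)

lemma velSq_nonneg (v : C4) : 0 ≤ velSq v := by unfold velSq; positivity

lemma divergence_sq_le (ζ : R3) (v : C4) :
    (ζ 0 * (v 1).re + ζ 1 * (v 2).re + ζ 2 * (v 3).re) ^ 2 +
    (ζ 0 * (v 1).im + ζ 1 * (v 2).im + ζ 2 * (v 3).im) ^ 2 ≤ ‖ζ‖ ^ 2 * velSq v := by
  have h1 := coord_sq_le (ζ 0) (ζ 1) (ζ 2) (v 1).re (v 2).re (v 3).re
  have h2 := coord_sq_le (ζ 0) (ζ 1) (ζ 2) (v 1).im (v 2).im (v 3).im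
  rw [norm_sq_R3, velSq]
  linarith

lemma le_dissipation (v : C4) :
    min μ 1 * ‖ζ‖ ^ 2 * velSq v ≤ dissipation μ ζ v := by
  have h1 := divergence_sq_le ζ v
  have h0 : 0 ≤ (ζ 0 * (v 1).re + ζ 1 * (v 2).re + ζ 2 * (v 3).re) ^ 2 +
    (ζ 0 * (v 1).im + ζ 1 * (v 2).im + ζ 2 * (v 3).im) ^ 2 := by positivity
  unfold dissipation
  change _ ≤ μ * ‖ζ‖ ^ 2 * velSq v + _
  have hv := mul_nonneg (sq_nonneg ‖ζ‖) (velSq_nonneg v)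
  rcases le_total μ 1 with h | h
  · rw [min_eq_left h]; nlinarith
  · rw [min_eq_right h]; nlinarith

lemma norm_sq_eq_velSq (v : C4) : ‖v‖ ^ 2 = ((v 0).re ^ 2 + (v 0).im ^ 2) + velSq v := by
  rw [norm_sq_C4, velSq]; ring

lemma opN_norm_le (hμ : 0 < μ) (v : C4) : ‖op (symN μ ζ) v‖ ≤ (1 + μ) * ‖ζ‖ ^ 2 * ‖v‖ := by
  obtain ⟨n0, n1, n2, n3⟩ := opN_re_im (μ := μ) (ζ := ζ) v Complex.re (Or.inl rfl)
  obtain ⟨m0, m1, m2, m3⟩ := opN_re_im (μ := μ) (ζ := ζ) v Complex.im (Or.inr rfl)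
  have hd := divergence_sq_le ζ v
  have h0 : 0 ≤ (ζ 0 * (v 1).re + ζ 1 * (v 2).re + ζ 2 * (v 3).re) ^ 2 +
    (ζ 0 * (v 1).im + ζ 1 * (v 2).im + ζ 2 * (v 3).im) ^ 2 := by positivity
  have hZ := norm_sq_R3 ζ
  refine abs_le_of_sq_le_sq' ?_ (by positivity) |>.2
  have e : ‖op (symN μ ζ) v‖ ^ 2 = μ ^ 2 * (‖ζ‖ ^ 2) ^ 2 * velSq v + (1 - μ ^ 2) * ‖ζ‖ ^ 2 *
      ((ζ 0 * (v 1).re + ζ 1 * (v 2).re + ζ 2 * (v 3).re) ^ 2 +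
    (ζ 0 * (v 1).im + ζ 1 * (v 2).im + ζ 2 * (v 3).im) ^ 2) := by
    rw [norm_sq_C4, n0, n1, n2, n3, m0, m1, m2, m3, hZ, velSq]
    ring
  rw [e, mul_pow, mul_pow, norm_sq_eq_velSq v]
  set D := (ζ 0 * (v 1).re + ζ 1 * (v 2).re + ζ 2 * (v 3).re) ^ 2 +
    (ζ 0 * (v 1).im + ζ 1 * (v 2).im + ζ 2 * (v 3).im) ^ 2
  have hZ0 := sq_nonneg ‖ζ‖
  have hV := velSq_nonneg v
  have h1 : (1 - μ ^ 2) * ‖ζ‖ ^ 2 * D ≤ ‖ζ‖ ^ 2 * (‖ζ‖ ^ 2 * velSq v) := by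
    have := mul_le_mul_of_nonneg_left hd hZ0
    have h3 : 0 ≤ μ ^ 2 * (‖ζ‖ ^ 2 * D) := by positivity
    linarith
  have h4 : 0 ≤ (1 + μ) ^ 2 * (‖ζ‖ ^ 2) ^ 2 * ((v 0).re ^ 2 + (v 0).im ^ 2) := by positivity
  have h5 : 0 ≤ 2 * μ * ((‖ζ‖ ^ 2) ^ 2 * velSq v) := by positivity
  nlinarith

/-- Exponential decay of a nonnegative quantity with a differential inequality. -/
lemma le_exp_mul_of_deriv_le {E E' : ℝ → ℝ} {c : ℝ} (hE : ∀ s, HasDerivAt E (E' s) s)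
    (h : ∀ s, E' s ≤ -c * E s) {s : ℝ} (hs : 0 ≤ s) : E s ≤ Real.exp (-c * s) * E 0 := by
  have hd : ∀ s, HasDerivAt (fun s => Real.exp (c * s) * E s)
      (Real.exp (c * s) * c * E s + Real.exp (c * s) * E' s) s := fun s => by
    have := ((hasDerivAt_id' s).const_mul c).exp.fun_mul (hE s)
    simpa using this
  have hanti : Antitone fun s => Real.exp (c * s) * E s := by
    refine antitone_of_deriv_nonpos (fun s => (hd s).differentiableAt) fun s => ?_
    rw [(hd s).deriv]
    have := mul_le_mul_of_nonneg_left (h s) (Real.exp_pos (c * s)).le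
    linarith
  have h1 := hanti hs
  simp only [mul_zero, Real.exp_zero, one_mul] at h1
  rw [neg_mul, Real.exp_neg, inv_mul_eq_div, le_div_iff₀ (Real.exp_pos _), mul_comm]
  exact h1

lemma hasDerivAt_flow (L : C4 →L[ℂ] C4) (v : C4) (s : ℝ) :
    HasDerivAt (fun s : ℝ => exp (s • L) v) (L (exp (s • L) v)) s := by
  have h := hasDerivAt_exp_smul_const' (𝕂 := ℝ) L s
  have h2 := ((ContinuousLinearMap.apply ℂ C4 v).restrictScalars ℝ).hasFDerivAt.comp_hasDerivAt s h
  exact h2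

lemma exp_zero_smul_apply (L : C4 →L[ℂ] C4) (v : C4) : exp ((0 : ℝ) • L) v = v := by
  have h : (0 : ℝ) • L = 0 := by ext; simp
  rw [h, NormedSpace.exp_zero]
  rfl

/-- The flow is a contraction. -/
lemma norm_flow_le (hμ : 0 < μ) (hε : ε ≠ 0) (v : C4) {s : ℝ} (hs : 0 ≤ s) :
    ‖exp (s • op (symB ε Ω ζ - symN μ ζ)) v‖ ≤ ‖v‖ := by
  set f : ℝ → C4 := fun s => exp (s • op (symB ε Ω ζ - symN μ ζ)) v with hf
  have hd : ∀ s, HasDerivAt f (op (symB ε Ω ζ - symN μ ζ) (f s)) s := hasDerivAt_flow _ v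
  have h := le_exp_mul_of_deriv_le (c := 0) (fun s => hasDerivAt_lyap hε 0 (hd s)) (fun s => by
    have h1 := le_dissipation (μ := μ) (ζ := ζ) (f s)
    have h2 : 0 ≤ min μ 1 * ‖ζ‖ ^ 2 * velSq (f s) := by
      have := velSq_nonneg (f s)
      positivity
    simp only [mul_zero, zero_mul, sub_zero, add_zero, neg_zero]
    linarith) hs
  have hf0 : f 0 = v := exp_zero_smul_apply _ v
  simp only [lyap, zero_mul, mul_zero, sub_zero, neg_zero, Real.exp_zero, one_mul, hf0] at h
  exact abs_le_of_sq_le_sq' h (norm_nonneg v) |>.2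

lemma sub_sq_le_mul (a b x y : ℝ) :
    (a * x - b * y) ^ 2 ≤ (a ^ 2 + b ^ 2) * (x ^ 2 + y ^ 2) := by
  linarith [sq_nonneg (a * y + b * x)]

lemma sub_sq_le_two (a b x y : ℝ) :
    (a * x - b * y) ^ 2 ≤ 2 * (a ^ 2 * x ^ 2 + b ^ 2 * y ^ 2) := by
  linarith [sq_nonneg (a * x + b * y)]

lemma sq_le_sq_of_le_mul {ε P A K Z V : ℝ} (h : ε ^ 2 * P ^ 2 ≤ A * (2 * K * Z ^ 2 * V)) :
    (2 * (ε * P)) ^ 2 ≤ (Z * A + 2 * K * Z * V) ^ 2 := by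
  have h1 := sq_nonneg (Z * A - 2 * K * Z * V)
  calc (2 * (ε * P)) ^ 2 = 4 * (ε ^ 2 * P ^ 2) := by ring
    _ ≤ 4 * (A * (2 * K * Z ^ 2 * V)) := by linarith
    _ ≤ _ := by linarith

lemma lyap_deriv_le {D m Z V δ W A ε P K E : ℝ} (j0 : m * Z * V ≤ D) (j3 : δ * W ≤ δ * (Z * V))
    (hP4 : -(2 * (δ * ε) * P) ≤ δ * (Z * A + 2 * K * Z * V))
    (j4 : 2 * (δ * (1 + K)) * (Z * V) ≤ m * (Z * V)) (j5 : δ * (Z * V) ≤ m * (Z * V))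
    (hL2 : 2 * (δ / 3) * Z * E ≤ δ * Z * (A + V)) :
    -2 * D + 2 * δ * W - 2 * δ * Z * A - 2 * (δ * ε) * P ≤ -(2 * (δ / 3) * Z * E) := by
  linarith

set_option maxHeartbeats 1000000 in
/-- The flow decays exponentially, at the rate of the heat flow, away from low and high
frequencies. -/
lemma exists_norm_flow_le (hμ : 0 < μ) {C₀ C₁ : ℝ} (hC₀ : 0 < C₀) (hC₁ : 0 < C₁) :
    ∃ c : ℝ, 0 < c ∧ ∀ (ε Ω : ℝ) (ζ : R3), 0 < ε → |Ω| * ε ≤ C₀ * ‖ζ‖ → ε * ‖ζ‖ ≤ C₁ →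
      ∀ (v : C4) (s : ℝ), 0 ≤ s →
        ‖exp (s • op (symB ε Ω ζ - symN μ ζ)) v‖ ≤
          2 * Real.exp (-c * ‖ζ‖ ^ 2 * s) * ‖v‖ := by
  set K := C₀ ^ 2 + C₁ ^ 2 with hK
  have hK0 : 0 < K := by positivity
  have hc0 : 0 < min μ 1 := lt_min hμ one_pos
  set δ := min (1 / (2 * C₁)) (min μ 1 / (2 * (1 + K))) with hδ
  have hδ0 : 0 < δ := by positivity
  have hδ1 : δ * C₁ ≤ 1 / 2 := by
    have : δ ≤ 1 / (2 * C₁) := min_le_left _ _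
    rw [le_div_iff₀ (by positivity)] at this
    linarith only [this]
  have hδ2 : 2 * (δ * (1 + K)) ≤ min μ 1 := by
    have : δ ≤ min μ 1 / (2 * (1 + K)) := min_le_right _ _
    rw [le_div_iff₀ (by positivity)] at this
    linarith
  refine ⟨δ / 3, by positivity, fun ε Ω ζ hε h1 h2 v s hs => ?_⟩
  set f : ℝ → C4 := fun s => exp (s • op (symB ε Ω ζ - symN μ ζ)) v with hf
  have hd : ∀ s, HasDerivAt f (op (symB ε Ω ζ - symN μ ζ) (f s)) s := hasDerivAt_flow _ v
  have hζ := norm_nonneg ζ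
  have hcross : ∀ v : C4, |2 * (δ * ε) * ((v 0).im * (ζ 0 * (v 1).re + ζ 1 * (v 2).re + ζ 2 * (v 3).re) -
    (v 0).re * (ζ 0 * (v 1).im + ζ 1 * (v 2).im + ζ 2 * (v 3).im))| ≤ 1 / 2 * ‖v‖ ^ 2 := by
    intro v
    have i1 := divergence_sq_le ζ v
    rw [norm_sq_eq_velSq]
    generalize ζ 0 * (v 1).re + ζ 1 * (v 2).re + ζ 2 * (v 3).re = wr at i1 ⊢
    generalize ζ 0 * (v 1).im + ζ 1 * (v 2).im + ζ 2 * (v 3).im = wi at i1 ⊢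
    have hV := velSq_nonneg v
    have i2 : ((v 0).im * wr - (v 0).re * wi) ^ 2 ≤
        ((v 0).re ^ 2 + (v 0).im ^ 2) * (‖ζ‖ ^ 2 * velSq v) := by
      have : ((v 0).im * wr - (v 0).re * wi) ^ 2 ≤
        ((v 0).re ^ 2 + (v 0).im ^ 2) * (wr ^ 2 + wi ^ 2) :=
        (sub_sq_le_mul _ _ _ _).trans_eq (by rw [add_comm ((v 0).re ^ 2)])
      exact this.trans (mul_le_mul_of_nonneg_left i1 (by positivity))
    set A := (v 0).re ^ 2 + (v 0).im ^ 2
    have hA : 0 ≤ A := by positivity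
    have i3 : δ * ε * ‖ζ‖ ≤ 1 / 2 := by
      calc δ * ε * ‖ζ‖ = δ * (ε * ‖ζ‖) := by ring
        _ ≤ δ * C₁ := by gcongr
        _ ≤ _ := hδ1
    refine abs_le_of_sq_le_sq ?_ (by positivity)
    calc (2 * (δ * ε) * ((v 0).im * wr - (v 0).re * wi)) ^ 2
        = 4 * (δ * ε) ^ 2 * ((v 0).im * wr - (v 0).re * wi) ^ 2 := by ring
      _ ≤ 4 * (δ * ε) ^ 2 * (A * (‖ζ‖ ^ 2 * velSq v)) := by gcongr
      _ = 4 * (δ * ε * ‖ζ‖) ^ 2 * (A * velSq v) := by ring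
      _ ≤ 4 * (1 / 2) ^ 2 * (A * velSq v) := by gcongr
      _ ≤ _ := by linarith only [sq_nonneg (A - velSq v)]
  have hder := le_exp_mul_of_deriv_le (c := 2 * (δ / 3) * ‖ζ‖ ^ 2)
    (fun s => hasDerivAt_lyap hε.ne' δ (hd s)) (fun s => by
    have j0 := le_dissipation (μ := μ) (ζ := ζ) (f s)
    have j1 := divergence_sq_le ζ (f s)
    have j2 := (abs_le.1 (hcross (f s))).1
    have hV := velSq_nonneg (f s)
    have hlyap : lyap (δ * ε) ζ (f s) ≤ 3 / 2 * ‖f s‖ ^ 2 := by unfold lyap; linarith only [j2]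
    have hL2 : 2 * (δ / 3) * ‖ζ‖ ^ 2 * lyap (δ * ε) ζ (f s) ≤ δ * ‖ζ‖ ^ 2 * ‖f s‖ ^ 2 := by
      calc _ ≤ 2 * (δ / 3) * ‖ζ‖ ^ 2 * (3 / 2 * ‖f s‖ ^ 2) := by gcongr
        _ = _ := by ring
    rw [norm_sq_eq_velSq] at hL2
    have hq1 : (ζ 1 * (f s 1).re - ζ 0 * (f s 2).re) ^ 2 + (ζ 1 * (f s 1).im - ζ 0 * (f s 2).im) ^ 2 ≤
        ‖ζ‖ ^ 2 * velSq (f s) := by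
      have k1 := coord_sq_le (ζ 1) (-ζ 0) (ζ 2) (f s 1).re (f s 2).re 0
      have k2 := coord_sq_le (ζ 1) (-ζ 0) (ζ 2) (f s 1).im (f s 2).im 0
      have hZ : 0 ≤ ζ 1 ^ 2 + (-ζ 0) ^ 2 + ζ 2 ^ 2 := by positivity
      have k3 := mul_nonneg hZ (by positivity : 0 ≤ (f s 3).re ^ 2 + (f s 3).im ^ 2)
      rw [norm_sq_R3, velSq]
      linarith only [k1, k2, k3]
    generalize ζ 0 * (f s 1).re + ζ 1 * (f s 2).re + ζ 2 * (f s 3).re = wr at j1 ⊢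
    generalize ζ 0 * (f s 1).im + ζ 1 * (f s 2).im + ζ 2 * (f s 3).im = wi at j1 ⊢
    generalize ζ 1 * (f s 1).re - ζ 0 * (f s 2).re = qr at hq1 ⊢
    generalize ζ 1 * (f s 1).im - ζ 0 * (f s 2).im = qi at hq1 ⊢
    set A := (f s 0).re ^ 2 + (f s 0).im ^ 2 with hA
    have hA0 : 0 ≤ A := by positivity
    set Z := ‖ζ‖ ^ 2 with hZ
    have hZ0 : 0 ≤ Z := by positivity
    set V := velSq (f s)
    set P := (f s 0).im * (Ω * qr - Z * wr) - (f s 0).re * (Ω * qi - Z * wi) with hP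
    have hP1 : P ^ 2 ≤ A * ((Ω * qr - Z * wr) ^ 2 + (Ω * qi - Z * wi) ^ 2) :=
      (sub_sq_le_mul _ _ _ _).trans_eq (by rw [hA, add_comm ((f s 0).re ^ 2)])
    have hQ : (Ω * qr - Z * wr) ^ 2 + (Ω * qi - Z * wi) ^ 2 ≤ 2 * (Ω ^ 2 * (Z * V) + Z ^ 2 * (Z * V)) := by
      have e1 : (Ω * qr - Z * wr) ^ 2 ≤ 2 * (Ω ^ 2 * qr ^ 2 + Z ^ 2 * wr ^ 2) := sub_sq_le_two _ _ _ _
      have e2 : (Ω * qi - Z * wi) ^ 2 ≤ 2 * (Ω ^ 2 * qi ^ 2 + Z ^ 2 * wi ^ 2) := sub_sq_le_two _ _ _ _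
      have e3 := mul_le_mul_of_nonneg_left hq1 (sq_nonneg Ω)
      have e4 := mul_le_mul_of_nonneg_left j1 (sq_nonneg Z)
      linarith only [e1, e2, e3, e4]
    have hΩ : (Ω * ε) ^ 2 ≤ C₀ ^ 2 * Z := by
      have : (|Ω| * ε) ^ 2 ≤ (C₀ * ‖ζ‖) ^ 2 := pow_le_pow_left₀ (by positivity) h1 2
      rw [mul_pow, sq_abs, mul_pow] at this
      rw [mul_pow]; exact this
    have hεZ : ε ^ 2 * Z ≤ C₁ ^ 2 := by
      have : (ε * ‖ζ‖) ^ 2 ≤ C₁ ^ 2 := pow_le_pow_left₀ (by positivity) h2 2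
      rwa [mul_pow] at this
    have hP2 : (2 * (ε * P)) ^ 2 ≤ (Z * A + 2 * K * Z * V) ^ 2 := by
      have e1 : ε ^ 2 * P ^ 2 ≤ A * (2 * K * Z ^ 2 * V) := by
        calc ε ^ 2 * P ^ 2 ≤ ε ^ 2 * (A * (2 * (Ω ^ 2 * (Z * V) + Z ^ 2 * (Z * V)))) := by
              gcongr
              exact hP1.trans (mul_le_mul_of_nonneg_left hQ hA0)
          _ = A * (2 * (((Ω * ε) ^ 2 + (ε ^ 2 * Z) * Z) * (Z * V))) := by ring
          _ ≤ A * (2 * ((C₀ ^ 2 * Z + C₁ ^ 2 * Z) * (Z * V))) := by gcongr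
          _ = _ := by rw [hK]; ring
      exact sq_le_sq_of_le_mul e1
    have hP3 : -(2 * (ε * P)) ≤ Z * A + 2 * K * Z * V := by
      have := abs_le_of_sq_le_sq' hP2 (by positivity)
      linarith only [this.1]
    have hP4 : -(2 * (δ * ε) * P) ≤ δ * (Z * A + 2 * K * Z * V) := by
      have := mul_le_mul_of_nonneg_left hP3 hδ0.le
      linarith only [this]
    have j3 := mul_le_mul_of_nonneg_left j1 hδ0.le
    have hZV : 0 ≤ Z * V := mul_nonneg hZ0 hV
    have hδ3 : δ ≤ min μ 1 := by
      have := mul_nonneg hδ0.le hK0.le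
      linarith only [this, hδ2, hδ0]
    have j4 := mul_le_mul_of_nonneg_right hδ2 hZV
    have j5 := mul_le_mul_of_nonneg_right hδ3 hZV
    exact (lyap_deriv_le j0 j3 hP4 j4 j5 hL2).trans_eq (by ring)) hs
  have hf0 : f 0 = v := exp_zero_smul_apply _ v
  rw [hf0] at hder
  have u1 := (abs_le.1 (hcross (f s))).2
  have u2 := (abs_le.1 (hcross v)).1
  have l1 : 1 / 2 * ‖f s‖ ^ 2 ≤ lyap (δ * ε) ζ (f s) := by unfold lyap; linarith
  have l2 : lyap (δ * ε) ζ v ≤ 3 / 2 * ‖v‖ ^ 2 := by unfold lyap; linarith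
  have hexp : Real.exp (-(2 * (δ / 3) * ‖ζ‖ ^ 2) * s) = Real.exp (-(δ / 3) * ‖ζ‖ ^ 2 * s) ^ 2 := by
    rw [← Real.exp_nat_mul]; congr 1; push_cast; ring
  rw [hexp] at hder
  refine abs_le_of_sq_le_sq' ?_ (by positivity) |>.2
  have := mul_le_mul_of_nonneg_left l2 (sq_nonneg (Real.exp (-(δ / 3) * ‖ζ‖ ^ 2 * s)))
  rw [mul_pow, mul_pow]
  have h0 : 0 ≤ Real.exp (-(δ / 3) * ‖ζ‖ ^ 2 * s) ^ 2 * ‖v‖ ^ 2 := by positivity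
  change ‖f s‖ ^ 2 ≤ _
  linarith

end Lyapunov

/-! ### The skew-adjoint flow -/

lemma inner_C4 (v w : C4) : (inner ℂ v w : ℂ) =
    w 0 * (starRingEnd ℂ) (v 0) + w 1 * (starRingEnd ℂ) (v 1) + w 2 * (starRingEnd ℂ) (v 2) +
      w 3 * (starRingEnd ℂ) (v 3) := by
  simp [PiLp.inner_apply, Fin.sum_univ_four]

lemma inner_opB (ε Ω : ℝ) (ζ : R3) (v w : C4) :
    (inner ℂ (op (symB ε Ω ζ) v) w : ℂ) = -inner ℂ v (op (symB ε Ω ζ) w) := by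
  rw [inner_C4, inner_C4]
  simp only [op_apply, symB]
  simp
  ring

lemma det_symB (K z0 z1 z2 Ω : ℂ) :
    (!![-K, -z0, -z1, -z2; -z0, -K, -Ω, 0; -z1, Ω, -K, 0; -z2, 0, 0, -K] :
      Matrix (Fin 4) (Fin 4) ℂ).det =
    K ^ 4 + (Ω ^ 2 - (z0 ^ 2 + z1 ^ 2 + z2 ^ 2)) * K ^ 2 - Ω ^ 2 * z2 ^ 2 := by
  simp [Matrix.det_succ_row_zero, Fin.sum_univ_succ, Fin.succAbove]
  ring

/-- The eigenvalues of the symbol without dissipation are the two pairs of phases. -/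
lemma eigenvalue_opB {ε Ω κ : ℝ} {ζ : R3} (hε : 0 < ε) (hΩ : Ω ≠ 0) {v : C4} (hv : v ≠ 0)
    (h : op (symB ε Ω ζ) v = (I * κ) • v) :
    ∃ θ ∈ ({Ω, -Ω} : Set ℝ), κ = θ * sig ((|Ω| * ε)⁻¹ • ζ) ∨ κ = θ * nu ((|Ω| * ε)⁻¹ • ζ) := by
  have hdet : (!![-(I * κ), -(I * ζ 0 / ε), -(I * ζ 1 / ε), -(I * ζ 2 / ε);
     -(I * ζ 0 / ε), -(I * κ), -Ω, 0;
     -(I * ζ 1 / ε), Ω, -(I * κ), 0;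
     -(I * ζ 2 / ε), 0, 0, -(I * κ)] : Matrix (Fin 4) (Fin 4) ℂ).det = 0 := by
    rw [← Matrix.exists_mulVec_eq_zero_iff]
    refine ⟨v.ofLp, fun h0 => hv (by ext k; exact congrFun h0 k), ?_⟩
    ext k
    have hk : op (symB ε Ω ζ) v k = I * κ * v k := by rw [h]; rfl
    rw [op_apply] at hk
    fin_cases k <;>
    · simp [symB] at hk
      simp [Matrix.mulVec, dotProduct, Fin.sum_univ_four]
      linear_combination hk
  rw [det_symB] at hdet
  set η := (|Ω| * ε)⁻¹ • ζ with hη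
  have hΩa : 0 < |Ω| := abs_pos.2 hΩ
  have hcoord : ∀ k, ζ k = |Ω| * ε * η k := fun k => by
    simp only [hη, PiLp.smul_apply, smul_eq_mul]
    field_simp
  have hεc : (ε : ℂ) ≠ 0 := Complex.ofReal_ne_zero.2 hε.ne'
  have hz : ∀ k, I * (ζ k : ℂ) / ε = I * ((|Ω| * η k : ℝ) : ℂ) := fun k => by
    rw [hcoord k]; push_cast; field_simp
  rw [hz, hz, hz] at hdet
  have hre : κ ^ 4 - Ω ^ 2 * (1 + ‖η‖ ^ 2) * κ ^ 2 + Ω ^ 2 * (Ω ^ 2 * η 2 ^ 2) = 0 := by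
    have : ((κ ^ 4 - Ω ^ 2 * (1 + ‖η‖ ^ 2) * κ ^ 2 + Ω ^ 2 * (Ω ^ 2 * η 2 ^ 2) : ℝ) : ℂ) = 0 := by
      rw [← hdet, ← sq_abs Ω, norm_sq_R3]
      have hΩc : (Ω : ℂ) ^ 2 = ((|Ω| : ℝ) : ℂ) ^ 2 := by
        rw [← ofReal_pow, ← ofReal_pow, sq_abs]
      rw [hΩc]
      push_cast
      simp only [mul_pow, I_sq, Complex.I_pow_four]
      ring
    exact_mod_cast this
  have hfac : (κ - Ω * sig η) * (κ + Ω * sig η) * ((κ - Ω * nu η) * (κ + Ω * nu η)) = 0 := by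
    rw [← hre, ← sig_mul_nu, add_comm 1, ← sig_sq_add_nu_sq]
    ring
  rcases mul_eq_zero.1 hfac with h | h <;> rcases mul_eq_zero.1 h with h | h
  · exact ⟨Ω, by simp, Or.inl (by linarith)⟩
  · exact ⟨-Ω, by simp, Or.inl (by linarith)⟩
  · exact ⟨Ω, by simp, Or.inr (by linarith)⟩
  · exact ⟨-Ω, by simp, Or.inr (by linarith)⟩

lemma continuous_flow (L : C4 →L[ℂ] C4) (v : C4) :
    Continuous fun s : ℝ => exp (s • L) v :=
  continuous_iff_continuousAt.2 fun s => (hasDerivAt_flow L v s).continuousAt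

/-- The component of a skew-adjoint flow along an eigenvector. -/
lemma inner_flow {B : C4 →L[ℂ] C4} (hB : ∀ v w, (inner ℂ (B v) w : ℂ) = -inner ℂ v (B w))
    {κ : ℝ} {b : C4} (hb : B b = (I * κ) • b) (e : C4) (s : ℝ) :
    (inner ℂ b (exp (s • B) e) : ℂ) =
      cexp ((s * κ : ℝ) * I) * inner ℂ b e := by
  have hd : ∀ s : ℝ, HasDerivAt (fun s : ℝ => (inner ℂ b (exp (s • B) e) : ℂ))
      (I * κ * inner ℂ b (exp (s • B) e)) s := fun s => by
    have h1 := ((innerSL ℂ b).restrictScalars ℝ).hasFDerivAt.comp_hasDerivAt s (hasDerivAt_flow B e s)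
    refine h1.congr_deriv ?_
    change (inner ℂ b (B _) : ℂ) = _
    have h2 := hB b (exp (s • B) e)
    rw [hb, inner_smul_left] at h2
    simp only [map_mul, Complex.conj_I, Complex.conj_ofReal] at h2
    linear_combination h2
  have he : ∀ s : ℝ, HasDerivAt (fun s : ℝ => cexp (-(((s * κ : ℝ) : ℂ) * I)))
      (cexp (-(((s * κ : ℝ) : ℂ) * I)) * (-(κ * I))) s := fun s => by
    have h1 := (((hasDerivAt_id' s).mul_const κ).ofReal_comp.mul_const I).fun_neg.cexp
    refine h1.congr_deriv ?_
    push_cast; ring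
  have hp : ∀ s : ℝ, HasDerivAt (fun s : ℝ => cexp (-(((s * κ : ℝ) : ℂ) * I)) *
      (inner ℂ b (exp (s • B) e) : ℂ)) 0 s := fun s =>
    ((he s).fun_mul (hd s)).congr_deriv (by ring)
  have hc := is_const_of_deriv_eq_zero (fun s => (hp s).differentiableAt) (fun s => (hp s).deriv) s 0
  simp only [exp_zero_smul_apply] at hc
  rw [zero_mul, Complex.ofReal_zero, zero_mul, neg_zero, Complex.exp_zero, one_mul] at hc
  rw [← hc, ← mul_assoc, ← exp_add, add_neg_cancel, Complex.exp_zero, one_mul]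

/-- A forced skew-adjoint evolution is controlled by the oscillatory integrals along its
eigenvalues. -/
lemma norm_sq_integral_flow_le {B : C4 →L[ℂ] C4}
    (hB : ∀ v w, (inner ℂ (B v) w : ℂ) = -inner ℂ v (B w)) {G : ℝ → ℂ} (hG : Continuous G)
    {a t Z : ℝ} (hZ : ∀ (κ : ℝ) (v : C4), v ≠ 0 → B v = (I * κ) • v →
      ‖∫ s in a..t, cexp ((s * κ : ℝ) * I) * G s‖ ^ 2 ≤ Z) (e : C4) :
    ‖∫ s in a..t, G s • exp ((s - a) • B) e‖ ^ 2 ≤ Z * ‖e‖ ^ 2 := by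
  have hsymm : ((-I) • B).toLinearMap.IsSymmetric := fun v w => by
    change (inner ℂ ((-I) • B v) w : ℂ) = inner ℂ v ((-I) • B w)
    rw [inner_smul_left, inner_smul_right, hB]
    simp
  have hn : Module.finrank ℂ C4 = 4 := by simp
  set b := hsymm.eigenvectorBasis hn
  set κ := hsymm.eigenvalues hn
  have hb : ∀ m, B (b m) = (I * (κ m : ℝ)) • b m := fun m => by
    have h : (-I) • B (b m) = ((κ m : ℝ) : ℂ) • b m := hsymm.apply_eigenvectorBasis hn m
    rw [mul_smul, ← h, smul_smul]
    simp
  have hcont : Continuous fun s => G s • exp ((s - a) • B) e :=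
    hG.smul ((continuous_flow B e).comp (continuous_id.sub continuous_const))
  rw [← b.sum_sq_norm_inner_right e, ← b.sum_sq_norm_inner_right, mul_sum]
  refine sum_le_sum fun m _ => ?_
  have h1 : (inner ℂ (b m) (∫ s in a..t, G s • exp ((s - a) • B) e) : ℂ) =
      cexp (-(((a * κ m : ℝ) : ℂ) * I)) * inner ℂ (b m) e *
        ∫ s in a..t, cexp ((s * κ m : ℝ) * I) * G s := by
    rw [← intervalIntegral.integral_const_mul]
    change (innerSL ℂ (b m)) _ = _
    rw [← ContinuousLinearMap.intervalIntegral_comp_comm _ (hcont.intervalIntegrable _ _)]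
    refine integral_congr fun s _ => ?_
    change (inner ℂ (b m) (G s • exp ((s - a) • B) e) : ℂ) = _
    rw [inner_smul_right, inner_flow hB (hb m)]
    have : cexp (((s - a) * κ m : ℝ) * I) =
        cexp (-(((a * κ m : ℝ) : ℂ) * I)) *
          cexp ((s * κ m : ℝ) * I) := by
      rw [← exp_add]; congr 1; push_cast; ring
    rw [this]; ring
  rw [h1, norm_mul, norm_mul, ← neg_mul, ← Complex.ofReal_neg, norm_exp_ofReal_mul_I, one_mul,
    mul_pow, mul_comm]
  have hbne : b m ≠ 0 := fun h0 => by
    have := b.norm_eq_one m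
    rw [h0, norm_zero] at this
    exact zero_ne_one this
  exact mul_le_mul_of_nonneg_right (hZ _ _ hbne (hb m)) (sq_nonneg _)

/-! ### Duhamel's formula with respect to the skew-adjoint flow -/

lemma exp_smul_sub (B : C4 →L[ℂ] C4) (x y : ℝ) (v : C4) :
    exp ((x - y) • B) v = exp ((-y) • B) (exp (x • B) v) := by
  have h : (x - y) • B = (-y) • B + x • B := by
    ext v : 1
    change (x - y) • B v = (-y) • B v + x • B v
    rw [← add_smul]; congr 1; ring
  have hc : Commute ((-y) • B) (x • B) := by
    ext v : 1
    change (-y) • B (x • B v) = x • B ((-y) • B v)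
    rw [map_real_smul B B.continuous, map_real_smul B B.continuous, smul_comm]
  rw [h, NormedSpace.exp_add_of_commute_of_mem_ball (𝕂 := ℂ) hc
    ((NormedSpace.expSeries_radius_eq_top ℂ (C4 →L[ℂ] C4)).symm ▸ edist_lt_top _ _)
    ((NormedSpace.expSeries_radius_eq_top ℂ (C4 →L[ℂ] C4)).symm ▸ edist_lt_top _ _)]
  rfl

lemma flow_comm (B : C4 →L[ℂ] C4) (s : ℝ) (v : C4) :
    exp (s • B) (B v) = B (exp (s • B) v) := by
  have h1 := hasDerivAt_exp_smul_const (𝕂 := ℝ) B s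
  have h2 := hasDerivAt_exp_smul_const' (𝕂 := ℝ) B s
  exact congrArg (fun T : C4 →L[ℂ] C4 => T v) (h1.unique h2)

lemma hasDerivAt_flow_apply (L : C4 →L[ℂ] C4) {w : ℝ → C4} {w' : C4} {s : ℝ}
    (hw : HasDerivAt w w' s) (c a : ℝ) :
    HasDerivAt (fun s : ℝ => exp ((c * s - a) • L) (w s))
      (exp ((c * s - a) • L) (c • L (w s) + w')) s := by
  have h0 : HasDerivAt (fun s : ℝ => c * s - a) c s := by
    simpa using ((hasDerivAt_id' s).const_mul c).sub_const a
  have h1 := (hasDerivAt_exp_smul_const (𝕂 := ℝ) L (c * s - a)).scomp s h0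
  have h2 : HasDerivAt (fun s : ℝ => (exp ((c * s - a) • L)).restrictScalars ℝ)
      ((c • (exp ((c * s - a) • L) * L)).restrictScalars ℝ) s :=
    (ContinuousLinearMap.restrictScalarsL ℂ C4 C4 ℝ ℝ).hasFDerivAt.comp_hasDerivAt s h1
  have h3 := h2.clm_apply hw
  refine h3.congr_deriv ?_
  change c • (exp ((c * s - a) • L)) (L (w s)) + (exp ((c * s - a) • L)) w' = _
  rw [map_add]
  congr 1
  exact ((exp ((c * s - a) • L)).restrictScalars ℝ).map_smul c (L (w s)) |>.symm

lemma hasDerivAt_backward (B : C4 →L[ℂ] C4) {G : ℝ → ℂ} (hG : Continuous G) (t : ℝ) (e : C4) (a : ℝ) :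
    HasDerivAt (fun a => ∫ s in a..t, G s • exp ((s - a) • B) e)
      (-(G a • e) - B (∫ s in a..t, G s • exp ((s - a) • B) e)) a := by
  have hc : Continuous fun s => G s • exp (s • B) e := hG.smul (continuous_flow B e)
  have hrep : ∀ a, (∫ s in a..t, G s • exp ((s - a) • B) e) =
      exp ((-a) • B) (∫ s in a..t, G s • exp (s • B) e) := fun a => by
    rw [← ContinuousLinearMap.intervalIntegral_comp_comm _ (hc.intervalIntegrable _ _)]
    refine integral_congr fun s _ => ?_
    rw [exp_smul_sub, map_smul]
  simp only [hrep]
  have hW : HasDerivAt (fun a => ∫ s in a..t, G s • exp (s • B) e)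
      (-(G a • exp (a • B) e)) a :=
    intervalIntegral.integral_hasDerivAt_left (hc.intervalIntegrable _ _)
      hc.stronglyMeasurable.stronglyMeasurableAtFilter hc.continuousAt
  have h := hasDerivAt_flow_apply B hW (-1) 0
  simp only [neg_one_mul, sub_zero] at h
  refine h.congr_deriv ?_
  have h0 : exp ((-a) • B) (exp (a • B) e) = e := by
    rw [← exp_smul_sub, sub_self, exp_zero_smul_apply]
  rw [neg_smul, one_smul, map_add, map_neg, map_neg, map_smul, h0, flow_comm]
  abel

/-- Duhamel's formula comparing two backward flows. -/
lemma backward_eq (B N : C4 →L[ℂ] C4) {G : ℝ → ℂ} (hG : Continuous G) (a t : ℝ) (e : C4) :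
    (∫ s in a..t, G s • exp ((s - a) • (B - N)) e) =
      (∫ s in a..t, G s • exp ((s - a) • B) e) -
        ∫ s in a..t, exp ((s - a) • (B - N))
          (N (∫ s' in s..t, G s' • exp ((s' - s) • B) e)) := by
  set Y : ℝ → C4 := fun a => ∫ s in a..t, G s • exp ((s - a) • B) e with hY
  have hYd := fun s => hasDerivAt_backward B hG t e s
  have hYc : Continuous Y := continuous_iff_continuousAt.2 fun s => (hYd s).continuousAt
  have hexpc : ∀ {w : ℝ → C4}, Continuous w →
      Continuous fun s => exp ((s - a) • (B - N)) (w s) := fun {w} hw => by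
    have h1 : Continuous fun s : ℝ => exp (s • (B - N)) :=
      continuous_iff_continuousAt.2 fun s => (hasDerivAt_exp_smul_const (𝕂 := ℝ) (B - N) s).continuousAt
    exact (h1.comp (continuous_id.sub continuous_const)).clm_apply hw
  have hd : ∀ s, HasDerivAt (fun s => exp ((s - a) • (B - N)) (Y s))
      (-(exp ((s - a) • (B - N)) (N (Y s))) -
        G s • exp ((s - a) • (B - N)) e) s := fun s => by
    have h := hasDerivAt_flow_apply (B - N) (hYd s) 1 a
    simp only [one_mul, one_smul] at h
    refine h.congr_deriv ?_
    have : (B - N) (Y s) + (-(G s • e) - B (Y s)) = -(N (Y s)) - G s • e := by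
      rw [sub_apply]; abel
    change exp ((s - a) • (B - N)) ((B - N) (Y s) + (-(G s • e) - B (Y s))) = _
    rw [this, map_sub, map_neg, map_smul]
  have hNc : Continuous fun s => exp ((s - a) • (B - N)) (N (Y s)) :=
    hexpc (N.continuous.comp hYc)
  have hGc : Continuous fun s => G s • exp ((s - a) • (B - N)) e :=
    hG.smul (hexpc continuous_const)
  have hi := integral_eq_sub_of_hasDerivAt (a := a) (b := t)
    (fun s _ => hd s) ((hNc.fun_neg.sub hGc).intervalIntegrable _ _)
  have hYt : Y t = 0 := by simp [hY]
  rw [hYt, map_zero, sub_self, exp_zero_smul_apply, intervalIntegral.integral_sub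
    (hNc.fun_neg.intervalIntegrable _ _) (hGc.intervalIntegrable _ _), intervalIntegral.integral_neg] at hi
  have hYa : (∫ s in a..t, G s • exp ((s - a) • B) e) = Y a := rfl
  rw [hYa]
  change _ = Y a - ∫ s in a..t, exp ((s - a) • (B - N)) (N (Y s))
  rw [zero_sub, ← neg_add', neg_inj] at hi
  rw [← hi]
  abel

lemma norm_sq_backward_le (B N : C4 →L[ℂ] C4)
    (hB : ∀ v w, (inner ℂ (B v) w : ℂ) = -inner ℂ v (B w)) {G : ℝ → ℂ} (hG : Continuous G)
    {a t : ℝ} (hat : a ≤ t) {Z k : ℝ → ℝ} (hZc : Continuous Z) (hkc : Continuous k)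
    (hk0 : ∀ s, 0 ≤ k s) {κ : ℝ} (hκ : ∫ s in a..t, k (s - a) ≤ κ)
    (hk : ∀ s, 0 ≤ s → ∀ v, ‖exp (s • (B - N)) (N v)‖ ≤ k s * ‖v‖)
    (hZ : ∀ s ∈ Icc a t, ∀ (κ : ℝ) (v : C4), v ≠ 0 → B v = (I * κ) • v →
      ‖∫ s' in s..t, cexp ((s' * κ : ℝ) * I) * G s'‖ ^ 2 ≤ Z s)
    {e : C4} (he : ‖e‖ = 1) :
    ‖∫ s in a..t, G s • exp ((s - a) • (B - N)) e‖ ^ 2 ≤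
      2 * Z a + 2 * κ * ∫ s in a..t, k (s - a) * Z s := by
  set Y : ℝ → C4 := fun a => ∫ s in a..t, G s • exp ((s - a) • B) e with hY
  have hYc : Continuous Y :=
    continuous_iff_continuousAt.2 fun s => (hasDerivAt_backward B hG t e s).continuousAt
  have hYZ : ∀ s ∈ Icc a t, ‖Y s‖ ^ 2 ≤ Z s := fun s hs => by
    have := norm_sq_integral_flow_le hB hG (hZ s hs) e
    rwa [he, one_pow, mul_one] at this
  have hka : Continuous fun s => k (s - a) := hkc.comp (continuous_id.sub continuous_const)
  have h1 : ‖∫ s in a..t, exp ((s - a) • (B - N)) (N (Y s))‖ ≤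
      ∫ s in a..t, k (s - a) * ‖Y s‖ := by
    refine intervalIntegral.norm_integral_le_of_norm_le hat (ae_of_all _ fun s hs => ?_)
      ((hka.mul hYc.norm).intervalIntegrable _ _)
    exact hk _ (by linarith [hs.1]) _
  have h2 : (∫ s in a..t, k (s - a) * ‖Y s‖) ^ 2 ≤
      (∫ s in a..t, k (s - a)) * ∫ s in a..t, k (s - a) * ‖Y s‖ ^ 2 := by
    have hq : ∀ x : ℝ, 0 ≤ (∫ s in a..t, k (s - a)) * (x * x) +
        (-2 * ∫ s in a..t, k (s - a) * ‖Y s‖) * x + ∫ s in a..t, k (s - a) * ‖Y s‖ ^ 2 := fun x => by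
      have e : (∫ s in a..t, k (s - a)) * (x * x) +
        (-2 * ∫ s in a..t, k (s - a) * ‖Y s‖) * x + (∫ s in a..t, k (s - a) * ‖Y s‖ ^ 2) =
          ∫ s in a..t, k (s - a) * (x - ‖Y s‖) ^ 2 := by
        rw [← intervalIntegral.integral_mul_const, ← intervalIntegral.integral_const_mul,
          ← intervalIntegral.integral_mul_const, ← intervalIntegral.integral_add,
          ← intervalIntegral.integral_add]
        · refine integral_congr fun s _ => ?_
          ring
        all_goals exact Continuous.intervalIntegrable (by fun_prop) _ _
      rw [e]
      exact intervalIntegral.integral_nonneg hat fun s _ => mul_nonneg (hk0 _) (sq_nonneg _)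
    have := discrim_le_zero hq
    unfold discrim at this
    linarith
  have h3 : ∫ s in a..t, k (s - a) * ‖Y s‖ ^ 2 ≤ ∫ s in a..t, k (s - a) * Z s :=
    intervalIntegral.integral_mono_on hat (Continuous.intervalIntegrable (by fun_prop) _ _)
      (Continuous.intervalIntegrable (by fun_prop) _ _) fun s hs =>
      mul_le_mul_of_nonneg_left (hYZ s hs) (hk0 _)
  have h0 : 0 ≤ ∫ s in a..t, k (s - a) := intervalIntegral.integral_nonneg hat fun s _ => hk0 _
  have h4 : 0 ≤ ∫ s in a..t, k (s - a) * ‖Y s‖ ^ 2 :=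
    intervalIntegral.integral_nonneg hat fun s _ => mul_nonneg (hk0 _) (sq_nonneg _)
  rw [backward_eq B N hG]
  have h5 : ‖Y a - ∫ s in a..t, exp ((s - a) • (B - N)) (N (Y s))‖ ^ 2 ≤
      2 * ‖Y a‖ ^ 2 + 2 * ‖∫ s in a..t, exp ((s - a) • (B - N)) (N (Y s))‖ ^ 2 := by
    set W := ∫ s in a..t, exp ((s - a) • (B - N)) (N (Y s))
    have := pow_le_pow_left₀ (norm_nonneg _) (norm_sub_le (Y a) W) 2
    linarith [sq_nonneg (‖Y a‖ - ‖W‖)]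
  refine h5.trans ?_
  have h6 : ‖∫ s in a..t, exp ((s - a) • (B - N)) (N (Y s))‖ ^ 2 ≤
      κ * ∫ s in a..t, k (s - a) * Z s :=
    (pow_le_pow_left₀ (norm_nonneg _) h1 2).trans <| h2.trans <|
      mul_le_mul hκ h3 h4 (h0.trans hκ)
  have h7 := hYZ a ⟨le_rfl, hat⟩
  linarith

/-! ### The dual estimate for the full system at localized frequencies -/

/-- The oscillatory integral over `[s, t]` along a phase. -/
def oscIntegral (θ ω : ℝ) (b : Prop) [Decidable b] (G : ℝ → 𝒮) (t s : ℝ) (ξ : R3) : ℂ :=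
  ∫ s' in s..t, cexp ((s' * phase θ ω b ξ : ℝ) * I) * G s' ξ

/-- The sum of the squares of the oscillatory integrals along the four phases. -/
def oscSq (Ω ω : ℝ) (G : ℝ → 𝒮) (t s : ℝ) (ξ : R3) : ℝ :=
  ‖oscIntegral Ω ω True G t s ξ‖ ^ 2 + ‖oscIntegral (-Ω) ω True G t s ξ‖ ^ 2 +
    (‖oscIntegral Ω ω False G t s ξ‖ ^ 2 + ‖oscIntegral (-Ω) ω False G t s ξ‖ ^ 2)

/-- The backward flow of the dual system with the force `G e`. -/
def backward (μ ε Ω : ℝ) (e : C4) (G : ℝ → 𝒮) (t a : ℝ) (ξ : R3) : C4 :=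
  ∫ s in a..t, G s ξ • exp ((s - a) •
    op (symB ε Ω ((2 * π) • ξ) - symN μ ((2 * π) • ξ))) e

section
variable {G : ℝ → 𝒮}

lemma continuous_oscIntegral (hG : Continuous fun z : ℝ × R3 => G z.1 z.2) (θ ω : ℝ) (b : Prop)
    [Decidable b] (t : ℝ) : Continuous fun z : R3 × ℝ => oscIntegral θ ω b G t z.2 z.1 := by
  have hp := continuous_phase θ ω b
  have hf : Continuous (uncurry fun (ξ : R3) (s : ℝ) =>
      cexp ((s * phase θ ω b ξ : ℝ) * I) * G s ξ) :=
    (by fun_prop : Continuous fun z : R3 × ℝ =>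
      cexp ((z.2 * phase θ ω b z.1 : ℝ) * I)).mul
      (hG.comp (continuous_snd.prodMk continuous_fst))
  have := (intervalIntegral.continuous_parametric_primitive_of_continuous (μ := volume)
    (a₀ := t) hf).neg
  refine this.congr fun z => ?_
  rw [oscIntegral, intervalIntegral.integral_symm]
  rfl

lemma continuous_oscSq (hG : Continuous fun z : ℝ × R3 => G z.1 z.2) (Ω ω : ℝ) (t : ℝ) :
    Continuous fun z : R3 × ℝ => oscSq Ω ω G t z.2 z.1 := by
  have h1 := continuous_oscIntegral hG Ω ω True t
  have h2 := continuous_oscIntegral hG (-Ω) ω True t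
  have h3 := continuous_oscIntegral hG Ω ω False t
  have h4 := continuous_oscIntegral hG (-Ω) ω False t
  unfold oscSq
  fun_prop

lemma continuous_oscIntegral_freq (hG : Continuous fun z : ℝ × R3 => G z.1 z.2) (θ ω : ℝ)
    (b : Prop) [Decidable b] (t s : ℝ) : Continuous fun ξ => oscIntegral θ ω b G t s ξ := by
  have h := (continuous_oscIntegral hG θ ω b t).comp
    (by fun_prop : Continuous fun ξ : R3 => ((ξ, s) : R3 × ℝ))
  exact h

lemma continuous_oscSq_freq (hG : Continuous fun z : ℝ × R3 => G z.1 z.2) (Ω ω : ℝ) (t s : ℝ) :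
    Continuous fun ξ => oscSq Ω ω G t s ξ := by
  have h := (continuous_oscSq hG Ω ω t).comp
    (by fun_prop : Continuous fun ξ : R3 => ((ξ, s) : R3 × ℝ))
  exact h

lemma continuous_oscSq_time (hG : Continuous fun z : ℝ × R3 => G z.1 z.2) (Ω ω : ℝ) (t : ℝ)
    (ξ : R3) : Continuous fun s => oscSq Ω ω G t s ξ := by
  have h := (continuous_oscSq hG Ω ω t).comp
    (by fun_prop : Continuous fun s : ℝ => ((ξ, s) : R3 × ℝ))
  exact h

lemma oscSq_nonneg (Ω ω t s : ℝ) (ξ : R3) : 0 ≤ oscSq Ω ω G t s ξ := by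
  unfold oscSq; positivity

lemma integrable_weight_comp_mul {S c : ℝ} (hc : 0 < c) {h : R3 → ℝ} (hh : Continuous h) :
    Integrable fun ξ => weight S (c • ξ) * h ξ := by
  have hm : Measurable fun ξ : R3 => weight S (c • ξ) :=
    (measurable_weight S).comp (measurable_const_smul c)
  have h1 : IntegrableOn (fun ξ => weight S (c • ξ) * h ξ) (Metric.closedBall 0 (S / c)) := by
    refine Integrable.bdd_mul (c := 2)
      (hh.continuousOn.integrableOn_compact (isCompact_closedBall _ _)) hm.aestronglyMeasurable
      (ae_of_all _ fun ξ => ?_)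
    rw [norm_of_nonneg (weight_nonneg _ _)]
    exact weight_le _ _
  rw [← integrableOn_univ]
  refine h1.of_forall_sdiff_eq_zero MeasurableSet.univ fun ξ hξ => ?_
  have : S / c < ‖ξ‖ := by simpa using hξ.2
  rw [weight_eq_zero, zero_mul]
  rw [norm_smul, norm_of_nonneg hc.le]
  rw [div_lt_iff₀ hc] at this
  linarith

/-- The hypotheses on the force of the dual problem: joint continuity of the force and of its
Fourier transform, boundedness, and a bound for the dual norm. -/
structure IsForce (γ N t : ℝ) (G : ℝ → 𝒮) : Prop where
  cont : Continuous fun z : ℝ × R3 => G z.1 z.2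
  bdd : ∃ M : ℝ, ∀ s ∈ Icc 0 t, ∀ ξ, ‖G s ξ‖ ≤ M
  cont_fourier : Continuous fun z : ℝ × R3 => (𝓕 (G z.1)) z.2
  pos : 0 < N
  bound : ∫⁻ s in Ioc 0 t, ofReal ((∫ x, ‖(𝓕 (G s)) x‖ ^ (2 / (1 + γ))) ^ ((1 + γ) / 2)) ^
      (2 / (2 - γ)) ≤ ofReal N

/-- The constant of the dual Strichartz estimate. -/
def strichartzBound (γ ω S Ω N : ℝ) : ℝ :=
  dualConst γ * (1088 * (ω ^ 3 * S ^ 3) / |Ω|) ^ γ * N ^ (2 - γ)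

variable {γ N t Ω ε lam : ℝ} {χ : R3 → ℝ}

lemma hasCompactSupport_cutoff_mul {χ : R3 → ℝ} (hχs : HasCompactSupport χ) (h : R3 → ℝ) :
    HasCompactSupport fun ξ => χ ξ ^ 2 * h ξ :=
  hχs.mono fun ξ hξ h0 => hξ (by simp only [h0]; ring)

lemma integrable_cutoff {χ : R3 → ℝ} (hχc : Continuous χ) (hχs : HasCompactSupport χ) {h : R3 → ℝ}
    (hh : Continuous h) : Integrable fun ξ => χ ξ ^ 2 * h ξ :=
  Continuous.integrable_of_hasCompactSupport (by fun_prop) (hasCompactSupport_cutoff_mul hχs h)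

lemma integral_cutoff_oscIntegral_le (hγ : 0 < γ) (hγ1 : γ < 1) (hG : IsForce γ N t G)
    {θ ω S : ℝ} (hθ : θ ≠ 0) (hω : 0 < ω) (hS : 1 ≤ S) (hχc : Continuous χ)
    (hχs : HasCompactSupport χ) (h0 : ∀ ξ, 0 ≤ χ ξ) (h1 : ∀ ξ, χ ξ ≤ 1)
    (hχ : ∀ ξ, χ ξ ≠ 0 → sig ((2 * π / ω) • ξ) ≤ S) (b : Prop) [Decidable b]
    {s : ℝ} (hs : s ∈ Icc 0 t) :
    ∫ ξ, χ ξ ^ 2 * ‖oscIntegral θ ω b G t s ξ‖ ^ 2 ≤ 2 * strichartzBound γ ω S θ N := by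
  have hst : ∫⁻ s in Ioc s t, ofReal ((∫ x, ‖(𝓕 (G s)) x‖ ^ (2 / (1 + γ))) ^ ((1 + γ) / 2)) ^
      (2 / (2 - γ)) ≤ ofReal N :=
    (lintegral_mono_set (Ioc_subset_Ioc_left hs.1)).trans hG.bound
  obtain ⟨M, hM⟩ := hG.bdd
  have key := dual_strichartz_phase hγ hγ1 hθ hω hS b hs.2 hG.cont
    ⟨M, fun s' hs' => hM s' ⟨hs.1.trans hs'.1, hs'.2⟩⟩ hG.cont_fourier hG.pos hst
  have hc : Continuous fun ξ => ‖oscIntegral θ ω b G t s ξ‖ ^ 2 :=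
    (continuous_oscIntegral_freq hG.cont θ ω b t s).norm.pow 2
  have hpi := pi_pos
  have hw : (0 : ℝ) < 2 * π / ω := by positivity
  refine le_trans ?_ (mul_le_mul_of_nonneg_left key (by norm_num : (0 : ℝ) ≤ 2))
  have i1 : Integrable fun ξ => χ ξ ^ 2 * ‖oscIntegral θ ω b G t s ξ‖ ^ 2 :=
    integrable_cutoff hχc hχs hc
  have i2 : Integrable fun ξ => 2 * (weight S ((2 * π / ω) • ξ) *
      ‖oscIntegral θ ω b G t s ξ‖ ^ 2) := (integrable_weight_comp_mul hw hc).const_mul 2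
  change _ ≤ 2 * ∫ ξ, weight S ((2 * π / ω) • ξ) * ‖oscIntegral θ ω b G t s ξ‖ ^ 2
  rw [← integral_const_mul]
  refine integral_mono_ae i1 i2 ?_
  · filter_upwards [ae_coord_ne 0 0] with ξ hξ
    rw [← mul_assoc]
    refine mul_le_mul_of_nonneg_right ?_ (by positivity)
    by_cases hx : χ ξ = 0
    · rw [hx]
      have := weight_nonneg S ((2 * π / ω) • ξ)
      simpa using this
    · have h2 : 1 / 2 ≤ weight S ((2 * π / ω) • ξ) := by
        refine le_weight (hχ ξ hx) ?_
        simp only [PiLp.smul_apply, smul_eq_mul]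
        exact mul_ne_zero hw.ne' hξ
      have h3 : χ ξ ^ 2 ≤ 1 := pow_le_one₀ (h0 ξ) (h1 ξ)
      linarith

lemma integral_cutoff_oscSq_le (hγ : 0 < γ) (hγ1 : γ < 1) (hG : IsForce γ N t G)
    {ω S : ℝ} (hΩ : Ω ≠ 0) (hω : 0 < ω) (hS : 1 ≤ S) (hχc : Continuous χ)
    (hχs : HasCompactSupport χ) (h0 : ∀ ξ, 0 ≤ χ ξ) (h1 : ∀ ξ, χ ξ ≤ 1)
    (hχ : ∀ ξ, χ ξ ≠ 0 → sig ((2 * π / ω) • ξ) ≤ S) {s : ℝ} (hs : s ∈ Icc 0 t) :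
    ∫ ξ, χ ξ ^ 2 * oscSq Ω ω G t s ξ ≤ 8 * strichartzBound γ ω S Ω N := by
  have hb : ∀ (θ : ℝ) (b : Prop) [Decidable b],
      Integrable fun ξ => χ ξ ^ 2 * ‖oscIntegral θ ω b G t s ξ‖ ^ 2 := fun θ b _ =>
    integrable_cutoff hχc hχs ((continuous_oscIntegral_freq hG.cont θ ω b t s).norm.pow 2)
  have hneg : strichartzBound γ ω S (-Ω) N = strichartzBound γ ω S Ω N := by
    rw [strichartzBound, abs_neg, strichartzBound]
  have hle : ∀ (θ : ℝ) (_ : θ ≠ 0) (b : Prop) [Decidable b], _ := fun θ hθ b _ =>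
    integral_cutoff_oscIntegral_le hγ hγ1 hG hθ hω hS hχc hχs h0 h1 hχ b hs
  have i1 := hle Ω hΩ True
  have i2 := hle (-Ω) (neg_ne_zero.2 hΩ) True
  have i3 := hle Ω hΩ False
  have i4 := hle (-Ω) (neg_ne_zero.2 hΩ) False
  rw [hneg] at i2 i4
  have e : ∀ ξ, χ ξ ^ 2 * oscSq Ω ω G t s ξ =
      (χ ξ ^ 2 * ‖oscIntegral Ω ω True G t s ξ‖ ^ 2 +
        χ ξ ^ 2 * ‖oscIntegral (-Ω) ω True G t s ξ‖ ^ 2) +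
      (χ ξ ^ 2 * ‖oscIntegral Ω ω False G t s ξ‖ ^ 2 +
        χ ξ ^ 2 * ‖oscIntegral (-Ω) ω False G t s ξ‖ ^ 2) := fun ξ => by
    unfold oscSq; ring
  simp only [e]
  rw [integral_add ((hb _ _).fun_add (hb _ _)) ((hb _ _).fun_add (hb _ _)), integral_add (hb _ _) (hb _ _),
    integral_add (hb _ _) (hb _ _)]
  linarith

lemma norm_sq_backward_le_oscSq {μ : ℝ} (hε : 0 < ε) (hΩ : Ω ≠ 0)
    (hG : Continuous fun z : ℝ × R3 => G z.1 z.2) {a : ℝ} (hat : a ≤ t) {k : ℝ → ℝ}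
    (hkc : Continuous k) (hk0 : ∀ s, 0 ≤ k s) {κ : ℝ} (hκ : ∫ s in a..t, k (s - a) ≤ κ) {ξ : R3}
    (hk : ∀ s, 0 ≤ s → ∀ v, ‖exp (s • op (symB ε Ω ((2 * π) • ξ) -
      symN μ ((2 * π) • ξ))) (op (symN μ ((2 * π) • ξ)) v)‖ ≤ k s * ‖v‖)
    {e : C4} (he : ‖e‖ = 1) :
    ‖backward μ ε Ω e G t a ξ‖ ^ 2 ≤ 2 * oscSq Ω (|Ω| * ε) G t a ξ +
      2 * κ * ∫ s in a..t, k (s - a) * oscSq Ω (|Ω| * ε) G t s ξ := by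
  have hZ := continuous_oscSq_time hG Ω (|Ω| * ε) t ξ
  have hGξ : Continuous fun s => G s ξ :=
    hG.comp (by fun_prop : Continuous fun s : ℝ => ((s, ξ) : ℝ × R3))
  unfold backward
  rw [op_sub] at hk ⊢
  refine norm_sq_backward_le _ _ (inner_opB ε Ω _) hGξ hat hZ hkc hk0 hκ hk (fun s _ κ v hv hκv => ?_) he
  obtain ⟨θ, hθ, h⟩ := eigenvalue_opB hε hΩ hv hκv
  have hsc : (|Ω| * ε)⁻¹ • (2 * π) • ξ = (2 * π / (|Ω| * ε)) • ξ := by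
    rw [smul_smul]; congr 1; rw [div_eq_inv_mul]
  rw [hsc] at h
  have hterm : ∀ (b : Prop) [Decidable b], κ = phase θ (|Ω| * ε) b ξ →
      ‖∫ s' in s..t, cexp ((s' * κ : ℝ) * I) * G s' ξ‖ ^ 2 =
        ‖oscIntegral θ (|Ω| * ε) b G t s ξ‖ ^ 2 := fun b _ hb => by rw [hb]; rfl
  have p1 := sq_nonneg ‖oscIntegral Ω (|Ω| * ε) True G t s ξ‖
  have p2 := sq_nonneg ‖oscIntegral (-Ω) (|Ω| * ε) True G t s ξ‖
  have p3 := sq_nonneg ‖oscIntegral Ω (|Ω| * ε) False G t s ξ‖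
  have p4 := sq_nonneg ‖oscIntegral (-Ω) (|Ω| * ε) False G t s ξ‖
  unfold oscSq
  rcases h with h | h
  · rw [hterm True (by rw [phase, if_pos trivial]; exact h)]
    rcases hθ with rfl | rfl <;> linarith
  · rw [hterm False (by rw [phase, if_neg not_false]; exact h)]
    rcases hθ with rfl | rfl <;> linarith

/-- The dual estimate for the full system, given a bound for the dissipative flow. -/
lemma integral_cutoff_backward_le {μ : ℝ} (hγ : 0 < γ) (hγ1 : γ < 1) (hG : IsForce γ N t G)
    (hε : 0 < ε) (hΩ : Ω ≠ 0) {S : ℝ} (hS : 1 ≤ S) (hχc : Continuous χ)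
    (hχs : HasCompactSupport χ) (h0 : ∀ ξ, 0 ≤ χ ξ) (h1 : ∀ ξ, χ ξ ≤ 1)
    (hχ : ∀ ξ, χ ξ ≠ 0 → sig ((2 * π / (|Ω| * ε)) • ξ) ≤ S)
    {a : ℝ} (ha : a ∈ Icc 0 t) {k : ℝ → ℝ}
    (hkc : Continuous k) (hk0 : ∀ s, 0 ≤ k s) {κ : ℝ} (hκ : ∫ s in a..t, k (s - a) ≤ κ)
    (hk : ∀ ξ, χ ξ ≠ 0 → ∀ s, 0 ≤ s → ∀ v, ‖exp (s • op (symB ε Ω ((2 * π) • ξ) -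
      symN μ ((2 * π) • ξ))) (op (symN μ ((2 * π) • ξ)) v)‖ ≤ k s * ‖v‖)
    {e : C4} (he : ‖e‖ = 1) :
    ∫ ξ, χ ξ ^ 2 * ‖backward μ ε Ω e G t a ξ‖ ^ 2 ≤
      16 * (1 + κ ^ 2) * strichartzBound γ (|Ω| * ε) S Ω N := by
  set ω := |Ω| * ε with hω
  have hω0 : 0 < ω := mul_pos (abs_pos.2 hΩ) hε
  set X := strichartzBound γ ω S Ω N
  have hZc := continuous_oscSq hG.cont Ω ω t
  have hosc := fun s (hs : s ∈ Icc 0 t) =>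
    integral_cutoff_oscSq_le hγ hγ1 hG hΩ hω0 hS hχc hχs h0 h1 hχ hs
  have hkint : 0 ≤ ∫ s in a..t, k (s - a) := intervalIntegral.integral_nonneg ha.2 fun s _ => hk0 _
  have hκ0 : 0 ≤ κ := hkint.trans hκ
  have hX : 0 ≤ X := by
    have h2 := hosc a ha
    have h3 : 0 ≤ ∫ ξ, χ ξ ^ 2 * oscSq Ω ω G t a ξ :=
      integral_nonneg fun ξ => mul_nonneg (sq_nonneg _) (oscSq_nonneg _ _ _ _ _)
    linarith
  have hka : Continuous fun s => k (s - a) := hkc.comp (continuous_id.sub continuous_const)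
  have hc1 := continuous_oscSq_freq hG.cont Ω ω t a
  have hF : Continuous (uncurry fun (ξ : R3) (s : ℝ) => k (s - a) * oscSq Ω ω G t s ξ) :=
    (hka.comp continuous_snd).mul hZc
  have hc2 : Continuous fun ξ => ∫ s in a..t, k (s - a) * oscSq Ω ω G t s ξ :=
    intervalIntegral.continuous_parametric_intervalIntegral_of_continuous' hF a t
  have i1 := integrable_cutoff hχc hχs hc1
  have i2 := integrable_cutoff hχc hχs hc2
  have hswap : ∫ ξ, χ ξ ^ 2 * ∫ s in a..t, k (s - a) * oscSq Ω ω G t s ξ =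
      ∫ s in a..t, k (s - a) * ∫ ξ, χ ξ ^ 2 * oscSq Ω ω G t s ξ := by
    have hint : Integrable (uncurry fun (ξ : R3) (s : ℝ) =>
        χ ξ ^ 2 * (k (s - a) * oscSq Ω ω G t s ξ)) (volume.prod (volume.restrict (Ioc a t))) := by
      have hcc : Continuous (uncurry fun (ξ : R3) (s : ℝ) =>
        χ ξ ^ 2 * (k (s - a) * oscSq Ω ω G t s ξ)) := ((hχc.comp continuous_fst).pow 2).mul hF
      have h1 : IntegrableOn (uncurry fun (ξ : R3) (s : ℝ) =>
        χ ξ ^ 2 * (k (s - a) * oscSq Ω ω G t s ξ)) (tsupport χ ×ˢ Icc a t) (volume.prod volume) :=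
        hcc.continuousOn.integrableOn_compact (hχs.isCompact.prod isCompact_Icc)
      have h2 : IntegrableOn (uncurry fun (ξ : R3) (s : ℝ) =>
        χ ξ ^ 2 * (k (s - a) * oscSq Ω ω G t s ξ)) (univ ×ˢ Ioc a t) (volume.prod volume) := by
        refine h1.of_forall_sdiff_eq_zero (MeasurableSet.univ.prod measurableSet_Ioc) ?_
        rintro ⟨ξ, s⟩ ⟨hx1, hx2⟩
        have : χ ξ = 0 := by
          by_contra hne
          exact hx2 ⟨subset_tsupport _ hne, Ioc_subset_Icc_self hx1.2⟩
        simp [uncurry, this]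
      rwa [IntegrableOn, ← Measure.prod_restrict, Measure.restrict_univ] at h2
    simp only [integral_of_le ha.2, ← integral_const_mul]
    rw [integral_integral_swap hint]
    refine integral_congr_ae (ae_of_all _ fun s => ?_)
    refine integral_congr_ae (ae_of_all _ fun ξ => ?_)
    simp only; ring
  calc ∫ ξ, χ ξ ^ 2 * ‖backward μ ε Ω e G t a ξ‖ ^ 2
      ≤ ∫ ξ, (2 * (χ ξ ^ 2 * oscSq Ω ω G t a ξ) +
          2 * κ * (χ ξ ^ 2 * ∫ s in a..t, k (s - a) * oscSq Ω ω G t s ξ)) := by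
        refine integral_mono_of_nonneg (ae_of_all _ fun ξ => by positivity)
          ((i1.const_mul 2).add (i2.const_mul (2 * κ))) (ae_of_all _ fun ξ => ?_)
        by_cases hx : χ ξ = 0
        · simp [hx]
        · have := norm_sq_backward_le_oscSq hε hΩ hG.cont ha.2 hkc hk0 hκ (hk ξ hx) he
          have h2 := mul_le_mul_of_nonneg_left this (sq_nonneg (χ ξ))
          simp only
          linarith
    _ = 2 * (∫ ξ, χ ξ ^ 2 * oscSq Ω ω G t a ξ) +
          2 * κ * ∫ s in a..t, k (s - a) * ∫ ξ, χ ξ ^ 2 * oscSq Ω ω G t s ξ := by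
        rw [integral_add (i1.const_mul 2) (i2.const_mul (2 * κ)), integral_const_mul,
          integral_const_mul, hswap]
    _ ≤ 2 * (8 * X) + 2 * κ * (κ * (8 * X)) := by
        have h2 : ∫ s in a..t, k (s - a) * ∫ ξ, χ ξ ^ 2 * oscSq Ω ω G t s ξ ≤ κ * (8 * X) := by
          have hcont : Continuous fun s => ∫ ξ, χ ξ ^ 2 * oscSq Ω ω G t s ξ := by
            have h3 : ∀ s, ∫ ξ, χ ξ ^ 2 * oscSq Ω ω G t s ξ =
                ∫ ξ in tsupport χ, χ ξ ^ 2 * oscSq Ω ω G t s ξ := fun s => by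
              rw [setIntegral_eq_integral_of_forall_compl_eq_zero]
              intro ξ hξ
              rw [image_eq_zero_of_notMem_tsupport hξ]; simp
            simp only [h3]
            exact continuous_parametric_integral_of_continuous
              (((hχc.comp continuous_snd).pow 2).mul
                (hZc.comp (continuous_snd.prodMk continuous_fst))) hχs.isCompact
          calc _ ≤ ∫ s in a..t, k (s - a) * (8 * X) := by
                refine intervalIntegral.integral_mono_on ha.2
                  ((hka.mul hcont).intervalIntegrable _ _)
                  ((hka.mul continuous_const).intervalIntegrable _ _) fun s hs => ?_
                exact mul_le_mul_of_nonneg_left (hosc s ⟨ha.1.trans hs.1, hs.2⟩) (hk0 _)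
            _ ≤ _ := by
                rw [intervalIntegral.integral_mul_const]
                exact mul_le_mul_of_nonneg_right hκ (by positivity)
        have h3 := hosc a ha
        have h4 := mul_le_mul_of_nonneg_left h2 (by positivity : (0 : ℝ) ≤ 2 * κ)
        linarith
    _ = _ := by ring

end

/-! ### Uniform boundedness for tempered distributions -/

/-- A tempered distribution as a continuous linear map. -/
def Distr.toCLM (T : Distr) : 𝒮 →L[ℂ] ℂ := T

lemma Distr.toCLM_apply (T : Distr) (θ : 𝒮) : Distr.toCLM T θ = T θ := rfl

/-- An absolutely convergent combination of a bounded sequence of Schwartz functions converges. -/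
lemma exists_hasSum_schwartz {ψ : ℕ → 𝒮}
    (hψ : ∀ k n, ∃ M : ℝ, ∀ N, seminorm ℂ k n (ψ N) ≤ M) {c : ℕ → ℂ}
    (hc : Summable fun N => ‖c N‖) : ∃ φ : 𝒮, HasSum (fun N => c N • ψ N) φ := by
  choose M hM using hψ
  have hM0 : ∀ k n, 0 ≤ M k n := fun k n => (apply_nonneg _ (ψ 0)).trans (hM k n 0)
  have hit : ∀ (n N : ℕ) (x : R3), iteratedFDeriv ℝ n (fun y => c N * ψ N y) x =
      c N • iteratedFDeriv ℝ n (ψ N) x := fun n N x =>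
    iteratedFDeriv_const_smul_apply' (𝕜 := ℝ) (a := c N) ((ψ N).smooth n).contDiffAt
  have hb : ∀ (k n N : ℕ) (x : R3), ‖x‖ ^ k * ‖iteratedFDeriv ℝ n (fun y => c N * ψ N y) x‖ ≤
      ‖c N‖ * M k n := fun k n N x => by
    rw [hit, norm_smul, mul_left_comm]
    exact mul_le_mul_of_nonneg_left ((SchwartzMap.le_seminorm ℂ k n (ψ N) x).trans (hM k n N))
      (norm_nonneg _)
  have hb0 : ∀ (n N : ℕ) (x : R3), ‖iteratedFDeriv ℝ n (fun y => c N * ψ N y) x‖ ≤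
      ‖c N‖ * M 0 n := fun n N x => by simpa using hb 0 n N x
  have hsm : ∀ N, ContDiff ℝ ((⊤ : ℕ∞) : WithTop ℕ∞) fun y => c N * ψ N y := fun N =>
    contDiff_const.mul ((ψ N).smooth ⊤)
  have hsum : ∀ k n, Summable fun N => ‖c N‖ * M k n := fun k n => hc.mul_right _
  have hiter : ∀ (n : ℕ) (x : R3), iteratedFDeriv ℝ n (fun y => ∑' N, c N * ψ N y) x =
      ∑' N, iteratedFDeriv ℝ n (fun y => c N * ψ N y) x := fun n x =>
    iteratedFDeriv_tsum_apply (N := ⊤) hsm (fun k _ => hsum 0 k) (fun k N x _ => hb0 k N x) le_top x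
  have hitsum : ∀ (n : ℕ) (x : R3), Summable fun N => iteratedFDeriv ℝ n (fun y => c N * ψ N y) x :=
    fun n x => Summable.of_norm_bounded (hsum 0 n) fun N => hb0 n N x
  have htail : ∀ (s : Finset ℕ) (k n : ℕ) (x : R3),
      ‖x‖ ^ k * ‖(∑' N, iteratedFDeriv ℝ n (fun y => c N * ψ N y) x) -
        ∑ N ∈ s, iteratedFDeriv ℝ n (fun y => c N * ψ N y) x‖ ≤
      (∑' N, ‖c N‖ * M k n) - ∑ N ∈ s, ‖c N‖ * M k n := fun s k n x => by
    rw [← (hitsum n x).sum_add_tsum_subtype_compl s, ← (hsum k n).sum_add_tsum_subtype_compl s,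
      add_sub_cancel_left, add_sub_cancel_left]
    have h1 : ‖x‖ ^ k * ‖∑' N : {N // N ∉ s}, iteratedFDeriv ℝ n (fun y => c N * ψ N y) x‖ =
        ‖∑' N : {N // N ∉ s}, ‖x‖ ^ k • iteratedFDeriv ℝ n (fun y => c N * ψ N y) x‖ := by
      rw [tsum_const_smul'', norm_smul, norm_of_nonneg (by positivity)]
    rw [h1]
    refine tsum_of_norm_bounded ((hsum k n).subtype _).hasSum fun N => ?_
    rw [norm_smul, norm_of_nonneg (by positivity)]
    exact hb k n N x
  let φ : 𝒮 :=
    { toFun := fun y => ∑' N, c N * ψ N y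
      smooth' := contDiff_tsum (N := ⊤) hsm (fun k _ => hsum 0 k) (fun k N x _ => hb0 k N x)
      decay' := fun k n => ⟨∑' N, ‖c N‖ * M k n, fun x => by
        rw [hiter]
        simpa using htail ∅ k n x⟩ }
  have hφ : ∀ y, φ y = ∑' N, c N * ψ N y := fun y => rfl
  refine ⟨φ, ?_⟩
  rw [HasSum, (schwartz_withSeminorms ℂ R3 ℂ).tendsto_nhds]
  rintro ⟨k, n⟩ δ hδ
  have hlim := (hsum k n).hasSum
  rw [HasSum, Metric.tendsto_nhds] at hlim
  filter_upwards [hlim δ hδ] with s hs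
  rw [Real.dist_eq, abs_sub_comm] at hs
  refine (SchwartzMap.seminorm_le_bound ℂ k n _ (abs_nonneg _) fun x => ?_).trans_lt hs
  refine le_trans (le_of_eq ?_) ((htail s k n x).trans (le_abs_self _))
  have hfun : (⇑(∑ N ∈ s, c N • ψ N - φ) : R3 → ℂ) =
      fun y => (∑ N ∈ s, c N * ψ N y) - ∑' N, c N * ψ N y := by
    ext y
    rw [sub_apply, hφ]
    congr 1
    simp
  have hcφ : ContDiff ℝ n fun y => ∑' N, c N * ψ N y := φ.smooth n
  have hcs : ContDiff ℝ n fun y => ∑ N ∈ s, c N * ψ N y :=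
    ContDiff.sum fun N _ => contDiff_const.mul ((ψ N).smooth n)
  rw [hfun, show (fun y => (∑ N ∈ s, c N * ψ N y) - ∑' N, c N * ψ N y) =
    (fun y => ∑ N ∈ s, c N * ψ N y) - fun y => ∑' N, c N * ψ N y from rfl,
    iteratedFDeriv_sub_apply hcs.contDiffAt hcφ.contDiffAt, hiter, norm_sub_rev]
  congr 3
  exact iteratedFDeriv_fun_sum_apply fun N _ => (contDiff_const.mul ((ψ N).smooth n)).contDiffAt

lemma isBounded_apply {ψ : ℕ → 𝒮}
    (hψ : ∀ k n, ∃ M : ℝ, ∀ N, seminorm ℂ k n (ψ N) ≤ M) (T : Distr) :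
    ∃ C : ℝ, ∀ N, ‖T (ψ N)‖ ≤ C := by
  have h1 : Bornology.IsVonNBounded ℂ (range ψ) := by
    rw [(schwartz_withSeminorms ℂ R3 ℂ).isVonNBounded_iff_seminorm_bounded]
    rintro ⟨k, n⟩
    obtain ⟨M, hM⟩ := hψ k n
    refine ⟨|M| + 1, by positivity, ?_⟩
    rintro _ ⟨N, rfl⟩
    exact (hM N).trans_lt (by linarith [le_abs_self M])
  have h2 := h1.image (Distr.toCLM T)
  rw [NormedSpace.isVonNBounded_iff] at h2
  obtain ⟨C, hC⟩ := h2.exists_norm_le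
  exact ⟨C, fun N => hC _ ⟨ψ N, ⟨N, rfl⟩, rfl⟩⟩

/-- A pointwise bounded family of tempered distributions is bounded on bounded sequences. -/
lemma exists_bound_of_pointwise {ι : Type*} {T : ι → Distr} (hT : ∀ θ, ∃ C : ℝ, ∀ i, ‖T i θ‖ ≤ C)
    {ψ : ℕ → 𝒮} (hψ : ∀ k n, ∃ M : ℝ, ∀ N, seminorm ℂ k n (ψ N) ≤ M) :
    ∃ C : ℝ, ∀ i N, ‖T i (ψ N)‖ ≤ C := by
  have hsum1 : ∀ c : lp (fun _ : ℕ => ℂ) 1, Summable fun N => ‖c N‖ := fun c => by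
    have := (lp.memℓp c).summable (by norm_num)
    simpa using this
  have hnorm : ∀ c : lp (fun _ : ℕ => ℂ) 1, ‖c‖ = ∑' N, ‖c N‖ := fun c => by
    have := lp.norm_eq_tsum_rpow (p := 1) (by norm_num) c
    simpa using this
  choose B hB using fun i => isBounded_apply hψ (T i)
  have hsum2 : ∀ i (c : lp (fun _ : ℕ => ℂ) 1), Summable fun N => c N * T i (ψ N) := fun i c => by
    refine Summable.of_norm_bounded ((hsum1 c).mul_right (B i)) fun N => ?_
    rw [norm_mul]
    exact mul_le_mul_of_nonneg_left (hB i N) (norm_nonneg _)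
  let g : ι → lp (fun _ : ℕ => ℂ) 1 →L[ℂ] ℂ := fun i => LinearMap.mkContinuous
    { toFun := fun c => ∑' N, c N * T i (ψ N)
      map_add' := fun c d => by
        rw [← (hsum2 i c).tsum_add (hsum2 i d)]
        refine tsum_congr fun N => ?_
        rw [lp.coeFn_add, Pi.add_apply, add_mul]
      map_smul' := fun a c => by
        rw [RingHom.id_apply, smul_eq_mul, ← tsum_mul_left]
        refine tsum_congr fun N => ?_
        rw [lp.coeFn_smul, Pi.smul_apply, smul_eq_mul, mul_assoc] } (B i) fun c => by
      change ‖∑' N, c N * T i (ψ N)‖ ≤ _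
      rw [hnorm, mul_comm, ← tsum_mul_right]
      refine tsum_of_norm_bounded ((hsum1 c).mul_right (B i)).hasSum fun N => ?_
      rw [norm_mul]
      exact mul_le_mul_of_nonneg_left (hB i N) (norm_nonneg _)
  have hg : ∀ i c, g i c = ∑' N, c N * T i (ψ N) := fun i c => rfl
  obtain ⟨C, hC⟩ := banach_steinhaus (g := g) fun c => by
    obtain ⟨φ, hφ⟩ := exists_hasSum_schwartz hψ (hsum1 c)
    obtain ⟨C, hC⟩ := hT φ
    refine ⟨C, fun i => ?_⟩
    have h1 := hφ.mapL (Distr.toCLM (T i))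
    simp only [map_smul, smul_eq_mul, Distr.toCLM_apply] at h1
    rw [hg, h1.tsum_eq]
    exact hC i
  refine ⟨C, fun i N => ?_⟩
  have h1 := (g i).le_of_opNorm_le (hC i) (lp.single 1 N (1 : ℂ))
  rw [hg, tsum_eq_single N (fun N' hN' => by rw [lp.single_apply_ne _ _ _ hN', zero_mul]),
    lp.single_apply_self, one_mul, lp.norm_single (by norm_num)] at h1
  simpa using h1

/-! ### The system on the Fourier side -/

/-- The components `(a, u)` of the state as a single family. -/
def state (a : Distr) (u : Fin 3 → Distr) : Fin 4 → Distr := ![a, u 0, u 1, u 2]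

/-- The entries of the symbol of the dual system, in Mathlib's frequency variable. -/
def symbolEntry (μ ε Ω : ℝ) (k l : Fin 4) (ξ : R3) : ℂ :=
  (symB ε Ω ((2 * π) • ξ) - symN μ ((2 * π) • ξ)) k l

lemma hasTemperateGrowth_coord (k : Fin 3) :
    Function.HasTemperateGrowth fun ξ : R3 => ((ξ k : ℝ) : ℂ) := by
  have h : (fun ξ : R3 => ((ξ k : ℝ) : ℂ)) = Complex.ofReal ∘ (proj k : R3 →L[ℝ] ℝ) :=
    rfl
  rw [h]
  exact Function.HasTemperateGrowth.comp (by fun_prop)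
    (proj k : R3 →L[ℝ] ℝ).hasTemperateGrowth

lemma hasTemperateGrowth_symbolEntry (μ ε Ω : ℝ) (k l : Fin 4) :
    Function.HasTemperateGrowth (symbolEntry μ ε Ω k l) := by
  have h0 := hasTemperateGrowth_coord 0
  have h1 := hasTemperateGrowth_coord 1
  have h2 := hasTemperateGrowth_coord 2
  have hn : ∀ ξ : R3, ((‖(2 * π) • ξ‖ : ℝ) : ℂ) ^ 2 =
      (2 * π) ^ 2 * ((ξ 0 : ℂ) ^ 2 + (ξ 1 : ℂ) ^ 2 + (ξ 2 : ℂ) ^ 2) := fun ξ => by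
    rw [← ofReal_pow, norm_smul, mul_pow, norm_sq_R3, norm_eq_abs, sq_abs]
    push_cast; ring
  unfold symbolEntry
  fin_cases k <;> fin_cases l <;> simp [symB, symN, hn, div_eq_mul_inv] <;> fun_prop

/-- Multiplication by `i ζ_k`, the Fourier image of a partial derivative. -/
def derivMul (k : Fin 3) : 𝒮 →L[ℂ] 𝒮 :=
  smulLeftCLM ℂ fun ξ : R3 => I * (2 * π * (ξ k : ℂ))

lemma derivMul_apply (k : Fin 3) (ψ : 𝒮) (ξ : R3) :
    derivMul k ψ ξ = I * (2 * π * (ξ k : ℂ)) * ψ ξ := by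
  have h0 := hasTemperateGrowth_coord k
  rw [derivMul, smulLeftCLM_apply_apply (by fun_prop), smul_eq_mul]

lemma fourier_deriv_apply (k : Fin 3) (T : Distr) (ψ : 𝒮) :
    (∂_{basisVec k} T) (𝓕 ψ) = T (𝓕 (derivMul k ψ)) := by
  rw [TemperedDistribution.lineDerivOp_apply_apply, SchwartzMap.lineDerivOp_fourier_eq,
    ← FourierTransform.fourier_neg]
  congr 2
  ext ξ
  have h : Function.HasTemperateGrowth fun x : R3 => inner ℝ x (basisVec k) := by fun_prop
  rw [neg_apply, smul_apply, smulLeftCLM_apply_apply h, inner_basisVec, derivMul_apply]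
  simp only [smul_eq_mul, real_smul]
  ring

lemma fourier_laplacian_apply (T : Distr) (ψ : 𝒮) :
    (Laplacian.laplacian T) (𝓕 ψ) = T (𝓕 (derivMul 0 (derivMul 0 ψ))) +
      T (𝓕 (derivMul 1 (derivMul 1 ψ))) + T (𝓕 (derivMul 2 (derivMul 2 ψ))) := by
  have hb : ∀ i, (EuclideanSpace.basisFun (Fin 3) ℝ) i = basisVec i := fun i => by simp [basisVec]
  rw [TemperedDistribution.laplacian_eq_sum (EuclideanSpace.basisFun (Fin 3) ℝ)]
  simp only [hb, Fin.sum_univ_three]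
  change (∂_{basisVec 0} (∂_{basisVec 0} T)) (𝓕 ψ) + (∂_{basisVec 1} (∂_{basisVec 1} T)) (𝓕 ψ) +
    (∂_{basisVec 2} (∂_{basisVec 2} T)) (𝓕 ψ) = _
  simp only [fourier_deriv_apply]

lemma fourier_divergence_apply (u : Fin 3 → Distr) (ψ : 𝒮) :
    (divergence u) (𝓕 ψ) = u 0 (𝓕 (derivMul 0 ψ)) + u 1 (𝓕 (derivMul 1 ψ)) +
      u 2 (𝓕 (derivMul 2 ψ)) := by
  unfold divergence
  rw [Fin.sum_univ_three]
  change (∂_{basisVec 0} (u 0)) (𝓕 ψ) + (∂_{basisVec 1} (u 1)) (𝓕 ψ) +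
    (∂_{basisVec 2} (u 2)) (𝓕 ψ) = _
  simp only [fourier_deriv_apply]

/-- Multiplication of a Schwartz function by an entry of the symbol. -/
def symbolMul (μ ε Ω : ℝ) (k l : Fin 4) : 𝒮 →L[ℂ] 𝒮 :=
  smulLeftCLM ℂ (symbolEntry μ ε Ω k l)

lemma symbolMul_apply (μ ε Ω : ℝ) (k l : Fin 4) (ψ : 𝒮) (ξ : R3) :
    symbolMul μ ε Ω k l ψ ξ = symbolEntry μ ε Ω k l ξ * ψ ξ := by
  rw [symbolMul, smulLeftCLM_apply_apply (hasTemperateGrowth_symbolEntry μ ε Ω k l),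
    smul_eq_mul]

section
variable (μ ε Ω : ℝ) (ψ : 𝒮)

lemma symbolMul_zero_zero : symbolMul μ ε Ω 0 0 ψ = 0 := by
  ext ξ
  simp [symbolMul_apply, symbolEntry, symB, symN]

lemma symbolMul_zero_succ (k : Fin 3) :
    symbolMul μ ε Ω 0 k.succ ψ = (-(1 / ε : ℝ) : ℂ) • derivMul k ψ := by
  ext ξ
  rw [symbolMul_apply, smul_apply, derivMul_apply]
  fin_cases k <;> simp [symbolEntry, symB, symN] <;> ring

lemma symbolMul_succ_zero (k : Fin 3) :
    symbolMul μ ε Ω k.succ 0 ψ = (-(1 / ε : ℝ) : ℂ) • derivMul k ψ := by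
  ext ξ
  rw [symbolMul_apply, smul_apply, derivMul_apply]
  fin_cases k <;> simp [symbolEntry, symB, symN] <;> ring

lemma symbolMul_succ_succ (l k : Fin 3) :
    symbolMul μ ε Ω l.succ k.succ ψ =
      (if l = k then (μ : ℂ) • (derivMul 0 (derivMul 0 ψ) + derivMul 1 (derivMul 1 ψ) +
        derivMul 2 (derivMul 2 ψ)) else 0) + (1 - μ : ℂ) • derivMul l (derivMul k ψ) +
      ((if l = 1 ∧ k = 0 then (Ω : ℂ) else 0) - (if l = 0 ∧ k = 1 then (Ω : ℂ) else 0)) • ψ := by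
  have hn : ∀ ξ : R3, ((‖(2 * π) • ξ‖ : ℝ) : ℂ) ^ 2 =
      (2 * π) ^ 2 * ((ξ 0 : ℂ) ^ 2 + (ξ 1 : ℂ) ^ 2 + (ξ 2 : ℂ) ^ 2) := fun ξ => by
    rw [← ofReal_pow, norm_smul, mul_pow, norm_sq_R3, norm_eq_abs, sq_abs]
    push_cast; ring
  have hI := Complex.I_mul_I
  ext ξ
  fin_cases l <;> fin_cases k <;>
  · simp [symbolMul_apply, symbolEntry, symB, symN, hn, derivMul_apply]
    ring_nf
    try simp only [I_sq]
    try ring_nf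

end

lemma lame_fourier {μ μ' : ℝ} (hν : 2 * μ + μ' = 1) (u : Fin 3 → Distr) (k : Fin 3)
    (ψ : 𝒮) : lame μ μ' u k (𝓕 ψ) =
      (μ : ℂ) * (u k (𝓕 (derivMul 0 (derivMul 0 ψ))) + u k (𝓕 (derivMul 1 (derivMul 1 ψ))) +
        u k (𝓕 (derivMul 2 (derivMul 2 ψ)))) +
      (1 - μ : ℂ) * (u 0 (𝓕 (derivMul 0 (derivMul k ψ))) + u 1 (𝓕 (derivMul 1 (derivMul k ψ))) +
        u 2 (𝓕 (derivMul 2 (derivMul k ψ)))) := by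
  have h : ((μ + μ' : ℝ) : ℂ) = 1 - μ := by
    have : μ + μ' = 1 - μ := by linarith
    rw [this]; push_cast; ring
  unfold lame
  rw [h]
  change (μ : ℂ) * (Laplacian.laplacian (u k)) (𝓕 ψ) +
    (1 - μ : ℂ) * (∂_{basisVec k} (divergence u)) (𝓕 ψ) = _
  rw [fourier_laplacian_apply, fourier_deriv_apply, fourier_divergence_apply]

lemma IsSolution.weak_fourier {μ μ' ε Ω T : ℝ} (hν : 2 * μ + μ' = 1) {a₀ : Distr}
    {u₀ : Fin 3 → Distr} {f : ℝ → Distr} {g : ℝ → Fin 3 → Distr} {a : ℝ → Distr}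
    {u : ℝ → Fin 3 → Distr} (h : IsSolution μ μ' ε Ω T a₀ u₀ f g a u) {s : ℝ} (hs : s ∈ Icc 0 T)
    (k : Fin 4) (ψ : 𝒮) :
    state (a s) (u s) k (𝓕 ψ) = state a₀ u₀ k (𝓕 ψ) +
      ∫ σ in (0 : ℝ)..s, (state (f σ) (g σ) k (𝓕 ψ) +
        ∑ l, state (a σ) (u σ) l (𝓕 (symbolMul μ ε Ω l k ψ))) := by
  have hadd : ∀ (T : Distr) (ψ₁ ψ₂ : 𝒮), T (𝓕 (ψ₁ + ψ₂)) = T (𝓕 ψ₁) + T (𝓕 ψ₂) :=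
    fun T ψ₁ ψ₂ => by rw [FourierTransform.fourier_add, map_add]
  have hsmul : ∀ (T : Distr) (c : ℂ) (ψ : 𝒮), T (𝓕 (c • ψ)) = c * T (𝓕 ψ) :=
    fun T c ψ => by rw [FourierTransform.fourier_smul, map_smul, smul_eq_mul]
  have hzero : ∀ T : Distr, T (𝓕 (0 : 𝒮)) = 0 := fun T => by
    have := hsmul T 0 0
    rwa [zero_smul, zero_mul] at this
  refine Fin.cases ?_ (fun i => ?_) k
  · have := h.eq_a s hs (𝓕 ψ)
    change a s (𝓕 ψ) = a₀ (𝓕 ψ) + ∫ σ in (0 : ℝ)..s, (f σ (𝓕 ψ) + _)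
    rw [this]
    congr 1
    refine integral_congr fun σ _ => ?_
    change f σ (𝓕 ψ) - ((1 / ε : ℝ) : ℂ) * divergence (u σ) (𝓕 ψ) = _
    rw [fourier_divergence_apply, Fin.sum_univ_succ, Fin.sum_univ_three, symbolMul_zero_zero, hzero]
    simp only [symbolMul_succ_zero, hsmul]
    change _ = f σ (𝓕 ψ) + (0 + (_ * u σ 0 _ + _ * u σ 1 _ + _ * u σ 2 _))
    ring
  · have := h.eq_u s hs i (𝓕 ψ)
    have hst : ∀ (a : Distr) (u : Fin 3 → Distr) (i : Fin 3), state a u i.succ = u i :=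
      fun a u i => by fin_cases i <;> rfl
    rw [hst, hst, this]
    congr 1
    refine integral_congr fun σ _ => ?_
    change g σ i (𝓕 ψ) + lame μ μ' (u σ) i (𝓕 ψ) - (Ω : ℂ) * e3Cross (u σ) i (𝓕 ψ) -
      ((1 / ε : ℝ) : ℂ) * (∂_{basisVec i} (a σ)) (𝓕 ψ) = _
    rw [lame_fourier hν, fourier_deriv_apply]
    simp only [Fin.sum_univ_succ (n := 3), Fin.sum_univ_three, hst, symbolMul_zero_succ,
      symbolMul_succ_succ, hadd, hsmul]
    change _ = _ + (_ * a σ (𝓕 (derivMul i ψ)) + _)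
    fin_cases i <;>
    · simp only [e3Cross]
      simp [hadd, hsmul, -Complex.coe_smul, -FourierTransform.fourier_smul,
        -FourierTransform.fourier_add]
      ring

/-! ### Iterated integrals and the iterated Duhamel formula -/

/-- The iterated integrals from `s` to `t`. -/
def iterInt (t : ℝ) (η : ℝ → ℂ) : ℕ → ℝ → ℂ
  | 0 => η
  | n + 1 => fun s => ∫ x in s..t, iterInt t η n x

lemma continuous_iterInt {t : ℝ} {η : ℝ → ℂ} (hη : Continuous η) (n : ℕ) :
    Continuous (iterInt t η n) := by
  induction n with
  | zero => exact hη
  | succ n ih =>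
    have h : iterInt t η (n + 1) = fun s => -∫ x in t..s, iterInt t η n x := by
      ext s
      exact intervalIntegral.integral_symm _ _
    rw [h]
    exact (intervalIntegral.continuous_primitive (fun a b => ih.intervalIntegrable a b) t).neg

lemma hasDerivAt_iterInt {t : ℝ} {η : ℝ → ℂ} (hη : Continuous η) (n : ℕ) (s : ℝ) :
    HasDerivAt (iterInt t η (n + 1)) (-iterInt t η n s) s :=
  have h := continuous_iterInt (t := t) hη n
  intervalIntegral.integral_hasDerivAt_left (h.intervalIntegrable _ _)
    h.stronglyMeasurable.stronglyMeasurableAtFilter h.continuousAt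

lemma norm_iterInt_le {t M : ℝ} {η : ℝ → ℂ}
    (hM : ∀ s ∈ Icc 0 t, ‖η s‖ ≤ M) (n : ℕ) :
    ∀ s ∈ Icc 0 t, ‖iterInt t η n s‖ ≤ M * (t - s) ^ n / n.factorial := by
  induction n with
  | zero => intro s hs; simpa [iterInt] using hM s hs
  | succ n ih =>
    intro s hs
    have h1 : ‖iterInt t η (n + 1) s‖ ≤ ∫ x in s..t, M * (t - x) ^ n / n.factorial := by
      refine intervalIntegral.norm_integral_le_of_norm_le hs.2 (ae_of_all _ fun x hx => ?_)
        (Continuous.intervalIntegrable (by fun_prop) _ _)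
      exact ih x ⟨hs.1.trans hx.1.le, hx.2⟩
    refine h1.trans (le_of_eq ?_)
    have h2 : ∫ x in s..t, M * (t - x) ^ n / n.factorial =
        ∫ x in s..t, (M / n.factorial) * (t - x) ^ n :=
      integral_congr fun x _ => by ring
    rw [h2, intervalIntegral.integral_const_mul, intervalIntegral.integral_comp_sub_left (fun x => x ^ n),
      integral_pow, Nat.factorial_succ]
    have := Nat.factorial_pos n
    push_cast
    field_simp
    simp

lemma integral_mul_primitive {t : ℝ} (ht : 0 ≤ t) {η w h : ℝ → ℂ} {h₀ : ℂ} (hη : Continuous η)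
    (hw : IntervalIntegrable w volume 0 t) (hh : ∀ s ∈ Icc 0 t, h s = h₀ + ∫ σ in (0 : ℝ)..s, w σ) :
    ∫ s in (0 : ℝ)..t, η s * h s =
      (∫ s in (0 : ℝ)..t, η s) * h₀ + ∫ σ in (0 : ℝ)..t, (∫ s in σ..t, η s) * w σ := by
  have hηi : IntegrableOn η (Ioc 0 t) := (hη.integrableOn_Icc).mono_set Ioc_subset_Icc_self
  have hwi : IntegrableOn w (Ioc 0 t) := (intervalIntegrable_iff_integrableOn_Ioc_of_le ht).1 hw
  have hprod := Integrable.mul_prod hηi hwi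
  have hmeas : MeasurableSet {z : ℝ × ℝ | z.2 ≤ z.1} := measurableSet_le measurable_snd measurable_fst
  have hint : Integrable (uncurry fun s σ : ℝ => if σ ≤ s then η s * w σ else 0)
      ((volume.restrict (Ioc 0 t)).prod (volume.restrict (Ioc 0 t))) := by
    refine (hprod.indicator hmeas).congr (ae_of_all _ ?_)
    rintro ⟨s, σ⟩
    by_cases hσ : σ ≤ s <;> simp [uncurry, indicator, hσ]
  have hswap := integral_integral_swap hint
  have e1 : ∫ s in (0 : ℝ)..t, η s * h s =
      ∫ s in (0 : ℝ)..t, (η s * h₀ + ∫ σ in Ioc 0 t, if σ ≤ s then η s * w σ else 0) := by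
    refine integral_congr fun s hs => ?_
    rw [uIcc_of_le ht] at hs
    rw [hh s hs, mul_add]
    congr 1
    rw [integral_of_le hs.1, ← integral_const_mul,
      ← integral_indicator measurableSet_Ioc, ← integral_indicator measurableSet_Ioc]
    congr 1
    ext σ
    by_cases hσ : σ ≤ s
    · by_cases h0 : 0 < σ
      · rw [indicator_of_mem (show σ ∈ Ioc 0 s from ⟨h0, hσ⟩),
          indicator_of_mem (show σ ∈ Ioc 0 t from ⟨h0, hσ.trans hs.2⟩), if_pos hσ]
      · rw [indicator_of_notMem (fun h => h0 h.1), indicator_of_notMem (fun h => h0 h.1)]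
    · rw [indicator_of_notMem (fun h => hσ h.2)]
      by_cases h1 : σ ∈ Ioc 0 t
      · rw [indicator_of_mem h1, if_neg hσ]
      · rw [indicator_of_notMem h1]
  have e2 : ∫ σ in (0 : ℝ)..t, (∫ s in σ..t, η s) * w σ =
      ∫ σ in Ioc 0 t, ∫ s in Ioc 0 t, if σ ≤ s then η s * w σ else 0 := by
    rw [integral_of_le ht]
    refine setIntegral_congr_fun measurableSet_Ioc fun σ hσ => ?_
    rw [integral_of_le hσ.2, ← integral_mul_const, ← integral_Icc_eq_integral_Ioc,
      ← integral_indicator measurableSet_Ioc, ← integral_indicator measurableSet_Icc]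
    congr 1
    ext s
    by_cases hs : σ ≤ s
    · by_cases h1 : s ≤ t
      · rw [indicator_of_mem (show s ∈ Icc σ t from ⟨hs, h1⟩),
          indicator_of_mem (show s ∈ Ioc 0 t from ⟨hσ.1.trans_le hs, h1⟩), if_pos hs]
      · rw [indicator_of_notMem (fun h => h1 h.2), indicator_of_notMem (fun h => h1 h.2)]
    · rw [indicator_of_notMem (fun h => hs h.1)]
      by_cases h1 : s ∈ Ioc 0 t
      · rw [indicator_of_mem h1, if_neg hs]
      · rw [indicator_of_notMem h1]
  rw [e1, e2, ← hswap, intervalIntegral.integral_add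
    ((by fun_prop : Continuous fun s => η s * h₀).intervalIntegrable _ _), intervalIntegral.integral_mul_const,
    integral_of_le (f := fun s => ∫ σ in Ioc 0 t, _) ht]
  exact (intervalIntegrable_iff_integrableOn_Ioc_of_le ht).2 hint.integral_prod_left

section
variable {E : Type*} [AddCommGroup E] [Module ℂ E]

/-- The Taylor polynomial of the backward evolution. -/
def taylorBack (A : E →ₗ[ℂ] E) (t : ℝ) (η : ℝ → ℂ) (Ψ : E) (N : ℕ) (s : ℝ) : E :=
  ∑ n ∈ Finset.range N, iterInt t η (n + 1) s • (A ^ n) Ψ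

lemma duhamel_iterate {A : E →ₗ[ℂ] E} {U F : ℝ → E →ₗ[ℂ] ℂ} {U₀ : E →ₗ[ℂ] ℂ} {t : ℝ} (ht : 0 ≤ t)
    (hU : ∀ Ψ, ContinuousOn (fun s => U s Ψ) (Icc 0 t))
    (hF : ∀ Ψ, IntervalIntegrable (fun s => F s Ψ) volume 0 t)
    (heq : ∀ Ψ, ∀ s ∈ Icc 0 t, U s Ψ = U₀ Ψ + ∫ σ in (0 : ℝ)..s, (F σ Ψ + U σ (A Ψ)))
    {η : ℝ → ℂ} (hη : Continuous η) (Ψ : E) (N : ℕ) :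
    ∫ s in (0 : ℝ)..t, η s * U s Ψ = U₀ (taylorBack A t η Ψ N 0) +
      (∫ s in (0 : ℝ)..t, F s (taylorBack A t η Ψ N s)) +
      ∫ s in (0 : ℝ)..t, iterInt t η N s * U s ((A ^ N) Ψ) := by
  have hUi : ∀ Ψ, IntervalIntegrable (fun s => U s Ψ) volume 0 t := fun Ψ =>
    ContinuousOn.intervalIntegrable (by rw [uIcc_of_le ht]; exact hU Ψ)
  have hmul : ∀ (b : ℝ → ℂ) (w : ℝ → ℂ), Continuous b → IntervalIntegrable w volume 0 t →
      IntervalIntegrable (fun s => b s * w s) volume 0 t := fun b w hb hw =>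
    hw.continuousOn_mul hb.continuousOn
  have hTF : ∀ N, IntervalIntegrable (fun s => F s (taylorBack A t η Ψ N s)) volume 0 t := fun N => by
    simp only [taylorBack, map_sum, map_smul, smul_eq_mul]
    simp only [← Finset.sum_fn]
    exact IntervalIntegrable.sum _ fun n _ => hmul _ _ (continuous_iterInt hη _) (hF _)
  induction N with
  | zero => simp [taylorBack, iterInt]
  | succ N ih =>
    rw [ih, integral_mul_primitive ht (continuous_iterInt hη N) ((hF _).add (hUi _))
      (fun s hs => heq ((A ^ N) Ψ) s hs)]
    have e1 : ∀ s, taylorBack A t η Ψ (N + 1) s =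
        taylorBack A t η Ψ N s + iterInt t η (N + 1) s • (A ^ N) Ψ := fun s =>
      Finset.sum_range_succ _ _
    have e2 : ∀ σ, (∫ s in σ..t, iterInt t η N s) = iterInt t η (N + 1) σ := fun _ => rfl
    simp only [e1, e2, map_add, map_smul, smul_eq_mul, mul_add]
    rw [intervalIntegral.integral_add (hTF N) (hmul _ _ (continuous_iterInt hη _) (hF _)),
      intervalIntegral.integral_add (hmul _ _ (continuous_iterInt hη _) (hF _))
        (hmul _ _ (continuous_iterInt hη _) (hUi _))]
    have e3 : (A ^ (N + 1)) Ψ = A ((A ^ N) Ψ) := by rw [pow_succ']; rfl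
    rw [e3]
    ring

end

/-- The Taylor expansion of a backward flow, with integral remainder. -/
lemma flow_iterate (L : C4 →L[ℂ] C4) (v : C4) {η : ℝ → ℂ} (hη : Continuous η) (a t : ℝ) (N : ℕ) :
    ∫ s in a..t, η s • exp ((s - a) • L) v =
      (∑ n ∈ Finset.range N, iterInt t η (n + 1) a • (L ^ n) v) +
      ∫ s in a..t, iterInt t η N s • exp ((s - a) • L) ((L ^ N) v) := by
  induction N with
  | zero => simp [iterInt]
  | succ N ih =>
    rw [ih, Finset.sum_range_succ, add_assoc]
    congr 1
    have hpow : (L ^ (N + 1)) v = L ((L ^ N) v) := by rw [pow_succ']; rfl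
    rw [hpow]
    set w := (L ^ N) v
    have hflow : ∀ w : C4, Continuous fun s => exp ((s - a) • L) w := fun w =>
      (continuous_flow L w).comp (continuous_id.sub continuous_const)
    have hd : ∀ s, HasDerivAt (fun s => iterInt t η (N + 1) s • exp ((s - a) • L) w)
        (iterInt t η (N + 1) s • exp ((s - a) • L) (L w) -
          iterInt t η N s • exp ((s - a) • L) w) s := fun s => by
      have h1 := (hasDerivAt_flow L w (s - a)).comp_sub_const s a
      refine ((hasDerivAt_iterInt hη N s).smul h1).congr_deriv ?_
      rw [flow_comm, neg_smul, ← sub_eq_add_neg]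
    have c1 : Continuous fun s => iterInt t η (N + 1) s • exp ((s - a) • L) (L w) :=
      (continuous_iterInt hη _).smul (hflow _)
    have c2 : Continuous fun s => iterInt t η N s • exp ((s - a) • L) w :=
      (continuous_iterInt hη _).smul (hflow _)
    have hi := integral_eq_sub_of_hasDerivAt (a := a) (b := t)
      (fun s _ => hd s) ((c1.sub c2).intervalIntegrable _ _)
    have hb : iterInt t η (N + 1) t = 0 := by simp [iterInt]
    rw [hb, zero_smul, zero_sub, sub_self, exp_zero_smul_apply, intervalIntegral.integral_sub
      (c1.intervalIntegrable _ _) (c2.intervalIntegrable _ _)] at hi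
    rw [← sub_eq_zero] at hi ⊢
    rw [← neg_eq_zero, ← hi]
    abel

/-! ### Growth of the powers of the symbol -/

/-- Multiplication of vectors of Schwartz functions by the symbol. -/
def symbolOp (μ ε Ω : ℝ) : (Fin 4 → 𝒮) →ₗ[ℂ] (Fin 4 → 𝒮) where
  toFun Ψ l := ∑ k, symbolMul μ ε Ω l k (Ψ k)
  map_add' Ψ Φ := by
    ext l : 1
    simp [sum_add_distrib]
  map_smul' c Ψ := by
    ext l : 1
    simp [Finset.smul_sum]

lemma symbolOp_apply (μ ε Ω : ℝ) (Ψ : Fin 4 → 𝒮) (l : Fin 4) (ξ : R3) :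
    symbolOp μ ε Ω Ψ l ξ = ∑ k, symbolEntry μ ε Ω l k ξ * Ψ k ξ := by
  change (∑ k, symbolMul μ ε Ω l k (Ψ k)) ξ = _
  rw [sum_apply]
  simp only [symbolMul_apply]

lemma symbolOp_pow_apply (μ ε Ω : ℝ) (Ψ : Fin 4 → 𝒮) (n : ℕ) (ξ : R3) :
    WithLp.toLp 2 (fun l => (symbolOp μ ε Ω ^ n) Ψ l ξ) =
      ((op (symB ε Ω ((2 * π) • ξ) - symN μ ((2 * π) • ξ))) ^ n)
        (WithLp.toLp 2 fun l => Ψ l ξ) := by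
  induction n with
  | zero => rfl
  | succ n ih =>
    have e1 : (symbolOp μ ε Ω ^ (n + 1)) Ψ = symbolOp μ ε Ω ((symbolOp μ ε Ω ^ n) Ψ) := by
      rw [pow_succ']; rfl
    have e2 : ∀ (L : C4 →L[ℂ] C4) v, (L ^ (n + 1)) v = L ((L ^ n) v) := fun L v => by
      rw [pow_succ']; rfl
    rw [e1, e2, ← ih]
    ext l
    rw [op_apply]
    simp only [symbolOp_apply, Fin.sum_univ_four]
    rfl

lemma tsupport_symbolOp_pow (μ ε Ω : ℝ) {Ψ : Fin 4 → 𝒮} {K : Set R3} (hK : IsClosed K)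
    (h : ∀ k, tsupport (Ψ k) ⊆ K) (n : ℕ) : ∀ k, tsupport ((symbolOp μ ε Ω ^ n) Ψ k) ⊆ K := by
  induction n with
  | zero => exact h
  | succ n ih =>
    intro l
    have e1 : (symbolOp μ ε Ω ^ (n + 1)) Ψ = symbolOp μ ε Ω ((symbolOp μ ε Ω ^ n) Ψ) := by
      rw [pow_succ']; rfl
    rw [e1]
    refine closure_minimal (fun ξ hξ => ?_) hK
    by_contra hn
    refine hξ ?_
    rw [symbolOp_apply]
    refine Finset.sum_eq_zero fun k _ => ?_
    rw [image_eq_zero_of_notMem_tsupport (fun hx => hn (ih k hx)), mul_zero]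

lemma exists_growth (μ ε Ω : ℝ) {Ψ : Fin 4 → 𝒮} {K : Set R3} (hK : IsCompact K)
    (h : ∀ k, tsupport (Ψ k) ⊆ K) (m : ℕ) : ∃ C ρ : ℝ, 0 ≤ C ∧ 0 ≤ ρ ∧ ∀ N, ∀ i ≤ m, ∀ l ξ,
      ‖iteratedFDeriv ℝ i ((symbolOp μ ε Ω ^ N) Ψ l) ξ‖ ≤ C * ρ ^ N := by
  have hsm : ∀ l k, ContDiff ℝ ((⊤ : ℕ∞) : WithTop ℕ∞) (symbolEntry μ ε Ω l k) := fun l k =>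
    (hasTemperateGrowth_symbolEntry μ ε Ω l k).1
  have hB : ∃ B : ℝ, 0 ≤ B ∧ ∀ i ≤ m, ∀ l k, ∀ ξ ∈ K, ‖iteratedFDeriv ℝ i (symbolEntry μ ε Ω l k) ξ‖ ≤ B := by
    have h1 : ∀ i l k, ∃ B : ℝ, ∀ ξ ∈ K, ‖iteratedFDeriv ℝ i (symbolEntry μ ε Ω l k) ξ‖ ≤ B :=
      fun i l k => hK.exists_bound_of_continuousOn
        ((hsm l k).continuous_iteratedFDeriv (by exact_mod_cast le_top)).continuousOn
    choose B hB using h1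
    refine ⟨∑ i ∈ Finset.range (m + 1), ∑ l, ∑ k, |B i l k|, by positivity,
      fun i hi l k ξ hξ => ((hB i l k ξ hξ).trans (le_abs_self _)).trans ?_⟩
    calc |B i l k| ≤ ∑ k, |B i l k| :=
          single_le_sum (f := fun k => |B i l k|) (fun _ _ => abs_nonneg _) (Finset.mem_univ k)
      _ ≤ ∑ l, ∑ k, |B i l k| :=
          single_le_sum (f := fun l => ∑ k, |B i l k|) (fun _ _ => by positivity)
            (Finset.mem_univ l)
      _ ≤ _ := single_le_sum (f := fun i => ∑ l, ∑ k, |B i l k|) (fun _ _ => by positivity)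
            (Finset.mem_range.2 (by omega))
  obtain ⟨B, hB0, hB⟩ := hB
  set C := ∑ i ∈ Finset.range (m + 1), ∑ l, seminorm ℂ 0 i (Ψ l)
  have hC0 : 0 ≤ C := sum_nonneg fun i _ => sum_nonneg fun l _ => apply_nonneg _ _
  refine ⟨C, 4 * (2 ^ m * B), hC0, by positivity, fun N => ?_⟩
  induction N with
  | zero =>
    intro i hi l ξ
    rw [pow_zero (4 * (2 ^ m * B)), mul_one]
    refine (SchwartzMap.norm_iteratedFDeriv_le_seminorm ℂ (Ψ l) i ξ).trans ?_
    calc seminorm ℂ 0 i (Ψ l) ≤ ∑ l, seminorm ℂ 0 i (Ψ l) :=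
          single_le_sum (f := fun l => seminorm ℂ 0 i (Ψ l))
            (fun _ _ => apply_nonneg _ _) (Finset.mem_univ l)
      _ ≤ _ := single_le_sum (f := fun i => ∑ l, seminorm ℂ 0 i (Ψ l))
            (fun i _ => sum_nonneg fun l _ => apply_nonneg _ _) (Finset.mem_range.2 (by omega))
  | succ N ih =>
    intro i hi l ξ
    have hsupp := tsupport_symbolOp_pow μ ε Ω hK.isClosed h (N + 1) l
    by_cases hξ : ξ ∈ K
    swap
    · have : iteratedFDeriv ℝ i ((symbolOp μ ε Ω ^ (N + 1)) Ψ l) ξ = 0 := by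
        by_contra hne
        exact hξ (hsupp (support_iteratedFDeriv_subset i hne))
      rw [this, norm_zero]
      positivity
    have e1 : (⇑((symbolOp μ ε Ω ^ (N + 1)) Ψ l) : R3 → ℂ) =
        fun ξ => ∑ k, symbolEntry μ ε Ω l k ξ * (symbolOp μ ε Ω ^ N) Ψ k ξ := by
      ext ξ
      rw [← symbolOp_apply, pow_succ']; rfl
    rw [e1, iteratedFDeriv_fun_sum_apply fun k _ =>
      (((hsm l k).mul (((symbolOp μ ε Ω ^ N) Ψ k).smooth ⊤)).of_le (by exact_mod_cast le_top)).contDiffAt]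
    have e2 : ∀ k, ‖iteratedFDeriv ℝ i (fun ξ => symbolEntry μ ε Ω l k ξ *
        (symbolOp μ ε Ω ^ N) Ψ k ξ) ξ‖ ≤ 2 ^ m * B * (C * (4 * (2 ^ m * B)) ^ N) := fun k => by
      refine (norm_iteratedFDeriv_mul_le (hsm l k) (((symbolOp μ ε Ω ^ N) Ψ k).smooth ⊤) ξ
        (by exact_mod_cast le_top)).trans ?_
      calc _ ≤ ∑ i' ∈ Finset.range (i + 1), (i.choose i' : ℝ) * B * (C * (4 * (2 ^ m * B)) ^ N) := by
            refine sum_le_sum fun i' hi' => ?_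
            have hi'' : i' ≤ i := Nat.lt_succ_iff.1 (Finset.mem_range.1 hi')
            exact mul_le_mul (mul_le_mul_of_nonneg_left (hB i' (hi''.trans hi) l k ξ hξ)
              (by positivity)) (ih (i - i') ((Nat.sub_le _ _).trans hi) k ξ) (norm_nonneg _)
              (by positivity)
        _ = 2 ^ i * B * (C * (4 * (2 ^ m * B)) ^ N) := by
            rw [← sum_mul, ← sum_mul]
            congr 2
            exact_mod_cast Nat.sum_range_choose i
        _ ≤ _ := by
            have : (2 : ℝ) ^ i ≤ 2 ^ m := pow_le_pow_right₀ (by norm_num) hi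
            gcongr
    refine (norm_sum_le _ _).trans ((sum_le_sum fun k _ => e2 k).trans (le_of_eq ?_))
    rw [Finset.sum_const, Finset.card_univ, Fintype.card_fin, nsmul_eq_mul]
    push_cast
    ring

/-- The powers of the symbol, divided by the square roots of the factorials, are bounded on
compactly supported vectors of Schwartz functions. -/
lemma exists_seminorm_le (μ ε Ω : ℝ) {Ψ : Fin 4 → 𝒮} {K : Set R3} (hK : IsCompact K)
    (h : ∀ k, tsupport (Ψ k) ⊆ K) (l : Fin 4) (k n : ℕ) : ∃ M : ℝ, ∀ N, seminorm ℂ k n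
      ((((sqrt N.factorial)⁻¹ : ℝ) : ℂ) • (symbolOp μ ε Ω ^ N) Ψ l) ≤ M := by
  obtain ⟨C, ρ, hC, hρ, hb⟩ := exists_growth μ ε Ω hK h n
  obtain ⟨R, hR⟩ := hK.isBounded.exists_norm_le
  refine ⟨|R| ^ k * C * sqrt (Real.exp (ρ ^ 2)), fun N => ?_⟩
  have hf : (0 : ℝ) < N.factorial := by exact_mod_cast Nat.factorial_pos N
  have h1 : (sqrt N.factorial)⁻¹ * ρ ^ N ≤ sqrt (Real.exp (ρ ^ 2)) := by
    have h2 := Real.pow_div_factorial_le_exp (ρ ^ 2) (sq_nonneg ρ) N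
    refine le_trans (le_of_eq ?_) (Real.sqrt_le_sqrt h2)
    rw [Real.sqrt_div' _ hf.le, ← pow_mul, mul_comm 2 N, pow_mul, sqrt_sq (by positivity),
      inv_mul_eq_div]
  rw [map_smul_eq_mul, norm_real, norm_of_nonneg (by positivity)]
  have h3 : seminorm ℂ k n ((symbolOp μ ε Ω ^ N) Ψ l) ≤ |R| ^ k * (C * ρ ^ N) := by
    refine SchwartzMap.seminorm_le_bound ℂ k n _ (by positivity) fun ξ => ?_
    by_cases hξ : ξ ∈ K
    · exact mul_le_mul (pow_le_pow_left₀ (norm_nonneg _) ((hR ξ hξ).trans (le_abs_self R)) k)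
        (hb N n le_rfl l ξ) (norm_nonneg _) (by positivity)
    · have : iteratedFDeriv ℝ n ((symbolOp μ ε Ω ^ N) Ψ l) ξ = 0 := by
        by_contra hne
        exact hξ (tsupport_symbolOp_pow μ ε Ω hK.isClosed h N l (support_iteratedFDeriv_subset n hne))
      rw [this, norm_zero, mul_zero]
      positivity
  calc _ ≤ (sqrt N.factorial)⁻¹ * (|R| ^ k * (C * ρ ^ N)) := by gcongr
    _ = |R| ^ k * C * ((sqrt N.factorial)⁻¹ * ρ ^ N) := by ring
    _ ≤ _ := by gcongr

/-! ### Dyadic blocks on the frequency side -/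

namespace LittlewoodPaley

variable (P : LittlewoodPaley) (j : ℤ)

/-- The Fourier multiplier of the dyadic block `Δ_j`. -/
def mult (ξ : R3) : ℝ := P.φ ((2 : ℝ) ^ (-j) • ((2 * π) • ξ))

/-- A cutoff function that is `1` on the support of the multiplier of `Δ_j`. -/
def cutoff (ξ : R3) : ℝ := ∑ i ∈ Finset.Icc (-2 : ℤ) 2, P.mult (j + i) ξ

lemma hasTemperateGrowth_mult : (P.mult j).HasTemperateGrowth := by
  unfold mult
  have h1 : Function.HasTemperateGrowth
      (fun ξ : R3 => ((2 : ℝ) ^ (-j) • ((2 * π) • ξ))) := by fun_prop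
  exact P.φ.hasTemperateGrowth.comp h1

lemma hasTemperateGrowth_mult_ofReal :
    Function.HasTemperateGrowth fun ξ => ((P.mult j ξ : ℝ) : ℂ) := by
  have := P.hasTemperateGrowth_mult j
  fun_prop

lemma hasTemperateGrowth_cutoff_ofReal :
    Function.HasTemperateGrowth fun ξ => ((P.cutoff j ξ : ℝ) : ℂ) := by
  have := fun i => P.hasTemperateGrowth_mult i
  unfold cutoff
  fun_prop

lemma continuous_mult : Continuous (P.mult j) := by
  unfold mult
  have := P.φ.continuous
  fun_prop

lemma continuous_cutoff : Continuous (P.cutoff j) := by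
  have := fun i => P.continuous_mult i
  unfold cutoff
  fun_prop

lemma mult_nonneg (ξ : R3) : 0 ≤ P.mult j ξ := P.nonneg _

lemma cutoff_nonneg (ξ : R3) : 0 ≤ P.cutoff j ξ :=
  sum_nonneg fun _ _ => P.mult_nonneg _ _

lemma norm_of_mult_ne_zero {ξ : R3} (h : P.mult j ξ ≠ 0) :
    (2 : ℝ) ^ j / 2 ≤ ‖(2 * π) • ξ‖ ∧ ‖(2 * π) • ξ‖ ≤ 2 * (2 : ℝ) ^ j := by
  have h1 := P.supp (subset_tsupport _ h)
  simp only [Set.mem_ofPred_eq] at h1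
  rw [norm_smul, norm_of_nonneg (by positivity), zpow_neg] at h1
  have h2 : (0 : ℝ) < 2 ^ j := by positivity
  rw [inv_mul_eq_div, le_div_iff₀ h2, div_le_iff₀ h2] at h1
  constructor <;> linarith [h1.1, h1.2]

lemma norm_of_cutoff_ne_zero {ξ : R3} (h : P.cutoff j ξ ≠ 0) :
    (2 : ℝ) ^ j / 8 ≤ ‖(2 * π) • ξ‖ ∧ ‖(2 * π) • ξ‖ ≤ 8 * (2 : ℝ) ^ j := by
  obtain ⟨i, hi, hne⟩ := Finset.exists_ne_zero_of_sum_ne_zero h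
  obtain ⟨h1, h2⟩ := P.norm_of_mult_ne_zero _ hne
  rw [zpow_add₀ two_ne_zero] at h1 h2
  have h0 : (0 : ℝ) < 2 ^ j := by positivity
  rw [Finset.mem_Icc] at hi
  have h3 : (2 : ℝ) ^ (-2 : ℤ) ≤ 2 ^ i := zpow_le_zpow_right₀ one_le_two hi.1
  have h4 : (2 : ℝ) ^ i ≤ 2 ^ (2 : ℤ) := zpow_le_zpow_right₀ one_le_two hi.2
  norm_num at h3 h4
  constructor <;> nlinarith

lemma cutoff_le_one (ξ : R3) : P.cutoff j ξ ≤ 1 := by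
  by_cases h0 : P.cutoff j ξ = 0
  · rw [h0]; exact zero_le_one
  · have h1 := (P.norm_of_cutoff_ne_zero j h0).1
    have h2 : (2 * π) • ξ ≠ 0 := by
      intro h
      rw [h, norm_zero] at h1
      have : (0 : ℝ) < 2 ^ j / 8 := by positivity
      linarith
    have h3 := P.sum_eq_one _ h2
    have h4 := sum_le_hasSum ((Finset.Icc (-2 : ℤ) 2).map (addLeftEmbedding j))
      (fun i _ => P.nonneg _) h3
    rw [Finset.sum_map] at h4
    exact h4

lemma cutoff_eq_one {ξ : R3} (h : P.mult j ξ ≠ 0) : P.cutoff j ξ = 1 := by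
  have h1 := P.norm_of_mult_ne_zero j h
  have h2 : (2 * π) • ξ ≠ 0 := by
    intro h
    rw [h, norm_zero] at h1
    have : (0 : ℝ) < 2 ^ j / 2 := by positivity
    linarith [h1.1]
  have h3 := P.sum_eq_one _ h2
  have h4 := hasSum_sum_of_ne_finset_zero (L := .unconditional ℤ) (f := fun i : ℤ => P.mult i ξ)
    (s := (Finset.Icc (-2 : ℤ) 2).map (addLeftEmbedding j)) (by
      intro i hi
      by_contra hne
      apply hi
      have h5 := P.norm_of_mult_ne_zero i hne
      have h6 : (2 : ℝ) ^ i ≤ 2 ^ (j + 2) := by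
        rw [zpow_add₀ two_ne_zero]; norm_num; linarith [h1.2, h5.1]
      have h7 : (2 : ℝ) ^ j ≤ 2 ^ (i + 2) := by
        rw [zpow_add₀ two_ne_zero]; norm_num; linarith [h1.1, h5.2]
      rw [zpow_le_zpow_iff_right₀ one_lt_two] at h6 h7
      simp only [Finset.mem_map, Finset.mem_Icc, addLeftEmbedding_apply]
      exact ⟨i - j, by omega, by omega⟩)
  have h5 := h4.unique h3
  rw [Finset.sum_map] at h5
  exact h5

lemma mult_mul_cutoff (ξ : R3) : P.mult j ξ * P.cutoff j ξ = P.mult j ξ := by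
  by_cases h : P.mult j ξ = 0
  · simp [h]
  · rw [P.cutoff_eq_one j h, mul_one]

lemma mem_closedBall_of_cutoff_ne_zero {ξ : R3} (h : P.cutoff j ξ ≠ 0) :
    ξ ∈ Metric.closedBall (0 : R3) (8 * (2 : ℝ) ^ j) := by
  have h1 := (P.norm_of_cutoff_ne_zero j h).2
  rw [norm_smul, norm_of_nonneg (by positivity)] at h1
  rw [mem_closedBall_zero_iff]
  nlinarith [Real.pi_gt_three, norm_nonneg ξ]

lemma hasCompactSupport_cutoff : HasCompactSupport (P.cutoff j) :=
  HasCompactSupport.intro (isCompact_closedBall (0 : R3) (8 * (2 : ℝ) ^ j)) fun ξ hξ => by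
    by_contra h
    exact hξ (P.mem_closedBall_of_cutoff_ne_zero j h)

/-- Multiplication by the multiplier of `Δ_j`. -/
def blockMul : 𝒮 →L[ℂ] 𝒮 :=
  smulLeftCLM ℂ fun ξ => ((P.mult j ξ : ℝ) : ℂ)

/-- Multiplication by the cutoff function. -/
def cutoffMul : 𝒮 →L[ℂ] 𝒮 :=
  smulLeftCLM ℂ fun ξ => ((P.cutoff j ξ : ℝ) : ℂ)

lemma blockMul_apply (ψ : 𝒮) (ξ : R3) : P.blockMul j ψ ξ = P.mult j ξ * ψ ξ := by
  rw [blockMul, smulLeftCLM_apply_apply (P.hasTemperateGrowth_mult_ofReal j), smul_eq_mul]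

lemma cutoffMul_apply (ψ : 𝒮) (ξ : R3) : P.cutoffMul j ψ ξ = P.cutoff j ξ * ψ ξ := by
  rw [cutoffMul, smulLeftCLM_apply_apply (P.hasTemperateGrowth_cutoff_ofReal j),
    smul_eq_mul]

lemma blockMul_cutoffMul (ψ : 𝒮) : P.blockMul j (P.cutoffMul j ψ) = P.blockMul j ψ := by
  ext ξ
  rw [blockMul_apply, blockMul_apply, cutoffMul_apply, ← mul_assoc, ← Complex.ofReal_mul,
    mult_mul_cutoff]

lemma tsupport_cutoffMul_subset (ψ : 𝒮) :
    tsupport (P.cutoffMul j ψ) ⊆ Metric.closedBall (0 : R3) (8 * (2 : ℝ) ^ j) := by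
  refine closure_minimal (fun ξ hξ => ?_) Metric.isClosed_closedBall
  rw [Function.mem_support, cutoffMul_apply] at hξ
  exact P.mem_closedBall_of_cutoff_ne_zero j fun h => hξ (by simp [h])

lemma block_fourier (T : Distr) (ψ : 𝒮) : P.block j T (𝓕 ψ) = T (𝓕 (P.blockMul j ψ)) := by
  have h : (𝓕⁻ (𝓕 ψ : 𝒮) : 𝒮) = ψ := FourierTransform.fourierInv_fourier_eq ψ
  change T (𝓕 (P.blockMul j (𝓕⁻ (𝓕 ψ : 𝒮) : 𝒮))) = _
  rw [h]

end LittlewoodPaley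

lemma eLpNorm_fourier_schwartz (ψ : 𝒮) :
    eLpNorm (⇑(𝓕 ψ : 𝒮)) 2 = eLpNorm ψ 2 := by
  rw [SchwartzMap.fourier_coe]
  exact (memLp_fourier_two ψ.integrable (ψ.memLp 2)).2

lemma enorm_apply_le_lqNorm (T : Distr) (θ : 𝒮) :
    ‖T θ‖ₑ ≤ lqNorm 2 T * eLpNorm θ 2 := by
  by_cases h0 : eLpNorm θ 2 = 0
  · rw [eLpNorm_eq_zero_iff θ.continuous.aestronglyMeasurable two_ne_zero] at h0
    have h1 : (θ : R3 → ℂ) = 0 :=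
      (Continuous.ae_eq_iff_eq volume θ.continuous continuous_zero).1 h0
    have h2 : θ = 0 := by ext x; rw [h1]; rfl
    simp [h2]
  · have ht : eLpNorm θ 2 ≠ ∞ := (θ.memLp 2 volume).2.ne
    rw [← ENNReal.div_le_iff h0 ht]
    refine le_iInf fun h => le_iInf fun hh => le_iInf fun hT => ?_
    rw [ENNReal.div_le_iff h0 ht, hT]
    refine (enorm_integral_le_lintegral_enorm _).trans ?_
    rw [← eLpNorm_one_eq_lintegral_enorm]
    have := eLpNorm_smul_le_mul_eLpNorm (p := 2) (q := 2) (r := 1) (μ := volume)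
      hh.aestronglyMeasurable (φ := θ) θ.continuous.aestronglyMeasurable
    rw [mul_comm]
    exact this

lemma enorm_apply_fourier_le_lqNorm (T : Distr) (ψ : 𝒮) :
    ‖T (𝓕 ψ)‖ₑ ≤ lqNorm 2 T * eLpNorm ψ 2 := by
  rw [← eLpNorm_fourier_schwartz]
  exact enorm_apply_le_lqNorm T _

/-! ### The Duhamel bound -/

/-- The operator with symbol `B - N` at the frequency `ξ`. -/
abbrev symL (μ ε Ω : ℝ) (ξ : R3) : C4 →L[ℂ] C4 :=
  op (symB ε Ω ((2 * π) • ξ) - symN μ ((2 * π) • ξ))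

lemma continuous_symL (μ ε Ω : ℝ) : Continuous (symL μ ε Ω) := by
  refine continuous_clm_apply.2 fun v => ?_
  have h1 : ∀ l k, Continuous (symbolEntry μ ε Ω l k) := fun l k =>
    (hasTemperateGrowth_symbolEntry μ ε Ω l k).1.continuous
  have h2 : (fun ξ => symL μ ε Ω ξ v) =
      fun ξ => WithLp.toLp 2 fun l => ∑ k, symbolEntry μ ε Ω l k ξ * v k := by
    ext ξ l
    rw [op_apply]
    simp only [Fin.sum_univ_four]
    rfl
  rw [h2]
  exact (PiLp.continuous_toLp 2 _).comp (continuous_pi fun l => by fun_prop)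

lemma continuous_backward (μ ε Ω : ℝ) (e : C4) {G : ℝ → 𝒮}
    (hG : Continuous fun z : ℝ × R3 => G z.1 z.2) (t a : ℝ) :
    Continuous (backward μ ε Ω e G t a) := by
  have h1 : Continuous fun z : R3 × ℝ => G z.2 z.1 := by
    have h := hG.comp (by fun_prop : Continuous fun z : R3 × ℝ => (z.2, z.1)); exact h
  have h2 : Continuous fun z : R3 × ℝ => (z.2 - a) • symL μ ε Ω z.1 := by
    have h := (continuous_symL μ ε Ω).comp (continuous_fst : Continuous fun z : R3 × ℝ => z.1)
    exact (continuous_snd.sub continuous_const).smul h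
  let _ : NormedAlgebra ℚ (C4 →L[ℂ] C4) := NormedAlgebra.restrictScalars ℚ ℂ _
  have h3 : Continuous fun z : R3 × ℝ => exp ((z.2 - a) • symL μ ε Ω z.1) e :=
    ((NormedSpace.exp_continuous.comp h2).clm_apply continuous_const)
  exact intervalIntegral.continuous_parametric_intervalIntegral_of_continuous' (h1.smul h3) a t

lemma eLpNorm_two_le_of_integral {h : R3 → ℝ} (hh : MemLp h 2) {Q : ℝ} (hQ : 0 ≤ Q)
    (hb : ∫ ξ, h ξ ^ 2 ≤ Q ^ 2) : eLpNorm h 2 ≤ ofReal Q := by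
  rw [hh.eLpNorm_eq_integral_rpow_norm (by norm_num) (by norm_num)]
  refine ofReal_le_ofReal ?_
  simp only [ENNReal.toReal_ofNat, Real.rpow_ofNat, norm_eq_abs, sq_abs]
  calc (∫ ξ, h ξ ^ 2) ^ ((2 : ℝ)⁻¹) ≤ (Q ^ 2) ^ ((2 : ℝ)⁻¹) :=
        rpow_le_rpow (integral_nonneg fun _ => sq_nonneg _) hb (by norm_num)
    _ = Q := by rw [← rpow_natCast, ← rpow_mul hQ]; norm_num

/-- The pairing of vectors of distributions with vectors of test functions on the frequency side. -/
def pair (S : Fin 4 → Distr) : (Fin 4 → 𝒮) →ₗ[ℂ] ℂ where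
  toFun Ψ := ∑ l, S l (𝓕 (Ψ l))
  map_add' Ψ Φ := by
    simp [FourierTransform.fourier_add, map_add, sum_add_distrib]
  map_smul' c Ψ := by
    simp [FourierTransform.fourier_smul, mul_sum]

lemma pair_apply (S : Fin 4 → Distr) (Ψ : Fin 4 → 𝒮) :
    pair S Ψ = ∑ l, S l (𝓕 (Ψ l)) := rfl

lemma pair_single (S : Fin 4 → Distr) (k : Fin 4) (ψ : 𝒮) :
    pair S (Pi.single k ψ) = S k (𝓕 ψ) := by
  rw [pair_apply, Finset.sum_eq_single k]
  · rw [Pi.single_eq_same]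
  · intro l _ hl
    rw [Pi.single_eq_of_ne hl, FourierTransform.fourier_zero, map_zero]
  · simp

variable (P : LittlewoodPaley) (j : ℤ)

/-- The norm of a block of the initial data and of the forces. -/
abbrev dataNorm (t : ℝ) (a₀ : Distr) (u₀ : Fin 3 → Distr) (f : ℝ → Distr)
    (g : ℝ → Fin 3 → Distr) : ℝ≥0∞ :=
  blockNorm P j 2 a₀ u₀ + blockNormLr P j 1 2 t f g

/-- The action of `Δ_j` on vectors of test functions on the frequency side. -/
def LittlewoodPaley.blockVec :
    (Fin 4 → 𝒮) →ₗ[ℂ] (Fin 4 → 𝒮) :=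
  (P.blockMul j).toLinearMap.compLeft (Fin 4)

lemma symbolOp_pow_blockVec (μ ε Ω : ℝ) (n : ℕ)
    (Ψ : Fin 4 → 𝒮) : (symbolOp μ ε Ω ^ n) (P.blockVec j Ψ) =
      P.blockVec j ((symbolOp μ ε Ω ^ n) Ψ) := by
  have h : Commute (symbolOp μ ε Ω) (P.blockVec j) := by
    refine LinearMap.ext fun Ψ => ?_
    ext l ξ
    change symbolOp μ ε Ω (P.blockVec j Ψ) l ξ = P.blockMul j (symbolOp μ ε Ω Ψ l) ξ
    rw [P.blockMul_apply, symbolOp_apply, symbolOp_apply, mul_sum]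
    refine sum_congr rfl fun k _ => ?_
    change _ * P.blockMul j (Ψ k) ξ = _
    rw [P.blockMul_apply]
    ring
  exact LinearMap.congr_fun (h.pow_left n) Ψ

lemma blockVec_single (k : Fin 4) (ψ : 𝒮) :
    P.blockVec j (Pi.single k (P.cutoffMul j ψ)) = Pi.single k (P.blockMul j ψ) := by
  ext l : 1
  change P.blockMul j ((Pi.single k (P.cutoffMul j ψ) : Fin 4 → 𝒮) l) = _
  by_cases h : l = k
  · subst h; rw [Pi.single_eq_same, Pi.single_eq_same, P.blockMul_cutoffMul]
  · rw [Pi.single_eq_of_ne h, Pi.single_eq_of_ne h, map_zero]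

lemma blockNorm_eq_sum (q : ℝ≥0∞) (a : Distr) (u : Fin 3 → Distr) :
    blockNorm P j q a u = ∑ l, lqNorm q (P.block j (state a u l)) := by
  simp [blockNorm, state, Fin.sum_univ_four, Fin.sum_univ_three, add_assoc]

lemma enorm_pair_blockVec_le (a : Distr) (u : Fin 3 → Distr)
    (Ψ : Fin 4 → 𝒮) {c : ℝ≥0∞} (hc : ∀ l, eLpNorm (Ψ l) 2 ≤ c) :
    ‖pair (state a u) (P.blockVec j Ψ)‖ₑ ≤ blockNorm P j 2 a u * c := by
  rw [blockNorm_eq_sum, sum_mul]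
  rw [pair_apply]
  refine (enorm_sum_le (f := fun l => state a u l (𝓕 (P.blockVec j Ψ l))) _).trans (sum_le_sum fun l _ => ?_)
  have : state a u l (𝓕 (P.blockVec j Ψ l)) = P.block j (state a u l) (𝓕 (Ψ l)) :=
    (P.block_fourier j _ _).symm
  rw [this]
  exact (enorm_apply_fourier_le_lqNorm _ _).trans (by gcongr; exact hc l)

section Solution

variable {μ μ' ε Ω T : ℝ} {a₀ : Distr} {u₀ : Fin 3 → Distr} {f : ℝ → Distr}
  {g : ℝ → Fin 3 → Distr} {a : ℝ → Distr} {u : ℝ → Fin 3 → Distr}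

lemma IsSolution.continuousOn_state (h : IsSolution μ μ' ε Ω T a₀ u₀ f g a u) (l : Fin 4)
    (θ : 𝒮) : ContinuousOn (fun s => state (a s) (u s) l θ) (Icc 0 T) := by
  fin_cases l
  exacts [h.cont_a θ, h.cont_u 0 θ, h.cont_u 1 θ, h.cont_u 2 θ]

lemma IsSolution.integrable_force (h : IsSolution μ μ' ε Ω T a₀ u₀ f g a u) {t : ℝ}
    (ht : t ∈ Icc 0 T) (l : Fin 4) (θ : 𝒮) :
    IntervalIntegrable (fun s => state (f s) (g s) l θ) volume 0 t := by
  rw [intervalIntegrable_iff_integrableOn_Ioo_of_le ht.1]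
  refine IntegrableOn.mono_set ?_ (Ioo_subset_Ioo_right ht.2)
  fin_cases l
  exacts [h.int_f θ, h.int_g 0 θ, h.int_g 1 θ, h.int_g 2 θ]

lemma IsSolution.pair_eq (hν : 2 * μ + μ' = 1) (h : IsSolution μ μ' ε Ω T a₀ u₀ f g a u)
    (Ψ : Fin 4 → 𝒮) {s : ℝ} (hs : s ∈ Icc 0 T) :
    pair (state (a s) (u s)) Ψ = pair (state a₀ u₀) Ψ + ∫ σ in (0 : ℝ)..s,
      (pair (state (f σ) (g σ)) Ψ + pair (state (a σ) (u σ)) (symbolOp μ ε Ω Ψ)) := by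
  have hi : ∀ l θ, IntervalIntegrable (fun σ => state (a σ) (u σ) l θ) volume 0 s := fun l θ =>
    ContinuousOn.intervalIntegrable (by
      rw [uIcc_of_le hs.1]
      exact (h.continuousOn_state l θ).mono (Icc_subset_Icc_right hs.2))
  simp only [pair_apply]
  rw [sum_congr rfl fun k _ => h.weak_fourier hν hs k (Ψ k), sum_add_distrib,
    ← intervalIntegral.integral_finsetSum]
  · congr 2
    ext σ
    rw [sum_add_distrib, Finset.sum_comm]
    congr 1
    refine sum_congr rfl fun l _ => ?_
    change _ = state (a σ) (u σ) l (𝓕 (∑ k, symbolMul μ ε Ω l k (Ψ k)))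
    have : (𝓕 (∑ k, symbolMul μ ε Ω l k (Ψ k)) : 𝒮) = ∑ k, 𝓕 (symbolMul μ ε Ω l k (Ψ k)) :=
      map_sum (FourierTransform.fourierCLM ℂ 𝒮) _ _
    rw [this, map_sum]
  · intro k _
    refine (h.integrable_force hs k _).add ?_
    simp only [← Finset.sum_fn]
    exact IntervalIntegrable.sum _ fun l _ => hi l _

end Solution

lemma tendsto_iterInt_remainder {t : ℝ} (ht : 0 ≤ t) {η : ℝ → ℂ} (hη : Continuous η) {c : ℕ → ℝ → ℂ}
    {C : ℝ} (hc : ∀ N, ∀ s ∈ Icc 0 t, ‖c N s‖ ≤ C * sqrt N.factorial) :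
    Tendsto (fun N => ∫ s in (0 : ℝ)..t, iterInt t η N s * c N s) atTop (𝓝 0) := by
  obtain ⟨M, hM⟩ := isCompact_Icc.exists_bound_of_continuousOn (hη.continuousOn (s := Icc 0 t))
  have hM0 : 0 ≤ M := (norm_nonneg _).trans (hM 0 (left_mem_Icc.2 ht))
  have h1 : Tendsto (fun N : ℕ => M * C * t * sqrt ((t ^ 2) ^ N / N.factorial)) atTop (𝓝 0) := by
    have h2 := (Real.continuous_sqrt.tendsto 0).comp
      (FloorSemiring.tendsto_pow_div_factorial_atTop (t ^ 2))
    rw [Real.sqrt_zero] at h2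
    simpa using h2.const_mul (M * C * t)
  refine squeeze_zero_norm (fun N => ?_) h1
  have hf : (0 : ℝ) < N.factorial := by exact_mod_cast Nat.factorial_pos N
  refine (intervalIntegral.norm_integral_le_of_norm_le_const (C := M * t ^ N / N.factorial *
    (C * sqrt N.factorial)) fun s hs => ?_).trans (le_of_eq ?_)
  · rw [uIoc_of_le ht] at hs
    have hs' := Ioc_subset_Icc_self hs
    rw [norm_mul]
    refine mul_le_mul ((norm_iterInt_le hM N s hs').trans ?_) (hc N s hs') (norm_nonneg _)
      (by positivity)
    have : (t - s) ^ N ≤ t ^ N := pow_le_pow_left₀ (by linarith [hs.2]) (by linarith [hs.1]) N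
    gcongr
  · rw [sub_zero, abs_of_nonneg ht, Real.sqrt_div (by positivity), ← pow_mul, mul_comm 2 N, pow_mul,
      sqrt_sq (by positivity)]
    have h3 : (N.factorial : ℝ) = sqrt N.factorial * sqrt N.factorial :=
      (Real.mul_self_sqrt hf.le).symm
    have h4 : sqrt N.factorial ≠ 0 := (Real.sqrt_pos.2 hf).ne'
    nth_rewrite 1 [h3]
    field_simp

lemma exists_flow_remainder_le {μ ε : ℝ} (hμ : 0 < μ) (hε : 0 < ε) (Ω : ℝ) {t : ℝ} (ht : 0 ≤ t) {η : ℝ → ℂ}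
    (hη : Continuous η) (ψ : 𝒮) (e : C4) {K : Set R3} (hK : IsCompact K) :
    ∃ R : ℕ → ℝ, Tendsto R atTop (𝓝 0) ∧ ∀ N, ∀ s ∈ Icc 0 t, ∀ ξ ∈ K,
      ‖∫ x in s..t, iterInt t η N x • exp ((x - s) • symL μ ε Ω ξ)
        ((symL μ ε Ω ξ ^ N) (ψ ξ • e))‖ ≤ R N := by
  obtain ⟨M, hM⟩ := isCompact_Icc.exists_bound_of_continuousOn (hη.continuousOn (s := Icc 0 t))
  have hM0 : 0 ≤ M := (norm_nonneg _).trans (hM 0 (left_mem_Icc.2 ht))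
  obtain ⟨Λ', hΛ'⟩ := hK.exists_bound_of_continuousOn (continuous_symL μ ε Ω).continuousOn
  set Λ := max Λ' 0
  have hΛ0 : 0 ≤ Λ := le_max_right _ _
  set S := seminorm ℂ 0 0 ψ
  have hS : ∀ ξ, ‖ψ ξ‖ ≤ S := fun ξ => SchwartzMap.norm_le_seminorm ℂ ψ ξ
  have hS0 : 0 ≤ S := (norm_nonneg _).trans (hS 0)
  refine ⟨fun N => M * S * ‖e‖ * t * ((t * Λ) ^ N / N.factorial), ?_, fun N s hs ξ hξ => ?_⟩
  · simpa using (FloorSemiring.tendsto_pow_div_factorial_atTop (t * Λ)).const_mul (M * S * ‖e‖ * t)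
  refine (intervalIntegral.norm_integral_le_of_norm_le_const (C := M * t ^ N / N.factorial *
    (Λ ^ N * (S * ‖e‖))) fun x hx => ?_).trans ?_
  · rw [uIoc_of_le hs.2] at hx
    have hx' : x ∈ Icc 0 t := ⟨hs.1.trans hx.1.le, hx.2⟩
    rw [norm_smul]
    refine mul_le_mul ((norm_iterInt_le hM N x hx').trans ?_) ?_ (norm_nonneg _) (by positivity)
    · have : (t - x) ^ N ≤ t ^ N := pow_le_pow_left₀ (by linarith [hx.2]) (by linarith [hx'.1]) N
      gcongr
    · refine (norm_flow_le hμ hε.ne' _ (by linarith [hx.1])).trans ?_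
      refine ((symL μ ε Ω ξ ^ N).le_opNorm _).trans ?_
      rw [norm_smul]
      have h1 : ‖symL μ ε Ω ξ ^ N‖ ≤ Λ ^ N := (norm_pow_le _ N).trans
        (pow_le_pow_left₀ (norm_nonneg _) ((hΛ' ξ hξ).trans (le_max_left _ _)) N)
      have := hS ξ
      gcongr
  · rw [abs_of_nonneg (by linarith [hs.2])]
    calc _ ≤ M * t ^ N / N.factorial * (Λ ^ N * (S * ‖e‖)) * t :=
          mul_le_mul_of_nonneg_left (by linarith [hs.1]) (by positivity)
      _ = _ := by simp only [mul_pow]; ring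

variable {μ μ' ε Ω T : ℝ} {a₀ : Distr} {u₀ : Fin 3 → Distr} {f : ℝ → Distr}
  {g : ℝ → Fin 3 → Distr} {a : ℝ → Distr} {u : ℝ → Fin 3 → Distr} {t : ℝ}
  {ι : Type*} [Fintype ι] {η : ι → ℝ → ℂ} {ψ : ι → 𝒮} {k : Fin 4}

/-- The force with finitely many time and frequency profiles. -/
def finiteForce (η : ι → ℝ → ℂ) (ψ : ι → 𝒮) (s : ℝ) : 𝒮 := ∑ i, η i s • ψ i

lemma finiteForce_apply (s : ℝ) (ξ : R3) : finiteForce η ψ s ξ = ∑ i, η i s * ψ i ξ := by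
  rw [finiteForce, sum_apply]; rfl

lemma continuous_finiteForce (hη : ∀ i, Continuous (η i)) :
    Continuous fun z : ℝ × R3 => finiteForce η ψ z.1 z.2 := by
  simp only [finiteForce_apply]
  have := fun i => (ψ i).continuous
  fun_prop

lemma eLpNorm_two_le_of_norm_le {θ : R3 → ℂ} {h χ : R3 → ℝ} (hh : MemLp h 2) (hχ : MemLp χ 2)
    {Q c : ℝ} (hQ : 0 ≤ Q) (hc : 0 ≤ c) (hb : ∫ ξ, h ξ ^ 2 ≤ Q ^ 2)
    (hle : ∀ ξ, ‖θ ξ‖ ≤ ‖h ξ + c * χ ξ‖) :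
    eLpNorm θ 2 ≤ ofReal (Q + c * (eLpNorm χ 2).toReal) := by
  have h1 : eLpNorm θ 2 ≤ eLpNorm (h + c • χ) 2 volume := eLpNorm_mono hle
  refine h1.trans ((eLpNorm_add_le hh.1 (hχ.const_smul c).1 one_le_two).trans ?_)
  rw [ENNReal.ofReal_add hQ (mul_nonneg hc toReal_nonneg), ofReal_mul hc,
    ofReal_toReal hχ.2.ne, eLpNorm_const_smul, Real.enorm_eq_ofReal hc]
  exact add_le_add (eLpNorm_two_le_of_integral hh hQ hb) le_rfl

/-- The localized Taylor polynomials of the backward evolution converge to it. -/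
lemma exists_taylorBack_approx (hμ : 0 < μ) (hε : 0 < ε) (ht : 0 ≤ t)
    (hη : ∀ i, Continuous (η i)) {Q : ℝ} (hQ0 : 0 ≤ Q) (hQ : ∀ s ∈ Icc 0 t, ∫ ξ, P.cutoff j ξ ^ 2 *
      ‖backward μ ε Ω (EuclideanSpace.single k 1) (finiteForce η ψ) t s ξ‖ ^ 2 ≤ Q ^ 2) :
    ∃ R : ℕ → ℝ, Tendsto R atTop (𝓝 0) ∧ ∀ N, ∀ s ∈ Icc 0 t, ∀ l, eLpNorm ((∑ i, taylorBack
      (symbolOp μ ε Ω) t (η i) (Pi.single k (P.cutoffMul j (ψ i))) N s : Fin 4 → 𝒮) l) 2 ≤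
        ofReal (Q + R N) := by
  set e : C4 := EuclideanSpace.single k 1
  choose R hR hRb using fun i => exists_flow_remainder_le hμ hε Ω ht (hη i) (ψ i) e
    (isCompact_closedBall (0 : R3) (8 * (2 : ℝ) ^ j))
  set χ := P.cutoff j
  have hχ2 : MemLp χ 2 := (P.continuous_cutoff j).memLp_of_hasCompactSupport (P.hasCompactSupport_cutoff j)
  have hR0 : ∀ i N, 0 ≤ R i N := fun i N =>
    (norm_nonneg _).trans (hRb i N 0 (left_mem_Icc.2 ht) 0 (Metric.mem_closedBall_self (by positivity)))
  have hsum0 : ∀ N, 0 ≤ ∑ i, R i N := fun N => sum_nonneg fun i _ => hR0 i N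
  refine ⟨fun N => (∑ i, R i N) * (eLpNorm χ 2).toReal, ?_, fun N s hs l => ?_⟩
  · have h1 : Tendsto (fun N => ∑ i, R i N) atTop (𝓝 (∑ _i : ι, 0)) :=
      tendsto_finsetSum _ fun i _ => hR i
    have h2 := h1.mul_const (eLpNorm χ 2).toReal
    rwa [Finset.sum_const_zero, zero_mul] at h2
  generalize hΘ : (∑ i, taylorBack (symbolOp μ ε Ω) t (η i)
    (Pi.single k (P.cutoffMul j (ψ i))) N s : Fin 4 → 𝒮) = Θ
  set V := backward μ ε Ω e (finiteForce η ψ) t s with hV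
  have hVc : Continuous V := continuous_backward _ _ _ _ (continuous_finiteForce hη) _ _
  have hflow : ∀ i ξ (w : C4), Continuous fun x => η i x • exp ((x - s) • symL μ ε Ω ξ) w :=
    fun i ξ w => (hη i).smul ((continuous_flow _ w).comp (continuous_id.sub continuous_const))
  have hpt : ∀ ξ, WithLp.toLp 2 (fun l => Θ l ξ) =
      ((χ ξ : ℝ) : ℂ) • (V ξ - ∑ i, ∫ x in s..t, iterInt t (η i) N x •
        exp ((x - s) • symL μ ε Ω ξ) ((symL μ ε Ω ξ ^ N) (ψ i ξ • e))) := fun ξ => by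
    have e1 : V ξ = ∑ i, ∫ x in s..t, η i x • exp ((x - s) • symL μ ε Ω ξ) (ψ i ξ • e) := by
      rw [hV, ← intervalIntegral.integral_finsetSum fun i _ =>
        (hflow i ξ _).intervalIntegrable _ _]
      refine integral_congr fun x _ => ?_
      rw [finiteForce_apply, Finset.sum_smul]
      exact sum_congr rfl fun i _ => by rw [map_smul, mul_smul]
    rw [e1, ← Finset.sum_sub_distrib, Finset.smul_sum]
    have e2 : ∀ (n : ℕ) i, WithLp.toLp 2 (fun l => ((symbolOp μ ε Ω ^ n)
        (Pi.single k (P.cutoffMul j (ψ i)))) l ξ) =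
        ((χ ξ : ℝ) : ℂ) • (symL μ ε Ω ξ ^ n) (ψ i ξ • e) := fun n i => by
      rw [symbolOp_pow_apply, ← map_smul]
      congr 1
      ext l
      by_cases h : l = k
      · subst h; simp [e, χ, P.cutoffMul_apply]
      · simp [e, h]
    have e3 : ∀ i, (∫ x in s..t, η i x • exp ((x - s) • symL μ ε Ω ξ) (ψ i ξ • e)) -
        (∫ x in s..t, iterInt t (η i) N x •
        exp ((x - s) • symL μ ε Ω ξ) ((symL μ ε Ω ξ ^ N) (ψ i ξ • e))) =
        ∑ n ∈ Finset.range N, iterInt t (η i) (n + 1) s • (symL μ ε Ω ξ ^ n) (ψ i ξ • e) := fun i => by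
      rw [flow_iterate _ _ (hη i), add_sub_cancel_right]
    simp only [e3, Finset.smul_sum, smul_comm _ (iterInt _ _ _ _), ← e2]
    ext l
    simp [← hΘ, taylorBack, Finset.sum_apply, sum_apply]
  have hle : ∀ ξ, ‖Θ l ξ‖ ≤
      ‖χ ξ * ‖V ξ‖ + (∑ i, R i N) * χ ξ‖ := fun ξ => by
    have hχ0 : 0 ≤ χ ξ := P.cutoff_nonneg j ξ
    have h1 := PiLp.norm_apply_le (WithLp.toLp 2 (fun l => Θ l ξ)) l
    refine h1.trans ?_
    rw [hpt, norm_smul, norm_real, norm_of_nonneg hχ0, norm_of_nonneg (by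
      have := hsum0 N; positivity)]
    by_cases hξ : χ ξ = 0
    · simp [hξ]
    · rw [mul_comm _ (χ ξ), ← mul_add]
      refine mul_le_mul_of_nonneg_left ((norm_sub_le _ _).trans (add_le_add_right ?_ _)) hχ0
      exact (norm_sum_le _ _).trans (sum_le_sum fun i _ => hRb i N s hs ξ
        (P.mem_closedBall_of_cutoff_ne_zero j hξ))
  have hc1 : Continuous fun ξ => χ ξ * ‖V ξ‖ := (P.continuous_cutoff j).mul hVc.norm
  have hs1 : HasCompactSupport fun ξ => χ ξ * ‖V ξ‖ := 
    (P.hasCompactSupport_cutoff j).mul_right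
  refine eLpNorm_two_le_of_norm_le (hc1.memLp_of_hasCompactSupport hs1) hχ2 hQ0 (hsum0 N) ?_ hle
  simpa only [mul_pow] using hQ s hs

/-- The pairing of the solution with a force is bounded by the data and the localized backward
evolution of the force. -/
lemma IsSolution.enorm_integral_le (hμ : 0 < μ) (hν : 2 * μ + μ' = 1)
    (hε : 0 < ε) (h : IsSolution μ μ' ε Ω T a₀ u₀ f g a u) (ht : t ∈ Icc 0 T)
    (hη : ∀ i, Continuous (η i)) {Q : ℝ} (hQ0 : 0 < Q) (hQ : ∀ s ∈ Icc 0 t, ∫ ξ, P.cutoff j ξ ^ 2 *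
      ‖backward μ ε Ω (EuclideanSpace.single k 1) (finiteForce η ψ) t s ξ‖ ^ 2 ≤ Q ^ 2) :
    ‖∫ s in (0 : ℝ)..t, P.block j (state (a s) (u s) k) (𝓕 (finiteForce η ψ s))‖ₑ ≤
      dataNorm P j t a₀ u₀ f g * ofReal Q := by
  obtain ⟨R, hR, hRb⟩ := exists_taylorBack_approx P j hμ hε ht.1 hη hQ0.le hQ
  set D := dataNorm P j t a₀ u₀ f g with hD
  set A := symbolOp μ ε Ω
  set Θ : ℕ → ℝ → Fin 4 → 𝒮 := fun N s =>
    ∑ i, taylorBack A t (η i) (Pi.single k (P.cutoffMul j (ψ i))) N s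
  set Φ : ι → Fin 4 → 𝒮 := fun i => Pi.single k (P.blockMul j (ψ i))
  have hst : ∀ l θ, ContinuousOn (fun s => state (a s) (u s) l θ) (Icc 0 t) := fun l θ =>
    (h.continuousOn_state l θ).mono (Icc_subset_Icc_right ht.2)
  have hU : ∀ Ψ, ContinuousOn (fun s => pair (state (a s) (u s)) Ψ) (Icc 0 t) := fun Ψ => by
    simp only [pair_apply]
    exact continuousOn_finsetSum _ fun l _ => hst l _
  have hF : ∀ Ψ, IntervalIntegrable (fun s => pair (state (f s) (g s)) Ψ) volume 0 t := fun Ψ => by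
    simp only [pair_apply, ← Finset.sum_fn]
    exact IntervalIntegrable.sum _ fun l _ => h.integrable_force ht l _
  set rem : ℕ → ℂ := fun N => ∑ i, ∫ s in (0 : ℝ)..t, iterInt t (η i) N s *
    pair (state (a s) (u s)) ((A ^ N) (Φ i))
  have hrem : Tendsto rem atTop (𝓝 0) := by
    have h1 : ∀ i, Tendsto (fun N => ∫ s in (0 : ℝ)..t, iterInt t (η i) N s *
        pair (state (a s) (u s)) ((A ^ N) (Φ i))) atTop (𝓝 0) := fun i => by
      have hb : ∀ l, ∃ C : ℝ, ∀ (s : Icc 0 t) (N : ℕ), ‖(𝓕 (state (a s) (u s) l) : Distr)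
          ((((sqrt N.factorial)⁻¹ : ℝ) : ℂ) • (A ^ N) (Φ i) l)‖ ≤ C := fun l => by
        refine exists_bound_of_pointwise (fun θ => ?_) fun m n => exists_seminorm_le μ ε Ω
          (isCompact_closedBall (0 : R3) (8 * (2 : ℝ) ^ j)) (fun k' => ?_) l m n
        · obtain ⟨C, hC⟩ := isCompact_Icc.exists_bound_of_continuousOn (hst l (𝓕 θ))
          exact ⟨C, fun s => hC s s.2⟩
        · by_cases hk : k' = k
          · subst hk
            simp only [Φ, Pi.single_eq_same]
            rw [← P.blockMul_cutoffMul]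
            refine closure_minimal (fun ξ hξ => ?_) Metric.isClosed_closedBall
            rw [Function.mem_support, P.blockMul_apply] at hξ
            exact P.tsupport_cutoffMul_subset j (ψ i) (subset_tsupport _ (right_ne_zero_of_mul hξ))
          · simp only [Φ, Pi.single_eq_of_ne hk]
            intro ξ hξ
            simp [tsupport] at hξ
      choose C hC using hb
      refine tendsto_iterInt_remainder ht.1 (hη i) (C := ∑ l, C l) fun N s hs => ?_
      have hf : (0 : ℝ) < sqrt N.factorial :=
        Real.sqrt_pos.2 (by exact_mod_cast Nat.factorial_pos N)
      rw [pair_apply, sum_mul]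
      refine (norm_sum_le _ _).trans (sum_le_sum fun l _ => ?_)
      have h2 := hC l ⟨s, hs⟩ N
      rw [map_smul, norm_smul, norm_real, norm_of_nonneg (by positivity),
        inv_mul_le_iff₀ hf, mul_comm] at h2
      exact h2
    simpa using tendsto_finsetSum Finset.univ fun i _ => h1 i
  have hkey : ∀ N, ∫ s in (0 : ℝ)..t, P.block j (state (a s) (u s) k) (𝓕 (finiteForce η ψ s)) =
      pair (state a₀ u₀) (P.blockVec j (Θ N 0)) +
        (∫ s in (0 : ℝ)..t, pair (state (f s) (g s)) (P.blockVec j (Θ N s))) + rem N := fun N => by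
    have e1 : ∀ s, P.block j (state (a s) (u s) k) (𝓕 (finiteForce η ψ s)) =
        ∑ i, η i s * pair (state (a s) (u s)) (Φ i) := fun s => by
      have e : P.blockMul j (finiteForce η ψ s) = ∑ i, η i s • P.blockMul j (ψ i) := by
        simp [finiteForce]
      rw [P.block_fourier, e, ← pair_single]
      have e' : (Pi.single k (∑ i, η i s • P.blockMul j (ψ i)) : Fin 4 → 𝒮) =
          ∑ i, η i s • Φ i := by
        refine (map_sum (LinearMap.single ℂ (fun _ : Fin 4 => 𝒮) k)
          (fun i => η i s • P.blockMul j (ψ i)) Finset.univ).trans ?_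
        exact sum_congr rfl fun i _ => map_smul (LinearMap.single ℂ _ k) _ _
      rw [e', map_sum]
      simp only [map_smul, smul_eq_mul]
    have e2 : ∀ s, P.blockVec j (Θ N s) = ∑ i, taylorBack A t (η i) (Φ i) N s := fun s => by
      simp only [Θ, Φ, taylorBack, map_sum, map_smul, ← symbolOp_pow_blockVec, A, blockVec_single]
    have e3 : ∀ i, IntervalIntegrable (fun s => pair (state (f s) (g s))
        (taylorBack A t (η i) (Φ i) N s)) volume 0 t := fun i => by
      simp only [taylorBack, map_sum, map_smul, smul_eq_mul]
      simp only [← Finset.sum_fn]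
      exact IntervalIntegrable.sum _ fun n _ =>
        (hF _).continuousOn_mul (continuous_iterInt (hη i) _).continuousOn
    simp only [e1, e2, map_sum]
    rw [intervalIntegral.integral_finsetSum, intervalIntegral.integral_finsetSum (fun i _ => e3 i),
      ← sum_add_distrib, ← sum_add_distrib]
    · exact sum_congr rfl fun i _ => duhamel_iterate ht.1 hU hF
        (fun Ψ s hs => h.pair_eq hν Ψ ⟨hs.1, hs.2.trans ht.2⟩) (hη i) _ N
    · exact fun i _ => (ContinuousOn.intervalIntegrable (by
        rw [uIcc_of_le ht.1]; exact (hη i).continuousOn.mul (hU _)))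
  by_cases hDt : D = ∞
  · rw [hDt, ENNReal.top_mul (by simpa using hQ0)]
    exact le_top
  have hbound : ∀ N, ‖∫ s in (0 : ℝ)..t, P.block j (state (a s) (u s) k) (𝓕 (finiteForce η ψ s))‖ₑ ≤
      D * ofReal (Q + R N) + ‖rem N‖ₑ := fun N => by
    rw [hkey N]
    refine (enorm_add_le _ _).trans (add_le_add_left ?_ _)
    refine (enorm_add_le _ _).trans ?_
    rw [hD, add_mul]
    refine add_le_add (enorm_pair_blockVec_le P j _ _ _ fun l => hRb N 0 (left_mem_Icc.2 ht.1) l) ?_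
    rw [integral_of_le ht.1]
    refine (enorm_integral_le_lintegral_enorm _).trans ?_
    rw [blockNormLr, eLpNorm_one_eq_lintegral_enorm, ← lintegral_mul_const' _ _ ofReal_ne_top,
      Measure.restrict_congr_set Ioo_ae_eq_Ioc]
    refine setLIntegral_mono' measurableSet_Ioc fun s hs => ?_
    exact enorm_pair_blockVec_le P j _ _ _ fun l => hRb N s (Ioc_subset_Icc_self hs) l
  have hlim : Tendsto (fun N => D * ofReal (Q + R N) + ‖rem N‖ₑ) atTop
      (𝓝 (D * ofReal Q)) := by
    have h1 : Tendsto (fun N => ofReal (Q + R N)) atTop (𝓝 (ofReal Q)) := by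
      have := ENNReal.tendsto_ofReal (hR.const_add Q)
      rwa [add_zero] at this
    have h2 := (ENNReal.Tendsto.const_mul h1 (Or.inr hDt)).add (hrem.enorm)
    simpa using h2
  exact ge_of_tendsto' hlim hbound

/-! ### Duality for maxima of continuous functions -/

lemma integral_sup_rpow_le {ι : Type*} [Fintype ι] [Nonempty ι] {t r K : ℝ} (ht : 0 ≤ t) (hr : 2 < r)
    (hK : 0 ≤ K) {F : ι → ℝ → ℂ} (hF : ∀ i, Continuous (F i))
    (hyp : ∀ η : ι → ℝ → ℂ, (∀ i, Continuous (η i)) → ‖∫ s in (0 : ℝ)..t, ∑ i, η i s * F i s‖ ≤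
      K * (∫ s in (0 : ℝ)..t, (∑ i, ‖η i s‖) ^ (r / (r - 1))) ^ (1 - 1 / r)) :
    ∫ s in (0 : ℝ)..t, (Finset.univ.sup' Finset.univ_nonempty fun i => ‖F i s‖) ^ r ≤ K ^ r := by
  set m : ℝ → ℝ := fun s => Finset.univ.sup' Finset.univ_nonempty fun i => ‖F i s‖ with hm
  have hmc : Continuous m := Continuous.finset_sup'_apply _ fun i _ => (hF i).norm
  have hle : ∀ i s, ‖F i s‖ ≤ m s := fun i s =>
    Finset.le_sup' (fun i => ‖F i s‖) (Finset.mem_univ i)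
  have hm0 : ∀ s, 0 ≤ m s := fun s => (norm_nonneg _).trans (hle (Classical.arbitrary ι) s)
  have hmr : ∀ p : ℝ, 0 ≤ p → Continuous fun s => m s ^ p := fun p hp =>
    hmc.rpow_const fun _ => Or.inr hp
  set X := ∫ s in (0 : ℝ)..t, m s ^ r
  set Y := ∫ s in (0 : ℝ)..t, m s ^ (r - 1)
  have hX0 : 0 ≤ X := intervalIntegral.integral_nonneg ht fun s _ => rpow_nonneg (hm0 s) _
  have hY0 : 0 ≤ Y := intervalIntegral.integral_nonneg ht fun s _ => rpow_nonneg (hm0 s) _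
  have e1 : ∀ s, m s ^ (r - 2) * m s ^ 2 = m s ^ r := fun s => by
    rw [← rpow_natCast, ← Real.rpow_add_of_nonneg (hm0 s) (by linarith) (by norm_num)]
    norm_num
  have e2 : ∀ s, m s ^ (r - 2) * m s = m s ^ (r - 1) := fun s => by
    nth_rewrite 2 [← rpow_one (m s)]
    rw [← Real.rpow_add_of_nonneg (hm0 s) (by linarith) (by norm_num)]
    ring_nf
  have hδ : ∀ δ : ℝ, 0 < δ → X - 2 * δ * Y ≤ K * X ^ (1 - 1 / r) := fun δ hδ => by
    set w : ι → ℝ → ℝ := fun i s => max (‖F i s‖ - (m s - δ)) 0 with hw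
    have hwc : ∀ i, Continuous (w i) := fun i => by
      have := hF i
      fun_prop
    have hw0 : ∀ i s, 0 ≤ w i s := fun i s => le_max_right _ _
    have hW : ∀ s, 0 < ∑ i, w i s := fun s => by
      obtain ⟨i, -, hi⟩ := Finset.exists_mem_eq_sup' Finset.univ_nonempty fun i => ‖F i s‖
      refine lt_of_lt_of_le hδ (le_trans ?_
        (single_le_sum (f := fun i => w i s) (fun i _ => hw0 i s) (Finset.mem_univ i)))
      refine le_trans (le_of_eq ?_) (le_max_left _ _)
      rw [← hi]
      simp only [hm]
      ring
    set v : ι → ℝ → ℝ := fun i s => w i s / ∑ i, w i s with hv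
    have hvc : ∀ i, Continuous (v i) := fun i =>
      (hwc i).div (continuous_finsetSum _ fun i _ => hwc i) fun s => (hW s).ne'
    have hv0 : ∀ i s, 0 ≤ v i s := fun i s => div_nonneg (hw0 i s) (hW s).le
    have hv1 : ∀ s, ∑ i, v i s = 1 := fun s => by
      simp only [hv]
      rw [← Finset.sum_div, div_self (hW s).ne']
    set η : ι → ℝ → ℂ := fun i s => ((m s ^ (r - 2) * v i s : ℝ) : ℂ) * (starRingEnd ℂ) (F i s)
    have hηc : ∀ i, Continuous (η i) := fun i =>
      (Complex.continuous_ofReal.comp ((hmr _ (by linarith)).mul (hvc i))).mul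
        (Complex.continuous_conj.comp (hF i))
    have h1 := hyp η hηc
    have h2 : ∀ s, ∑ i, η i s * F i s = ((∑ i, m s ^ (r - 2) * (v i s * ‖F i s‖ ^ 2) : ℝ) : ℂ) := fun s => by
      rw [Complex.ofReal_sum]
      refine sum_congr rfl fun i _ => ?_
      simp only [η]
      rw [mul_assoc, Complex.conj_mul']
      push_cast
      ring
    have h3 : ∀ s, m s ^ r - 2 * δ * m s ^ (r - 1) ≤ ∑ i, m s ^ (r - 2) * (v i s * ‖F i s‖ ^ 2) := fun s => by
      have h4 : ∀ i, v i s * (m s ^ 2 - 2 * δ * m s) ≤ v i s * ‖F i s‖ ^ 2 := fun i => by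
        by_cases hi : ‖F i s‖ ≤ m s - δ
        · have : v i s = 0 := by
            simp only [hv, hw, max_eq_right (sub_nonpos.2 hi), zero_div]
          rw [this, zero_mul, zero_mul]
        · refine mul_le_mul_of_nonneg_left ?_ (hv0 i s)
          have h5 := hm0 s
          have h6 := norm_nonneg (F i s)
          push Not at hi
          by_cases h7 : m s ≤ δ <;> nlinarith
      rw [← mul_sum, ← e1, ← e2]
      have h5 := sum_le_sum fun i (_ : i ∈ Finset.univ) => h4 i
      rw [← sum_mul, hv1, one_mul] at h5
      have h6 := mul_le_mul_of_nonneg_left h5 (rpow_nonneg (hm0 s) (r - 2))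
      linarith
    have h4 : ∀ s, (∑ i, ‖η i s‖) ^ (r / (r - 1)) ≤ m s ^ r := fun s => by
      have h5 : ∑ i, ‖η i s‖ ≤ m s ^ (r - 1) := by
        rw [← e2]
        calc ∑ i, ‖η i s‖ ≤ ∑ i, m s ^ (r - 2) * v i s * m s := by
              refine sum_le_sum fun i _ => ?_
              have h6 : 0 ≤ m s ^ (r - 2) * v i s := mul_nonneg (rpow_nonneg (hm0 s) _) (hv0 i s)
              simp only [η]
              rw [norm_mul, norm_real, norm_of_nonneg h6, RCLike.norm_conj]
              exact mul_le_mul_of_nonneg_left (hle i s) h6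
          _ = _ := by rw [← sum_mul, ← mul_sum, hv1, mul_one]
      calc _ ≤ (m s ^ (r - 1)) ^ (r / (r - 1)) := rpow_le_rpow
            (sum_nonneg fun _ _ => norm_nonneg _) h5 (div_nonneg (by linarith) (by linarith))
        _ = _ := by rw [← rpow_mul (hm0 s), mul_div_cancel₀ _ (by linarith)]
    have hc3 : Continuous fun s => ∑ i, m s ^ (r - 2) * (v i s * ‖F i s‖ ^ 2) :=
      continuous_finsetSum _ fun i _ => (hmr _ (by linarith)).mul ((hvc i).mul ((hF i).norm.pow 2))
    have h5 : X - 2 * δ * Y ≤ ∫ s in (0 : ℝ)..t, ∑ i, m s ^ (r - 2) * (v i s * ‖F i s‖ ^ 2) := by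
      have c1 := hmr r (by linarith)
      have c2 := hmr (r - 1) (by linarith)
      have c3 : Continuous fun s => 2 * δ * m s ^ (r - 1) := continuous_const.mul c2
      rw [← intervalIntegral.integral_const_mul, ← intervalIntegral.integral_sub
        (c1.intervalIntegrable _ _) (c3.intervalIntegrable _ _)]
      exact intervalIntegral.integral_mono ht ((c1.sub c3).intervalIntegrable _ _)
        (hc3.intervalIntegrable _ _) h3
    simp only [h2] at h1
    rw [intervalIntegral.integral_ofReal, norm_real] at h1
    refine h5.trans ((Real.le_norm_self _).trans (h1.trans (mul_le_mul_of_nonneg_left ?_ hK)))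
    refine rpow_le_rpow (intervalIntegral.integral_nonneg ht fun s _ => by positivity) ?_ ?_
    · refine intervalIntegral.integral_mono ht (Continuous.intervalIntegrable ?_ _ _)
        ((hmr r (by linarith)).intervalIntegrable _ _) h4
      exact (continuous_finsetSum _ fun i _ => (hηc i).norm).rpow_const fun _ =>
        Or.inr (div_nonneg (by linarith) (by linarith))
    · rw [sub_nonneg, div_le_one (by linarith)]; linarith
  have hfin : X ≤ K * X ^ (1 - 1 / r) := by
    refine le_of_forall_pos_le_add fun e he => ?_
    have := hδ (e / (2 * (Y + 1))) (by positivity)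
    have h6 : 2 * (e / (2 * (Y + 1))) * Y ≤ e := by
      rw [show 2 * (e / (2 * (Y + 1))) * Y = e * (Y / (Y + 1)) by field_simp]
      exact mul_le_of_le_one_right he.le ((div_le_one (by positivity)).2 (by linarith))
    linarith
  rcases hX0.eq_or_lt with h | h
  · rw [← h]; positivity
  · rw [Real.rpow_sub h, rpow_one, mul_div_assoc', le_div_iff₀ (by positivity), mul_comm K] at hfin
    have h7 : X ^ (1 / r) ≤ K := le_of_mul_le_mul_left hfin h
    calc X = (X ^ (1 / r)) ^ r := by rw [← rpow_mul hX0, one_div, inv_mul_cancel₀ (by linarith), rpow_one]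
      _ ≤ K ^ r := rpow_le_rpow (by positivity) h7 (by linarith)

lemma lintegral_iSup_rpow_le {t r K : ℝ} (ht : 0 ≤ t) (hr : 2 < r)
    (hK : 0 ≤ K) {F : ℕ → ℝ → ℂ} (hF : ∀ i, Continuous (F i))
    (hyp : ∀ n, ∀ η : Fin (n + 1) → ℝ → ℂ, (∀ i, Continuous (η i)) →
      ‖∫ s in (0 : ℝ)..t, ∑ i, η i s * F i s‖ ≤
      K * (∫ s in (0 : ℝ)..t, (∑ i, ‖η i s‖) ^ (r / (r - 1))) ^ (1 - 1 / r)) :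
    ∫⁻ s in Ioc 0 t, (⨆ i, ‖F i s‖ₑ) ^ r ≤ ofReal K ^ r := by
  have hr0 : 0 < r := by linarith
  set m : ℕ → ℝ → ℝ := fun n s => Finset.univ.sup' Finset.univ_nonempty fun i : Fin (n + 1) => ‖F i s‖
  have hmc : ∀ n, Continuous (m n) := fun n => Continuous.finset_sup'_apply _ fun i _ => (hF i).norm
  have hm0 : ∀ n s, 0 ≤ m n s := fun n s => (norm_nonneg _).trans
    (Finset.le_sup' (fun i : Fin (n + 1) => ‖F i s‖) (Finset.mem_univ 0))
  have hmono : ∀ s, Monotone fun n => m n s := fun s n n' hn => by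
    refine Finset.sup'_le _ _ fun i _ => ?_
    exact Finset.le_sup' (fun i : Fin (n' + 1) => ‖F i s‖) (Finset.mem_univ (Fin.castLE (by omega) i))
  have hsup : ∀ s, (⨆ i, ‖F i s‖ₑ) ^ r = ⨆ n, ofReal (m n s ^ r) := fun s => by
    have e : ∀ n, ofReal (m n s ^ r) = ofReal (m n s) ^ r := fun n =>
      (ofReal_rpow_of_nonneg (hm0 n s) hr0.le).symm
    simp only [e]
    have := (ENNReal.orderIsoRpow r hr0).map_iSup fun n => ofReal (m n s)
    rw [ENNReal.orderIsoRpow_apply] at this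
    simp only [ENNReal.orderIsoRpow_apply] at this
    rw [← this]
    congr 1
    refine le_antisymm (iSup_le fun i => ?_) (iSup_le fun n => ?_)
    · refine le_trans ?_ (le_iSup _ i)
      rw [← ofReal_norm]
      exact ofReal_le_ofReal
        (Finset.le_sup' (fun i : Fin (_ + 1) => ‖F i s‖) (Finset.mem_univ (Fin.last i)))
    · obtain ⟨i, -, hi⟩ := Finset.exists_mem_eq_sup' Finset.univ_nonempty fun i : Fin (n + 1) => ‖F i s‖
      simp only [m]
      rw [hi, ofReal_norm]
      exact le_iSup (fun i => ‖F i s‖ₑ) (i : ℕ)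
  simp only [hsup]
  have hc : ∀ n, Continuous fun s => m n s ^ r := fun n => (hmc n).rpow_const fun _ => Or.inr hr0.le
  rw [lintegral_iSup (fun n => (hc n).measurable.ennreal_ofReal) fun n n' hn s =>
    ofReal_le_ofReal (rpow_le_rpow (hm0 n s) (hmono s hn) hr0.le)]
  refine iSup_le fun n => ?_
  have h1 := integral_sup_rpow_le ht hr hK (F := fun i : Fin (n + 1) => F i) (fun i => hF i) (hyp n)
  rw [integral_of_le ht] at h1
  rw [← ofReal_integral_eq_lintegral_ofReal ((hc n).integrableOn_Ioc)
    (Eventually.of_forall fun s => rpow_nonneg (hm0 n s) _), ofReal_rpow_of_nonneg hK hr0.le]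
  exact ofReal_le_ofReal h1

/-! ### Densities of distributions with localized frequencies, and Bernstein's inequality -/

/-- Riesz' representation of a tempered distribution that is bounded in `L²` on the frequency side. -/
lemma exists_density_two {T : Distr} {c : ℝ} (hc : 0 ≤ c)
    (hT : ∀ ψ : 𝒮, ‖T (𝓕 ψ)‖ ≤ c * (eLpNorm ψ 2 volume).toReal) :
    ∃ H : R3 → ℂ, MemLp H 2 ∧ eLpNorm H 2 ≤ ofReal c ∧ ∀ ψ : 𝒮, T (𝓕 ψ) = ∫ ξ, H ξ * ψ ξ := by
  set e : 𝒮 →ₗ[ℂ] Lp ℂ 2 (volume : Measure R3) :=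
    (toLpCLM ℂ ℂ 2 (volume : Measure R3)).toLinearMap
  have hd : DenseRange e := SchwartzMap.denseRange_toLpCLM ENNReal.ofNat_ne_top
  let f : 𝒮 →ₗ[ℂ] ℂ :=
    { toFun := fun ψ => T (𝓕 ψ)
      map_add' := fun ψ φ => by rw [FourierTransform.fourier_add, map_add]
      map_smul' := fun z ψ => by rw [FourierTransform.fourier_smul, map_smul]; rfl }
  have hn : ∀ ψ, ‖f ψ‖ ≤ c * ‖e ψ‖ := fun ψ => by
    have : ‖e ψ‖ = (eLpNorm ψ 2 volume).toReal := SchwartzMap.norm_toLp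
    rw [this]; exact hT ψ
  set w := (InnerProductSpace.toDual ℂ (Lp ℂ 2 (volume : Measure R3))).symm (f.extendOfNorm e) with hw
  have hwn : ‖w‖ ≤ c := by
    rw [hw, LinearIsometryEquiv.norm_map]
    exact LinearMap.opNorm_extendOfNorm_le hd hc hn
  have hwm : MemLp (⇑w) 2 volume := Lp.memLp w
  refine ⟨fun ξ => star (w ξ), hwm.star, ?_, fun ψ => ?_⟩
  · have e1 : eLpNorm (fun ξ => star (w ξ)) 2 volume = eLpNorm w 2 volume :=
      eLpNorm_congr_norm_ae (Eventually.of_forall fun ξ => norm_star _)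
    rw [e1, ← ofReal_toReal hwm.2.ne]
    exact ofReal_le_ofReal hwn
  · have e1 : T (𝓕 ψ) = f.extendOfNorm e (e ψ) := (LinearMap.extendOfNorm_eq hd ⟨c, hn⟩ ψ).symm
    rw [e1, ← InnerProductSpace.toDual_symm_apply, ← hw, L2.inner_def]
    refine integral_congr_ae ?_
    filter_upwards [SchwartzMap.coeFn_toLp ψ 2 volume] with ξ hξ
    have : (e ψ) ξ = ψ ξ := hξ
    rw [this]
    exact mul_comm _ _

lemma memLp_cutoff (p : ℝ≥0∞) :
    MemLp (fun ξ => ((P.cutoff j ξ : ℝ) : ℂ)) p volume :=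
  Continuous.memLp_of_hasCompactSupport (Complex.continuous_ofReal.comp (P.continuous_cutoff j))
    ((P.hasCompactSupport_cutoff j).comp_left (g := fun x : ℝ => (x : ℂ)) (by simp))

/-- The cutoff function as a Schwartz function. -/
def LittlewoodPaley.cutoffSchwartz : 𝒮 :=
  HasCompactSupport.toSchwartzMap (f := fun ξ => ((P.cutoff j ξ : ℝ) : ℂ))
    ((P.hasCompactSupport_cutoff j).comp_left (g := fun x : ℝ => (x : ℂ)) (by simp))
    (P.hasTemperateGrowth_cutoff_ofReal j).1

lemma cutoffSchwartz_apply (ξ : R3) :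
    P.cutoffSchwartz j ξ = P.cutoff j ξ := rfl

/-- The reproducing kernel of functions with localized frequencies. -/
def LittlewoodPaley.kernel : 𝒮 := 𝓕 (P.cutoffSchwartz j)

lemma fourier_kernel_sub (x ξ : R3) :
    𝓕 (fun y => P.kernel j (y - x)) ξ = Real.fourierChar (-inner ℝ x ξ) • ((P.cutoff j (-ξ) : ℝ) : ℂ) := by
  have h1 := congrFun (VectorFourier.fourierIntegral_comp_add_right Real.fourierChar
    (volume : Measure R3) (innerₗ R3) (P.kernel j) (-x)) ξ
  have h2 : 𝓕 (⇑(P.kernel j)) ξ = P.cutoff j (-ξ) := by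
    have h3 : 𝓕 (⇑(P.kernel j)) ξ = 𝓕⁻ (⇑(P.kernel j)) (-ξ) := by
      rw [Real.fourierInv_eq_fourier_neg, neg_neg]
    rw [h3, LittlewoodPaley.kernel, fourierInv_fourier_coe, cutoffSchwartz_apply]
  rw [← h2]
  have h4 : innerₗ R3 (-x) ξ = -inner ℝ x ξ := by simp
  rw [h4] at h1
  simp only [← sub_eq_add_neg] at h1
  exact h1

/-- A distribution with localized frequencies that is bounded in `L²` has a continuous square
integrable density, reproduced by the kernel. -/
lemma exists_density {T : Distr} {c : ℝ} (hc : 0 ≤ c)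
    (hT : ∀ ψ : 𝒮, ‖T (𝓕 ψ)‖ ≤ c * (eLpNorm ψ 2 volume).toReal)
    (hχ : ∀ ψ, T (𝓕 (P.cutoffMul j ψ)) = T (𝓕 ψ)) :
    ∃ h : R3 → ℂ, Continuous h ∧ MemLp h 2 ∧ eLpNorm h 2 ≤ ofReal c ∧
      (∀ θ : 𝒮, T θ = ∫ x, θ x * h x) ∧ ∀ x, h x = ∫ y, h y * P.kernel j (y - x) := by
  obtain ⟨H, hH, hHn, hTH⟩ := exists_density_two hc hT
  set χ : R3 → ℂ := fun ξ => ((P.cutoff j ξ : ℝ) : ℂ)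
  have hχn : ∀ ξ, ‖χ ξ‖ ≤ 1 := fun ξ => by
    rw [norm_real, norm_of_nonneg (P.cutoff_nonneg j ξ)]
    exact P.cutoff_le_one j ξ
  have hχc : Continuous χ := Complex.continuous_ofReal.comp (P.continuous_cutoff j)
  have hK2 : MemLp (fun ξ => χ ξ * H ξ) 2 volume :=
    hH.of_le (hχc.aestronglyMeasurable.mul hH.1) (Eventually.of_forall fun ξ => by
      rw [norm_mul]; exact mul_le_of_le_one_left (norm_nonneg _) (hχn ξ))
  have hK1 : Integrable fun ξ => χ ξ * H ξ := (memLp_cutoff P j 2).integrable_mul hH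
  have hKT : ∀ ψ : 𝒮, T (𝓕 ψ) = ∫ ξ, (χ ξ * H ξ) * ψ ξ := fun ψ => by
    rw [← hχ, hTH]
    refine integral_congr_ae (Eventually.of_forall fun ξ => ?_)
    simp only [P.cutoffMul_apply]; ring
  have hrep : ∀ᵐ ξ, χ ξ * (χ ξ * H ξ) = χ ξ * H ξ := by
    have hK3 : MemLp (fun ξ => χ ξ * (χ ξ * H ξ)) 2 volume :=
      hK2.of_le (hχc.aestronglyMeasurable.mul hK2.1) (Eventually.of_forall fun ξ => by
        rw [norm_mul (χ ξ)]; exact mul_le_of_le_one_left (norm_nonneg _) (hχn ξ))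
    refine ae_eq_of_integral_contDiff_smul_eq (hK3.locallyIntegrable (by norm_num))
      (hK2.locallyIntegrable (by norm_num)) fun g hg hgc => ?_
    have hg' : ContDiff ℝ (⊤ : ℕ∞) fun x => ((g x : ℝ) : ℂ) := Complex.ofRealCLM.contDiff.comp hg
    have hgc' : HasCompactSupport fun x => ((g x : ℝ) : ℂ) :=
      hgc.comp_left (g := fun x : ℝ => (x : ℂ)) (by simp)
    have h1 := hKT (hgc'.toSchwartzMap hg')
    rw [← hχ, hKT] at h1
    refine Eq.trans (integral_congr_ae (Eventually.of_forall fun ξ => ?_)) (h1.trans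
      (integral_congr_ae (Eventually.of_forall fun ξ => ?_)))
    · simp only [P.cutoffMul_apply, real_smul]
      change _ = _ * (_ * ((g ξ : ℝ) : ℂ)); ring
    · simp only [real_smul]
      change _ * ((g ξ : ℝ) : ℂ) = _; ring
  set K : R3 → ℂ := fun ξ => χ (-ξ) * H (-ξ)
  have hmp : MeasurePreserving (fun x : R3 => -x) volume volume := Measure.measurePreserving_neg _
  have hKi : Integrable K := hK1.comp_neg
  have hKm : MemLp K 2 := hK2.comp_measurePreserving hmp
  have hpair : ∀ f : R3 → ℂ, Integrable f → ∫ x, f x * 𝓕 K x = ∫ ξ, (χ ξ * H ξ) * 𝓕 f (-ξ) := fun f hf => by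
    have h1 := integral_fourier_smul hKi hf
    have h2 := integral_neg_eq_self (fun ξ => (χ ξ * H ξ) * 𝓕 f (-ξ)) volume
    simp only [neg_neg] at h2
    rw [← h2]
    refine Eq.trans ?_ h1
    exact integral_congr_ae (Eventually.of_forall fun x => mul_comm _ _)
  refine ⟨𝓕 K, continuous_fourier hKi, (memLp_fourier_two hKi hKm).1, ?_, fun θ => ?_, fun x => ?_⟩
  · rw [(memLp_fourier_two hKi hKm).2]
    have h1 : eLpNorm K 2 volume = eLpNorm (fun ξ => χ ξ * H ξ) 2 volume :=
      eLpNorm_comp_measurePreserving (g := fun ξ => χ ξ * H ξ) hK2.1 hmp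
    have h2 : eLpNorm (fun ξ => χ ξ * H ξ) 2 volume ≤ eLpNorm H 2 volume :=
      eLpNorm_mono fun ξ => by
        rw [norm_mul]; exact mul_le_of_le_one_left (norm_nonneg _) (hχn ξ)
    rw [h1]
    exact h2.trans hHn
  · have h1 : θ = 𝓕 (𝓕⁻ θ : 𝒮) := (FourierTransform.fourier_fourierInv_eq θ).symm
    rw [hpair θ θ.integrable]
    conv_lhs => rw [h1, hKT]
    refine integral_congr_ae (Eventually.of_forall fun ξ => ?_)
    simp only
    rw [SchwartzMap.fourierInv_coe, Real.fourierInv_eq_fourier_neg]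
  · have h1 := hpair (fun y => P.kernel j (y - x)) ((P.kernel j).integrable.comp_sub_right x)
    have h2 : ∫ y, 𝓕 K y * P.kernel j (y - x) = ∫ y, P.kernel j (y - x) * 𝓕 K y :=
      integral_congr_ae (Eventually.of_forall fun x => mul_comm _ _)
    rw [h2, h1, Real.fourier_eq, ← integral_neg_eq_self]
    refine integral_congr_ae ?_
    filter_upwards [hrep] with ξ hξ
    simp only [K, neg_neg]
    rw [fourier_kernel_sub, neg_neg]
    simp only [Circle.smul_def, smul_eq_mul, inner_neg_left, inner_neg_right, neg_neg, real_inner_comm]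
    have key : ∀ z : ℂ, z * (χ ξ * H ξ) = χ ξ * H ξ * (z * χ ξ) := fun z => by
      linear_combination (-z) * hξ
    exact key _

lemma cutoff_eq_cutoff_zero (ξ : R3) :
    P.cutoff j ξ = P.cutoff 0 ((2 : ℝ) ^ (-j) • ξ) := by
  unfold LittlewoodPaley.cutoff LittlewoodPaley.mult
  refine sum_congr rfl fun i _ => ?_
  rw [smul_comm (2 * π) ((2 : ℝ) ^ (-j)), smul_smul ((2 : ℝ) ^ (-(0 + i))),
    ← zpow_add₀ two_ne_zero]
  congr 3
  ring

lemma kernel_eq_kernel_zero (x : R3) :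
    P.kernel j x = (((2 : ℝ) ^ j) ^ 3 : ℝ) * P.kernel 0 ((2 : ℝ) ^ j • x) := by
  have h0 : (0 : ℝ) < 2 ^ j := by positivity
  have e : ∀ i x, P.kernel i x = ∫ v, Real.fourierChar (-inner ℝ v x) • ((P.cutoff i v : ℝ) : ℂ) := fun i x => by
    rw [LittlewoodPaley.kernel, SchwartzMap.fourier_coe, Real.fourier_eq]; rfl
  rw [e, e]
  have h1 := Measure.integral_comp_smul (volume : Measure R3)
    (fun v => Real.fourierChar (-inner ℝ v ((2 : ℝ) ^ j • x)) • ((P.cutoff 0 v : ℝ) : ℂ)) ((2 : ℝ) ^ (-j))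
  rw [finrank_euclideanSpace_fin, zpow_neg, inv_pow, inv_inv, abs_of_pos (by positivity),
    real_smul] at h1
  rw [← h1]
  refine integral_congr_ae (Eventually.of_forall fun v => ?_)
  simp only
  rw [cutoff_eq_cutoff_zero P j, zpow_neg, inner_smul_left, inner_smul_right]
  congr 3
  simp
  field_simp

lemma eLpNorm_kernel {p p' : ℝ} (hp : p.HolderConjugate p') :
    eLpNorm (P.kernel j) (ofReal p') =
      ofReal (((2 : ℝ) ^ j) ^ (3 / p)) * eLpNorm (P.kernel 0) (ofReal p') := by
  have h0 : (0 : ℝ) < 2 ^ j := by positivity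
  have hp'0 : 0 < p' := hp.symm.pos
  have hne : ofReal p' ≠ 0 := by simpa using hp'0
  rw [((P.kernel j).memLp _ volume).eLpNorm_eq_integral_rpow_norm hne ofReal_ne_top,
    ((P.kernel 0).memLp _ volume).eLpNorm_eq_integral_rpow_norm hne ofReal_ne_top,
    toReal_ofReal hp'0.le, ← ofReal_mul (by positivity)]
  congr 1
  have h1 := Measure.integral_comp_smul (volume : Measure R3) (fun x => ‖P.kernel 0 x‖ ^ p') ((2 : ℝ) ^ j)
  rw [finrank_euclideanSpace_fin, abs_of_pos (by positivity), smul_eq_mul] at h1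
  have h2 : ∀ x, ‖P.kernel j x‖ ^ p' = (((2 : ℝ) ^ j) ^ 3) ^ p' * ‖P.kernel 0 ((2 : ℝ) ^ j • x)‖ ^ p' := fun x => by
    rw [kernel_eq_kernel_zero, norm_mul, norm_real, norm_of_nonneg (by positivity),
      mul_rpow (by positivity) (norm_nonneg _)]
  simp only [h2]
  rw [integral_const_mul, h1, ← mul_assoc, mul_rpow (by positivity)
    (integral_nonneg fun _ => by positivity)]
  congr 1
  generalize (2 : ℝ) ^ j = c at h0
  rw [← rpow_natCast, ← rpow_mul h0.le, ← Real.rpow_neg h0.le, ← rpow_add h0, ← rpow_mul h0.le]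
  congr 1
  have := hp.inv_add_inv_eq_one
  have hp0 := hp.pos
  field_simp at this ⊢
  push_cast
  linarith

lemma eLpNorm_kernel_ne_top (p : ℝ≥0∞) :
    eLpNorm (P.kernel j) p volume ≠ ∞ := ((P.kernel j).memLp p volume).2.ne

/-- Bernstein's inequality. -/
lemma eLpNorm_le_of_reproduced {h : R3 → ℂ} (hc : Continuous h)
    (hrep : ∀ x, h x = ∫ y, h y * P.kernel j (y - x)) {p p' : ℝ} (hp : p.HolderConjugate p')
    {q : ℝ≥0∞} (hq : ofReal p ≤ q) :
    eLpNorm h q ≤ eLpNorm h (ofReal p) *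
      eLpNorm (P.kernel j) (ofReal p') ^ (1 - p * (q⁻¹).toReal) := by
  have hp0 : 0 < p := hp.pos
  have hpne : ofReal p ≠ 0 := by simpa using hp0
  set N := eLpNorm h (ofReal p)
  set b := eLpNorm (P.kernel j) (ofReal p')
  have hb : ∀ x, ‖h x‖ₑ ≤ N * b := fun x => by
    have hκc : Continuous fun y => P.kernel j (y - x) := (P.kernel j).continuous.comp (by fun_prop)
    have := hp.ennrealOfReal
    have h1 := eLpNorm_smul_le_mul_eLpNorm (p := ofReal p) (q := ofReal p') (r := 1)
      (μ := volume) hκc.aestronglyMeasurable (φ := h) hc.aestronglyMeasurable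
    have h2 : eLpNorm (fun y => P.kernel j (y - x)) (ofReal p') = b :=
      eLpNorm_comp_measurePreserving (P.kernel j).continuous.aestronglyMeasurable
        (measurePreserving_sub_right volume x)
    rw [h2, eLpNorm_one_eq_lintegral_enorm] at h1
    rw [hrep x]
    exact (enorm_integral_le_lintegral_enorm _).trans h1
  by_cases hqt : q = ∞
  · rw [hqt, ENNReal.inv_top, ENNReal.toReal_zero, mul_zero, sub_zero, ENNReal.rpow_one,
      eLpNorm_exponent_top]
    exact essSup_le_of_ae_le _ (Eventually.of_forall hb)
  have hq0 : q ≠ 0 := fun h => hpne (le_antisymm (h ▸ hq) bot_le)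
  have hs : p ≤ q.toReal := by
    have := (ENNReal.toReal_le_toReal ofReal_ne_top hqt).2 hq
    rwa [toReal_ofReal hp0.le] at this
  have hs0 : 0 < q.toReal := hp0.trans_le hs
  have hNp : N ^ p = ∫⁻ x, ‖h x‖ₑ ^ p := by
    simp only [N]
    rw [eLpNorm_eq_lintegral_rpow_enorm_toReal hpne ofReal_ne_top, toReal_ofReal hp0.le,
      ← ENNReal.rpow_mul, one_div, inv_mul_cancel₀ hp0.ne', ENNReal.rpow_one]
  rw [eLpNorm_eq_lintegral_rpow_enorm_toReal hq0 hqt, toReal_inv]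
  set s := q.toReal
  have h1 : ∫⁻ x, ‖h x‖ₑ ^ s ≤ N ^ p * (N * b) ^ (s - p) := by
    rw [hNp, ← lintegral_mul_const _ (hc.measurable.enorm.pow_const p)]
    refine lintegral_mono fun x => ?_
    calc ‖h x‖ₑ ^ s = ‖h x‖ₑ ^ p * ‖h x‖ₑ ^ (s - p) := by
          rw [← ENNReal.rpow_add_of_nonneg _ _ hp0.le (by linarith)]; congr 1; ring
      _ ≤ _ := by
          gcongr
          exact hb x
  refine (ENNReal.rpow_le_rpow h1 (by positivity)).trans (le_of_eq ?_)
  rw [ENNReal.mul_rpow_of_nonneg _ _ (by linarith : 0 ≤ s - p), ← mul_assoc,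
    ← ENNReal.rpow_add_of_nonneg _ _ hp0.le (by linarith), ENNReal.mul_rpow_of_nonneg _ _ (by positivity),
    ← ENNReal.rpow_mul, ← ENNReal.rpow_mul]
  congr 1
  · rw [show (p + (s - p)) * (1 / s) = 1 by field_simp; ring, ENNReal.rpow_one]
  · congr 1
    field_simp

/-! ### Duality in `L^p` on a dense sequence -/

lemma exists_dense_schwartz (p : ℝ≥0∞) [Fact (1 ≤ p)] (hp : p ≠ ∞) :
    ∃ θ : ℕ → 𝒮, DenseRange fun i => (θ i).toLp p (volume : Measure R3) := by
  have : Fact (p ≠ ∞) := ⟨hp⟩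
  have hd : Dense (range (toLpCLM ℝ ℂ p (volume : Measure R3))) :=
    SchwartzMap.denseRange_toLpCLM hp
  obtain ⟨A, hA, hAc, hAd⟩ := hd.exists_countable_dense_subset
  obtain ⟨v, hv⟩ := hAc.exists_eq_range hAd.nonempty
  have h1 : ∀ i, ∃ θ : 𝒮, toLpCLM ℝ ℂ p (volume : Measure R3) θ = v i := fun i =>
    hA (hv ▸ mem_range_self i)
  choose θ hθ using h1
  refine ⟨θ, ?_⟩
  have : (fun i => (θ i).toLp p (volume : Measure R3)) = v := funext hθ
  rw [this, DenseRange, ← hv]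
  exact hAd

lemma eLpNorm_le_of_dense {p p' : ℝ} (hp : 2 < p) (hpp : p.HolderConjugate p')
    [Fact (1 ≤ ofReal p')] {θ : ℕ → 𝒮}
    (hθ : DenseRange fun i => (θ i).toLp (ofReal p') (volume : Measure R3))
    {h : R3 → ℂ} (hc : Continuous h) (hm : MemLp h (ofReal p)) {c : ℝ}
    (hc0 : 0 ≤ c) (hyp : ∀ i, ‖∫ x, θ i x * h x‖ ≤ c * (eLpNorm (θ i) (ofReal p') volume).toReal) :
    eLpNorm h (ofReal p) ≤ ofReal c := by
  have hp0 : 0 < p := by linarith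
  have hp'0 : 0 < p' := hpp.symm.pos
  have hpne : ofReal p ≠ 0 := by simpa using hp0
  have hp'ne : ofReal p' ≠ 0 := by simpa using hp'0
  have := hpp.ennrealOfReal
  have hF : Fact (1 ≤ ofReal p) := ⟨by
    rw [← ofReal_one]; exact ofReal_le_ofReal (by linarith)⟩
  set Φ := (ContinuousLinearMap.mul ℂ ℂ).lpPairing volume (ofReal p) (ofReal p') (hm.toLp h)
  have hΦ : ∀ (f : R3 → ℂ) (hf : MemLp f (ofReal p')), Φ (hf.toLp f) = ∫ x, f x * h x := fun f hf => by
    rw [ContinuousLinearMap.lpPairing_eq_integral]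
    refine integral_congr_ae ?_
    filter_upwards [hm.coeFn_toLp, hf.coeFn_toLp] with x h1 h2
    rw [h1, h2]
    exact mul_comm _ _
  have hall : ∀ f : Lp ℂ (ofReal p') (volume : Measure R3), ‖Φ f‖ ≤ c * ‖f‖ := fun f => by
    refine hθ.induction_on (p := fun f => ‖Φ f‖ ≤ c * ‖f‖) f
      (isClosed_le Φ.continuous.norm (continuous_const.mul continuous_norm)) fun i => ?_
    have h1 := hΦ (θ i) ((θ i).memLp _ volume)
    have h2 : ‖(θ i).toLp (ofReal p') (volume : Measure R3)‖ =
      (eLpNorm (θ i) (ofReal p') volume).toReal := SchwartzMap.norm_toLp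
    rw [h2]
    exact (le_of_eq (congrArg norm h1)).trans (hyp i)
  set f : R3 → ℂ := fun x => ((‖h x‖ ^ (p - 2) : ℝ) : ℂ) * (starRingEnd ℂ) (h x)
  have hfc : Continuous f := (Complex.continuous_ofReal.comp
    (hc.norm.rpow_const fun _ => Or.inr (by linarith))).mul (Complex.continuous_conj.comp hc)
  have hfn : ∀ x, ‖f x‖ = ‖h x‖ ^ (p - 1) := fun x => by
    simp only [f]
    rw [norm_mul, norm_real, norm_of_nonneg (by positivity), RCLike.norm_conj]
    nth_rewrite 2 [← rpow_one ‖h x‖]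
    rw [← Real.rpow_add_of_nonneg (norm_nonneg _) (by linarith) zero_le_one]
    ring_nf
  have hfp : ∀ x, ‖f x‖ ^ p' = ‖h x‖ ^ p := fun x => by
    rw [hfn, ← rpow_mul (norm_nonneg _), hpp.sub_one_mul_conj]
  have hfe : ∀ x, ‖f x‖ₑ ^ p' = ‖h x‖ₑ ^ p := fun x => by
    rw [← ofReal_norm, ← ofReal_norm, ofReal_rpow_of_nonneg (norm_nonneg _) hp'0.le,
      ofReal_rpow_of_nonneg (norm_nonneg _) hp0.le, hfp]
  have hfm : MemLp f (ofReal p') := by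
    refine ⟨hfc.aestronglyMeasurable, ?_⟩
    rw [eLpNorm_lt_top_iff_lintegral_rpow_enorm_lt_top hp'ne ofReal_ne_top,
      toReal_ofReal hp'0.le]
    simp only [hfe]
    have := (eLpNorm_lt_top_iff_lintegral_rpow_enorm_lt_top hpne ofReal_ne_top).1 hm.2
    rwa [toReal_ofReal hp0.le] at this
  have h1 := hall (hfm.toLp f)
  rw [hΦ, Lp.norm_toLp, hfm.eLpNorm_eq_integral_rpow_norm hp'ne ofReal_ne_top,
    toReal_ofReal hp'0.le, toReal_ofReal (by positivity)] at h1
  rw [hm.eLpNorm_eq_integral_rpow_norm hpne ofReal_ne_top, toReal_ofReal hp0.le]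
  refine ofReal_le_ofReal ?_
  simp only [hfp] at h1
  have h2 : ∀ x, f x * h x = ((‖h x‖ ^ p : ℝ) : ℂ) := fun x => by
    simp only [f]
    rw [mul_assoc, Complex.conj_mul', ← ofReal_pow, ← Complex.ofReal_mul, ← rpow_natCast,
      ← Real.rpow_add_of_nonneg (norm_nonneg _) (by linarith) (by norm_num)]
    congr 2
    push_cast; ring
  simp only [h2] at h1
  have h3 : ∫ x, ((‖h x‖ ^ p : ℝ) : ℂ) = ((∫ x, ‖h x‖ ^ p : ℝ) : ℂ) := integral_ofReal
  have hX0 : 0 ≤ ∫ x, ‖h x‖ ^ p := integral_nonneg fun _ => by positivity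
  rw [h3, norm_real, norm_of_nonneg hX0] at h1
  generalize (∫ x, ‖h x‖ ^ p) = X at h1 hX0
  rcases hX0.eq_or_lt with h | h
  · rw [← h, Real.zero_rpow (by positivity)]
    exact hc0
  · have h5 : p'⁻¹ = 1 - p⁻¹ := by linarith [hpp.inv_add_inv_eq_one]
    rw [h5, Real.rpow_sub h, rpow_one, mul_div_assoc', le_div_iff₀ (by positivity), mul_comm c] at h1
    exact le_of_mul_le_mul_left h1 h

/-! ### Estimates for the dyadic blocks of the solution -/

lemma norm_le_of_integral_le {t c : ℝ} (ht : 0 < t) (hc : 0 ≤ c) {F : ℝ → ℂ} (hF : Continuous F)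
    (hyp : ∀ η : ℝ → ℂ, Continuous η → ‖∫ s in (0 : ℝ)..t, η s * F s‖ ≤ c * ∫ s in (0 : ℝ)..t, ‖η s‖)
    {s : ℝ} (hs : s ∈ Icc 0 t) : ‖F s‖ ≤ c := by
  by_contra! hlt
  set w : ℝ → ℝ := fun s => max (‖F s‖ - c) 0 with hw
  have hwc : Continuous w := by fun_prop
  have hw0 : ∀ s, 0 ≤ w s := fun s => le_max_right _ _
  have h1 := hyp (fun s => (w s : ℂ) * (starRingEnd ℂ) (F s))
    ((Complex.continuous_ofReal.comp hwc).mul (Complex.continuous_conj.comp hF))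
  have h2 : ∀ s, (w s : ℂ) * (starRingEnd ℂ) (F s) * F s = ((w s * ‖F s‖ ^ 2 : ℝ) : ℂ) := fun s => by
    rw [mul_assoc, Complex.conj_mul']; push_cast; rfl
  have h3 : ∀ s, ‖(w s : ℂ) * (starRingEnd ℂ) (F s)‖ = w s * ‖F s‖ := fun s => by
    rw [norm_mul, norm_real, norm_of_nonneg (hw0 s), RCLike.norm_conj]
  simp only [h2, h3] at h1
  rw [intervalIntegral.integral_ofReal, norm_real] at h1
  have h4 := (Real.le_norm_self _).trans h1
  have c1 : Continuous fun s => w s * ‖F s‖ ^ 2 := hwc.mul (hF.norm.pow 2)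
  have c2 : Continuous fun s => c * (w s * ‖F s‖) := continuous_const.mul (hwc.mul hF.norm)
  rw [← intervalIntegral.integral_const_mul, ← sub_nonpos, ← intervalIntegral.integral_sub
    (c1.intervalIntegrable _ _) (c2.intervalIntegrable _ _)] at h4
  refine absurd (intervalIntegral.integral_pos ht (by fun_prop :
    Continuous fun x => w x * ‖F x‖ ^ 2 - c * (w x * ‖F x‖)).continuousOn (fun x _ => ?_) ⟨s, hs, ?_⟩)
    (not_lt.2 h4)
  · by_cases h : ‖F x‖ ≤ c
    · simp [hw, max_eq_right (sub_nonpos.2 h)]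
    · push Not at h
      have := hw0 x
      have h5 : 0 ≤ w x * ‖F x‖ * (‖F x‖ - c) := by
        have : 0 ≤ ‖F x‖ - c := by linarith
        positivity
      linarith
  · have h5 : 0 < ‖F s‖ - c := by linarith
    have h6 : 0 < w s := lt_max_of_lt_left h5
    have : 0 < w s * ‖F s‖ * (‖F s‖ - c) := mul_pos (mul_pos h6 (hc.trans_lt hlt)) h5
    linarith

lemma lqNorm_le_eLpNorm {q : ℝ≥0∞} {T : Distr} {h : R3 → ℂ} (hm : MemLp h q)
    (hT : ∀ θ : 𝒮, T θ = ∫ x, θ x * h x) : lqNorm q T ≤ eLpNorm h q :=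
  iInf_le_of_le h (iInf_le_of_le hm (iInf_le _ hT))

lemma isForce_finiteForce {γ N t : ℝ} (hγ : 0 < γ) (hγ1 : γ < 1) (hN : 0 < N) {n : ℕ} {η : Fin n → ℝ → ℂ}
    (hη : ∀ i, Continuous (η i)) (θ : Fin n → 𝒮)
    (hb : ∫⁻ s in Ioc 0 t, (∑ i, ‖η i s‖ₑ * eLpNorm (θ i) (ofReal (2 / (1 + γ))) volume) ^
      (2 / (2 - γ)) ≤ ofReal N) :
    IsForce γ N t (finiteForce η fun i => 𝓕⁻ (θ i)) := by
  have hF : ∀ s, 𝓕 (finiteForce η (fun i => 𝓕⁻ (θ i)) s) = finiteForce η θ s := fun s => by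
    have h1 := map_sum (FourierTransform.fourierCLM ℂ 𝒮)
      (fun i => η i s • (𝓕⁻ (θ i) : 𝒮)) Finset.univ
    refine h1.trans (sum_congr rfl fun i _ => ?_)
    rw [map_smul]
    congr 1
    exact FourierTransform.fourier_fourierInv_eq (F := 𝒮) (θ i)
  refine ⟨continuous_finiteForce hη, ?_, by simpa only [hF] using continuous_finiteForce hη, hN, ?_⟩
  · choose M hM using fun i => isCompact_Icc.exists_bound_of_continuousOn
      ((hη i).continuousOn (s := Icc 0 t))
    refine ⟨∑ i, M i * seminorm ℂ 0 0 (𝓕⁻ (θ i) : 𝒮), fun s hs ξ => ?_⟩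
    rw [finiteForce_apply]
    refine (norm_sum_le _ _).trans (sum_le_sum fun i _ => ?_)
    rw [norm_mul]
    exact mul_le_mul (hM i s hs) (SchwartzMap.norm_le_seminorm ℂ _ ξ) (norm_nonneg _)
      ((norm_nonneg _).trans (hM i s hs))
  · refine le_trans (lintegral_mono fun s => ?_) hb
    simp only [hF]
    have hp0 : 0 < 2 / (1 + γ) := by positivity
    have h1 := ((finiteForce η θ s).memLp (ofReal (2 / (1 + γ)))
      volume).eLpNorm_eq_integral_rpow_norm (by simpa using by positivity) ofReal_ne_top
    rw [toReal_ofReal hp0.le, inv_div] at h1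
    rw [← h1]
    refine ENNReal.rpow_le_rpow ?_ (div_nonneg zero_le_two (by linarith))
    have h2 : (finiteForce η θ s : R3 → ℂ) = ∑ i, η i s • (θ i : R3 → ℂ) := by
      ext x; rw [finiteForce_apply]; simp
    rw [h2]
    refine (eLpNorm_sum_le (fun i _ => ((θ i).continuous.const_smul _).aestronglyMeasurable) ?_).trans
      (sum_le_sum fun i _ => (eLpNorm_const_smul _ _ _ _).le)
    rw [← ofReal_one]
    exact ofReal_le_ofReal ((one_le_div (by positivity)).2 (by linarith))

section Solution

variable {μ μ' ε Ω T : ℝ} {a₀ : Distr} {u₀ : Fin 3 → Distr} {f : ℝ → Distr}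
  {g : ℝ → Fin 3 → Distr} {a : ℝ → Distr} {u : ℝ → Fin 3 → Distr} {t : ℝ}

lemma IsSolution.continuousOn_block (h : IsSolution μ μ' ε Ω T a₀ u₀ f g a u) (ht : t ∈ Icc 0 T)
    (k : Fin 4) (θ : 𝒮) :
    ContinuousOn (fun s => P.block j (state (a s) (u s) k) θ) (Icc 0 t) := by
  have h1 : θ = 𝓕 (𝓕⁻ θ : 𝒮) := (FourierTransform.fourier_fourierInv_eq θ).symm
  rw [h1]
  simp only [P.block_fourier]
  exact (h.continuousOn_state k _).mono (Icc_subset_Icc_right ht.2)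

/-- The energy estimate for a dyadic block at a fixed time. -/
lemma IsSolution.norm_block_le (k : Fin 4) (hμ : 0 < μ)
    (hν : 2 * μ + μ' = 1) (hε : 0 < ε) (h : IsSolution μ μ' ε Ω T a₀ u₀ f g a u) (ht0 : 0 < t)
    (ht : t ≤ T) (hD : dataNorm P j t a₀ u₀ f g ≠ ∞)
    {s : ℝ} (hs : s ∈ Icc 0 t) (ψ : 𝒮) :
    ‖P.block j (state (a s) (u s) k) (𝓕 ψ)‖ ≤
      (dataNorm P j t a₀ u₀ f g).toReal * (eLpNorm ψ 2 volume).toReal := by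
  set D := dataNorm P j t a₀ u₀ f g with hDdef
  set n := (eLpNorm ψ 2 volume).toReal
  have hn0 : 0 ≤ n := toReal_nonneg
  have hψi : Integrable fun ξ => ‖ψ ξ‖ ^ 2 := (ψ.memLp 2 volume).integrable_norm_pow two_ne_zero
  have hn : ∫ ξ, ‖ψ ξ‖ ^ 2 = n ^ 2 := by
    have h1 := (ψ.memLp 2 volume).eLpNorm_eq_integral_rpow_norm (by norm_num) (by norm_num)
    have h2 : n = (∫ ξ, ‖ψ ξ‖ ^ 2) ^ (2⁻¹ : ℝ) := by
      simp only [n]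
      rw [h1, toReal_ofReal (by positivity)]
      norm_num
    rw [h2, ← rpow_natCast, ← rpow_mul (integral_nonneg fun _ => by positivity)]
    norm_num
  have hcont := h.continuousOn_block P j ⟨ht0.le, ht⟩ k (𝓕 ψ)
  set F := IccExtend ht0.le ((Icc 0 t).domRestrict fun s => P.block j (state (a s) (u s) k) (𝓕 ψ))
  have hFc : Continuous F := hcont.domRestrict.Icc_extend'
  have hFe : ∀ s ∈ Icc 0 t, F s = P.block j (state (a s) (u s) k) (𝓕 ψ) := fun s hs =>
    IccExtend_of_mem _ _ hs
  rw [← hFe s hs]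
  refine norm_le_of_integral_le ht0 (by positivity) hFc (fun η hη => ?_) hs
  set I := ∫ s in (0 : ℝ)..t, ‖η s‖
  have hI0 : 0 ≤ I := intervalIntegral.integral_nonneg ht0.le fun _ _ => norm_nonneg _
  have hG : ∀ s, finiteForce (fun _ : Unit => η) (fun _ => ψ) s = η s • ψ := fun s => by
    simp [finiteForce]
  have hV : ∀ s ∈ Icc 0 t, ∀ ξ, ‖backward μ ε Ω (EuclideanSpace.single k 1)
      (finiteForce (fun _ : Unit => η) fun _ => ψ) t s ξ‖ ≤ I * ‖ψ ξ‖ := fun s hs ξ => by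
    have h1 : ‖backward μ ε Ω (EuclideanSpace.single k 1)
      (finiteForce (fun _ : Unit => η) fun _ => ψ) t s ξ‖ ≤ ∫ x in s..t, ‖η x‖ * ‖ψ ξ‖ := by
      refine intervalIntegral.norm_integral_le_of_norm_le hs.2 (Eventually.of_forall fun x hx => ?_)
        ((hη.norm.mul continuous_const).intervalIntegrable _ _)
      rw [hG, norm_smul, smul_apply, norm_smul]
      refine mul_le_of_le_one_right (by positivity) ((norm_flow_le hμ hε.ne' _ (by linarith [hx.1])).trans ?_)
      simp
    refine h1.trans ?_
    rw [intervalIntegral.integral_mul_const]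
    refine mul_le_mul_of_nonneg_right ?_ (norm_nonneg _)
    have h2 := integral_add_adjacent_intervals (hη.norm.intervalIntegrable 0 s)
      (hη.norm.intervalIntegrable s t) (μ := volume)
    have h3 : 0 ≤ ∫ x in (0 : ℝ)..s, ‖η x‖ := intervalIntegral.integral_nonneg hs.1 fun _ _ => norm_nonneg _
    linarith
  have hmain : ∀ δ : ℝ, 0 < δ → ‖∫ s in (0 : ℝ)..t, η s * F s‖ ≤ D.toReal * (I * n + δ) := fun δ hδ => by
    have h1 := h.enorm_integral_le (ι := Unit) (η := fun _ => η) (ψ := fun _ => ψ) (k := k) P j hμ hν hε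
      ⟨ht0.le, ht⟩ (fun _ => hη) (Q := I * n + δ) (by positivity) fun s hs => by
        calc _ ≤ ∫ ξ, I ^ 2 * ‖ψ ξ‖ ^ 2 := by
              refine integral_mono_of_nonneg (Eventually.of_forall fun ξ => by positivity)
                (hψi.const_mul _) (Eventually.of_forall fun ξ => ?_)
              have h2 : P.cutoff j ξ ^ 2 ≤ 1 := pow_le_one₀ (P.cutoff_nonneg j ξ) (P.cutoff_le_one j ξ)
              have h3 := pow_le_pow_left₀ (norm_nonneg _) (hV s hs ξ) 2
              rw [mul_pow] at h3
              exact (mul_le_of_le_one_left (by positivity) h2).trans h3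
          _ = (I * n) ^ 2 := by rw [integral_const_mul, hn, mul_pow]
          _ ≤ _ := pow_le_pow_left₀ (by positivity) (by linarith) 2
    have h2 : ∫ s in (0 : ℝ)..t, P.block j (state (a s) (u s) k)
        (𝓕 (finiteForce (fun _ : Unit => η) (fun _ => ψ) s)) = ∫ s in (0 : ℝ)..t, η s * F s := by
      refine integral_congr fun s hs => ?_
      rw [uIcc_of_le ht0.le] at hs
      rw [hFe s hs, hG, FourierTransform.fourier_smul, map_smul, smul_eq_mul]
    rw [h2, ← hDdef, ← ofReal_toReal hD, ← ofReal_mul toReal_nonneg,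
      ← ofReal_norm] at h1
    exact (ENNReal.ofReal_le_ofReal_iff (by positivity)).1 h1
  refine le_of_forall_pos_le_add fun e he => ?_
  have h1 := hmain (e / (D.toReal + 1)) (by positivity)
  have h2 : D.toReal * (e / (D.toReal + 1)) ≤ e := by
    rw [mul_div_assoc', div_le_iff₀ (by positivity)]
    nlinarith [toReal_nonneg (a := D)]
  linarith

/-- The density of a dyadic block of the solution. -/
lemma IsSolution.exists_block_density (k : Fin 4) (hμ : 0 < μ)
    (hν : 2 * μ + μ' = 1) (hε : 0 < ε) (h : IsSolution μ μ' ε Ω T a₀ u₀ f g a u) (ht0 : 0 < t)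
    (ht : t ≤ T) (hD : dataNorm P j t a₀ u₀ f g ≠ ∞)
    {s : ℝ} (hs : s ∈ Icc 0 t) :
    ∃ v : R3 → ℂ, Continuous v ∧ (∀ q, 2 ≤ q → MemLp v q) ∧
      eLpNorm v 2 ≤ dataNorm P j t a₀ u₀ f g ∧
      (∀ θ : 𝒮, P.block j (state (a s) (u s) k) θ = ∫ x, θ x * v x) ∧
      ∀ x, v x = ∫ y, v y * P.kernel j (y - x) := by
  obtain ⟨v, h1, h2, h3, h4, h5⟩ := exists_density P j toReal_nonneg
    (fun ψ => h.norm_block_le P j k hμ hν hε ht0 ht hD hs ψ) fun ψ => by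
      rw [P.block_fourier, P.block_fourier, P.blockMul_cutoffMul]
  rw [ofReal_toReal hD] at h3
  refine ⟨v, h1, fun q hq => ⟨h1.aestronglyMeasurable, ?_⟩, h3, h4, h5⟩
  have hc : (2 : ℝ).HolderConjugate 2 := Real.HolderConjugate.two_two
  refine (eLpNorm_le_of_reproduced P j h1 h5 hc (by simpa using hq)).trans_lt (ENNReal.mul_lt_top ?_ ?_)
  · simpa using h2.2
  · refine ENNReal.rpow_lt_top_of_nonneg ?_ (eLpNorm_kernel_ne_top P j _)
    rw [sub_nonneg, toReal_inv]
    by_cases hqt : q = ∞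
    · simp [hqt]
    · have h6 : 2 ≤ q.toReal := by
        have := (ENNReal.toReal_le_toReal (by norm_num) hqt).2 hq
        simpa using this
      rw [← div_eq_mul_inv, div_le_one (by linarith)]
      exact h6

/-- Pairing of a block with finitely many time profiles, given the dual Strichartz estimate. -/
lemma IsSolution.norm_integral_block_le (k : Fin 4) (hμ : 0 < μ)
    (hν : 2 * μ + μ' = 1) (hε : 0 < ε) (h : IsSolution μ μ' ε Ω T a₀ u₀ f g a u) (ht0 : 0 < t)
    (ht : t ≤ T) (hD : dataNorm P j t a₀ u₀ f g ≠ ∞)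
    {γ X : ℝ} (hγ : 0 < γ) (hγ1 : γ < 1) (hX : 0 < X)
    (hdual : ∀ G N, IsForce γ N t G → ∀ s ∈ Icc 0 t, ∫ ξ, P.cutoff j ξ ^ 2 *
      ‖backward μ ε Ω (EuclideanSpace.single k 1) G t s ξ‖ ^ 2 ≤ X ^ 2 * N ^ (2 - γ))
    {n : ℕ} {η : Fin n → ℝ → ℂ} (hη : ∀ i, Continuous (η i)) (θ : Fin n → 𝒮) :
    ‖∫ s in (0 : ℝ)..t, ∑ i, η i s * ((((eLpNorm (θ i) (ofReal (2 / (1 + γ))) volume).toReal⁻¹ : ℝ) : ℂ) *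
        P.block j (state (a s) (u s) k) (θ i))‖ ≤
      (dataNorm P j t a₀ u₀ f g).toReal * X *
        (∫ s in (0 : ℝ)..t, (∑ i, ‖η i s‖) ^ (2 / (2 - γ))) ^ ((2 - γ) / 2) := by
  set D := dataNorm P j t a₀ u₀ f g with hDdef
  set m : Fin n → ℝ≥0∞ := fun i => eLpNorm (θ i) (ofReal (2 / (1 + γ))) volume
  have hm : ∀ i, m i ≠ ∞ := fun i => ((θ i).memLp _ volume).2.ne
  set I := ∫ s in (0 : ℝ)..t, (∑ i, ‖η i s‖) ^ (2 / (2 - γ))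
  have hp0 : 0 < 2 / (2 - γ) := div_pos two_pos (by linarith)
  have hIc : Continuous fun s => (∑ i, ‖η i s‖) ^ (2 / (2 - γ)) :=
    (continuous_finsetSum _ fun i _ => (hη i).norm).rpow_const fun _ => Or.inr hp0.le
  have hI0 : 0 ≤ I := intervalIntegral.integral_nonneg ht0.le fun _ _ => by positivity
  set η' : Fin n → ℝ → ℂ := fun i s => ((m i).toReal⁻¹ : ℝ) * η i s
  have hη' : ∀ i, Continuous (η' i) := fun i => continuous_const.mul (hη i)
  have hmain : ∀ δ : ℝ, 0 < δ → ‖∫ s in (0 : ℝ)..t, ∑ i, η i s *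
      ((((m i).toReal⁻¹ : ℝ) : ℂ) * P.block j (state (a s) (u s) k) (θ i))‖ ≤
      D.toReal * X * (I + δ) ^ ((2 - γ) / 2) := fun δ hδ => by
    have hforce : IsForce γ (I + δ) t (finiteForce η' fun i => 𝓕⁻ (θ i)) := by
      refine isForce_finiteForce hγ hγ1 (by positivity) hη' θ ?_
      calc _ ≤ ∫⁻ s in Ioc 0 t, ofReal ((∑ i, ‖η i s‖) ^ (2 / (2 - γ))) := by
            refine lintegral_mono fun s => ?_
            simp only
            rw [← ofReal_rpow_of_nonneg (by positivity) hp0.le,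
              ENNReal.ofReal_sum_of_nonneg fun _ _ => norm_nonneg _]
            refine ENNReal.rpow_le_rpow (sum_le_sum fun i _ => ?_) hp0.le
            simp only [η']
            rw [enorm_mul, ofReal_norm, mul_comm, ← mul_assoc]
            refine mul_le_of_le_one_left' ?_
            change m i * _ ≤ 1
            rw [← ofReal_norm, norm_real, norm_of_nonneg (by positivity)]
            nth_rewrite 1 [← ofReal_toReal (hm i)]
            rw [← ofReal_mul toReal_nonneg, ← ofReal_one]
            exact ofReal_le_ofReal mul_inv_le_one
        _ = ofReal I := by
            simp only [I]
            rw [integral_of_le ht0.le, ofReal_integral_eq_lintegral_ofReal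
              hIc.integrableOn_Ioc (Eventually.of_forall fun _ => by positivity)]
        _ ≤ _ := ofReal_le_ofReal (by linarith)
    have h1 := h.enorm_integral_le (k := k) P j hμ hν hε ⟨ht0.le, ht⟩ hη'
      (Q := X * (I + δ) ^ ((2 - γ) / 2)) (by positivity) fun s hs => by
        refine (hdual _ _ hforce s hs).trans (le_of_eq ?_)
        rw [mul_pow, ← rpow_natCast ((I + δ) ^ _), ← rpow_mul (by positivity)]
        congr 2
        push_cast; ring
    have h2 : ∀ s, P.block j (state (a s) (u s) k) (𝓕 (finiteForce η' (fun i => 𝓕⁻ (θ i)) s)) =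
        ∑ i, η i s * ((((m i).toReal⁻¹ : ℝ) : ℂ) * P.block j (state (a s) (u s) k) (θ i)) := fun s => by
      have h3 := map_sum (FourierTransform.fourierCLM ℂ 𝒮)
        (fun i => η' i s • (𝓕⁻ (θ i) : 𝒮)) Finset.univ
      have h4 : 𝓕 (finiteForce η' (fun i => 𝓕⁻ (θ i)) s) = ∑ i, η' i s • θ i := by
        refine h3.trans (sum_congr rfl fun i _ => ?_)
        rw [map_smul]
        congr 1
        exact FourierTransform.fourier_fourierInv_eq (F := 𝒮) (θ i)
      rw [h4, map_sum]
      refine sum_congr rfl fun i _ => ?_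
      rw [map_smul, smul_eq_mul]
      simp only [η']
      ring
    simp only [h2] at h1
    rw [← hDdef, ← ofReal_toReal hD, ← ofReal_mul toReal_nonneg,
      ← ofReal_norm, ENNReal.ofReal_le_ofReal_iff (by positivity), ← mul_assoc] at h1
    exact h1
  have hlim : Tendsto (fun δ : ℝ => D.toReal * X * (I + δ) ^ ((2 - γ) / 2)) (𝓝[>] 0)
      (𝓝 (D.toReal * X * I ^ ((2 - γ) / 2))) := by
    have h1 : Continuous fun δ : ℝ => D.toReal * X * (I + δ) ^ ((2 - γ) / 2) :=
      continuous_const.mul ((continuous_const.add continuous_id).rpow_const fun _ => Or.inr (by linarith))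
    have h2 := h1.tendsto 0
    rw [add_zero] at h2
    exact h2.mono_left nhdsWithin_le_nhds
  exact ge_of_tendsto hlim (eventually_nhdsWithin_of_forall fun δ hδ => hmain δ hδ)

/-- The Strichartz estimate for a dyadic block, given the dual estimate. -/
lemma IsSolution.exists_block_bound (k : Fin 4) (hμ : 0 < μ)
    (hν : 2 * μ + μ' = 1) (hε : 0 < ε) (h : IsSolution μ μ' ε Ω T a₀ u₀ f g a u) (ht0 : 0 < t)
    (ht : t ≤ T) (hD : dataNorm P j t a₀ u₀ f g ≠ ∞)
    {γ X : ℝ} (hγ : 0 < γ) (hγ1 : γ < 1) (hX : 0 < X)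
    (hdual : ∀ G N, IsForce γ N t G → ∀ s ∈ Icc 0 t, ∫ ξ, P.cutoff j ξ ^ 2 *
      ‖backward μ ε Ω (EuclideanSpace.single k 1) G t s ξ‖ ^ 2 ≤ X ^ 2 * N ^ (2 - γ))
    {q : ℝ≥0∞} (hq : ofReal (2 / (1 - γ)) ≤ q) :
    ∃ F : ℝ → ℝ≥0∞, Measurable F ∧ (∀ s ∈ Icc 0 t, lqNorm q (P.block j (state (a s) (u s) k)) ≤
        F s * eLpNorm (P.kernel j) (ofReal (2 / (1 + γ))) ^ (1 - 2 / (1 - γ) * (q⁻¹).toReal)) ∧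
      ∫⁻ s in Ioc 0 t, F s ^ (2 / γ) ≤
        (dataNorm P j t a₀ u₀ f g * ofReal X) ^ (2 / γ) := by
  set D := dataNorm P j t a₀ u₀ f g
  set p := 2 / (1 - γ)
  set p' := 2 / (1 + γ)
  have hγ' : 0 < 1 - γ := by linarith
  have hp2 : 2 < p := (lt_div_iff₀ hγ').2 (by linarith)
  have hpp : p.HolderConjugate p' := by
    rw [Real.holderConjugate_iff]
    exact ⟨by linarith, by simp only [p, p', inv_div]; ring⟩
  have hF1 : Fact (1 ≤ ofReal p') := ⟨by
    rw [← ofReal_one]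
    exact ofReal_le_ofReal ((one_le_div (by positivity)).2 (by linarith))⟩
  obtain ⟨θ, hθ⟩ := exists_dense_schwartz (ofReal p') ofReal_ne_top
  set m : ℕ → ℝ := fun i => (eLpNorm (θ i) (ofReal p') volume).toReal
  set Φ : ℕ → ℝ → ℂ := fun i => IccExtend ht0.le ((Icc 0 t).domRestrict fun s =>
    (((m i)⁻¹ : ℝ) : ℂ) * P.block j (state (a s) (u s) k) (θ i))
  have hΦc : ∀ i, Continuous (Φ i) := fun i =>
    (continuousOn_const.mul (h.continuousOn_block P j ⟨ht0.le, ht⟩ k (θ i))).domRestrict.Icc_extend'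
  have hΦe : ∀ i, ∀ s ∈ Icc 0 t, Φ i s = (((m i)⁻¹ : ℝ) : ℂ) * P.block j (state (a s) (u s) k) (θ i) :=
    fun i s hs => IccExtend_of_mem _ _ hs
  refine ⟨fun s => ⨆ i, ‖Φ i s‖ₑ, .iSup fun i => (hΦc i).measurable.enorm, fun s hs => ?_, ?_⟩
  · obtain ⟨v, hv, hvm, -, hrep, hker⟩ := h.exists_block_density P j k hμ hν hε ht0 ht hD hs
    have hpe : (2 : ℝ≥0∞) ≤ ofReal p := by
      rw [← ofReal_ofNat]; exact ofReal_le_ofReal hp2.le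
    refine (lqNorm_le_eLpNorm (hvm q (hpe.trans hq)) hrep).trans
      ((eLpNorm_le_of_reproduced P j hv hker hpp hq).trans (mul_le_mul_left ?_ _))
    change eLpNorm v _ _ ≤ ⨆ i, ‖Φ i s‖ₑ
    by_cases hinf : (⨆ i, ‖Φ i s‖ₑ) = ∞
    · rw [hinf]; exact le_top
    rw [← ofReal_toReal hinf]
    refine eLpNorm_le_of_dense hp2 hpp hθ hv (hvm _ hpe) toReal_nonneg fun i => ?_
    rw [← hrep]
    have h1 : ‖Φ i s‖ ≤ (⨆ i, ‖Φ i s‖ₑ).toReal := by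
      rw [← toReal_enorm]
      exact toReal_mono hinf (le_iSup (fun i => ‖Φ i s‖ₑ) i)
    by_cases hm0 : m i = 0
    · have h2 : eLpNorm (θ i) (ofReal p') volume = 0 :=
        ((ENNReal.toReal_eq_zero_iff _).1 hm0).resolve_right ((θ i).memLp _ volume).2.ne
      rw [eLpNorm_eq_zero_iff (θ i).continuous.aestronglyMeasurable
        (by simpa using hpp.symm.pos)] at h2
      have h3 : θ i = 0 := by
        ext x
        exact congrFun ((Continuous.ae_eq_iff_eq volume (θ i).continuous continuous_zero).1 h2) x
      rw [h3, map_zero, norm_zero]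
      positivity
    · have hm1 : 0 < m i := lt_of_le_of_ne toReal_nonneg (Ne.symm hm0)
      rw [hΦe i s hs, norm_mul, norm_real, norm_of_nonneg (by positivity),
        inv_mul_le_iff₀ hm1, mul_comm] at h1
      exact h1
  · have hr : 2 < 2 / γ := (lt_div_iff₀ hγ).2 (by linarith)
    have h1 := lintegral_iSup_rpow_le ht0.le hr (K := D.toReal * X) (by positivity) hΦc fun n η hη => by
      have h2 := h.norm_integral_block_le P j k hμ hν hε ht0 ht hD hγ hγ1 hX hdual hη fun i => θ i
      have e1 : 2 / γ / (2 / γ - 1) = 2 / (2 - γ) := by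
        have : 2 - γ ≠ 0 := by linarith
        field_simp
      have e2 : 1 - 1 / (2 / γ) = (2 - γ) / 2 := by field_simp
      rw [e1, e2]
      refine le_trans (le_of_eq (congrArg norm (integral_congr fun s hs => ?_))) h2
      rw [uIcc_of_le ht0.le] at hs
      exact sum_congr rfl fun i _ => by rw [hΦe _ s hs]
    rwa [ofReal_mul toReal_nonneg, ofReal_toReal hD] at h1

end Solution

lemma blockNormLr_le_of_lintegral (q : ℝ≥0∞) {r t : ℝ} (hr : 1 ≤ r)
    {a : ℝ → Distr} {u : ℝ → Fin 3 → Distr} {F : Fin 4 → ℝ → ℝ≥0∞} (hF : ∀ l, Measurable (F l))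
    (hle : ∀ l, ∀ s ∈ Icc 0 t, lqNorm q (P.block j (state (a s) (u s) l)) ≤ F l s) {M : ℝ≥0∞}
    (hM : ∀ l, ∫⁻ s in Ioc 0 t, F l s ^ r ≤ M ^ r) :
    blockNormLr P j (ofReal r) q t a u ≤ 4 * M := by
  have hr0 : 0 < r := by linarith
  have h1 : blockNormLr P j (ofReal r) q t a u ≤
      eLpNorm (∑ l, F l) (ofReal r) (volume.restrict (Ioo 0 t)) := by
    refine eLpNorm_mono_enorm_ae ((ae_restrict_mem measurableSet_Ioo).mono fun s hs => ?_)
    rw [enorm_eq_self, enorm_eq_self, blockNorm_eq_sum, Finset.sum_apply]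
    exact sum_le_sum fun l _ => hle l s (Ioo_subset_Icc_self hs)
  have h2 : ∀ l, eLpNorm (F l) (ofReal r) (volume.restrict (Ioo 0 t)) ≤ M := fun l => by
    rw [eLpNorm_eq_lintegral_rpow_enorm_toReal (by simpa using hr0) ofReal_ne_top,
      toReal_ofReal hr0.le, Measure.restrict_congr_set Ioo_ae_eq_Ioc]
    simp only [enorm_eq_self]
    refine (ENNReal.rpow_le_rpow (hM l) (by positivity)).trans (le_of_eq ?_)
    rw [← ENNReal.rpow_mul, mul_one_div_cancel hr0.ne', ENNReal.rpow_one]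
  refine h1.trans ((eLpNorm_sum_le (fun l _ => (hF l).aestronglyMeasurable) ?_).trans
    ((sum_le_sum fun l _ => h2 l).trans ?_))
  · rw [← ofReal_one]; exact ofReal_le_ofReal hr
  · simp

section Solution

variable {μ μ' ε Ω T : ℝ} {a₀ : Distr} {u₀ : Fin 3 → Distr} {f : ℝ → Distr}
  {g : ℝ → Fin 3 → Distr} {a : ℝ → Distr} {u : ℝ → Fin 3 → Distr} {t : ℝ}

/-- The estimate of a dyadic block by Bernstein's inequality and the energy estimate. -/
lemma exists_blockNormLr_le {q : ℝ≥0∞} (hq : 2 ≤ q) (r : ℝ≥0∞) :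
    ∃ A : ℝ, 0 < A ∧ ∀ {μ μ' ε Ω T : ℝ} {a₀ : Distr} {u₀ : Fin 3 → Distr} {f : ℝ → Distr}
      {g : ℝ → Fin 3 → Distr} {a : ℝ → Distr} {u : ℝ → Fin 3 → Distr} {t : ℝ}, 0 < μ → 2 * μ + μ' = 1 →
      0 < ε → IsSolution μ μ' ε Ω T a₀ u₀ f g a u → 0 < t → t ≤ T → ∀ j : ℤ,
      blockNormLr P j r q t a u ≤
        ofReal (A * (2 : ℝ) ^ (3 * (1 / 2 - (q⁻¹).toReal) * (j : ℝ)) * T ^ (r⁻¹).toReal) *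
          dataNorm P j t a₀ u₀ f g := by
  have hq2 : (q⁻¹).toReal ≤ 1 / 2 := by
    have := toReal_mono (by norm_num) (ENNReal.inv_le_inv.2 hq)
    simpa using this
  set e := 1 - 2 * (q⁻¹).toReal with he
  have he0 : 0 ≤ e := by linarith
  set b := eLpNorm (P.kernel 0) 2 volume ^ e
  have hb : b ≠ ∞ := ENNReal.rpow_ne_top_of_nonneg he0 (eLpNorm_kernel_ne_top P 0 2)
  refine ⟨4 * (b.toReal + 1), by positivity, fun {μ μ' ε Ω T a₀ u₀ f g a u t} hμ hν hε h ht0 ht j => ?_⟩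
  have hT : 0 < T := ht0.trans_le ht
  set D := dataNorm P j t a₀ u₀ f g
  by_cases hD : D = ∞
  · rw [hD, ENNReal.mul_top (by simp only [ne_eq, ENNReal.ofReal_eq_zero, not_le]; positivity)]
    exact le_top
  set c : ℝ := (2 : ℝ) ^ (3 * (1 / 2 - (q⁻¹).toReal) * (j : ℝ))
  have h2p : (0 : ℝ) < 2 ^ j := by positivity
  have hker : eLpNorm (P.kernel j) 2 volume ^ e = ofReal c * b := by
    have h1 := eLpNorm_kernel P j (p := 2) (p' := 2) Real.HolderConjugate.two_two
    rw [ofReal_ofNat] at h1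
    rw [h1, ENNReal.mul_rpow_of_nonneg _ _ he0, ofReal_rpow_of_nonneg (by positivity) he0]
    congr 2
    rw [← rpow_mul h2p.le, ← Real.rpow_intCast, ← rpow_mul (by norm_num)]
    congr 1
    rw [he]; ring
  have hpt : ∀ s ∈ Icc 0 t, blockNorm P j q (a s) (u s) ≤ 4 * (D * (ofReal c * b)) := fun s hs => by
    rw [blockNorm_eq_sum]
    refine (sum_le_sum fun l _ => ?_ : _ ≤ ∑ l : Fin 4, D * (ofReal c * b)).trans (by simp)
    obtain ⟨v, hv, hvm, hvD, hrep, hk⟩ := h.exists_block_density P j l hμ hν hε ht0 ht hD hs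
    refine (lqNorm_le_eLpNorm (hvm q hq) hrep).trans ((eLpNorm_le_of_reproduced P j hv hk
      Real.HolderConjugate.two_two (by simpa using hq)).trans ?_)
    rw [ofReal_ofNat, ← he, hker]
    gcongr
  refine (eLpNorm_le_of_ae_enorm_bound (C := 4 * (D * (ofReal c * b)))
    ((ae_restrict_mem measurableSet_Ioo).mono fun s hs => by
      rw [enorm_eq_self]; exact hpt s (Ioo_subset_Icc_self hs))).trans ?_
  rw [Measure.restrict_apply_univ, Real.volume_Ioo, sub_zero, smul_eq_mul, ← toReal_inv]
  have h3 : ofReal t ^ (r⁻¹).toReal ≤ ofReal (T ^ (r⁻¹).toReal) := by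
    rw [ENNReal.ofReal_rpow_of_pos ht0]
    exact ofReal_le_ofReal (rpow_le_rpow ht0.le ht toReal_nonneg)
  have h4 : b ≤ ofReal (b.toReal + 1) := by
    nth_rewrite 1 [← ofReal_toReal hb]
    exact ofReal_le_ofReal (by linarith)
  calc 4 * (D * (ofReal c * b)) * ofReal t ^ (r⁻¹).toReal
      ≤ 4 * (D * (ofReal c * ofReal (b.toReal + 1))) * ofReal (T ^ (r⁻¹).toReal) := by
        gcongr
    _ = _ := by
        rw [ofReal_mul (by positivity), ofReal_mul (by positivity),
          ofReal_mul (by norm_num), ofReal_ofNat]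
        ring

/-- The Strichartz estimate of a dyadic block, given a bound for the dissipative flow. -/
lemma exists_blockNormLr_le_of_flow {γ : ℝ} (hγ : 0 < γ) (hγ1 : γ < 1)
    {q : ℝ≥0∞} (hq : ofReal (2 / (1 - γ)) ≤ q) :
    ∃ A : ℝ, 0 < A ∧ ∀ {μ μ' ε Ω T : ℝ} {a₀ : Distr} {u₀ : Fin 3 → Distr} {f : ℝ → Distr}
      {g : ℝ → Fin 3 → Distr} {a : ℝ → Distr} {u : ℝ → Fin 3 → Distr} {t : ℝ}, 0 < μ → 2 * μ + μ' = 1 →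
      0 < ε → Ω ≠ 0 → IsSolution μ μ' ε Ω T a₀ u₀ f g a u → 0 < t → t ≤ T → ∀ (j : ℤ) (W κ : ℝ) (k : ℝ → ℝ),
      8 * (2 : ℝ) ^ j + |Ω| * ε ≤ W → Continuous k → (∀ s, 0 ≤ k s) →
      (∀ s ∈ Icc 0 t, ∫ x in s..t, k (x - s) ≤ κ) →
      (∀ ξ, P.cutoff j ξ ≠ 0 → ∀ s, 0 ≤ s → ∀ v, ‖exp (s • op (symB ε Ω ((2 * π) • ξ) -
        symN μ ((2 * π) • ξ))) (op (symN μ ((2 * π) • ξ)) v)‖ ≤ k s * ‖v‖) →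
      blockNormLr P j (ofReal (2 / γ)) q t a u ≤
        ofReal (A * (1 + κ) * (W ^ 3 / |Ω|) ^ (γ / 2) *
          (2 : ℝ) ^ (3 * (1 / 2 - (q⁻¹).toReal - γ / 2) * (j : ℝ))) *
          dataNorm P j t a₀ u₀ f g := by
  have hγ' : 0 < 1 - γ := by linarith
  set p := 2 / (1 - γ) with hp
  set p' := 2 / (1 + γ) with hp'
  have hp0 : 0 < p := by positivity
  have hpp : p.HolderConjugate p' := by
    rw [Real.holderConjugate_iff]
    exact ⟨(one_lt_div hγ').2 (by linarith), by simp only [p, p', inv_div]; ring⟩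
  have hq2 : (q⁻¹).toReal ≤ p⁻¹ := by
    have := toReal_mono (by simpa using hp0) (ENNReal.inv_le_inv.2 hq)
    rwa [toReal_inv (ofReal p), toReal_ofReal hp0.le] at this
  set e := 1 - p * (q⁻¹).toReal with he
  have he0 : 0 ≤ e := by
    have := mul_le_mul_of_nonneg_left hq2 hp0.le
    rw [mul_inv_cancel₀ hp0.ne'] at this
    linarith
  set b := eLpNorm (P.kernel 0) (ofReal p') volume ^ e
  have hb : b ≠ ∞ := ENNReal.rpow_ne_top_of_nonneg he0 (eLpNorm_kernel_ne_top P 0 _)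
  set d := 1 + |dualConst γ|
  have hd : dualConst γ ≤ d ^ 2 := by nlinarith [le_abs_self (dualConst γ), abs_nonneg (dualConst γ)]
  refine ⟨4 * (b.toReal + 1) * (4 * d * 1088 ^ (γ / 2)), by positivity,
    fun {μ μ' ε Ω T a₀ u₀ f g a u t} hμ hν hε hΩ h ht0 ht j W κ k hW hkc hk0 hκ hk => ?_⟩
  have hΩ0 : 0 < |Ω| := abs_pos.2 hΩ
  have h2p : (0 : ℝ) < 2 ^ j := by positivity
  have hω : 0 < |Ω| * ε := by positivity
  have hW0 : 0 < W := by linarith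
  have hκ0 : 0 ≤ κ := (intervalIntegral.integral_nonneg ht0.le fun s _ => hk0 _).trans
    (hκ 0 (left_mem_Icc.2 ht0.le))
  set D := dataNorm P j t a₀ u₀ f g
  by_cases hD : D = ∞
  · rw [hD, ENNReal.mul_top (by simp only [ne_eq, ENNReal.ofReal_eq_zero, not_le]; positivity)]
    exact le_top
  set c : ℝ := (2 : ℝ) ^ (3 * (1 / 2 - (q⁻¹).toReal - γ / 2) * (j : ℝ))
  have hker : eLpNorm (P.kernel j) (ofReal p') volume ^ e = ofReal c * b := by
    rw [eLpNorm_kernel P j hpp, ENNReal.mul_rpow_of_nonneg _ _ he0,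
      ofReal_rpow_of_nonneg (by positivity) he0]
    congr 2
    rw [← rpow_mul h2p.le, ← Real.rpow_intCast, ← rpow_mul (by norm_num)]
    congr 1
    rw [he, hp]; field_simp; ring
  set X := 4 * d * 1088 ^ (γ / 2) * (1 + κ) * (W ^ 3 / |Ω|) ^ (γ / 2) with hX
  have hX0 : 0 < X := by positivity
  set S := 8 * (2 : ℝ) ^ j / (|Ω| * ε) + 1
  have hS1 : 1 ≤ S := by
    have : 0 ≤ 8 * (2 : ℝ) ^ j / (|Ω| * ε) := by positivity
    linarith
  have hSω : (|Ω| * ε) * S = 8 * (2 : ℝ) ^ j + |Ω| * ε := by simp only [S]; field_simp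
  have hdual : ∀ l : Fin 4, ∀ G N, IsForce γ N t G → ∀ s ∈ Icc 0 t, ∫ ξ, P.cutoff j ξ ^ 2 *
      ‖backward μ ε Ω (EuclideanSpace.single l 1) G t s ξ‖ ^ 2 ≤ X ^ 2 * N ^ (2 - γ) :=
    fun l G N hG s hs => by
      refine (integral_cutoff_backward_le hγ hγ1 hG hε hΩ hS1 (P.continuous_cutoff j)
        (P.hasCompactSupport_cutoff j) (P.cutoff_nonneg j) (P.cutoff_le_one j) (fun ξ hξ => ?_) hs hkc hk0
        (hκ s hs) hk (by simp)).trans ?_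
      · refine (sig_le_norm_add_one _).trans (add_le_add_left ?_ 1)
        have h1 := (P.norm_of_cutoff_ne_zero j hξ).2
        rw [norm_smul, norm_of_nonneg (by positivity)] at h1 ⊢
        rw [div_mul_eq_mul_div]
        gcongr
      · have hNr : 0 ≤ N ^ (2 - γ) := rpow_nonneg hG.pos.le _
        have e1 : ((4 * d * 1088 ^ (γ / 2) * (1 + κ) * (W ^ 3 / |Ω|) ^ (γ / 2)) ^ 2 : ℝ) =
            16 * (1 + κ) ^ 2 * (d ^ 2 * (1088 * W ^ 3 / |Ω|) ^ γ) := by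
          have e2 : ∀ y : ℝ, 0 ≤ y → (y ^ (γ / 2)) ^ 2 = y ^ γ := fun y hy => by
            rw [← rpow_natCast, ← rpow_mul hy]; congr 1; push_cast; ring
          rw [mul_div_assoc 1088, mul_rpow (by norm_num) (by positivity), ← e2 1088 (by norm_num),
            ← e2 (W ^ 3 / |Ω|) (by positivity)]
          ring
        rw [strichartzBound, ← mul_pow, hSω, hX, e1]
        have e3 : (1088 * (8 * (2 : ℝ) ^ j + |Ω| * ε) ^ 3 / |Ω|) ^ γ ≤ (1088 * W ^ 3 / |Ω|) ^ γ := by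
          gcongr
        have e4 : dualConst γ * (1088 * (8 * (2 : ℝ) ^ j + |Ω| * ε) ^ 3 / |Ω|) ^ γ ≤
            d ^ 2 * (1088 * W ^ 3 / |Ω|) ^ γ := mul_le_mul hd e3 (by positivity) (by positivity)
        have e5 : 1 + κ ^ 2 ≤ (1 + κ) ^ 2 := by nlinarith
        calc _ = 16 * (1 + κ ^ 2) * (dualConst γ * (1088 * (8 * (2 : ℝ) ^ j + |Ω| * ε) ^ 3 / |Ω|) ^ γ) *
              N ^ (2 - γ) := by ring
          _ ≤ 16 * (1 + κ ^ 2) * (d ^ 2 * (1088 * W ^ 3 / |Ω|) ^ γ) * N ^ (2 - γ) := by gcongr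
          _ ≤ _ := by gcongr
  choose F hFm hFle hFint using fun l => h.exists_block_bound P j l hμ hν hε ht0 ht hD hγ hγ1 hX0 (hdual l) hq
  have hr1 : 1 ≤ 2 / γ := (one_le_div hγ).2 (by linarith)
  have hfin := blockNormLr_le_of_lintegral P j q hr1 (a := a) (u := u) (t := t)
    (F := fun l s => F l s * (ofReal c * b)) (fun l => (hFm l).mul_const _)
    (fun l s hs => by rw [← hker]; exact hFle l s hs) (M := D * ofReal X * (ofReal c * b))
    fun l => by
      have hr0 : 0 ≤ 2 / γ := by linarith
      simp only [ENNReal.mul_rpow_of_nonneg _ (ofReal c * b) hr0]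
      rw [lintegral_mul_const _ ((hFm l).pow_const _)]
      exact mul_le_mul_left (hFint l) _
  refine hfin.trans ?_
  have h4 : b ≤ ofReal (b.toReal + 1) := by
    nth_rewrite 1 [← ofReal_toReal hb]
    exact ofReal_le_ofReal (by linarith)
  calc 4 * (D * ofReal X * (ofReal c * b))
      ≤ 4 * (D * ofReal X * (ofReal c * ofReal (b.toReal + 1))) := by gcongr
    _ = ofReal (4 * X * (c * (b.toReal + 1))) * D := by
        rw [ofReal_mul (p := 4 * X) (by positivity), ofReal_mul (p := 4) (by norm_num),
          ofReal_mul (p := c) (by positivity), ofReal_ofNat]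
        ring
    _ = _ := by
        congr 2
        rw [hX]; ring

end Solution

lemma one_le_bracket (x : ℝ) : 1 ≤ bracket x := by
  rw [bracket, Real.one_le_sqrt]; nlinarith [sq_nonneg x]

lemma le_bracket (x : ℝ) : x ≤ bracket x := Real.le_sqrt_of_sq_le (by linarith)

lemma bracket_mono {x y : ℝ} (hx : 0 ≤ x) (h : x ≤ y) : bracket x ≤ bracket y := by
  unfold bracket; gcongr

lemma exists_strichartz_exponent {q r : ℝ≥0∞} (hr : 2 ≤ r) (hqr : q⁻¹ + r⁻¹ ≤ 2⁻¹)
    (hne : (q, r) ≠ (∞, 2)) (hr' : r ≠ ∞) :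
    ∃ γ : ℝ, 0 < γ ∧ γ < 1 ∧ r = ofReal (2 / γ) ∧ (r⁻¹).toReal = γ / 2 ∧
      ofReal (2 / (1 - γ)) ≤ q := by
  have hr2 : (2 : ℝ) ≤ r.toReal := by simpa using toReal_mono hr' hr
  have h2 : 2 < r := by
    refine lt_of_le_of_ne hr fun h => hne ?_
    rw [← h] at hqr
    have : q⁻¹ ≤ 0 := (ENNReal.add_le_add_iff_right (a := 2⁻¹) (by simp)).1 (by simpa using hqr)
    rw [Prod.mk.injEq]
    exact ⟨by simpa using this, h.symm⟩
  have h2' : (2 : ℝ) < r.toReal := by simpa using ENNReal.toReal_strict_mono hr' h2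
  have hr0 : 0 < r.toReal := by linarith
  have hγ1 : 2 / r.toReal < 1 := (div_lt_one hr0).2 h2'
  have hri : (r⁻¹).toReal = 2 / r.toReal / 2 := by rw [toReal_inv]; field_simp
  refine ⟨2 / r.toReal, by positivity, hγ1, ?_, hri, ?_⟩
  · rw [div_div_cancel₀ (by norm_num), ofReal_toReal hr']
  · have hpos : 0 < 2 / (1 - 2 / r.toReal) := div_pos (by norm_num) (by linarith)
    rw [← ENNReal.inv_le_inv, ← ENNReal.ofReal_inv_of_pos hpos]
    have hqi : q⁻¹ ≠ ∞ := ne_top_of_le_ne_top (by simp) (le_self_add.trans hqr)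
    refine ENNReal.le_ofReal_iff_toReal_le hqi (by positivity) |>.2 ?_
    have := toReal_mono (by simp) hqr
    rw [ENNReal.toReal_add hqi (by simpa using (by positivity : (0:ℝ≥0∞) < 2).trans h2 |>.ne'), hri] at this
    rw [inv_div]
    rw [toReal_inv] at this ⊢
    norm_num at this ⊢
    linarith

section

variable {q r : ℝ≥0∞}

/-- The Strichartz estimate of a dyadic block of frequency at most `|Ω| ε`. -/
lemma exists_blockNormLr_le_of_le {μ μ' : ℝ} (hμ : 0 < μ)
    (hν : 2 * μ + μ' = 1) (hq : 2 ≤ q) (hr : 2 ≤ r) (hqr : q⁻¹ + r⁻¹ ≤ 2⁻¹) (hne : (q, r) ≠ (∞, 2)) :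
    ∃ C : ℝ, 0 < C ∧ ∀ {ε Ω t T : ℝ} {a₀ : Distr} {u₀ : Fin 3 → Distr} {f : ℝ → Distr}
      {g : ℝ → Fin 3 → Distr} {a : ℝ → Distr} {u : ℝ → Fin 3 → Distr}, 0 < ε → Ω ≠ 0 → 0 < t → t ≤ T →
      IsSolution μ μ' ε Ω T a₀ u₀ f g a u → ∀ j : ℤ, (2 : ℝ) ^ j ≤ |Ω| * ε →
      blockNormLr P j r q t a u ≤ ofReal (C *
        (2 : ℝ) ^ (3 * (1 / 2 - (q⁻¹).toReal - (r⁻¹).toReal) * (j : ℝ)) * |Ω| ^ (2 * (r⁻¹).toReal) *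
        ε ^ (3 * (r⁻¹).toReal) * bracket (Ω ^ 2 * ε ^ 2 * T)) *
        dataNorm P j t a₀ u₀ f g := by
  by_cases hr' : r = ∞
  · obtain ⟨A, hA, h⟩ := exists_blockNormLr_le P hq r
    refine ⟨A, hA, fun hε _ ht0 ht hs j _ => (h hμ hν hε hs ht0 ht j).trans ?_⟩
    refine mul_le_mul_left (ofReal_le_ofReal ?_) _
    simp only [hr', ENNReal.inv_top, ENNReal.toReal_zero, Real.rpow_zero, mul_zero, mul_one, sub_zero]
    exact le_mul_of_one_le_right (by positivity) (one_le_bracket _)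
  obtain ⟨γ, hγ, hγ1, hrγ, hρ, hqγ⟩ := exists_strichartz_exponent hr hqr hne hr'
  obtain ⟨A, hA, h⟩ := exists_blockNormLr_le_of_flow P hγ hγ1 hqγ
  refine ⟨A * (1 + (1 + μ) * 64) * 9 ^ (3 * (γ / 2)), by positivity,
    fun {ε Ω t T a₀ u₀ f g a u} hε hΩ ht0 ht hs j hj => ?_⟩
  have hΩ0 : 0 < |Ω| := abs_pos.2 hΩ
  have h2p : (0 : ℝ) < 2 ^ j := by positivity
  have hω : 0 < |Ω| * ε := by positivity
  have hT : 0 < T := ht0.trans_le ht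
  set k : ℝ := (1 + μ) * (8 * 2 ^ j) ^ 2
  have hk : 0 ≤ k := by positivity
  rw [hρ, hrγ]
  refine (h hμ hν hε hΩ hs ht0 ht j (9 * (|Ω| * ε)) (k * T) (fun _ => k) (by linarith) continuous_const
    (fun _ => hk) (fun s hs => ?_) fun ξ hξ s hs v => ?_).trans ?_
  · rw [intervalIntegral.integral_const, smul_eq_mul, mul_comm]
    have := hs.1
    gcongr; linarith
  · refine (norm_flow_le hμ hε.ne' _ hs).trans ((opN_norm_le hμ v).trans ?_)
    have := (P.norm_of_cutoff_ne_zero j hξ).2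
    gcongr ?_ * _
    simp only [k]
    gcongr
  · refine mul_le_mul_left (ofReal_le_ofReal ?_) _
    have hb : 1 + k * T ≤ (1 + (1 + μ) * 64) * bracket (Ω ^ 2 * ε ^ 2 * T) := by
      have h1 := one_le_bracket (Ω ^ 2 * ε ^ 2 * T)
      have h2 := le_bracket (Ω ^ 2 * ε ^ 2 * T)
      have h3 : (2 ^ j : ℝ) ^ 2 ≤ Ω ^ 2 * ε ^ 2 := by
        rw [← sq_abs Ω, ← mul_pow]; gcongr
      have h4 : (2 ^ j : ℝ) ^ 2 * T ≤ bracket (Ω ^ 2 * ε ^ 2 * T) :=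
        (mul_le_mul_of_nonneg_right h3 hT.le).trans h2
      calc 1 + k * T = 1 + (1 + μ) * 64 * ((2 ^ j : ℝ) ^ 2 * T) := by simp only [k]; ring
        _ ≤ bracket (Ω ^ 2 * ε ^ 2 * T) + (1 + μ) * 64 * bracket (Ω ^ 2 * ε ^ 2 * T) := by gcongr
        _ = _ := by ring
    have hW : ((9 * (|Ω| * ε)) ^ 3 / |Ω|) ^ (γ / 2) =
        9 ^ (3 * (γ / 2)) * |Ω| ^ (2 * (γ / 2)) * ε ^ (3 * (γ / 2)) := by
      have e1 : (9 * (|Ω| * ε)) ^ 3 / |Ω| = (9 : ℝ) ^ (3 : ℝ) * |Ω| ^ (2 : ℝ) * ε ^ (3 : ℝ) := by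
        simp only [Real.rpow_ofNat]
        field_simp
      rw [e1, mul_rpow (by positivity) (by positivity), mul_rpow (by positivity) (by positivity),
        ← rpow_mul (by norm_num), ← rpow_mul hΩ0.le, ← rpow_mul hε.le]
    rw [hW]
    calc _ ≤ A * ((1 + (1 + μ) * 64) * bracket (Ω ^ 2 * ε ^ 2 * T)) *
          (9 ^ (3 * (γ / 2)) * |Ω| ^ (2 * (γ / 2)) * ε ^ (3 * (γ / 2))) *
          2 ^ (3 * (1 / 2 - (q⁻¹).toReal - γ / 2) * (j : ℝ)) := by gcongr
      _ = _ := by ring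

/-- The Strichartz estimate of a dyadic block of frequency between `|Ω| ε` and `β₀ / ε`. -/
lemma exists_blockNormLr_le_of_lt {μ μ' β₀ : ℝ} (hμ : 0 < μ)
    (hν : 2 * μ + μ' = 1) (hβ : 0 < β₀) (hq : 2 ≤ q) (hr : 2 ≤ r) (hqr : q⁻¹ + r⁻¹ ≤ 2⁻¹)
    (hne : (q, r) ≠ (∞, 2)) :
    ∃ C : ℝ, 0 < C ∧ ∀ {ε Ω t T : ℝ} {a₀ : Distr} {u₀ : Fin 3 → Distr} {f : ℝ → Distr}
      {g : ℝ → Fin 3 → Distr} {a : ℝ → Distr} {u : ℝ → Fin 3 → Distr}, 0 < ε → Ω ≠ 0 → 0 < t → t ≤ T →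
      IsSolution μ μ' ε Ω T a₀ u₀ f g a u → ∀ j : ℤ, |Ω| * ε < (2 : ℝ) ^ j → (2 : ℝ) ^ j ≤ β₀ / ε →
      blockNormLr P j r q t a u ≤ ofReal (C *
        (2 : ℝ) ^ (3 * (1 / 2 - (q⁻¹).toReal) * (j : ℝ)) * |Ω| ^ (-(r⁻¹).toReal)) *
        dataNorm P j t a₀ u₀ f g := by
  by_cases hr' : r = ∞
  · obtain ⟨A, hA, h⟩ := exists_blockNormLr_le P hq r
    refine ⟨A, hA, fun hε _ ht0 ht hs j _ _ => (h hμ hν hε hs ht0 ht j).trans ?_⟩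
    simp [hr']
  obtain ⟨γ, hγ, hγ1, hrγ, hρ, hqγ⟩ := exists_strichartz_exponent hr hqr hne hr'
  obtain ⟨A, hA, h⟩ := exists_blockNormLr_le_of_flow P hγ hγ1 hqγ
  obtain ⟨c, hc, hflow⟩ := exists_norm_flow_le hμ (C₀ := 8) (C₁ := 8 * β₀) (by norm_num) (by positivity)
  refine ⟨A * (1 + 8192 * (1 + μ) / c) * 9 ^ (3 * (γ / 2)), by positivity,
    fun {ε Ω t T a₀ u₀ f g a u} hε hΩ ht0 ht hs j hj hj' => ?_⟩
  have hΩ0 : 0 < |Ω| := abs_pos.2 hΩ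
  have h2p : (0 : ℝ) < 2 ^ j := by positivity
  set m : ℝ := c * (2 ^ j / 8) ^ 2 with hm
  have hm0 : 0 < m := by positivity
  set B : ℝ := 2 * ((1 + μ) * (8 * 2 ^ j) ^ 2)
  have hB : 0 < B := by positivity
  rw [hρ, hrγ]
  refine (h hμ hν hε hΩ hs ht0 ht j (9 * 2 ^ j) (8192 * (1 + μ) / c) (fun s => B * Real.exp (-m * s))
    (by linarith) (by fun_prop) (fun _ => by positivity) (fun s hs => ?_) fun ξ hξ s hs v => ?_).trans ?_
  · have hd : ∀ x ∈ uIcc s t, HasDerivAt (fun x => -(B / m) * Real.exp (-m * (x - s)))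
        (B * Real.exp (-m * (x - s))) x := fun x _ => by
      have := ((((hasDerivAt_id x).sub_const s).const_mul (-m)).exp).const_mul (-(B / m))
      refine this.congr_deriv ?_
      simp only [id]
      field_simp
    rw [integral_eq_sub_of_hasDerivAt hd (Continuous.intervalIntegrable (by fun_prop) _ _),
      sub_self, mul_zero, Real.exp_zero]
    have h1 : 0 ≤ B / m * Real.exp (-m * (t - s)) := by positivity
    have h2 : B / m = 8192 * (1 + μ) / c := by
      simp only [B, hm]; field_simp; norm_num
    linarith
  · obtain ⟨hlow, hup⟩ := P.norm_of_cutoff_ne_zero j hξ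
    have hup' : ε * ‖(2 * π) • ξ‖ ≤ 8 * β₀ := by
      rw [le_div_iff₀ hε] at hj'
      calc _ ≤ ε * (8 * 2 ^ j) := by gcongr
        _ = 8 * (2 ^ j * ε) := by ring
        _ ≤ _ := by gcongr
    refine (hflow ε Ω _ hε (by linarith) hup' _ s hs).trans ?_
    calc _ ≤ 2 * Real.exp (-m * s) * ((1 + μ) * (8 * 2 ^ j) ^ 2 * ‖v‖) := by
          gcongr ?_ * Real.exp ?_ * ?_
          · rw [hm, neg_mul, neg_mul, neg_mul]
            gcongr
          · refine (opN_norm_le hμ v).trans ?_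
            gcongr
      _ = _ := by simp only [B]; ring
  · refine mul_le_mul_left (ofReal_le_ofReal ?_) _
    have hW : ((9 * (2 : ℝ) ^ j) ^ 3 / |Ω|) ^ (γ / 2) =
        9 ^ (3 * (γ / 2)) * 2 ^ (3 * (γ / 2) * (j : ℝ)) * |Ω| ^ (-(γ / 2)) := by
      have e1 : (9 * (2 : ℝ) ^ j) ^ 3 / |Ω| = (9 : ℝ) ^ (3 : ℝ) * (2 : ℝ) ^ (3 * (j : ℝ)) * |Ω| ^ (-1 : ℝ) := by
        rw [mul_comm 3 (j : ℝ), rpow_mul (by norm_num), Real.rpow_intCast, Real.rpow_neg_one]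
        simp only [Real.rpow_ofNat]
        field_simp
      rw [e1, mul_rpow (by positivity) (by positivity), mul_rpow (by positivity) (by positivity),
        ← rpow_mul (by norm_num), ← rpow_mul (by norm_num), ← rpow_mul hΩ0.le,
        mul_right_comm 3 (j : ℝ), neg_one_mul]
    have hE : (2 : ℝ) ^ (3 * (1 / 2 - (q⁻¹).toReal) * (j : ℝ)) = 2 ^ (3 * (γ / 2) * (j : ℝ)) *
        2 ^ (3 * (1 / 2 - (q⁻¹).toReal - γ / 2) * (j : ℝ)) := by
      rw [← rpow_add (by norm_num)]; congr 1; ring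
    rw [hW, hE]
    exact le_of_eq (by ring)

end

lemma sum_lintegral_le {α ι : Type*} [MeasurableSpace α] (ν : Measure α) (s : Finset ι)
    (F : ι → α → ℝ≥0∞) : ∑ i ∈ s, ∫⁻ x, F i x ∂ν ≤ ∫⁻ x, ∑ i ∈ s, F i x ∂ν := by
  classical
  induction s using Finset.induction_on with
  | empty => simp
  | insert i s hi ih =>
    simp only [Finset.sum_insert hi]
    exact (add_le_add_right ih _).trans (le_lintegral_add _ _)

lemma tsum_blockNorm_le (α s t : ℝ) (p : ℝ≥0∞) (a₀ : Distr)
    (u₀ : Fin 3 → Distr) (f : ℝ → Distr) (g : ℝ → Fin 3 → Distr) :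
    ∑' j : {j : ℤ // (2 : ℝ) ^ j ≤ α}, ofReal ((2 : ℝ) ^ (s * ((j : ℤ) : ℝ))) *
      (blockNorm P j p a₀ u₀ + blockNormLr P j 1 p t f g) ≤
      besovLow P α s p a₀ u₀ + lrBesovLow P α s 1 p t f g := by
  simp only [mul_add]
  rw [ENNReal.tsum_add, besovLow]
  gcongr
  rw [lrBesovLow, eLpNorm_one_eq_lintegral_enorm, ENNReal.tsum_eq_iSup_sum]
  refine iSup_le fun S => ?_
  simp only [blockNormLr, eLpNorm_one_eq_lintegral_enorm, enorm_eq_self,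
    ← lintegral_const_mul' _ _ ofReal_ne_top]
  exact (sum_lintegral_le _ _ _).trans (lintegral_mono fun τ => ENNReal.sum_le_tsum S)

lemma min_le_rpow_mul_rpow {x y θ : ℝ} (hx : 0 < x) (hy : 0 < y) (h0 : 0 ≤ θ) (h1 : θ ≤ 1) :
    min x y ≤ x ^ (1 - θ) * y ^ θ := by
  have hm : 0 < min x y := lt_min hx hy
  calc min x y = min x y ^ (1 - θ) * min x y ^ θ := by
        rw [← rpow_add hm, sub_add_cancel, rpow_one]
    _ ≤ _ := by
        have := min_le_left x y
        have := min_le_right x y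
        have : 0 ≤ 1 - θ := by linarith
        gcongr

lemma one_le_growthExponent (r : ℝ≥0∞) : 1 ≤ growthExponent r := by
  unfold growthExponent
  split_ifs
  · exact le_rfl
  · linarith [toReal_nonneg (a := r)]

/-- A geometric mean of the energy estimate and of the Strichartz estimate at low frequencies. -/
lemma lowFrequency_weight_le {A C ω Ω ε T α ρ η y E : ℝ} (hA : 0 < A) (hC : 0 < C) (hε : 0 < ε)
    (hΩ : 0 < Ω) (hT : 0 < T) (hω : ω = Ω * ε) (hω1 : ω ≤ 1) (hα : 1 ≤ α) (hρ : 0 ≤ ρ) (hρ1 : ρ ≤ 1)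
    (hy : 0 < y) (hE : 1 ≤ E) :
    y ^ (3 * η - 1 + 2 * ρ) * min (A * y ^ (3 * (1 / 2 - η)) * T ^ ρ)
      (C * y ^ (3 * (1 / 2 - η - ρ)) * Ω ^ (2 * ρ) * ε ^ (3 * ρ) * bracket (Ω ^ 2 * ε ^ 2 * T)) ≤
      (A + C) * bracket (α ^ 2 * T) ^ E * ε ^ (2 / 3 * ρ) * y ^ (1 / 2 : ℝ) := by
  have hω0 : 0 < ω := by rw [hω]; positivity
  set Br := bracket (Ω ^ 2 * ε ^ 2 * T)
  have hBr1 : 1 ≤ Br := one_le_bracket _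
  have hBr0 : 0 < Br := by linarith
  have hBr2 : ω ^ 2 * T ≤ Br := by rw [hω, mul_pow]; exact le_bracket _
  have hBr3 : Br ≤ bracket (α ^ 2 * T) := by
    refine bracket_mono (by positivity) ?_
    rw [← mul_pow, ← hω]
    gcongr
    linarith
  refine (mul_le_mul_of_nonneg_left (min_le_rpow_mul_rpow (θ := 2 / 3) (by positivity) (by positivity)
    (by norm_num) (by norm_num)) (by positivity)).trans ?_
  have hAC : A ^ (1 - 2 / 3 : ℝ) * C ^ (2 / 3 : ℝ) ≤ A + C := by
    calc _ ≤ (A + C) ^ (1 - 2 / 3 : ℝ) * (A + C) ^ (2 / 3 : ℝ) := by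
          gcongr ?_ ^ _ * ?_ ^ _ <;> linarith
      _ = A + C := by rw [← rpow_add (by positivity)]; norm_num
  have hpow : T ^ (ρ * (1 - 2 / 3)) * Ω ^ (2 * ρ * (2 / 3)) * ε ^ (3 * ρ * (2 / 3)) ≤
      Br ^ (ρ / 3) * ε ^ (2 / 3 * ρ) := by
    have e1 : T ^ (ρ * (1 - 2 / 3)) * Ω ^ (2 * ρ * (2 / 3)) * ε ^ (3 * ρ * (2 / 3)) =
        (ω ^ 2 * T) ^ (ρ / 3) * ω ^ (2 / 3 * ρ) * ε ^ (2 / 3 * ρ) := by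
      rw [hω, mul_rpow (by positivity) hT.le, mul_pow, mul_rpow (by positivity) (by positivity),
        mul_rpow hΩ.le hε.le, ← rpow_natCast Ω, ← rpow_natCast ε, ← rpow_mul hΩ.le,
        ← rpow_mul hε.le]
      have e2 : Ω ^ (2 * ρ * (2 / 3)) = Ω ^ (((2 : ℕ) : ℝ) * (ρ / 3)) * Ω ^ (2 / 3 * ρ) := by
        rw [← rpow_add hΩ]; congr 1; push_cast; ring
      have e3 : ε ^ (3 * ρ * (2 / 3)) = ε ^ (((2 : ℕ) : ℝ) * (ρ / 3)) * ε ^ (2 / 3 * ρ) * ε ^ (2 / 3 * ρ) := by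
        rw [← rpow_add hε, ← rpow_add hε]; congr 1; push_cast; ring
      have e4 : ρ * (1 - 2 / 3) = ρ / 3 := by ring
      rw [e2, e3, e4]; ring
    rw [e1]
    have e5 : ω ^ (2 / 3 * ρ) ≤ 1 := Real.rpow_le_one hω0.le hω1 (by positivity)
    calc _ ≤ Br ^ (ρ / 3) * 1 * ε ^ (2 / 3 * ρ) := by gcongr
      _ = _ := by ring
  have hbr : Br ^ (ρ / 3) * Br ^ (2 / 3 : ℝ) ≤ bracket (α ^ 2 * T) ^ E := by
    rw [← rpow_add hBr0]
    calc Br ^ (ρ / 3 + 2 / 3) ≤ Br ^ E := Real.rpow_le_rpow_of_exponent_le hBr1 (by linarith)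
      _ ≤ _ := by gcongr
  have hyy : y ^ (3 * η - 1 + 2 * ρ) * (y ^ (3 * (1 / 2 - η) * (1 - 2 / 3)) *
      y ^ (3 * (1 / 2 - η - ρ) * (2 / 3))) = y ^ (1 / 2 : ℝ) := by
    rw [← rpow_add hy, ← rpow_add hy]; congr 1; ring
  rw [mul_rpow (by positivity) (by positivity), mul_rpow hA.le (by positivity),
    mul_rpow (by positivity) hBr0.le, mul_rpow (by positivity) (by positivity),
    mul_rpow (by positivity) (by positivity), mul_rpow hC.le (by positivity),
    ← rpow_mul hy.le, ← rpow_mul hy.le, ← rpow_mul hT.le, ← rpow_mul hΩ.le,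
    ← rpow_mul hε.le]
  calc _ = (A ^ (1 - 2 / 3 : ℝ) * C ^ (2 / 3 : ℝ)) *
        (T ^ (ρ * (1 - 2 / 3)) * Ω ^ (2 * ρ * (2 / 3)) * ε ^ (3 * ρ * (2 / 3))) * Br ^ (2 / 3 : ℝ) *
        (y ^ (3 * η - 1 + 2 * ρ) * (y ^ (3 * (1 / 2 - η) * (1 - 2 / 3)) *
          y ^ (3 * (1 / 2 - η - ρ) * (2 / 3)))) := by ring
    _ ≤ (A + C) * (Br ^ (ρ / 3) * ε ^ (2 / 3 * ρ)) * Br ^ (2 / 3 : ℝ) * y ^ (1 / 2 : ℝ) := by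
        rw [hyy]; gcongr
    _ = (A + C) * (Br ^ (ρ / 3) * Br ^ (2 / 3 : ℝ)) * ε ^ (2 / 3 * ρ) * y ^ (1 / 2 : ℝ) := by ring
    _ ≤ _ := by gcongr

lemma highFrequency_weight_le {C Ω α ρ η y : ℝ} (hC : 0 < C) (hΩ : 0 < Ω) (hρ : 0 ≤ ρ) (hy : 0 < y)
    (hyα : y ≤ α) :
    y ^ (3 * η - 1 + 2 * ρ) * (C * y ^ (3 * (1 / 2 - η)) * Ω ^ (-ρ)) ≤
      C * (Ω ^ (-ρ) * α ^ (2 * ρ)) * y ^ (1 / 2 : ℝ) := by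
  have e : y ^ (3 * η - 1 + 2 * ρ) * y ^ (3 * (1 / 2 - η)) = y ^ (2 * ρ) * y ^ (1 / 2 : ℝ) := by
    rw [← rpow_add hy, ← rpow_add hy]; congr 1; ring
  calc _ = C * Ω ^ (-ρ) * (y ^ (3 * η - 1 + 2 * ρ) * y ^ (3 * (1 / 2 - η))) := by ring
    _ ≤ C * Ω ^ (-ρ) * (α ^ (2 * ρ) * y ^ (1 / 2 : ℝ)) := by rw [e]; gcongr
    _ = _ := by ring

lemma two_rpow_mul_intCast (s : ℝ) (j : ℤ) : (2 : ℝ) ^ (s * (j : ℝ)) = ((2 : ℝ) ^ j) ^ s := by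
  rw [mul_comm, rpow_mul (by norm_num), Real.rpow_intCast]

lemma le_ofReal_min_mul {x D : ℝ≥0∞} {a b : ℝ} (ha : x ≤ ofReal a * D)
    (hb : x ≤ ofReal b * D) : x ≤ ofReal (min a b) * D := by
  rcases min_choice a b with h | h <;> rw [h] <;> assumption

lemma ofReal_mul_le_ofReal_mul {x D : ℝ≥0∞} {w m K v : ℝ} (hw : 0 ≤ w) (hK : 0 ≤ K)
    (hx : x ≤ ofReal m * D) (h : w * m ≤ K * v) :
    ofReal w * x ≤ ofReal K * (ofReal v * D) := by
  calc _ ≤ ofReal w * (ofReal m * D) := by gcongr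
    _ = ofReal (w * m) * D := by rw [ofReal_mul hw, mul_assoc]
    _ ≤ ofReal (K * v) * D := by gcongr
    _ = _ := by rw [ofReal_mul hK, mul_assoc]

end

end RotatingNSC

theorem proposition3p1 (P : LittlewoodPaley) (μ μ' : ℝ) (hμ : 0 < μ) (hν : 2 * μ + μ' = 1)
    (β₀ : ℝ) (hβ₀ : 0 < β₀)
    (q r : ℝ≥0∞) (hq : 2 ≤ q) (hr : 2 ≤ r) (hqr : q⁻¹ + r⁻¹ ≤ 2⁻¹) (hne : (q, r) ≠ (∞, 2)) :
    ∃ C : ℝ, 0 < C ∧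
      ∀ (ε Ω t T : ℝ), 0 < ε → Ω ≠ 0 → 0 < t → t ≤ T →
      ∀ (a₀ : Distr) (u₀ : Fin 3 → Distr) (f : ℝ → Distr) (g : ℝ → Fin 3 → Distr)
        (a : ℝ → Distr) (u : ℝ → Fin 3 → Distr),
        IsSolution μ μ' ε Ω T a₀ u₀ f g a u →
        (∀ j : ℤ, (2 : ℝ) ^ j ≤ |Ω| * ε →
          blockNormLr P j r q t a u ≤
            ENNReal.ofReal (C
                * (2 : ℝ) ^ (3 * (1 / 2 - (q⁻¹).toReal - (r⁻¹).toReal) * (j : ℝ))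
                * |Ω| ^ (2 * (r⁻¹).toReal) * ε ^ (3 * (r⁻¹).toReal)
                * bracket (Ω ^ 2 * ε ^ 2 * T))
              * (blockNorm P j 2 a₀ u₀ + blockNormLr P j 1 2 t f g)) ∧
        (∀ j : ℤ, |Ω| * ε < (2 : ℝ) ^ j → (2 : ℝ) ^ j ≤ β₀ / ε →
          blockNormLr P j r q t a u ≤
            ENNReal.ofReal (C
                * (2 : ℝ) ^ (3 * (1 / 2 - (q⁻¹).toReal) * (j : ℝ))
                * |Ω| ^ (-(r⁻¹).toReal))
              * (blockNorm P j 2 a₀ u₀ + blockNormLr P j 1 2 t f g)) ∧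
        (|Ω| * ε ≤ 1 → ∀ α : ℝ, 1 ≤ α → α ≤ β₀ / ε →
          cheminLernerLow P α (3 * (q⁻¹).toReal - 1 + 2 * (r⁻¹).toReal) r q t a u ≤
            ENNReal.ofReal (C
                * bracket (α ^ 2 * T) ^ growthExponent r
                * (ε ^ (2 / 3 * (r⁻¹).toReal)
                    + |Ω| ^ (-(r⁻¹).toReal) * α ^ (2 * (r⁻¹).toReal)))
              * (besovLow P α (1 / 2) 2 a₀ u₀ + lrBesovLow P α (1 / 2) 1 2 t f g)) := by
  obtain ⟨A, hA, h0⟩ := exists_blockNormLr_le P hq r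
  obtain ⟨C₁, hC₁, h1⟩ := exists_blockNormLr_le_of_le P hμ hν hq hr hqr hne
  obtain ⟨C₂, hC₂, h2⟩ := exists_blockNormLr_le_of_lt P hμ hν hβ₀ hq hr hqr hne
  refine ⟨A + C₁ + C₂, by positivity, fun ε Ω t T hε hΩ ht0 ht a₀ u₀ f g a u hs => ⟨fun j hj => ?_,
    fun j hj hj' => ?_, fun hω α hα hαβ => ?_⟩⟩
  · refine (h1 hε hΩ ht0 ht hs j hj).trans (mul_le_mul_left (ENNReal.ofReal_le_ofReal ?_) _)
    have := one_le_bracket (Ω ^ 2 * ε ^ 2 * T)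
    gcongr
    linarith
  · refine (h2 hε hΩ ht0 ht hs j hj hj').trans (mul_le_mul_left (ENNReal.ofReal_le_ofReal ?_) _)
    gcongr
    linarith
  have hΩ0 : 0 < |Ω| := abs_pos.2 hΩ
  have hT : 0 < T := ht0.trans_le ht
  have hρ1 : (r⁻¹).toReal ≤ 1 := by
    have := ENNReal.toReal_mono (by norm_num) (ENNReal.inv_le_inv.2 hr)
    norm_num at this
    rw [ENNReal.toReal_inv]
    linarith
  have hBr := one_le_bracket (α ^ 2 * T)
  set E := growthExponent r
  have hE : 1 ≤ E := one_le_growthExponent r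
  have hBrE : 1 ≤ bracket (α ^ 2 * T) ^ E := Real.one_le_rpow hBr (by linarith)
  have hρ0 : 0 ≤ (r⁻¹).toReal := ENNReal.toReal_nonneg
  have hα0 : 0 < α := by linarith
  refine le_trans ?_ (mul_le_mul_right (tsum_blockNorm_le P α (1 / 2) t 2 a₀ u₀ f g) _)
  rw [cheminLernerLow, ← ENNReal.tsum_mul_left]
  refine ENNReal.tsum_le_tsum fun ⟨j, hj⟩ => ?_
  have h2p : (0 : ℝ) < 2 ^ j := by positivity
  simp only [two_rpow_mul_intCast] at h0 h1 h2 ⊢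
  rcases le_or_gt ((2 : ℝ) ^ j) (|Ω| * ε) with hjω | hjω
  · refine ofReal_mul_le_ofReal_mul (by positivity) (by positivity) (le_ofReal_min_mul
      (h0 hμ hν hε hs ht0 ht j) (h1 hε hΩ ht0 ht hs j hjω)) ?_
    rw [← sq_abs Ω]
    refine (lowFrequency_weight_le hA hC₁ hε hΩ0 hT rfl hω hα hρ0 hρ1 h2p hE).trans ?_
    gcongr ?_ * _ * ?_ * _
    · linarith
    · exact le_add_of_nonneg_right (by positivity)
  · refine ofReal_mul_le_ofReal_mul (by positivity) (by positivity)
      (h2 hε hΩ ht0 ht hs j hjω (hj.trans hαβ)) ?_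
    refine (highFrequency_weight_le hC₂ hΩ0 hρ0 h2p hj).trans ?_
    gcongr ?_ * _
    gcongr ?_ * ?_
    · calc C₂ ≤ A + C₁ + C₂ := by linarith
        _ ≤ _ := le_mul_of_one_le_right (by positivity) hBrE
    · exact le_add_of_nonneg_left (by positivity)
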